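/- **Notation.** Let $\mathbb K$ be an algebraically closed field of characteristic $0$, $Q$ a finite quiver with vertex set $Q_0$ and arrow set $Q_1$, and $\mathbf d\in\mathbb N^{Q_0}$ a dimension vector (in particular one whose moment map is flat; flatness is not needed below). $\overline Q$ is the double of $Q$ (an arrow $a^*$ opposite to each $a\in Q_1$), $\mathbb K\overline Q$ its path algebra (a product $xy$ of arrows is nonzero iff $s(x)=t(y)$), $\mathbf w=\sum_{a\in Q_1}(aa^*-a^*a)$, $\Pi Q=\mathbb K\overline Q/(\mathbf w)$, and $A_\natural=A/[A,A]$ (quotient of vector spaces). Let $\mathrm{pr}:(\mathbb K\overline Q)_\natural\to(\Pi Q)_\natural$ be the projection. Put $\{a,a^*\}=1$, $\{a^*,a\}=-1$, and $\{x,y\}=0$ for all other pairs of arrows of $\overline Q$. *Quantized necklace algebra.* Consider products $$X=(a_{1,1},h_{1,1})\cdots(a_{1,l_1},h_{1,l_1})\,\&\cdots\&\,(a_{k,1},h_{k,1})\cdots(a_{k,l_k},h_{k,l_k})\,\&\,v_1\&\cdots\& v_m$$ of cyclic words in $\overline Q$ whose letters carry pairwise distinct heights, and of vertices $v_i$; only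 the order of the heights matters, $\&$ is commutative, and a vertex is regarded as an empty cyclic word. For $\alpha,\beta\in\mathbb K[\hbar]$ let $N(\alpha,\beta)$ be the $\mathbb K[\hbar]$-module spanned by all $X$ modulo the skein relations: if letters $x,y$ of $X$ have adjacent heights, $x$ below $y$, then $$X-X'-\alpha\{x,y\}X''=0\quad\text{or}\quad X-X'-\beta\{x,y\}X''=0$$ according to whether $x,y$ lie in different cyclic words or in the same one. Here $X'$ is $X$ with these two heights interchanged, and $X''$ is $X$ with $xu\,\&\,yv$ replaced by the cyclic word $uv$, respectively with the cyclic word $xuyv$ replaced by $v\,\&\,u$. The product $X*Y$ places $Y$ above $X$. Schedler's algebra is $N(1,\hbar)$. For a closed path $p=x_1\cdots x_r$ put $\widehat p=(x_1,1)\cdots(x_r,r)$, and $\widehat{e_i}=i$; put $\widehat p=0$ for non-closed paths, and extend linearly to $\mathbb K\overline Q$. The non-commutative quantum reduction is $$\mathcal R_q(\alpha,\beta)=N(\alpha,\beta)\big/N(\alpha,\beta)\,\{\widehat{y\mathbf w}: y\in\mathbb K\overline Q\}\,N(\alpha,\beta),$$ the quotient by the indicated two-sided ideal. *Differential operators.*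 $\mathcal D_\hbar=\mathcal D_\hbar(\mathrm{Rep}(Q,\mathbf d))$ is the $\mathbb K[\hbar]$-algebra generated by $T=\mathbb K[\mathrm{Rep}(Q,\mathbf d)]$ (as a $\mathbb K$-algebra) and $\mathrm{Der}_{\mathbb K}T$ with relations $f*\xi=f\xi$, $\xi*f=f\xi+\hbar\,\xi(f)$, $\xi*\eta-\eta*\xi=\hbar[\xi,\eta]$. The group $\mathrm{GL}_{\mathbf d}$ acts on it by conjugation. For $a\in Q_1$, $[a]$ is the generic $d_{t(a)}\times d_{s(a)}$ matrix and $[a^*]_{pq}=\partial/\partial[a]_{qp}$. The infinitesimal action $\tau:\mathfrak{gl}_{\mathbf d}\to\mathrm{Der}_{\mathbb K}T$ is $\tau(x)[a]=[a]x_{s(a)}-x_{t(a)}[a]$, and $\chi_0=-\sum_{k\in Q_0}\big(\sum_{s(a)=k}d_{t(a)}\big)\mathrm{tr}_k$. **Theorem.** There are Lie brackets on $(\mathbb K\overline Q)_\natural$ and $(\Pi Q)_\natural$, the first one given on closed paths by the necklace formula $$\{a_1\cdots a_k,b_1\cdots b_l\}=\sum_{i,j}\{a_i,b_j\}\,a_{i+1}\cdots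 a_ka_1\cdots a_{i-1}b_{j+1}\cdots b_lb_1\cdots b_{j-1},$$ the second one such that $\mathrm{pr}$ is a homomorphism, with the following properties. **(1)** *(Non-commutative quantization commutes with reduction.)* (a) Let $N=N(1,\hbar)$ and $\mathcal R_q=\mathcal R_q(1,\hbar)$. Then $N$ is free over $\mathbb K[\hbar]$, and there are isomorphisms of $\mathbb K$-algebras $$l:\mathcal U((\mathbb K\overline Q)_\natural)\to N/\hbar N,\qquad v:\mathcal U((\Pi Q)_\natural)\to\mathcal R_q/\hbar\mathcal R_q$$ with $l(\bar x)=[\widehat x]$ and $v(\mathrm{pr}(\bar x))=[\widehat x]$ for all $x\in\mathbb K\overline Q$; they intertwine the map $\mathcal U(\mathrm{pr})$ with the map $N/\hbar N\to\mathcal R_q/\hbar\mathcal R_q$ induced by the reduction $N\to\mathcal R_q$. (b) Let $N=N(-\hbar,-\hbar)$ and $\mathcal R_q=\mathcal R_q(-\hbar,-\hbar)$. Then the assertions of (a) hold with the universal enveloping algebras replaced by the symmetric algebras $\mathrm{Sym}((\mathbb K\overline Q)_\natural)$ and $\mathrm{Sym}((\Pi Q)_\natural)$. Moreover, for $x,y,z\in\mathbb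 K\overline Q$ with $\bar z=\{\bar x,\bar y\}$ in $(\mathbb K\overline Q)_\natural$, $$\widehat x*\widehat y-\widehat y*\widehat x\in-\hbar\,\widehat z+\hbar^2N .$$ **(2)** *(Quantum trace.)* Let $N=N(-\hbar,-\hbar)$ and $\mathcal R_q=\mathcal R_q(-\hbar,-\hbar)$. There is a homomorphism of $\mathbb K[\hbar]$-algebras $\mathrm{Tr}^q:N\to\mathcal D_\hbar$ such that for every $X$ as above, with heights $1,\dots,n$ and with $a_h$ the letter at height $h$, $$\mathrm{Tr}^q(X)=d_{v_1}\cdots d_{v_m}\sum_{k_1,\dots,k_n}\ \prod_{h=1}^{n}[a_h]_{k_h,k_{h^+}},$$ where $k_h$ runs over $1,\dots,d_{t(a_h)}$, $h^+$ is the height of the letter that follows $a_h$ in its cyclic word and the product is taken in the order of increasing $h$. The image of $\mathrm{Tr}^q$ lies in $\mathcal D_\hbar^{\mathrm{GL}_{\mathbf d}}$; the left ideal $(\mathcal D_\hbar(\tau-\hbar\chi_0)(\mathfrak{gl}_{\mathbf d}))^{\mathrm{GL}_{\mathbf d}}$ of $\mathcal D_\hbar^{\mathrm{GL}_{\mathbf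 d}}$ is two-sided; and $\mathrm{Tr}^q$ descends to a homomorphism of $\mathbb K[\hbar]$-algebras $$\mathcal R_q\longrightarrow\frac{\mathcal D_\hbar^{\mathrm{GL}_{\mathbf d}}}{\big(\mathcal D_\hbar(\tau-\hbar\chi_0)(\mathfrak{gl}_{\mathbf d})\big)^{\mathrm{GL}_{\mathbf d}}},$$ that is, $\mathrm{Tr}^q$ commutes with the two reduction maps. -/

import Mathlib

noncomputable section

namespace NecklaceReduction

open Polynomial

universe u v w

/-! ### Generalities on algebras -/

section General

/-- The quotient of an algebra by the two-sided ideal generated by a set. -/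
abbrev QuotBy {A : Type*} [Ring A] (S : Set A) : Type _ :=
  (TwoSidedIdeal.span S).ringCon.Quotient

/-- The projection onto the quotient by a two-sided ideal, as a homomorphism of `k`-algebras. -/
abbrev QuotBy.mk (k : Type*) {A : Type*} [CommSemiring k] [Ring A] [Algebra k A] (S : Set A) :
    A →ₐ[k] QuotBy S :=
  RingCon.mkₐ k (TwoSidedIdeal.span S).ringCon

/-- The linear span `[A, A]` of all commutators. -/
def commutatorSpan (k A : Type*) [CommRing k] [Ring A] [Algebra k A] : Submodule k A :=
  Submodule.span k (Set.range fun z : A × A => z.1 * z.2 - z.2 * z.1)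

/-- The commutator quotient `A_♮ = A / [A, A]` (a quotient of vector spaces). -/
abbrev Nat0 (k A : Type*) [CommRing k] [Ring A] [Algebra k A] : Type _ :=
  A ⧸ commutatorSpan k A

/-- The linear map `A_♮ → B_♮` induced by an algebra homomorphism `A → B`. -/
def Nat0.map {k A B : Type*} [CommRing k] [Ring A] [Algebra k A] [Ring B] [Algebra k B]
    (f : A →ₐ[k] B) : Nat0 k A →ₗ[k] Nat0 k B :=
  Submodule.mapQ (commutatorSpan k A) (commutatorSpan k B) f.toLinearMap (by
    rw [commutatorSpan, Submodule.span_le]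
    rintro _ ⟨z, rfl⟩
    refine Submodule.subset_span ⟨(f z.1, f z.2), ?_⟩
    simp)

/-- A Lie bracket on a `k`-module. -/
structure LieBracket (k M : Type*) [CommRing k] [AddCommGroup M] [Module k M] where
  br : M →ₗ[k] M →ₗ[k] M
  alt : ∀ x, br x x = 0
  leibniz : ∀ x y z, br x (br y z) = br (br x y) z + br y (br x z)

variable {k M : Type*} [CommRing k] [AddCommGroup M] [Module k M]

/-- The Lie ring given by a Lie bracket. -/
abbrev LieBracket.lieRing (B : LieBracket k M) : LieRing M where
  bracket x y := B.br x y
  add_lie x y z := by simp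
  lie_add x y z := by simp
  lie_self x := B.alt x
  leibniz_lie x y z := B.leibniz x y z

/-- The Lie algebra given by a Lie bracket. -/
abbrev LieBracket.lieAlgebra (B : LieBracket k M) : @LieAlgebra k M _ B.lieRing :=
  letI := B.lieRing
  { (inferInstance : Module k M) with
    lie_smul := fun t x y => (B.br x).map_smul t y }

/-- The universal enveloping algebra of `M` with the Lie bracket `B`. -/
abbrev LieBracket.U (B : LieBracket k M) : Type _ :=
  @UniversalEnvelopingAlgebra k M _ B.lieRing B.lieAlgebra

/-- The canonical map of `M` into the universal enveloping algebra. -/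
def LieBracket.ι (B : LieBracket k M) (x : M) : B.U :=
  letI := B.lieRing
  letI := B.lieAlgebra
  UniversalEnvelopingAlgebra.ι k x

end General

/-! ### Quivers, doubled quivers, path algebras -/

/-- A quiver with vertex set `V` and set of arrows `E`. -/
structure QuiverData (V : Type u) (E : Type v) where
  src : E → V
  tgt : E → V

/-- The arrows of the doubled quiver: `Sum.inl a` is the arrow `a`,
`Sum.inr a` is the reversed arrow `a^*`. -/
abbrev Letter (E : Type v) : Type v := E ⊕ E

/-- The involution `a ↦ a^*`, `a^* ↦ a`. -/
abbrev rev {E : Type v} (x : Letter E) : Letter E := x.swap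

/-- `{a, a^*} = 1`, `{a^*, a} = -1`, and `{x, y} = 0` for all other pairs of arrows. -/
def letterBracket {E : Type v} [DecidableEq E] : Letter E → Letter E → ℤ
  | Sum.inl a, Sum.inr b => if a = b then 1 else 0
  | Sum.inr a, Sum.inl b => if a = b then -1 else 0
  | _, _ => 0

namespace QuiverData

variable {V : Type u} {E : Type v} (Q : QuiverData V E)

/-- Source of an arrow of the doubled quiver. -/
def lsrc : Letter E → V
  | Sum.inl a => Q.src a
  | Sum.inr a => Q.tgt a

/-- Target of an arrow of the doubled quiver. -/
def ltgt : Letter E → V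
  | Sum.inl a => Q.tgt a
  | Sum.inr a => Q.src a

lemma lsrc_rev (x : Letter E) : Q.lsrc (rev x) = Q.ltgt x := by cases x <;> rfl

lemma ltgt_rev (x : Letter E) : Q.ltgt (rev x) = Q.lsrc x := by cases x <;> rfl

/-- `x₁ x₂ ⋯ x_r` is composable with target `i`: the product `x y` of two arrows is
nonzero when the source of `x` is the target of `y`. -/
def IsChain : V → List (Letter E) → Prop
  | _, [] => True
  | i, x :: l => Q.ltgt x = i ∧ IsChain (Q.lsrc x) l

/-- The source of the path `x₁ x₂ ⋯ x_r` with target `i`. -/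
def endVertex : V → List (Letter E) → V
  | i, [] => i
  | _, x :: l => endVertex (Q.lsrc x) l

lemma endVertex_append (i : V) (l m : List (Letter E)) :
    Q.endVertex i (l ++ m) = Q.endVertex (Q.endVertex i l) m := by
  induction l generalizing i with
  | nil => rfl
  | cons x l ih => exact ih _

lemma isChain_append (i : V) (l m : List (Letter E)) :
    Q.IsChain i (l ++ m) ↔ Q.IsChain i l ∧ Q.IsChain (Q.endVertex i l) m := by
  induction l generalizing i with
  | nil => simp [IsChain, endVertex]
  | cons x l ih => simp [IsChain, endVertex, ih, and_assoc]

lemma IsChain.getElem {i : V} {l : List (Letter E)} (h : Q.IsChain i l) (n : ℕ)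
    {x y : Letter E} (hx : l[n]? = some x) (hy : l[n + 1]? = some y) :
    Q.lsrc x = Q.ltgt y := by
  induction l generalizing i n with
  | nil => simp at hx
  | cons z l ih =>
    cases n with
    | zero =>
      cases l with
      | nil => simp at hy
      | cons z' l =>
        simp only [List.getElem?_cons_zero, Option.some.injEq, zero_add,
          List.getElem?_cons_succ] at hx hy
        subst hx hy
        exact h.2.1.symm
    | succ n => exact ih h.2 n (by simpa using hx) (by simpa using hy)

lemma IsChain.getElem_zero {i : V} {l : List (Letter E)} (h : Q.IsChain i l)
    {y : Letter E} (hy : l[0]? = some y) : Q.ltgt y = i := by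
  cases l with
  | nil => simp at hy
  | cons z l =>
    simp only [List.getElem?_cons_zero, Option.some.injEq] at hy
    subst hy
    exact h.1

lemma endVertex_eq (i : V) (l : List (Letter E)) (n : ℕ) (hn : n + 1 = l.length)
    {x : Letter E} (hx : l[n]? = some x) : Q.endVertex i l = Q.lsrc x := by
  induction l generalizing i n with
  | nil => simp at hx
  | cons z l ih =>
    cases n with
    | zero =>
      have : l = [] := by simpa using hn.symm
      subst this
      simp only [List.getElem?_cons_zero, Option.some.injEq] at hx
      subst hx
      rfl
    | succ n => exact ih _ n (by simpa using hn) (by simpa using hx)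

/-- A path in the doubled quiver; the empty word at the vertex `i` is the trivial path `e_i`. -/
@[ext] structure DPath where
  tgt : V
  word : List (Letter E)
  chain : Q.IsChain tgt word

namespace DPath

variable {Q}

/-- The source of a path. -/
def src (p : Q.DPath) : V := Q.endVertex p.tgt p.word

/-- Closed paths. -/
def IsClosed (p : Q.DPath) : Prop := p.src = p.tgt

/-- The concatenation `p q` of two composable paths. -/
def comp (p q : Q.DPath) (h : p.src = q.tgt) : Q.DPath where
  tgt := p.tgt
  word := p.word ++ q.word
  chain := (Q.isChain_append _ _ _).2 ⟨p.chain, by have := q.chain; rwa [← h] at this⟩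

lemma src_comp (p q : Q.DPath) (h : p.src = q.tgt) : (p.comp q h).src = q.src := by
  change Q.endVertex p.tgt (p.word ++ q.word) = _
  rw [endVertex_append]
  change Q.endVertex p.src q.word = _
  rw [h]; rfl

variable (Q) in
/-- The trivial path at a vertex. -/
def triv (i : V) : Q.DPath := ⟨i, [], trivial⟩

variable (Q) in
/-- The path of length one given by an arrow of the doubled quiver. -/
def arrow (x : Letter E) : Q.DPath := ⟨Q.ltgt x, [x], rfl, trivial⟩

end DPath

variable (K : Type w) [Field K]

/-- The path algebra `K Q̄` of the doubled quiver: the vector space with basis the paths,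
with product given by concatenation of composable paths. -/
def PathAlg : Type _ := Q.DPath →₀ K

namespace PathAlg

instance : AddCommGroup (Q.PathAlg K) := inferInstanceAs (AddCommGroup (Q.DPath →₀ K))

instance : Module K (Q.PathAlg K) := inferInstanceAs (Module K (Q.DPath →₀ K))

/-- The basis element of the path algebra given by a path. -/
def ofPath (p : Q.DPath) : Q.PathAlg K := Finsupp.single p (1 : K)

/-- The linear map on the path algebra with prescribed values on paths. -/
def extend {M : Type*} [AddCommGroup M] [Module K M] (f : Q.DPath → M) : Q.PathAlg K →ₗ[K] M :=
  Finsupp.linearCombination K f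

variable {Q K}

@[simp] lemma extend_ofPath {M : Type*} [AddCommGroup M] [Module K M] (f : Q.DPath → M)
    (p : Q.DPath) : extend Q K f (ofPath Q K p) = f p :=
  (Finsupp.linearCombination_single K (1 : K) p).trans (one_smul K (f p))

lemma hom_ext {M : Type*} [AddCommGroup M] [Module K M] {f g : Q.PathAlg K →ₗ[K] M}
    (h : ∀ p, f (ofPath Q K p) = g (ofPath Q K p)) : f = g :=
  Finsupp.lhom_ext' fun p => LinearMap.ext_ring (h p)

open Classical in
/-- The product of two paths in the path algebra. -/
def pathMul (p q : Q.DPath) : Q.PathAlg K :=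
  if h : p.src = q.tgt then ofPath Q K (p.comp q h) else 0

/-- The multiplication of the path algebra. -/
def mulLin : Q.PathAlg K →ₗ[K] Q.PathAlg K →ₗ[K] Q.PathAlg K :=
  extend Q K fun p => extend Q K fun q => pathMul p q

lemma mulLin_ofPath (p q : Q.DPath) :
    mulLin (ofPath Q K p) (ofPath Q K q) = pathMul p q := by
  simp [mulLin]

lemma mulLin_assoc (x y z : Q.PathAlg K) :
    mulLin (mulLin x y) z = mulLin x (mulLin y z) := by
  have key : (mulLin (Q := Q) (K := K)).compr₂ mulLin =
      ((LinearMap.llcomp K (Q.PathAlg K) (Q.PathAlg K) (Q.PathAlg K)).comp mulLin).compl₂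
        mulLin := by
    refine hom_ext fun p => hom_ext fun q => hom_ext fun r => ?_
    simp only [LinearMap.compr₂_apply, LinearMap.compl₂_apply, LinearMap.comp_apply,
      LinearMap.llcomp_apply, mulLin_ofPath]
    by_cases h : p.src = q.tgt
    · by_cases h' : q.src = r.tgt
      · have h1 : (p.comp q h).src = r.tgt := (DPath.src_comp _ _ _).trans h'
        have h2 : p.src = (q.comp r h').tgt := h
        simp only [pathMul, dif_pos h, dif_pos h', mulLin_ofPath, dif_pos h1, dif_pos h2]
        congr 1
        ext1
        · rfl
        · exact List.append_assoc _ _ _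
      · have h1 : (p.comp q h).src ≠ r.tgt := by rw [DPath.src_comp]; exact h'
        simp [pathMul, dif_pos h, dif_neg h', mulLin_ofPath, dif_neg h1]
    · by_cases h' : q.src = r.tgt
      · have h2 : p.src ≠ (q.comp r h').tgt := h
        simp [pathMul, dif_neg h, dif_pos h', mulLin_ofPath, dif_neg h2]
      · simp [pathMul, dif_neg h, dif_neg h']
  have := congrArg (fun F => F x y z) key
  simpa using this

variable [Fintype V]

variable (Q K) in
/-- The unit `∑ e_i` of the path algebra. -/
def unit : Q.PathAlg K := ∑ i, ofPath Q K (DPath.triv Q i)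

lemma unit_mulLin (x : Q.PathAlg K) : mulLin (unit Q K) x = x := by
  have key : mulLin (unit Q K) = LinearMap.id := by
    refine hom_ext fun p => ?_
    classical
    simp only [unit, map_sum, LinearMap.sum_apply, mulLin_ofPath, LinearMap.id_apply]
    rw [Finset.sum_eq_single p.tgt]
    · have h : (DPath.triv Q p.tgt).src = p.tgt := rfl
      rw [pathMul, dif_pos h]
      rfl
    · intro i _ hi
      have h : ¬ (DPath.triv Q i).src = p.tgt := hi
      rw [pathMul, dif_neg h]
    · simp
  simp [key]

lemma mulLin_unit (x : Q.PathAlg K) : mulLin x (unit Q K) = x := by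
  have key : mulLin.flip (unit Q K) = LinearMap.id := by
    refine hom_ext fun p => ?_
    classical
    change mulLin (ofPath Q K p) (unit Q K) = ofPath Q K p
    simp only [unit, map_sum, mulLin_ofPath]
    rw [Finset.sum_eq_single p.src]
    · have h : p.src = (DPath.triv Q p.src).tgt := rfl
      rw [pathMul, dif_pos h]
      congr 1
      ext1
      · rfl
      · exact List.append_nil _
    · intro i _ hi
      have h : ¬ p.src = (DPath.triv Q i).tgt := fun h => hi h.symm
      rw [pathMul, dif_neg h]
    · simp
  have := congrArg (fun F => F x) key
  simpa using this

instance : Ring (Q.PathAlg K) :=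
  { (inferInstance : AddCommGroup (Q.PathAlg K)) with
    mul := fun x y => mulLin x y
    one := unit Q K
    left_distrib := fun x y z => (mulLin x).map_add y z
    right_distrib := fun x y z => by
      change mulLin (x + y) z = mulLin x z + mulLin y z
      simp
    zero_mul := fun x => by
      change mulLin 0 x = 0
      simp
    mul_zero := fun x => (mulLin x).map_zero
    mul_assoc := mulLin_assoc
    one_mul := unit_mulLin
    mul_one := mulLin_unit }

lemma mul_def (x y : Q.PathAlg K) : x * y = mulLin x y := rfl

instance : Algebra K (Q.PathAlg K) :=
  Algebra.ofModule
    (fun c x y => by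
      change mulLin (c • x) y = c • mulLin x y
      simp)
    (fun c x y => by
      change mulLin x (c • y) = c • mulLin x y
      simp)

variable (Q K)

/-- The idempotent `e_i`. -/
def e (i : V) : Q.PathAlg K := ofPath Q K (DPath.triv Q i)

/-- The element of the path algebra given by an arrow of the doubled quiver. -/
def arr (x : Letter E) : Q.PathAlg K := ofPath Q K (DPath.arrow Q x)

/-- The product `e_i x₁ ⋯ x_r` of a word of arrows. -/
def wordElem (i : V) (l : List (Letter E)) : Q.PathAlg K := e Q K i * (l.map (arr Q K)).prod

/-- The element `w = ∑ (a a^* - a^* a)`. -/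
def moment [Fintype E] : Q.PathAlg K :=
  ∑ a : E, (arr Q K (Sum.inl a) * arr Q K (Sum.inr a) -
    arr Q K (Sum.inr a) * arr Q K (Sum.inl a))

variable {Q}

/-- The necklace bracket of two closed paths `p = a₁ ⋯ a_k` and `q = b₁ ⋯ b_l`,
`∑_{i,j} {a_i, b_j} a_{i+1} ⋯ a_k a₁ ⋯ a_{i-1} b_{j+1} ⋯ b_l b₁ ⋯ b_{j-1}`,
as an element of the path algebra. Its summands begin (and end) at the source of `a_i`. -/
def necklace [DecidableEq E] (p q : Q.DPath) : Q.PathAlg K :=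
  ∑ i : Fin p.word.length, ∑ j : Fin q.word.length,
    (letterBracket (p.word.get i) (q.word.get j) : K) •
      wordElem Q K (Q.lsrc (p.word.get i))
        (p.word.drop (i + 1) ++ p.word.take i ++ (q.word.drop (j + 1) ++ q.word.take j))

end PathAlg

/-- The (non-deformed) preprojective algebra `Π Q = K Q̄ / (w)`. -/
abbrev Preproj [Fintype V] [Fintype E] : Type _ := QuotBy ({PathAlg.moment Q K} : Set (Q.PathAlg K))

/-- The projection `pr : (K Q̄)_♮ → (Π Q)_♮`. -/
def pr [Fintype V] [Fintype E] : Nat0 K (Q.PathAlg K) →ₗ[K] Nat0 K (Q.Preproj K) :=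
  Nat0.map (QuotBy.mk K ({PathAlg.moment Q K} : Set (Q.PathAlg K)))

/-- The class in `(K Q̄)_♮` of an element of the path algebra. -/
def cl [Fintype V] : Q.PathAlg K →ₗ[K] Nat0 K (Q.PathAlg K) :=
  (commutatorSpan K (Q.PathAlg K)).mkQ

/-- The Lie bracket on `(K Q̄)_♮` is the necklace bracket. -/
def IsNecklaceBracket [Fintype V] [DecidableEq E]
    (B : LieBracket K (Nat0 K (Q.PathAlg K))) : Prop :=
  ∀ p q : Q.DPath, p.IsClosed → q.IsClosed →
    B.br (Q.cl K (PathAlg.ofPath Q K p)) (Q.cl K (PathAlg.ofPath Q K q)) =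
      Q.cl K (PathAlg.necklace K p q)

end QuiverData

/-! ### Cyclic words with heights -/

/-- The permutation `τ` moved to `{m, m + 1, …}`. -/
def shiftPerm (m : ℕ) : Equiv.Perm ℕ →* Equiv.Perm ℕ where
  toFun τ :=
    { toFun := fun k => if k < m then k else m + τ (k - m)
      invFun := fun k => if k < m then k else m + τ⁻¹ (k - m)
      left_inv := fun k => by
        by_cases h : k < m
        · simp [h]
        · simp only [h, if_false, Nat.not_lt.2 (Nat.le_add_right m _), Nat.add_sub_cancel_left]
          have : τ⁻¹ (τ (k - m)) = k - m := τ.symm_apply_apply _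
          omega
      right_inv := fun k => by
        by_cases h : k < m
        · simp [h]
        · simp only [h, if_false, Nat.not_lt.2 (Nat.le_add_right m _), Nat.add_sub_cancel_left]
          have : τ (τ⁻¹ (k - m)) = k - m := τ.apply_symm_apply _
          omega }
  map_one' := by
    ext k
    by_cases h : k < m
    · simp [h]
    · simp only [Equiv.coe_fn_mk, h, if_false, Equiv.Perm.one_apply]
      omega
  map_mul' σ τ := by
    ext k
    by_cases h : k < m
    · simp [h]
    · simp [h]

lemma shiftPerm_apply (m : ℕ) (τ : Equiv.Perm ℕ) (k : ℕ) :
    shiftPerm m τ k = if k < m then k else m + τ (k - m) := rfl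

lemma shiftPerm_zero (τ : Equiv.Perm ℕ) : shiftPerm 0 τ = τ := by
  ext k
  simp [shiftPerm_apply]

lemma shiftPerm_add (m n : ℕ) (τ : Equiv.Perm ℕ) :
    shiftPerm (m + n) τ = shiftPerm m (shiftPerm n τ) := by
  ext k
  simp only [shiftPerm_apply]
  by_cases h : k < m
  · rw [if_pos h, if_pos (by omega)]
  · by_cases h' : k - m < n
    · rw [if_pos (by omega), if_neg h, if_pos h']
      omega
    · rw [if_neg (by omega), if_neg h, if_neg h', Nat.sub_sub]
      omega

/-- The order-preserving map `ℕ → ℕ \ {k, k + 1}`. -/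
def skip (k j : ℕ) : ℕ := if j < k then j else j + 2

/-- The inverse of `skip k` on `ℕ \ {k, k + 1}`. -/
def unskip (k j : ℕ) : ℕ := if j < k then j else j - 2

lemma unskip_skip (k j : ℕ) : unskip k (skip k j) = j := by
  unfold skip unskip
  split_ifs <;> omega

lemma skip_unskip (k j : ℕ) (h : j ≠ k) (h' : j ≠ k + 1) : skip k (unskip k j) = j := by
  unfold skip unskip
  split_ifs <;> omega

lemma skip_ne (k j : ℕ) : skip k j ≠ k ∧ skip k j ≠ k + 1 := by
  unfold skip
  split_ifs <;> omega

/-- Remove a point `p` from its cycle: `p` becomes a fixed point, and the predecessor of `p`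
is sent to the successor of `p`. -/
def bypass (p : ℕ) (σ : Equiv.Perm ℕ) : Equiv.Perm ℕ := Equiv.swap p (σ p) * σ

lemma bypass_self (p : ℕ) (σ : Equiv.Perm ℕ) : bypass p σ p = p := by simp [bypass]

lemma bypass_fixed (p q : ℕ) (σ : Equiv.Perm ℕ) (hq : σ q = q) : bypass p σ q = q := by
  by_cases h : q = p
  · subst h; exact bypass_self _ _
  · have : q ≠ σ p := fun h' => h (σ.injective (hq.trans h'))
    simp [bypass, hq, Equiv.swap_apply_of_ne_of_ne h this]

/-- The reconnection at two points `k` and `k + 1`: with respect to the cyclic successor `σ`,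
the predecessor of `k` is sent to the successor of `k + 1`, the predecessor of `k + 1` is sent to
the successor of `k`, and `k`, `k + 1` become fixed points. -/
def reconnect (k : ℕ) (σ : Equiv.Perm ℕ) : Equiv.Perm ℕ :=
  bypass (k + 1) (bypass k (σ * Equiv.swap k (k + 1)))

lemma reconnect_left (k : ℕ) (σ : Equiv.Perm ℕ) : reconnect k σ k = k :=
  bypass_fixed _ _ _ (bypass_self _ _)

lemma reconnect_right (k : ℕ) (σ : Equiv.Perm ℕ) : reconnect k σ (k + 1) = k + 1 :=
  bypass_self _ _

lemma reconnect_ne (k : ℕ) (σ : Equiv.Perm ℕ) {j : ℕ} (h : j ≠ k) (h' : j ≠ k + 1) :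
    reconnect k σ j ≠ k ∧ reconnect k σ j ≠ k + 1 :=
  ⟨fun e => h ((reconnect k σ).injective (e.trans (reconnect_left k σ).symm)),
    fun e => h' ((reconnect k σ).injective (e.trans (reconnect_right k σ).symm))⟩

/-- Delete the two fixed points `k` and `k + 1` and renumber the other points. -/
def deleteTwo (k : ℕ) (τ : Equiv.Perm ℕ) (h : τ k = k) (h' : τ (k + 1) = k + 1) :
    Equiv.Perm ℕ where
  toFun j := unskip k (τ (skip k j))
  invFun j := unskip k (τ⁻¹ (skip k j))
  left_inv j := by
    have h1 : τ (skip k j) ≠ k := fun e =>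
      (skip_ne k j).1 (τ.injective (e.trans h.symm))
    have h2 : τ (skip k j) ≠ k + 1 := fun e =>
      (skip_ne k j).2 (τ.injective (e.trans h'.symm))
    change unskip k (τ⁻¹ (skip k (unskip k (τ (skip k j))))) = j
    rw [skip_unskip _ _ h1 h2]
    simp [unskip_skip]
  right_inv j := by
    have h1 : τ⁻¹ (skip k j) ≠ k := fun e =>
      (skip_ne k j).1 (by rw [Equiv.Perm.inv_eq_iff_eq] at e; rw [e, h])
    have h2 : τ⁻¹ (skip k j) ≠ k + 1 := fun e =>
      (skip_ne k j).2 (by rw [Equiv.Perm.inv_eq_iff_eq] at e; rw [e, h'])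
    change unskip k (τ (skip k (unskip k (τ⁻¹ (skip k j))))) = j
    rw [skip_unskip _ _ h1 h2]
    simp [unskip_skip]

namespace QuiverData

variable {V : Type u} {E : Type v} (Q : QuiverData V E)

/-- A commutative product of cyclic words in arrows with pairwise distinct heights and of
vertices, `(a₁₁,h₁₁)⋯(a₁ₗ,h₁ₗ) & ⋯ & (aₖ₁,hₖ₁)⋯ & v₁ & ⋯ & v_m`, where only the order of the
heights matters.  It is recorded by the list `word` of its arrows by increasing height
(so that the heights are `0, 1, …, N - 1`), the permutation `next` that sends the height of an
arrow to the height of the arrow that follows it in its cyclic word (so that the cyclic words are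
the cycles of `next` on `{0, …, N - 1}`), and the multiset `verts` of vertices. -/
@[ext] structure Diagram where
  word : List (Letter E)
  next : Equiv.Perm ℕ
  verts : Multiset V
  next_fix : ∀ k, word.length ≤ k → next k = k
  compat : ∀ k x y, word[k]? = some x → word[next k]? = some y → Q.lsrc x = Q.ltgt y

namespace Diagram

variable {Q}

lemma next_lt (X : Q.Diagram) {k : ℕ} (h : k < X.word.length) : X.next k < X.word.length := by
  by_contra h'
  have h1 := X.next_fix _ (Nat.not_lt.1 h')
  exact h' ((X.next.injective h1).symm ▸ h)

instance : One Q.Diagram where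
  one :=
    { word := []
      next := 1
      verts := 0
      next_fix := fun _ _ => rfl
      compat := fun k x y hx => by simp at hx }

/-- The product `X * Y`: place `Y` above `X`. -/
instance : Mul Q.Diagram where
  mul X Y :=
    { word := X.word ++ Y.word
      next := X.next * shiftPerm X.word.length Y.next
      verts := X.verts + Y.verts
      next_fix := fun k hk => by
        simp only [List.length_append] at hk
        rw [Equiv.Perm.mul_apply, shiftPerm_apply, if_neg (by omega), Y.next_fix _ (by omega)]
        rw [show X.word.length + (k - X.word.length) = k by omega]
        exact X.next_fix _ (by omega)
      compat := fun k x y hx hy => by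
        rw [Equiv.Perm.mul_apply, shiftPerm_apply] at hy
        by_cases h : k < X.word.length
        · rw [if_pos h, List.getElem?_append_left (X.next_lt h)] at hy
          rw [List.getElem?_append_left h] at hx
          exact X.compat k x y hx hy
        · rw [if_neg h, X.next_fix _ (by omega), List.getElem?_append_right (by omega),
            Nat.add_sub_cancel_left] at hy
          rw [List.getElem?_append_right (by omega)] at hx
          exact Y.compat _ x y hx hy }

lemma word_one : (1 : Q.Diagram).word = [] := rfl
lemma next_one : (1 : Q.Diagram).next = 1 := rfl
lemma verts_one : (1 : Q.Diagram).verts = 0 := rfl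
lemma word_mul (X Y : Q.Diagram) : (X * Y).word = X.word ++ Y.word := rfl
lemma next_mul (X Y : Q.Diagram) :
    (X * Y).next = X.next * shiftPerm X.word.length Y.next := rfl
lemma verts_mul (X Y : Q.Diagram) : (X * Y).verts = X.verts + Y.verts := rfl

instance : Monoid Q.Diagram where
  mul_assoc X Y Z := by
    apply Diagram.ext
    · simp only [word_mul, List.append_assoc]
    · simp only [next_mul, word_mul, List.length_append, map_mul, shiftPerm_add, mul_assoc]
    · simp only [verts_mul, add_assoc]
  one_mul X := by
    apply Diagram.ext
    · rfl
    · simp only [next_mul, next_one, word_one, List.length_nil, shiftPerm_zero, one_mul]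
    · simp only [verts_mul, verts_one, zero_add]
  mul_one X := by
    apply Diagram.ext
    · simp only [word_mul, word_one, List.append_nil]
    · simp only [next_mul, next_one, map_one, mul_one]
    · simp only [verts_mul, verts_one, add_zero]

lemma getElem?_swap (l m : List (Letter E)) (x y : Letter E) (j : ℕ) :
    (l ++ y :: x :: m)[j]? = (l ++ x :: y :: m)[Equiv.swap l.length (l.length + 1) j]? := by
  rcases lt_or_ge j l.length with h | h
  · rw [Equiv.swap_apply_of_ne_of_ne (by omega) (by omega), List.getElem?_append_left h,
      List.getElem?_append_left h]
  · obtain ⟨n, rfl⟩ := Nat.exists_eq_add_of_le h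
    rcases n with _ | _ | n
    · rw [Nat.add_zero, Equiv.swap_apply_left, List.getElem?_append_right le_rfl,
        List.getElem?_append_right (by omega)]
      simp
    · rw [zero_add, Equiv.swap_apply_right, List.getElem?_append_right (by omega),
        List.getElem?_append_right le_rfl]
      simp
    · rw [Equiv.swap_apply_of_ne_of_ne (by omega) (by omega), List.getElem?_append_right h,
        List.getElem?_append_right h]
      simp

lemma getElem?_skip (l m : List (Letter E)) (x y : Letter E) (j : ℕ) :
    (l ++ m)[j]? = (l ++ x :: y :: m)[skip l.length j]? := by
  unfold skip
  rcases lt_or_ge j l.length with h | h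
  · rw [if_pos h, List.getElem?_append_left h, List.getElem?_append_left h]
  · rw [if_neg (by omega), List.getElem?_append_right h, List.getElem?_append_right (by omega),
      show j + 2 - l.length = (j - l.length) + 1 + 1 by omega]
    simp

/-- `X'`: the heights of the arrows `x`, `y` at the adjacent heights `k = l.length` and `k + 1`
are interchanged. -/
def interchange (X : Q.Diagram) (l m : List (Letter E)) (x y : Letter E)
    (h : X.word = l ++ x :: y :: m) : Q.Diagram where
  word := l ++ y :: x :: m
  next := Equiv.swap l.length (l.length + 1) * X.next * Equiv.swap l.length (l.length + 1)
  verts := X.verts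
  next_fix k hk := by
    have hX := X.next_fix k (by rw [h]; simpa using hk)
    have : Equiv.swap l.length (l.length + 1) k = k := by
      simp only [List.length_append, List.length_cons] at hk
      exact Equiv.swap_apply_of_ne_of_ne (by omega) (by omega)
    simp [this, hX]
  compat k z t hz ht := by
    rw [getElem?_swap, ← h] at hz ht
    refine X.compat _ z t hz ?_
    simpa [Equiv.Perm.mul_apply] using ht

lemma reconnect_lt (X : Q.Diagram) (k : ℕ) (hk : k + 1 < X.word.length) :
    ∀ j, X.word.length ≤ j → reconnect k X.next j = j := by
  intro j hj
  refine bypass_fixed _ _ _ (bypass_fixed _ _ _ ?_)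
  rw [Equiv.Perm.mul_apply, Equiv.swap_apply_of_ne_of_ne (by omega) (by omega)]
  exact X.next_fix j hj

lemma compat_reconnect (X : Q.Diagram) (k : ℕ) (x : Letter E)
    (hx : X.word[k]? = some x) (hy : X.word[k + 1]? = some (rev x)) (j : ℕ)
    (hj : j ≠ k) (hj' : j ≠ k + 1) (z t : Letter E) (hz : X.word[j]? = some z)
    (ht : X.word[reconnect k X.next j]? = some t) : Q.lsrc z = Q.ltgt t := by
  -- `Q`-compatibility of the three perturbed successors, one after the other
  have hswap : ∀ i z t, X.word[i]? = some z →
      X.word[(X.next * Equiv.swap k (k + 1)) i]? = some t →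
      (if i = k then Q.ltgt x else if i = k + 1 then Q.lsrc x else Q.lsrc z) = Q.ltgt t := by
    intro i z t hz ht
    rw [Equiv.Perm.mul_apply] at ht
    by_cases h1 : i = k
    · subst h1
      rw [Equiv.swap_apply_left] at ht
      rw [if_pos rfl, ← Q.lsrc_rev]
      exact X.compat _ _ _ hy ht
    · by_cases h2 : i = k + 1
      · subst h2
        rw [Equiv.swap_apply_right] at ht
        rw [if_neg h1, if_pos rfl]
        exact X.compat _ _ _ hx ht
      · rw [Equiv.swap_apply_of_ne_of_ne h1 h2] at ht
        rw [if_neg h1, if_neg h2]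
        exact X.compat _ _ _ hz ht
  have hby : ∀ (σ : Equiv.Perm ℕ) (p : ℕ) (f : ℕ → V) (g : ℕ → V),
      (∀ i, f i = g (σ i)) → f p = g p → ∀ i, i ≠ p → f i = g (bypass p σ i) := by
    intro σ p f g hfg hp i hi
    by_cases h : σ i = p
    · have : bypass p σ i = σ p := by simp [bypass, h]
      rw [this, ← hfg p, hp, hfg i, h]
    · have : bypass p σ i = σ i := by
        have h2 : σ i ≠ σ p := fun e => hi (σ.injective e)
        simp [bypass, Equiv.swap_apply_of_ne_of_ne h h2]
      rw [this, hfg i]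
  -- total versions of source and target along the word
  let N := X.word.length
  have hlt : ∀ i, i < N ↔ ∃ z, X.word[i]? = some z := fun i => by
    constructor
    · intro h; exact ⟨_, List.getElem?_eq_getElem h⟩
    · rintro ⟨z, h⟩; exact (List.getElem?_eq_some_iff.1 h).1
  have hk1 : k + 1 < N := (hlt _).2 ⟨_, hy⟩
  let f : ℕ → V := fun i => if i = k then Q.ltgt x else if i = k + 1 then Q.lsrc x else
    match X.word[i]? with | some z => Q.lsrc z | none => Q.lsrc z
  let g : ℕ → V := fun i =>
    match X.word[i]? with | some z => Q.ltgt z | none => Q.lsrc z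
  have hfg : ∀ i, f i = g ((X.next * Equiv.swap k (k + 1)) i) := by
    intro i
    by_cases hi : i < N
    · obtain ⟨z', hz'⟩ := (hlt i).1 hi
      have hi2 : (X.next * Equiv.swap k (k + 1)) i < N := by
        rw [Equiv.Perm.mul_apply]
        refine X.next_lt ?_
        change _ < N
        rcases Equiv.swap_apply_def k (k + 1) i with h
        rw [h]
        split_ifs <;> omega
      obtain ⟨t', ht'⟩ := (hlt _).1 hi2
      have := hswap i z' t' hz' ht'
      simp only [f, g, hz', ht']
      exact this
    · have h1 : (X.next * Equiv.swap k (k + 1)) i = i := by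
        rw [Equiv.Perm.mul_apply, Equiv.swap_apply_of_ne_of_ne (by omega) (by omega)]
        exact X.next_fix i (Nat.not_lt.1 hi)
      have h2 : X.word[i]? = none := List.getElem?_eq_none (Nat.not_lt.1 hi)
      simp only [h1, f, g, h2]
      rw [if_neg (by omega), if_neg (by omega)]
  have hfk : f k = g k := by simp [f, g, hx]
  have hfk1 : f (k + 1) = g (k + 1) := by simp [f, g, hy, ltgt_rev]
  have step1 := hby _ k f g hfg hfk
  have step1' : ∀ i, f i = g (bypass k (X.next * Equiv.swap k (k + 1)) i) := by
    intro i
    by_cases hi : i = k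
    · subst hi; rw [bypass_self]; exact hfk
    · exact step1 i hi
  have step2 := hby _ (k + 1) f g step1' hfk1 j hj'
  have e1 : f j = Q.lsrc z := by simp [f, hj, hj', hz]
  have e2 : g (reconnect k X.next j) = Q.ltgt t := by simp [g, ht]
  rw [← e1, ← e2]
  exact step2

open Classical in
/-- `X''`: the arrows `x` and `x^*` at the adjacent heights `k = l.length` and `k + 1` are removed,
and the rest is reconnected.  If `x u` and `x^* v` are two different cyclic words of `X`, they are
replaced by the cyclic word `u v`; if `x u x^* v` is a cyclic word of `X`, it is replaced by
`v & u`.  An empty word that arises is the vertex at which it is based. -/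
def contract (X : Q.Diagram) (l m : List (Letter E)) (x : Letter E)
    (h : X.word = l ++ x :: rev x :: m) : Q.Diagram where
  word := l ++ m
  next := deleteTwo l.length (reconnect l.length X.next)
    (reconnect_left _ _) (reconnect_right _ _)
  verts := X.verts
    + (if X.next (l.length + 1) = l.length then {Q.ltgt x} else 0)
    + (if X.next l.length = l.length + 1 then {Q.lsrc x} else 0)
    + (if X.next l.length = l.length ∧ X.next (l.length + 1) = l.length + 1
        then {Q.ltgt x} else 0)
  next_fix j hj := by
    change unskip _ (reconnect _ X.next (skip l.length j)) = j
    have hlen : X.word.length = (l ++ m).length + 2 := by simp [h]; omega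
    have hj2 : l.length ≤ j := le_trans (by simp) hj
    rw [X.reconnect_lt l.length (by rw [h]; simp)]
    · exact unskip_skip _ _
    · rw [skip, if_neg (by omega)]
      omega
  compat j z t hz ht := by
    change (l ++ m)[unskip _ (reconnect _ X.next (skip l.length j))]? = some t at ht
    have hne := reconnect_ne l.length X.next (skip_ne l.length j).1 (skip_ne l.length j).2
    rw [getElem?_skip l m x (rev x), ← h] at hz ht
    rw [skip_unskip _ _ hne.1 hne.2] at ht
    exact X.compat_reconnect l.length x (by rw [h]; simp)
      (by rw [h, List.getElem?_append_right (by omega)]; simp) _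
      (skip_ne l.length j).1 (skip_ne l.length j).2 z t hz ht

/-- The standard lift of a closed path `x₁ ⋯ x_r`: the cyclic word `(x₁,1)(x₂,2)⋯(x_r,r)` whose
heights increase from left to right; the trivial path `e_i` is lifted to the vertex `i`. -/
def ofClosed (p : Q.DPath) (hp : p.IsClosed) : Q.Diagram where
  word := p.word
  next := (List.range p.word.length).formPerm
  verts := if p.word = [] then {p.tgt} else 0
  next_fix k hk := List.formPerm_apply_of_notMem (by simpa using hk)
  compat k x y hx hy := by
    have hk : k < p.word.length := (List.getElem?_eq_some_iff.1 hx).1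
    have hform : (List.range p.word.length).formPerm k = (k + 1) % p.word.length := by
      have := List.formPerm_apply_getElem (List.range p.word.length) List.nodup_range k
        (by simpa using hk)
      simpa using this
    rw [hform] at hy
    by_cases hk1 : k + 1 < p.word.length
    · rw [Nat.mod_eq_of_lt hk1] at hy
      exact QuiverData.IsChain.getElem Q p.chain k hx hy
    · have hk2 : k + 1 = p.word.length := by omega
      rw [hk2, Nat.mod_self] at hy
      rw [QuiverData.IsChain.getElem_zero Q p.chain hy, ← hp, DPath.src,
        Q.endVertex_eq _ _ k hk2 hx]

end Diagram

/-! ### The quantized necklace algebra and its reduction -/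

variable (K : Type w) [Field K]

/-- The formal parameter. -/
abbrev _root_.NecklaceReduction.hbar (K : Type w) [Field K] : K[X] := Polynomial.X

/-- The algebra `Ã` over `K[ħ]` of linear combinations of products of cyclic words with heights. -/
abbrev HeightAlg : Type _ := MonoidAlgebra K[X] Q.Diagram

variable {Q} in
/-- The basis element of `Ã` given by a product of cyclic words with heights. -/
abbrev dg (X : Q.Diagram) : Q.HeightAlg K := MonoidAlgebra.of K[X] Q.Diagram X

/-- The skein relations, with coefficient `α` when two cyclic words are joined and
`β` when one cyclic word is split. In each case `x` and `y` are the arrows at two adjacent heights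
`k = l.length` and `k + 1`. -/
inductive Skein [DecidableEq E] (α β : K[X]) : Q.HeightAlg K → Prop
  | commute (X : Q.Diagram) (l m : List (Letter E)) (x y : Letter E)
      (h : X.word = l ++ x :: y :: m) (hxy : y ≠ rev x) :
      Skein α β (dg K X - dg K (X.interchange l m x y h))
  | join (X : Q.Diagram) (l m : List (Letter E)) (x : Letter E)
      (h : X.word = l ++ x :: rev x :: m)
      (hc : ¬ X.next.SameCycle l.length (l.length + 1)) :
      Skein α β (dg K X - dg K (X.interchange l m x (rev x) h) -
        (α * (letterBracket x (rev x) : K[X])) • dg K (X.contract l m x h))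
  | split (X : Q.Diagram) (l m : List (Letter E)) (x : Letter E)
      (h : X.word = l ++ x :: rev x :: m)
      (hc : X.next.SameCycle l.length (l.length + 1)) :
      Skein α β (dg K X - dg K (X.interchange l m x (rev x) h) -
        (β * (letterBracket x (rev x) : K[X])) • dg K (X.contract l m x h))

/-- The quantized necklace algebra with join coefficient `α` and split coefficient `β`.
Schedler's algebra is `N(1, ħ)`. -/
abbrev N [DecidableEq E] (α β : K[X]) : Type _ := QuotBy {z | Q.Skein K α β z}

variable {Q} in
/-- The class in `N(α, β)` of a product of cyclic words with heights. -/
def nclass [DecidableEq E] (α β : K[X]) (X : Q.Diagram) : Q.N K α β :=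
  QuotBy.mk K[X] {z | Q.Skein K α β z} (dg K X)

open Classical in
/-- The lift `x ↦ x̂` of elements of the path algebra: linear, given on closed paths by the standard
lift, and zero on the other paths (whose classes in `(K Q̄)_♮` are zero). -/
def hat [DecidableEq E] (α β : K[X]) : Q.PathAlg K →ₗ[K] Q.N K α β :=
  PathAlg.extend Q K fun p =>
    if hp : p.IsClosed then nclass K α β (Diagram.ofClosed p hp) else 0

/-- The lifts of the elements of `K Q̄ w`. -/
def momentLifts [Fintype V] [Fintype E] [DecidableEq E] (α β : K[X]) : Set (Q.N K α β) :=
  Set.range fun y : Q.PathAlg K => Q.hat K α β (y * PathAlg.moment Q K)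

/-- The non-commutative quantum reduction `R_q = N / N (K Q̄ w)^ N`. -/
abbrev Rq [Fintype V] [Fintype E] [DecidableEq E] (α β : K[X]) : Type _ :=
  QuotBy (Q.momentLifts K α β)

/-- The reduction map `N → R_q`. -/
abbrev toRq [Fintype V] [Fintype E] [DecidableEq E] (α β : K[X]) :
    Q.N K α β →ₐ[K[X]] Q.Rq K α β :=
  QuotBy.mk K[X] (Q.momentLifts K α β)

end QuiverData

/-- The algebra `A / ħ A` over `K`, for an algebra `A` over `K[ħ]`. -/
abbrev ModHbar (K : Type w) [Field K] (A : Type*) [Ring A] [Algebra K[X] A] : Type _ :=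
  QuotBy ({algebraMap K[X] A (hbar K)} : Set A)

/-- The projection `A → A / ħ A`. -/
abbrev toModHbar (K : Type w) [Field K] (A : Type*) [Ring A] [Algebra K[X] A] :
    A →ₐ[K[X]] ModHbar K A :=
  QuotBy.mk K[X] ({algebraMap K[X] A (hbar K)} : Set A)

/-! ### Homogenized differential operators -/

section DiffOps

variable (K : Type w) [Field K] (T : Type u) [CommRing T] [Algebra K T]

/-- Generators of the algebra of homogenized differential operators: functions and derivations. -/
abbrev DGen : Type _ := FreeAlgebra K[X] (T ⊕ Derivation K T T)

variable {T} in
/-- A function as a generator. -/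
abbrev DGen.fn (f : T) : DGen K T := FreeAlgebra.ι K[X] (Sum.inl f)

variable {K T} in
/-- A derivation as a generator. -/
abbrev DGen.der (D : Derivation K T T) : DGen K T := FreeAlgebra.ι K[X] (Sum.inr D)

/-- The defining relations of the homogenized differential operators. -/
inductive DRel : DGen K T → DGen K T → Prop
  | fn_const (c : K) : DRel (DGen.fn K (algebraMap K T c)) (algebraMap K[X] (DGen K T) (C c))
  | fn_add (f g : T) : DRel (DGen.fn K (f + g)) (DGen.fn K f + DGen.fn K g)
  | fn_mul (f g : T) : DRel (DGen.fn K f * DGen.fn K g) (DGen.fn K (f * g))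
  | der_add (D D' : Derivation K T T) :
      DRel (DGen.der (D + D')) (DGen.der D + DGen.der D')
  | fn_der (f : T) (D : Derivation K T T) :
      DRel (DGen.fn K f * DGen.der D) (DGen.der (f • D))
  | der_fn (D : Derivation K T T) (f : T) :
      DRel (DGen.der D * DGen.fn K f) (DGen.der (f • D) + hbar K • DGen.fn K (D f))
  | der_der (D D' : Derivation K T T) :
      DRel (DGen.der D * DGen.der D' - DGen.der D' * DGen.der D) (hbar K • DGen.der ⁅D, D'⁆)

/-- The algebra `D_ħ` of homogenized differential operators on the affine variety with coordinate
ring `T`. -/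
def DiffOp : Type _ := RingQuot (DRel K T)

instance : Ring (DiffOp K T) := inferInstanceAs (Ring (RingQuot (DRel K T)))

instance : Algebra K[X] (DiffOp K T) := inferInstanceAs (Algebra K[X] (RingQuot (DRel K T)))

/-- The projection from the free algebra. -/
def DiffOp.mk : DGen K T →ₐ[K[X]] DiffOp K T := RingQuot.mkAlgHom K[X] (DRel K T)

variable {T} in
/-- A function as a differential operator. -/
def DiffOp.fn (f : T) : DiffOp K T := DiffOp.mk K T (DGen.fn K f)

variable {K T} in
/-- A derivation as a differential operator. -/
def DiffOp.der (D : Derivation K T T) : DiffOp K T := DiffOp.mk K T (DGen.der D)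

variable {K T}

lemma DiffOp.mk_rel {x y : DGen K T} (h : DRel K T x y) : DiffOp.mk K T x = DiffOp.mk K T y :=
  RingQuot.mkAlgHom_rel K[X] h

/-- The derivation `φ ∘ D ∘ φ⁻¹`. -/
def conjDer (φ : T ≃ₐ[K] T) (D : Derivation K T T) : Derivation K T T :=
  Derivation.mk' (φ.toLinearMap ∘ₗ D.toLinearMap ∘ₗ φ.symm.toLinearMap) (fun a b => by
    simp [Derivation.leibniz])

@[simp] lemma conjDer_apply (φ : T ≃ₐ[K] T) (D : Derivation K T T) (f : T) :
    conjDer φ D f = φ (D (φ.symm f)) := rfl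

/-- The action `D ↦ φ ∘ D ∘ φ⁻¹` of an automorphism of `T` on `D_ħ`. -/
def DiffOp.map (φ : T ≃ₐ[K] T) : DiffOp K T →ₐ[K[X]] DiffOp K T :=
  RingQuot.liftAlgHom K[X]
    ⟨FreeAlgebra.lift K[X]
      (Sum.elim (fun f => DiffOp.fn K (φ f)) fun D => DiffOp.der (conjDer φ D)), by
      intro x y h
      cases h with
      | fn_const c =>
        simp only [FreeAlgebra.lift_ι_apply, Sum.elim_inl, AlgHom.commutes, AlgEquiv.commutes]
        exact (DiffOp.mk_rel (DRel.fn_const c)).trans (AlgHom.commutes _ _)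
      | fn_add f g =>
        simp only [map_add, FreeAlgebra.lift_ι_apply, Sum.elim_inl]
        exact (DiffOp.mk_rel (DRel.fn_add _ _)).trans (map_add _ _ _)
      | fn_mul f g =>
        simp only [map_mul, FreeAlgebra.lift_ι_apply, Sum.elim_inl]
        exact (map_mul _ _ _).symm.trans (DiffOp.mk_rel (DRel.fn_mul _ _))
      | der_add D D' =>
        simp only [map_add, FreeAlgebra.lift_ι_apply, Sum.elim_inr]
        rw [show conjDer φ (D + D') = conjDer φ D + conjDer φ D' by ext; simp]
        exact (DiffOp.mk_rel (DRel.der_add _ _)).trans (map_add _ _ _)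
      | fn_der f D =>
        simp only [map_mul, FreeAlgebra.lift_ι_apply, Sum.elim_inl, Sum.elim_inr]
        rw [show conjDer φ (f • D) = φ f • conjDer φ D by ext; simp]
        exact (map_mul _ _ _).symm.trans (DiffOp.mk_rel (DRel.fn_der _ _))
      | der_fn D f =>
        simp only [map_mul, map_add, map_smul, FreeAlgebra.lift_ι_apply, Sum.elim_inl,
          Sum.elim_inr]
        rw [show conjDer φ (f • D) = φ f • conjDer φ D by ext; simp,
          show φ (D f) = conjDer φ D (φ f) by simp]
        refine (map_mul _ _ _).symm.trans ((DiffOp.mk_rel (DRel.der_fn _ _)).trans ?_)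
        rw [map_add, map_smul]
        rfl
      | der_der D D' =>
        simp only [map_mul, map_sub, map_smul, FreeAlgebra.lift_ι_apply, Sum.elim_inr]
        rw [show conjDer φ ⁅D, D'⁆ = ⁅conjDer φ D, conjDer φ D'⁆ by
          ext; simp [Derivation.commutator_apply]]
        refine Eq.trans ?_ ((DiffOp.mk_rel (DRel.der_der _ _)).trans (map_smul _ _ _))
        rw [map_sub, map_mul, map_mul]
        rfl⟩

end DiffOps

/-! ### Representation spaces and the quantum trace -/

namespace QuiverData

variable {V : Type u} {E : Type v} (Q : QuiverData V E) (d : V → ℕ) (K : Type w) [Field K]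

/-- The rows and columns `1, …, |d|`, grouped by vertices. -/
abbrev Idx (d : V → ℕ) : Type u := Σ i : V, Fin (d i)

/-- The coordinates of `Rep(Q, d)`: the entries of the `d_{t(a)} × d_{s(a)}` matrices. -/
abbrev RepCoord : Type _ :=
  {c : E × Idx d × Idx d // c.2.1.1 = Q.tgt c.1 ∧ c.2.2.1 = Q.src c.1}

/-- The coordinate ring of `Rep(Q, d)`. -/
abbrev RepRing : Type _ := MvPolynomial (Q.RepCoord d) K

variable [DecidableEq V]

/-- The generic matrix `[a]` of an arrow `a`: a block matrix of coordinate functions whose only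
nonzero block has rows indexed by `t(a)` and columns indexed by `s(a)`. -/
def coordMat (a : E) : Matrix (Idx d) (Idx d) (Q.RepRing d K) := fun p q =>
  if h : p.1 = Q.tgt a ∧ q.1 = Q.src a then MvPolynomial.X ⟨(a, p, q), h⟩ else 0

/-- The matrix `[a^*]` of differential operators, with entries
`[a^*]_{pq} = ∂ / ∂[a]_{qp}` in the block with rows `s(a)` and columns `t(a)`. -/
def derMat [DecidableEq E] (a : E) :
    Matrix (Idx d) (Idx d) (Derivation K (Q.RepRing d K) (Q.RepRing d K)) := fun p q =>
  if h : q.1 = Q.tgt a ∧ p.1 = Q.src a then MvPolynomial.pderiv ⟨(a, q, p), h⟩ else 0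

/-- The algebra `D_ħ(Rep(Q, d))`. -/
abbrev RepDiff : Type _ := DiffOp K (Q.RepRing d K)

/-- The matrix `[x]` of differential operators given by an arrow `x` of the doubled quiver. -/
def opMat [DecidableEq E] : Letter E → Matrix (Idx d) (Idx d) (Q.RepDiff d K)
  | Sum.inl a => fun p q => DiffOp.fn K (Q.coordMat d K a p q)
  | Sum.inr a => fun p q => DiffOp.der (Q.derMat d K a p q)

/-- The value of the quantum trace on a product of cyclic words with heights:
`d_{v₁} ⋯ d_{v_m} ∑ ∏_h [a_h]_{k_h, k_{next h}}`, with one summation index `k_h` for each arrow,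
and with the factors in the order of increasing heights. -/
def traceFormula [Fintype V] [DecidableEq E] (X : Q.Diagram) : Q.RepDiff d K :=
  (X.verts.map fun i => (d i : K[X])).prod •
    ∑ k : Fin X.word.length → Idx d,
      (List.ofFn fun h : Fin X.word.length =>
        Q.opMat d K (X.word.get h) (k h) (k ⟨X.next h, X.next_lt h.2⟩)).prod

/-- The group `GL_d`. -/
abbrev GLd (d : V → ℕ) (K : Type w) [Field K] : Type _ :=
  ∀ i : V, Matrix.GeneralLinearGroup (Fin (d i)) K

/-- The Lie algebra `gl_d`. -/
abbrev gld (d : V → ℕ) (K : Type w) : Type _ := ∀ i : V, Matrix (Fin (d i)) (Fin (d i)) K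

variable {d K} in
/-- The block diagonal matrix given by an element of `gl_d`, with entries in the coordinate
ring. -/
def blk (x : gld d K) : Matrix (Idx d) (Idx d) (Q.RepRing d K) :=
  (Matrix.blockDiagonal' x).map (algebraMap K (Q.RepRing d K))

lemma blk_one : Q.blk (fun i => (1 : Matrix (Fin (d i)) (Fin (d i)) K)) = 1 := by
  rw [blk]
  rw [show (fun i => (1 : Matrix (Fin (d i)) (Fin (d i)) K)) = 1 from rfl,
    Matrix.blockDiagonal'_one]
  exact Matrix.map_one _ (map_zero _) (map_one _)

variable {d K} in
lemma blk_apply_ne (x : gld d K) {p q : Idx d} (h : p.1 ≠ q.1) : Q.blk x p q = 0 := by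
  rw [blk, Matrix.map_apply, Matrix.blockDiagonal'_apply, dif_neg h, map_zero]

variable [Fintype V]

variable {d K} in
/-- The action of `g ∈ GL_d` on functions, `(g f)(ρ) = f(g⁻¹ ρ)`, where `GL_d` acts on
representations by `(g ρ)_a = g_{t(a)} ρ_a g_{s(a)}⁻¹`; on coordinates it is
`[a] ↦ g_{t(a)}⁻¹ [a] g_{s(a)}`. -/
def glHom (g : GLd d K) : Q.RepRing d K →ₐ[K] Q.RepRing d K :=
  MvPolynomial.aeval fun c =>
    (Q.blk (fun i => ((g⁻¹) i : Matrix (Fin (d i)) (Fin (d i)) K)) * Q.coordMat d K c.1.1 *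
      Q.blk (fun i => (g i : Matrix (Fin (d i)) (Fin (d i)) K))) c.1.2.1 c.1.2.2


variable {d K} in
lemma blk_mul (x y : gld d K) : Q.blk x * Q.blk y = Q.blk (fun i => x i * y i) := by
  rw [blk, blk, blk, ← Matrix.map_mul]
  congr 1
  exact (Matrix.blockDiagonal'_mul x y).symm

variable {d K} in
lemma blk_conj_ne (x y : gld d K) (a : E) (p q : Idx d)
    (h : ¬ (p.1 = Q.tgt a ∧ q.1 = Q.src a)) :
    (Q.blk x * Q.coordMat d K a * Q.blk y) p q = 0 := by
  rw [Matrix.mul_apply]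
  refine Finset.sum_eq_zero fun q' _ => ?_
  rw [Matrix.mul_apply, Finset.sum_mul]
  refine Finset.sum_eq_zero fun p' _ => ?_
  by_cases h1 : p.1 = p'.1
  · by_cases h2 : q'.1 = q.1
    · have : Q.coordMat d K a p' q' = 0 := by
        rw [coordMat, dif_neg]
        rw [← h1, h2]
        exact h
      rw [this, mul_zero, zero_mul]
    · rw [Q.blk_apply_ne y h2, mul_zero]
  · rw [Q.blk_apply_ne x h1, zero_mul, zero_mul]

variable {d K} in
lemma glHom_coordMat (g : GLd d K) (a : E) :
    (Q.coordMat d K a).map (Q.glHom g) =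
      Q.blk (fun i => ((g⁻¹) i : Matrix (Fin (d i)) (Fin (d i)) K)) * Q.coordMat d K a *
        Q.blk (fun i => (g i : Matrix (Fin (d i)) (Fin (d i)) K)) := by
  ext p q : 2
  rw [Matrix.map_apply]
  by_cases h : p.1 = Q.tgt a ∧ q.1 = Q.src a
  · rw [coordMat, dif_pos h, glHom, MvPolynomial.aeval_X]
  · rw [Q.blk_conj_ne _ _ a p q h, coordMat, dif_neg h, map_zero]

variable {d K} in
lemma glHom_blk (g : GLd d K) (x : gld d K) : (Q.blk x).map (Q.glHom g) = Q.blk x := by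
  ext p q : 2
  simp [blk, Matrix.map_apply]

variable {d K} in
lemma glHom_inv (g : GLd d K) :
    (Q.glHom g).comp (Q.glHom g⁻¹) = AlgHom.id K (Q.RepRing d K) := by
  refine MvPolynomial.algHom_ext fun c => ?_
  obtain ⟨⟨a, p, q⟩, h⟩ := c
  have hX : (MvPolynomial.X ⟨(a, p, q), h⟩ : Q.RepRing d K) = Q.coordMat d K a p q := by
    rw [coordMat, dif_pos h]
  rw [AlgHom.comp_apply, AlgHom.id_apply, hX]
  have h1 := congrFun (congrFun (Q.glHom_coordMat g⁻¹ a) p) q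
  rw [Matrix.map_apply] at h1
  rw [h1, ← Matrix.map_apply (f := Q.glHom g), Matrix.map_mul, Matrix.map_mul, glHom_blk,
    glHom_blk, glHom_coordMat, inv_inv]
  rw [Matrix.mul_assoc, Matrix.mul_assoc, Matrix.mul_assoc, blk_mul, ← Matrix.mul_assoc,
    ← Matrix.mul_assoc, blk_mul]
  have e1 : (fun i => (g i : Matrix (Fin (d i)) (Fin (d i)) K) *
      ((g⁻¹) i : Matrix (Fin (d i)) (Fin (d i)) K)) = fun i => 1 := by
    funext i
    rw [← Units.val_mul, ← Pi.mul_apply, mul_inv_cancel]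
    rfl
  rw [e1, blk_one, Matrix.one_mul, Matrix.mul_one]

variable {d K} in
/-- The action of `g ∈ GL_d` on functions, as an automorphism. -/
def glEquiv (g : GLd d K) : Q.RepRing d K ≃ₐ[K] Q.RepRing d K :=
  AlgEquiv.ofAlgHom (Q.glHom g) (Q.glHom g⁻¹) (Q.glHom_inv g)
    (by simpa using Q.glHom_inv g⁻¹)

/-- The algebra `D_ħ(Rep(Q, d))^{GL_d}` of invariants for the action `g.D = g ∘ D ∘ g⁻¹`. -/
def invDiff : Subalgebra K[X] (Q.RepDiff d K) :=
  ⨅ g : GLd d K, AlgHom.equalizer (DiffOp.map (Q.glEquiv g)) (AlgHom.id K[X] (Q.RepDiff d K))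

variable {d K} in
/-- The infinitesimal action `τ : gl_d → Der`, which sends the elementary matrix `e^i_{pq}` to
`∑_{s(a)=i} ∑_j [a]_{jp} ∂/∂[a]_{jq} - ∑_{t(a)=i} ∑_j [a]_{qj} ∂/∂[a]_{pj}`; in other words
`τ(x)[a] = [a] x_{s(a)} - x_{t(a)} [a]`. -/
def tau (x : gld d K) : Derivation K (Q.RepRing d K) (Q.RepRing d K) :=
  MvPolynomial.mkDerivation K fun c =>
    (Q.coordMat d K c.1.1 * Q.blk x - Q.blk x * Q.coordMat d K c.1.1) c.1.2.1 c.1.2.2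

variable {d K} in
/-- The character `χ₀ = -∑_k (∑_{s(a)=k} d_{t(a)}) tr_k` of `gl_d`. -/
def chi0 [Fintype E] (x : gld d K) : K :=
  -∑ k : V, ((∑ a : E, if Q.src a = k then d (Q.tgt a) else 0 : ℕ) : K) * (x k).trace

/-- The left ideal `D_ħ(Rep(Q, d)) (τ - ħ χ₀)(gl_d)`. -/
def momentIdeal [Fintype E] : Ideal (Q.RepDiff d K) :=
  Ideal.span (Set.range fun x : gld d K =>
    DiffOp.der (Q.tau x) - algebraMap K[X] (Q.RepDiff d K) (hbar K * C (Q.chi0 x)))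

/-- `(D_ħ(Rep(Q, d)) (τ - ħ χ₀)(gl_d))^{GL_d}`, the invariant part of the left ideal, as a left
ideal of the algebra of invariants. -/
def invMomentIdeal [Fintype E] : Ideal (Q.invDiff d K) :=
  (Q.momentIdeal d K).comap (Q.invDiff d K).subtype

end QuiverData

end NecklaceReduction

end

open Polynomial NecklaceReduction NecklaceReduction.QuiverData

noncomputable section

namespace NecklaceReduction

open Polynomial

universe u v w

set_option linter.unusedSectionVars false

/-! ### Permutations of finite support and transpositions -/

/-! Everything about `N(α, β)` follows from one structural fact, valid for arbitrary `α`, `β`: the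
products of standard lifts, one for each multiset of closed paths up to rotation, form a
`K[ħ]`-basis (`stdBasis`).

They span because an exchange of two adjacent heights costs at most a diagram with two arrows fewer.
Hence heights can be rearranged freely modulo shorter diagrams, and up to rearrangement a diagram is
the multiset of its cyclic words (`exists_rearr_prod`, `rearr_of_mon_eq`).

They are independent because of an explicit normal form, a version of Wick's theorem. To a diagram
one attaches the sum, over all sets of disjoint contractions of an `a^*` with an `a` lying above it,
of the monomial of the cyclic words that remain, weighted by `-1` for each contraction and by `α` or
`β` according to whether it joins or splits cycles. This sum is well defined because the weight does
not depend on the order in which the contractions are made (`FinSupp.contrCoeff_comm`). It respects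
the skein relations, because exchanging two neighbours changes only the terms in which they are
contracted with each other (`wickOp_interchange`, `Diagram.normalForm_skein`). Its term without
contractions is the monomial of the diagram and all others have fewer arrows, so the standard
products are sent to a triangular family (`linearIndependent_stdClass`).

For the classical limits, moving the arrows of one closed path past those of another gives `α` times
the lift of the necklace bracket modulo `αβ` (`hat_commutator`), and the lift depends only on the
class modulo commutators up to multiples of `β` (`hat_mem_of_cl_eq_zero`). When `ħ` divides `β`, the
lift therefore induces an injection of `(K Q̄)_♮` into `N/ħN`. For `α = 1` its image is closed under
commutators, which gives the necklace bracket together with its Jacobi identity. The algebra map out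
of the enveloping or symmetric algebra is bijective because ordered monomials span the source and
are sent to a basis of the target (`bijective_of_ordered_monomials`).

For the reduction, the kernel of `pr` consists of the classes of the `y w` (`pr_eq_zero_iff`). The
bracket with a closed path is, modulo commutators, a derivation that kills `w` by a telescoping sum
(`pathDer_hamArr_moment`), so this kernel is a Lie ideal. The reduced isomorphism is inverted by a
map that exists because all relations of `R_q/ħR_q` hold in the classical quotient
(`quantization_reduction`).

For the quantum trace, the commutator of the entries of `[x]` and `[x^*]` is `-ħ {x, x^*}` times
Kronecker deltas. Summing over the indices contracts the diagram, and each index left free counts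
the dimension of a vertex, so the trace formula satisfies the skein relations with `α = β = -ħ`
(`traceFormula_sub_interchange_rev`). The entries of the matrix of `w` are, up to sign, the
generators of the moment ideal, the shift by `ħ χ₀` coming from reordering `a^* a`
(`momentMat_apply_mem`). Traces are invariant because `g` acts on the matrices by conjugation with
scalar matrices, and invariant operators commute with `τ` by an expansion in `t` of the action of `1
+ t x` (`tau_commute_of_mul_self`), which makes the invariant part of the moment ideal two-sided. -/

/-- A permutation of `ℕ` which fixes almost all points. -/
def FinSupp (σ : Equiv.Perm ℕ) : Prop := ∃ n, ∀ k, n ≤ k → σ k = k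

lemma FinSupp.lt {σ : Equiv.Perm ℕ} {n : ℕ} (h : ∀ k, n ≤ k → σ k = k) {k : ℕ} (hk : k < n) :
    σ k < n := by
  by_contra h'
  have := σ.injective (h _ (Nat.not_lt.1 h'))
  omega

/-- The forward orbit stays in a finite initial segment, so two iterates coincide, and injectivity
cancels the common initial part. -/
lemma FinSupp.mem_periodicPts {σ : Equiv.Perm ℕ} (h : FinSupp σ) (i : ℕ) :
    i ∈ Function.periodicPts σ := by
  obtain ⟨n, hn⟩ := h
  have hmaps : Set.MapsTo (fun k => σ^[k] i) Set.univ (Finset.range (max n (i + 1)) : Set ℕ) := by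
    intro k _
    simp only [Finset.coe_range, Set.mem_Iio]
    induction k with
    | zero => simp
    | succ k ih =>
      rw [Function.iterate_succ_apply']
      rcases lt_or_ge (σ^[k] i) n with h1 | h1
      · exact lt_of_lt_of_le (FinSupp.lt hn h1) (le_max_left _ _)
      · rw [hn _ h1]; exact ih trivial
  obtain ⟨a, -, b, -, hab, he⟩ :=
    Set.infinite_univ.exists_ne_map_eq_of_mapsTo hmaps (Finset.finite_toSet _)
  wlog hlt : a < b generalizing a b
  · exact this b a hab.symm he.symm (lt_of_le_of_ne (not_lt.1 hlt) hab.symm)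
  refine ⟨b - a, by omega, ?_⟩
  change σ^[b - a] i = i
  have hinj : Function.Injective (σ^[a]) := σ.injective.iterate a
  apply hinj
  rw [← Function.iterate_add_apply, show a + (b - a) = b by omega]
  exact he.symm

/-- Lying in a common cycle is the least equivalence relation that contains all steps of the
permutation. This bounds the cycles of a modified permutation from above. -/
lemma sameCycle_le {α : Type*} {σ : Equiv.Perm α} (r : Setoid α) (h : ∀ x, r x (σ x)) {x y : α}
    (hxy : σ.SameCycle x y) : r x y := by
  obtain ⟨z, rfl⟩ := hxy
  induction z with
  | zero => exact r.refl _
  | succ n ih =>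
    rw [add_comm, zpow_add, zpow_one, Equiv.Perm.mul_apply]
    exact r.trans ih (h _)
  | pred n ih =>
    refine r.trans ih (r.symm ?_)
    have := h ((σ ^ (-(n : ℤ) - 1)) x)
    rwa [← Equiv.Perm.mul_apply, ← zpow_one_add, show (1 : ℤ) + (-(n : ℤ) - 1) = -n by ring] at this

/-- Every point is periodic, so one step backwards can be replaced by `r - 1` steps forwards, where
`r` is a period. -/
lemma FinSupp.sameCycle_iff {σ : Equiv.Perm ℕ} (h : FinSupp σ) {i j : ℕ} :
    σ.SameCycle i j ↔ ∃ n : ℕ, σ^[n] i = j := by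
  constructor
  · intro hij
    obtain ⟨r, hr, hri⟩ := h.mem_periodicPts i
    have h1 : ∀ k : ℕ, σ^[k + r] i = σ^[k] i := fun k => by
      rw [Function.iterate_add_apply, hri]
    obtain ⟨z, rfl⟩ := hij
    induction z with
    | zero => exact ⟨0, rfl⟩
    | succ n ih =>
      obtain ⟨m, hm⟩ := ih
      refine ⟨m + 1, ?_⟩
      rw [add_comm (n : ℤ), zpow_add, zpow_one, Equiv.Perm.mul_apply, ← hm,
        Function.iterate_succ_apply']
    | pred n ih =>
      obtain ⟨m, hm⟩ := ih
      refine ⟨m + (r - 1), ?_⟩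
      apply σ.injective
      rw [← Function.iterate_succ_apply' (⇑σ), ← Equiv.Perm.mul_apply, ← zpow_one_add,
        show (1 : ℤ) + (-(n : ℤ) - 1) = -n by ring, ← hm,
        show (m + (r - 1)).succ = m + r by omega]
      exact h1 m
  · rintro ⟨n, rfl⟩
    exact ⟨n, by rw [zpow_natCast, Equiv.Perm.iterate_eq_pow]⟩

lemma FinSupp.mul_swap {σ : Equiv.Perm ℕ} (h : FinSupp σ) (i j : ℕ) :
    FinSupp (σ * Equiv.swap i j) := by
  obtain ⟨n, hn⟩ := h
  refine ⟨max n (max (i + 1) (j + 1)), fun k hk => ?_⟩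
  rw [Equiv.Perm.mul_apply, Equiv.swap_apply_of_ne_of_ne (by simp at hk; omega)
    (by simp at hk; omega)]
  exact hn k (by simp at hk; omega)

lemma FinSupp.mul_swap_iff {σ : Equiv.Perm ℕ} (i j : ℕ) :
    FinSupp (σ * Equiv.swap i j) ↔ FinSupp σ :=
  ⟨fun h => by simpa using h.mul_swap i j, fun h => h.mul_swap i j⟩

lemma sameCycle_self_apply {α : Type*} (σ : Equiv.Perm α) (x : α) : σ.SameCycle x (σ x) :=
  ⟨1, by simp⟩

/-- The modified permutation goes from `i` to `σ j` and then follows the old cycle of `j`, which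
avoids `i`, until it arrives at `j`. -/
lemma FinSupp.sameCycle_mul_swap_self {σ : Equiv.Perm ℕ} (h : FinSupp σ) {i j : ℕ}
    (hij : ¬ σ.SameCycle i j) : (σ * Equiv.swap i j).SameCycle i j := by
  set τ := σ * Equiv.swap i j with hτ
  have key : ∀ m : ℕ, τ.SameCycle i (σ^[m + 1] j) := by
    intro m
    induction m with
    | zero => simpa [hτ] using sameCycle_self_apply τ i
    | succ m ih =>
      rw [Function.iterate_succ_apply']
      set x := σ^[m + 1] j with hx
      have hxi : x ≠ i := fun e => hij ((h.sameCycle_iff.2 ⟨m + 1, hx.symm.trans e⟩).symm)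
      by_cases hxj : x = j
      · rw [hxj]; simpa [hτ] using sameCycle_self_apply τ i
      · refine ih.trans ?_
        have := sameCycle_self_apply τ x
        rwa [hτ, Equiv.Perm.mul_apply, Equiv.swap_apply_of_ne_of_ne hxi hxj] at this
  obtain ⟨r, hr, hrj⟩ := h.mem_periodicPts j
  have := key (r - 1)
  rw [show r - 1 + 1 = r by omega] at this
  rwa [show σ^[r] j = j from hrj] at this

/-- Multiplication by a transposition of points in different cycles joins the two cycles. -/
lemma FinSupp.sameCycle_mul_swap {σ : Equiv.Perm ℕ} (h : FinSupp σ) {i j : ℕ}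
    (hij : ¬ σ.SameCycle i j) (x y : ℕ) :
    (σ * Equiv.swap i j).SameCycle x y ↔ σ.SameCycle x y ∨
      ((σ.SameCycle x i ∨ σ.SameCycle x j) ∧ (σ.SameCycle y i ∨ σ.SameCycle y j)) := by
  have hself := h.sameCycle_mul_swap_self hij
  set τ := σ * Equiv.swap i j with hτ
  have hle : ∀ {x y}, σ.SameCycle x y → τ.SameCycle x y := by
    intro x y hxy
    refine sameCycle_le (Equiv.Perm.SameCycle.setoid τ) (fun z => ?_) hxy
    change τ.SameCycle z (σ z)
    by_cases h1 : z = i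
    · subst h1
      refine hself.trans ?_
      simpa [hτ] using sameCycle_self_apply τ j
    · by_cases h2 : z = j
      · subst h2
        refine hself.symm.trans ?_
        simpa [hτ] using sameCycle_self_apply τ i
      · have := sameCycle_self_apply τ z
        rwa [hτ, Equiv.Perm.mul_apply, Equiv.swap_apply_of_ne_of_ne h1 h2] at this
  constructor
  · intro hxy
    -- The right-hand side is an equivalence relation containing each step of the modified
    -- permutation, so it contains its cycles.
    let r : Setoid ℕ :=
      { r := fun x y => σ.SameCycle x y ∨
          ((σ.SameCycle x i ∨ σ.SameCycle x j) ∧ (σ.SameCycle y i ∨ σ.SameCycle y j))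
        iseqv :=
          { refl := fun x => Or.inl (Equiv.Perm.SameCycle.refl _ _)
            symm := by
              rintro x y (h | ⟨h1, h2⟩)
              · exact Or.inl h.symm
              · exact Or.inr ⟨h2, h1⟩
            trans := by
              rintro x y z (h | ⟨h1, h2⟩) (h' | ⟨h1', h2'⟩)
              · exact Or.inl (h.trans h')
              · exact Or.inr ⟨h1'.imp h.trans h.trans, h2'⟩
              · exact Or.inr ⟨h1, h2.imp h'.symm.trans h'.symm.trans⟩
              · exact Or.inr ⟨h1, h2'⟩ } }
    refine sameCycle_le r (fun z => ?_) hxy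
    change σ.SameCycle z _ ∨ _
    by_cases h1 : z = i
    · subst h1
      exact Or.inr ⟨Or.inl (Equiv.Perm.SameCycle.refl _ _),
        Or.inr (by simpa [hτ] using (sameCycle_self_apply σ j).symm)⟩
    · by_cases h2 : z = j
      · subst h2
        exact Or.inr ⟨Or.inr (Equiv.Perm.SameCycle.refl _ _),
          Or.inl (by simpa [hτ] using (sameCycle_self_apply σ i).symm)⟩
      · left
        rw [hτ, Equiv.Perm.mul_apply, Equiv.swap_apply_of_ne_of_ne h1 h2]
        exact sameCycle_self_apply σ z
  · rintro (hxy | ⟨hx, hy⟩)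
    · exact hle hxy
    · have hx' : τ.SameCycle x i := hx.elim hle fun h => (hle h).trans hself.symm
      have hy' : τ.SameCycle y i := hy.elim hle fun h => (hle h).trans hself.symm
      exact hx'.trans hy'.symm

/-- Multiplication by a transposition of points in the same cycle splits the cycle. -/
lemma FinSupp.not_sameCycle_mul_swap_self {σ : Equiv.Perm ℕ} (h : FinSupp σ) {i j : ℕ}
    (hne : i ≠ j) (hij : σ.SameCycle i j) : ¬ (σ * Equiv.swap i j).SameCycle i j := by
  intro hτ'
  classical
  have hex := h.sameCycle_iff.1 hij
  let m := Nat.find hex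
  have hm : σ^[m] i = j := Nat.find_spec hex
  have hmin : ∀ k < m, σ^[k] i ≠ j := fun k hk => Nat.find_min hex hk
  have hm0 : 1 ≤ m := by
    rcases Nat.eq_zero_or_pos m with h0 | h0
    · rw [h0] at hm; exact absurd hm hne
    · exact h0
  have hi : ∀ k, 1 ≤ k → k ≤ m → σ^[k] i ≠ i := by
    intro k hk hkm e
    apply hmin (m - k) (by omega)
    rw [← hm]
    conv_rhs => rw [show m = (m - k) + k by omega, Function.iterate_add_apply, e]
  obtain ⟨n, hn⟩ := (h.mul_swap i j).sameCycle_iff.1 hτ'.symm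
  -- With `m` the first time at which `σ` leads from `i` to `j`, the modified permutation started at
  -- `j` stays among `σ i, …, σ^m i = j`, and `i` is not one of these points.
  have key : ∀ n : ℕ, ∃ k, 1 ≤ k ∧ k ≤ m ∧ (σ * Equiv.swap i j)^[n] j = σ^[k] i := by
    intro n
    induction n with
    | zero => exact ⟨m, hm0, le_rfl, hm.symm⟩
    | succ n ih =>
      obtain ⟨k, hk1, hk2, hk⟩ := ih
      rw [Function.iterate_succ_apply', hk, Equiv.Perm.mul_apply]
      rcases Nat.lt_or_ge k m with hlt | hge
      · refine ⟨k + 1, by omega, hlt, ?_⟩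
        rw [Equiv.swap_apply_of_ne_of_ne (hi k hk1 hk2) (hmin k hlt),
          Function.iterate_succ_apply']
      · have : k = m := le_antisymm hk2 hge
        refine ⟨1, le_rfl, hm0, ?_⟩
        rw [this, hm, Equiv.swap_apply_right]
        rfl
  obtain ⟨k, hk1, hk2, hk⟩ := key n
  exact hi k hk1 hk2 (hk.symm.trans hn)

lemma FinSupp.sameCycle_mul_swap_self_iff {σ : Equiv.Perm ℕ} (h : FinSupp σ) {i j : ℕ}
    (hne : i ≠ j) : (σ * Equiv.swap i j).SameCycle i j ↔ ¬ σ.SameCycle i j :=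
  ⟨fun h1 h2 => h.not_sameCycle_mul_swap_self hne h2 h1, h.sameCycle_mul_swap_self⟩

section Coefficient

variable {C : Type*} (α β : C)

open Classical in
/-- The coefficient of the contraction of the points `i` and `j`: `β` if their cycle is split,
and `α` if their cycles are joined. -/
def contrCoeff (σ : Equiv.Perm ℕ) (i j : ℕ) : C := if σ.SameCycle i j then β else α

lemma contrCoeff_symm (σ : Equiv.Perm ℕ) (i j : ℕ) :
    contrCoeff α β σ i j = contrCoeff α β σ j i := by
  unfold contrCoeff
  by_cases h : σ.SameCycle i j
  · rw [if_pos h, if_pos h.symm]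
  · rw [if_neg h, if_neg fun h' => h h'.symm]

/-- Two disjoint contractions get the same total weight in either order; without this the sum over
contractions would not be well defined. If exactly one of the pairs lies in a common cycle, each
pair keeps its own type when the other one is contracted first. If both pairs do, or neither does,
the first weights agree, and the condition that decides the second weight is symmetric in the two
pairs. -/
lemma FinSupp.contrCoeff_comm [CommRing C] (α β : C) {σ : Equiv.Perm ℕ} (h : FinSupp σ) {i j k l : ℕ} (hij : i ≠ j)
    (hkl : k ≠ l) (hik : i ≠ k) (hil : i ≠ l) (hjk : j ≠ k) (hjl : j ≠ l) :
    contrCoeff α β σ i j * contrCoeff α β (σ * Equiv.swap i j) k l =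
      contrCoeff α β σ k l * contrCoeff α β (σ * Equiv.swap k l) i j := by
  have aux : ∀ (σ : Equiv.Perm ℕ), FinSupp σ → ∀ i j k l : ℕ, k ≠ l → ¬ σ.SameCycle i j →
      σ.SameCycle k l → (σ * Equiv.swap i j).SameCycle k l ∧
        ¬ (σ * Equiv.swap k l).SameCycle i j := by
    intro σ h i j k l hkl hP hR
    -- A join keeps `k` and `l` together. A split only refines cycles: multiplying by the same
    -- transposition again joins the pieces and gives back `σ`.
    refine ⟨(h.sameCycle_mul_swap hP k l).2 (Or.inl hR), fun hS => hP ?_⟩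
    have h1 := h.not_sameCycle_mul_swap_self hkl hR
    have h2 := ((h.mul_swap k l).sameCycle_mul_swap h1 i j).2 (Or.inl hS)
    rwa [mul_assoc, Equiv.swap_mul_self, mul_one] at h2
  have hcomm : σ * Equiv.swap i j * Equiv.swap k l = σ * Equiv.swap k l * Equiv.swap i j := by
    rw [mul_assoc, mul_assoc]
    congr 1
    refine (Equiv.Perm.Disjoint.commute ?_).eq
    intro x
    by_cases hx : x = i ∨ x = j
    · right
      rcases hx with rfl | rfl
      · exact Equiv.swap_apply_of_ne_of_ne hik hil
      · exact Equiv.swap_apply_of_ne_of_ne hjk hjl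
    · left
      exact Equiv.swap_apply_of_ne_of_ne (fun e => hx (Or.inl e)) (fun e => hx (Or.inr e))
  unfold contrCoeff
  by_cases hP : σ.SameCycle i j <;> by_cases hR : σ.SameCycle k l
  · have gen : ∀ (i j k l : ℕ), i ≠ j → k ≠ l → σ.SameCycle i j →
        σ * Equiv.swap i j * Equiv.swap k l = σ * Equiv.swap k l * Equiv.swap i j →
        (σ * Equiv.swap i j).SameCycle k l → (σ * Equiv.swap k l).SameCycle i j := by
      intro i j k l hij hkl hP hcomm hQ
      have h1 := h.not_sameCycle_mul_swap_self hij hP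
      -- If `k` and `l` stay together after the split at `i`, `j`, then `i` and `j` are apart after
      -- both contractions; undoing the one at `i`, `j` joins them.
      have h2 := (aux _ (h.mul_swap i j) i j k l hkl h1 hQ).2
      rw [hcomm] at h2
      exact not_not.1 fun h3 => h2 (((h.mul_swap k l).sameCycle_mul_swap_self_iff hij).2 h3)
    have : (σ * Equiv.swap i j).SameCycle k l ↔ (σ * Equiv.swap k l).SameCycle i j :=
      ⟨gen i j k l hij hkl hP hcomm, gen k l i j hkl hij hR hcomm.symm⟩
    by_cases hQ : (σ * Equiv.swap i j).SameCycle k l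
    · simp [hP, hR, hQ, this.1 hQ]
    · simp [hP, hR, hQ, mt this.2 hQ]
  · obtain ⟨h1, h2⟩ := aux σ h k l i j hij hR hP
    simp [hP, hR, h1, h2, mul_comm]
  · obtain ⟨h1, h2⟩ := aux σ h i j k l hkl hP hR
    simp [hP, hR, h1, h2, mul_comm]
  · have : (σ * Equiv.swap i j).SameCycle k l ↔ (σ * Equiv.swap k l).SameCycle i j := by
      rw [h.sameCycle_mul_swap hP, h.sameCycle_mul_swap hR]
      simp only [hP, hR, false_or, Equiv.Perm.sameCycle_comm (f := σ) (x := k),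
        Equiv.Perm.sameCycle_comm (f := σ) (x := l)]
      constructor
      · rintro ⟨h1 | h1, h2 | h2⟩
        · exact absurd (h1.symm.trans h2) hR
        · exact ⟨Or.inl h1, Or.inr h2⟩
        · exact ⟨Or.inr h2, Or.inl h1⟩
        · exact absurd (h1.symm.trans h2) hR
      · rintro ⟨h1 | h1, h2 | h2⟩
        · exact absurd (h1.trans h2.symm) hP
        · exact ⟨Or.inl h1, Or.inr h2⟩
        · exact ⟨Or.inr h2, Or.inl h1⟩
        · exact absurd (h1.trans h2.symm) hP
    by_cases hQ : (σ * Equiv.swap i j).SameCycle k l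
    · simp [hP, hR, hQ, this.1 hQ]
    · simp [hP, hR, hQ, mt this.2 hQ]

end Coefficient

lemma bypass_mul_swap {p i j : ℕ} (σ : Equiv.Perm ℕ) (hi : i ≠ p) (hj : j ≠ p) :
    bypass p (σ * Equiv.swap i j) = bypass p σ * Equiv.swap i j := by
  rw [bypass, bypass, Equiv.Perm.mul_apply, Equiv.swap_apply_of_ne_of_ne hi.symm hj.symm, mul_assoc]

/-- Removing a point is multiplication by the transposition with its predecessor, so the statements
on joins and splits apply to it. -/
lemma bypass_eq (p : ℕ) (σ : Equiv.Perm ℕ) : bypass p σ = σ * Equiv.swap (σ⁻¹ p) p := by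
  rw [bypass, Equiv.swap_comm p]
  have := Equiv.swap_apply_apply σ (σ⁻¹ p) p
  rw [show σ (σ⁻¹ p) = p from σ.apply_symm_apply p, Equiv.swap_comm] at this
  rw [this]
  simp

lemma bypass_apply_of_apply_ne {p i : ℕ} (σ : Equiv.Perm ℕ) (hi : i ≠ p) (h : σ i ≠ p) :
    bypass p σ i = σ i := by
  rw [bypass, Equiv.Perm.mul_apply, Equiv.swap_apply_of_ne_of_ne h (fun e => hi (σ.injective e))]

lemma bypass_apply_of_apply_eq {p i : ℕ} (σ : Equiv.Perm ℕ) (h : σ i = p) :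
    bypass p σ i = σ p := by
  rw [bypass, Equiv.Perm.mul_apply, h, Equiv.swap_apply_left]

lemma bypass_eq_self {p : ℕ} (σ : Equiv.Perm ℕ) (h : σ p = p) : bypass p σ = σ := by
  rw [bypass, h, Equiv.swap_self]; rfl

lemma FinSupp.bypass {σ : Equiv.Perm ℕ} (h : FinSupp σ) (p : ℕ) : FinSupp (bypass p σ) := by
  rw [bypass_eq]; exact h.mul_swap _ _

lemma finSupp_bypass_iff {σ : Equiv.Perm ℕ} (p : ℕ) : FinSupp (bypass p σ) ↔ FinSupp σ := by
  rw [bypass_eq, FinSupp.mul_swap_iff]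

/-- Removing `p` splits it off as a fixed point. Undoing this joins a cycle with `{p}`, which is not
felt by points other than `p`. -/
lemma FinSupp.sameCycle_bypass {σ : Equiv.Perm ℕ} (h : FinSupp σ) {p i j : ℕ} (hi : i ≠ p)
    (hj : j ≠ p) : (NecklaceReduction.bypass p σ).SameCycle i j ↔ σ.SameCycle i j := by
  by_cases hp : σ p = p
  · rw [bypass_eq_self σ hp]
  have hq : σ⁻¹ p ≠ p := fun e => hp (by rw [Equiv.Perm.inv_eq_iff_eq] at e; exact e.symm)
  have hpq : σ.SameCycle (σ⁻¹ p) p := by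
    simpa using sameCycle_self_apply σ (σ⁻¹ p)
  have h1 := h.not_sameCycle_mul_swap_self hq hpq
  have h2 := (h.mul_swap (σ⁻¹ p) p).sameCycle_mul_swap h1 i j
  rw [mul_assoc, Equiv.swap_mul_self, mul_one, ← bypass_eq] at h2
  rw [h2]
  have hfix : ∀ x, (NecklaceReduction.bypass p σ).SameCycle x p ↔ x = p := by
    intro x
    constructor
    · intro hx
      have := hx.symm.eq_of_left (bypass_self p σ)
      exact this.symm
    · rintro rfl; exact Equiv.Perm.SameCycle.refl _ _
  simp only [hfix, hi, hj, or_false]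
  constructor
  · exact Or.inl
  · rintro (h | ⟨h, h'⟩)
    · exact h
    · exact h.trans h'.symm

/-! ### Products of traces along the cycles of a permutation -/

/-- A function with `t (a b) = t (b a)`. -/
structure CycTrace (A C : Type*) [Monoid A] where
  toFun : A → C
  comm : ∀ a b, toFun (a * b) = toFun (b * a)

section Cyc

variable {A C : Type*} [Monoid A] (t : CycTrace A C)

/-- The trace of the product of `ω` along a cycle. -/
def cycVal (ω : ℕ → A) (c : Cycle ℕ) : C :=
  Quotient.liftOn c (fun l => t.toFun (l.map ω).prod) (by
    rintro l l' ⟨n, rfl⟩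
    simp only [List.rotate_eq_drop_append_take_mod, List.map_append, List.prod_append]
    rw [t.comm, ← List.prod_append, ← List.map_append, List.take_append_drop])

lemma cycVal_coe (ω : ℕ → A) (l : List ℕ) :
    cycVal t ω (l : Cycle ℕ) = t.toFun (l.map ω).prod := rfl

lemma cycVal_congr {ω ω' : ℕ → A} {f : ℕ → ℕ} {c : Cycle ℕ} (h : ∀ i ∈ c, ω' (f i) = ω i) :
    cycVal t ω' (c.map f) = cycVal t ω c := by
  induction c using Quotient.inductionOn with
  | h l =>
    change t.toFun _ = t.toFun _
    rw [List.map_map]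
    congr 2
    exact List.map_congr_left fun i hi => h i hi

variable [CommMonoid C]

/-- The product over the cycles of `σ` in `S` of the traces of the products of `ω`. -/
def cycProd (S : Finset ℕ) (σ : Equiv.Perm ℕ) (ω : ℕ → A) : C :=
  ∏ c ∈ S.image (fun i => Function.periodicOrbit σ i), cycVal t ω c

lemma periodicOrbit_semiconj {S : Finset ℕ} {σ σ' : Equiv.Perm ℕ} {f : ℕ → ℕ}
    (hf : Function.Injective f) (hS : ∀ i ∈ S, σ i ∈ S) (hσ : ∀ i ∈ S, σ' (f i) = f (σ i))
    {i : ℕ} (hi : i ∈ S) :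
    Function.periodicOrbit σ' (f i) = (Function.periodicOrbit σ i).map f := by
  have hit : ∀ n, σ^[n] i ∈ S ∧ σ'^[n] (f i) = f (σ^[n] i) := by
    intro n
    induction n with
    | zero => exact ⟨hi, rfl⟩
    | succ n ih =>
      rw [Function.iterate_succ_apply', Function.iterate_succ_apply', ih.2, hσ _ ih.1]
      exact ⟨hS _ ih.1, rfl⟩
  have hmin : Function.minimalPeriod σ' (f i) = Function.minimalPeriod σ i := by
    rw [Function.minimalPeriod_eq_minimalPeriod_iff]
    intro n
    change σ'^[n] (f i) = f i ↔ σ^[n] i = i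
    rw [(hit n).2, hf.eq_iff]
  rw [Function.periodicOrbit_def, Function.periodicOrbit_def, hmin]
  rw [Cycle.map_coe, List.map_map]
  congr 1
  exact List.map_congr_left fun n _ => (hit n).2

lemma mem_of_mem_periodicOrbit {S : Finset ℕ} {σ : Equiv.Perm ℕ} (hS : ∀ i ∈ S, σ i ∈ S)
    {i j : ℕ} (hi : i ∈ S) (hj : j ∈ Function.periodicOrbit σ i) : j ∈ S := by
  rw [Function.periodicOrbit_def] at hj
  obtain ⟨n, -, rfl⟩ := List.mem_map.1 hj
  clear hj
  induction n with
  | zero => exact hi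
  | succ n ih => rw [Function.iterate_succ_apply']; exact hS _ ih

/-- The map `f` has to intertwine the permutations on the stable set `S` only: renumberings such as
`skip` do not reach all of `ℕ`. -/
lemma cycProd_relabel {S : Finset ℕ} {σ σ' : Equiv.Perm ℕ} {ω ω' : ℕ → A} {f : ℕ → ℕ}
    (hf : Function.Injective f) (hS : ∀ i ∈ S, σ i ∈ S) (hσ : ∀ i ∈ S, σ' (f i) = f (σ i))
    (hω : ∀ i ∈ S, ω' (f i) = ω i) : cycProd t (S.image f) σ' ω' = cycProd t S σ ω := by
  have h1 : (S.image f).image (fun i => Function.periodicOrbit σ' i) =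
      (S.image (fun i => Function.periodicOrbit σ i)).image (Cycle.map f) := by
    rw [Finset.image_image, Finset.image_image]
    exact Finset.image_congr fun i hi => periodicOrbit_semiconj hf hS hσ hi
  have hinj : Function.Injective (Cycle.map f) := by
    intro c c'
    induction c using Quotient.inductionOn with
    | h l =>
      induction c' using Quotient.inductionOn with
      | h l' =>
        intro h
        have h2 : l.map f ~r l'.map f := Quotient.exact h
        obtain ⟨n, hn⟩ := h2
        rw [← List.map_rotate] at hn
        exact Quotient.sound ⟨n, (List.map_injective_iff.2 hf) hn⟩
  rw [cycProd, h1, Finset.prod_image hinj.injOn]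
  refine Finset.prod_congr rfl fun c hc => ?_
  obtain ⟨i, hi, rfl⟩ := Finset.mem_image.1 hc
  exact cycVal_congr t fun j hj => hω j (mem_of_mem_periodicOrbit hS hi hj)

lemma cycProd_congr {S : Finset ℕ} {σ σ' : Equiv.Perm ℕ} {ω ω' : ℕ → A}
    (hS : ∀ i ∈ S, σ i ∈ S) (hσ : ∀ i ∈ S, σ' i = σ i)
    (hω : ∀ i ∈ S, ω' i = ω i) : cycProd t S σ' ω' = cycProd t S σ ω := by
  have := cycProd_relabel t (f := id) Function.injective_id hS hσ hω
  rwa [Finset.image_id] at this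

/-- `cycProd` multiplies over a set of cycles, so it must be excluded that `S` and `T` share one.
Finiteness of the support puts each point on its own orbit, and the orbits of `S` stay in `S`. -/
lemma cycProd_union {S T : Finset ℕ} {σ : Equiv.Perm ℕ} (ω : ℕ → A) (h : FinSupp σ)
    (hS : ∀ i ∈ S, σ i ∈ S) (hST : Disjoint S T) :
    cycProd t (S ∪ T) σ ω = cycProd t S σ ω * cycProd t T σ ω := by
  rw [cycProd, Finset.image_union, Finset.prod_union]
  · rfl
  · rw [Finset.disjoint_left]
    intro c hc hc'
    obtain ⟨i, hi, rfl⟩ := Finset.mem_image.1 hc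
    obtain ⟨j, hj, hij⟩ := Finset.mem_image.1 hc'
    have h1 : j ∈ Function.periodicOrbit σ j :=
      Function.self_mem_periodicOrbit (h.mem_periodicPts j)
    rw [show Function.periodicOrbit σ j = Function.periodicOrbit σ i from hij] at h1
    exact Finset.disjoint_left.1 hST (mem_of_mem_periodicOrbit hS hi h1) hj

lemma cycProd_empty (σ : Equiv.Perm ℕ) (ω : ℕ → A) : cycProd t ∅ σ ω = 1 := by
  simp [cycProd]

/-- `L` lists a cycle of `σ`. -/
structure IsCycleList (σ : Equiv.Perm ℕ) (L : List ℕ) : Prop where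
  nodup : L.Nodup
  next : ∀ k (h : k < L.length), σ L[k] = L[(k + 1) % L.length]'(Nat.mod_lt _ (by omega))

lemma IsCycleList.iterate {σ : Equiv.Perm ℕ} {L : List ℕ} (h : IsCycleList σ L) (k m : ℕ)
    (hk : k < L.length) :
    σ^[m] L[k] = L[(k + m) % L.length]'(Nat.mod_lt _ (by omega)) := by
  induction m with
  | zero => simp [Nat.mod_eq_of_lt hk]
  | succ m ih =>
    rw [Function.iterate_succ_apply', ih, h.next]
    congr 1
    simp [← add_assoc]

lemma IsCycleList.apply_mem {σ : Equiv.Perm ℕ} {L : List ℕ} (h : IsCycleList σ L) {x : ℕ}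
    (hx : x ∈ L) : σ x ∈ L := by
  obtain ⟨k, hk, rfl⟩ := List.mem_iff_getElem.1 hx
  rw [h.next k hk]
  exact List.getElem_mem _

lemma IsCycleList.periodicOrbit_eq {σ : Equiv.Perm ℕ} {L : List ℕ} (h : IsCycleList σ L) {x : ℕ}
    (hx : x ∈ L) : Function.periodicOrbit σ x = (L : Cycle ℕ) := by
  obtain ⟨k, hk, rfl⟩ := List.mem_iff_getElem.1 hx
  have hpos : 0 < L.length := by omega
  have hper : Function.IsPeriodicPt σ L.length L[0] := by
    change σ^[L.length] L[0] = L[0]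
    rw [h.iterate 0 _ hpos]
    simp
  have h0 : Function.periodicOrbit σ L[0] = (L : Cycle ℕ) := by
    have hmin : Function.minimalPeriod σ L[0] = L.length := by
      apply le_antisymm (hper.minimalPeriod_le hpos)
      by_contra hlt
      rw [not_le] at hlt
      have h1 : σ^[Function.minimalPeriod σ L[0]] L[0] = L[0] := Function.iterate_minimalPeriod
      rw [h.iterate 0 _ hpos, h.nodup.getElem_inj_iff, zero_add, Nat.mod_eq_of_lt hlt] at h1
      have := hper.minimalPeriod_pos hpos
      omega
    rw [Function.periodicOrbit_def, hmin]
    congr 1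
    apply List.ext_getElem
    · simp
    · intro n h1 h2
      simp only [List.getElem_map, List.getElem_range]
      rw [h.iterate 0 n hpos]
      simp [Nat.mod_eq_of_lt h2]
  have := Function.periodicOrbit_apply_iterate_eq (f := σ) ⟨_, hpos, hper⟩ k
  rw [h.iterate 0 k hpos] at this
  simp only [zero_add, Nat.mod_eq_of_lt hk] at this
  rw [this, h0]

lemma IsCycleList.cycProd_eq {σ : Equiv.Perm ℕ} {L : List ℕ} (h : IsCycleList σ L) (hL : L ≠ [])
    (ω : ℕ → A) : cycProd t L.toFinset σ ω = t.toFun (L.map ω).prod := by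
  have : L.toFinset.image (fun i => Function.periodicOrbit σ i) = {(L : Cycle ℕ)} := by
    ext c
    simp only [Finset.mem_image, List.mem_toFinset, Finset.mem_singleton]
    constructor
    · rintro ⟨i, hi, rfl⟩
      exact h.periodicOrbit_eq hi
    · rintro rfl
      obtain ⟨x, hx⟩ := List.exists_mem_of_ne_nil L hL
      exact ⟨x, hx, h.periodicOrbit_eq hx⟩
  rw [cycProd, this, Finset.prod_singleton, cycVal_coe]

/-- The list `[p, σ p, σ² p, …]` of the elements of the cycle of `p`. -/
def orbitList (σ : Equiv.Perm ℕ) (p : ℕ) : List ℕ :=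
  (List.range (Function.minimalPeriod σ p)).map fun n => σ^[n] p

lemma orbitList_isCycleList (σ : Equiv.Perm ℕ) (p : ℕ) :
    IsCycleList σ (orbitList σ p) := by
  constructor
  · exact Function.nodup_periodicOrbit (f := σ) (x := p)
  · intro k hk
    simp only [orbitList, List.length_map, List.length_range, List.getElem_map,
      List.getElem_range, ← Function.iterate_succ_apply' (⇑σ)]
    exact (Function.iterate_mod_minimalPeriod_eq).symm

lemma FinSupp.orbitList_eq_cons {σ : Equiv.Perm ℕ} (h : FinSupp σ) (p : ℕ) :
    ∃ l, orbitList σ p = p :: l := by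
  have := Function.minimalPeriod_pos_of_mem_periodicPts (h.mem_periodicPts p)
  obtain ⟨n, hn⟩ := Nat.exists_eq_succ_of_ne_zero this.ne'
  rw [orbitList, hn, List.range_succ_eq_map]
  exact ⟨_, rfl⟩

lemma mem_orbitList_subset {S : Finset ℕ} {σ : Equiv.Perm ℕ} (hS : ∀ i ∈ S, σ i ∈ S)
    {i j : ℕ} (hi : i ∈ S) (hj : j ∈ orbitList σ i) : j ∈ S :=
  mem_of_mem_periodicOrbit hS hi hj

/-- Only the last entry had `p` as its successor; it is now sent to the successor of `p`, the head
of the shortened list. -/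
lemma IsCycleList.bypass {σ : Equiv.Perm ℕ} {p : ℕ} {l : List ℕ} (h : IsCycleList σ (p :: l)) :
    IsCycleList (NecklaceReduction.bypass p σ) l := by
  have hnd := List.nodup_cons.1 h.nodup
  refine ⟨hnd.2, fun k hk => ?_⟩
  have hne : l[k] ≠ p := fun e => hnd.1 (e ▸ List.getElem_mem hk)
  have h1 := h.next (k + 1) (by simpa using hk)
  simp only [List.getElem_cons_succ, List.length_cons] at h1
  by_cases hk' : k + 1 < l.length
  · have e1 : (k + 1 + 1) % (l.length + 1) = k + 1 + 1 := Nat.mod_eq_of_lt (by omega)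
    simp only [e1, List.getElem_cons_succ] at h1
    rw [bypass_apply_of_apply_ne σ hne, h1]
    · simp [Nat.mod_eq_of_lt hk']
    · rw [h1]; exact fun e => hnd.1 (e ▸ List.getElem_mem hk')
  · have e0 : k + 1 = l.length := by omega
    have e1 : (k + 1 + 1) % (l.length + 1) = 0 := by rw [e0]; simp
    simp only [e1, List.getElem_cons_zero] at h1
    rw [bypass_apply_of_apply_eq σ h1]
    have h2 := h.next 0 (by simp)
    have e2 : (0 + 1) % (l.length + 1) = 1 := Nat.mod_eq_of_lt (by omega)
    simp only [List.getElem_cons_zero, List.length_cons, e2] at h2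
    rw [h2]
    simp [e0]

/-- A point `p` whose label acts as a unit can be removed from its cycle. -/
lemma cycProd_bypass {S : Finset ℕ} {σ : Equiv.Perm ℕ} {ω : ℕ → A} (h : FinSupp σ)
    (hS : ∀ i ∈ S, σ i ∈ S) {p : ℕ} (hp : p ∈ S) (hω : σ p ≠ p → ω p * ω (σ p) = ω (σ p)) :
    cycProd t S σ ω =
      (if σ p = p then t.toFun (ω p) else 1) * cycProd t (S.erase p) (bypass p σ) ω := by
  obtain ⟨l, hl⟩ := h.orbitList_eq_cons p
  have hL : IsCycleList σ (p :: l) := hl ▸ orbitList_isCycleList σ p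
  have hLS : (p :: l).toFinset ⊆ S := fun j hj =>
    mem_orbitList_subset hS hp (hl ▸ List.mem_toFinset.1 hj)
  have hnd := List.nodup_cons.1 hL.nodup
  set O := (p :: l).toFinset with hO
  have hOinv : ∀ i ∈ O, σ i ∈ O := fun i hi => by
    rw [hO, List.mem_toFinset] at hi ⊢
    exact hL.apply_mem hi
  have hOinv' : ∀ i, σ i ∈ O → i ∈ O := by
    -- A finite set that is mapped into itself injectively is also stable under preimages, so its
    -- complement in `S` is stable too.
    have himg : O.image σ = O := Finset.eq_of_subset_of_card_le
      (fun x hx => by obtain ⟨i, hi, rfl⟩ := Finset.mem_image.1 hx; exact hOinv i hi)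
      (Finset.card_image_of_injective _ σ.injective).ge
    intro i hi
    rw [← himg] at hi
    obtain ⟨j, hj, hji⟩ := Finset.mem_image.1 hi
    rwa [← σ.injective hji]
  have hT : ∀ i ∈ S \ O, σ i ∈ S \ O := fun i hi => by
    rw [Finset.mem_sdiff] at hi ⊢
    exact ⟨hS i hi.1, fun h' => hi.2 (hOinv' i h')⟩
  have hpO : p ∈ O := by simp [hO]
  have hbT : ∀ i ∈ S \ O, bypass p σ i = σ i := fun i hi => by
    rw [Finset.mem_sdiff] at hi
    exact bypass_apply_of_apply_ne σ (fun e => hi.2 (e ▸ hpO))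
      (fun e => hi.2 (hOinv' i (e ▸ hpO)))
  have hOe : O.erase p = l.toFinset := by
    rw [hO, List.toFinset_cons, Finset.erase_insert (by simpa using hnd.1)]
  have hSe : S.erase p = l.toFinset ∪ S \ O := by
    rw [← hOe]
    ext x
    simp only [Finset.mem_erase, Finset.mem_union, Finset.mem_sdiff]
    constructor
    · rintro ⟨h1, h2⟩
      by_cases hx : x ∈ O
      · exact Or.inl ⟨h1, hx⟩
      · exact Or.inr ⟨h2, hx⟩
    · rintro (⟨h1, h2⟩ | ⟨h1, h2⟩)
      · exact ⟨h1, hLS h2⟩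
      · exact ⟨fun e => h2 (e ▸ hpO), h1⟩
  have e1 : cycProd t S σ ω = cycProd t O σ ω * cycProd t (S \ O) σ ω := by
    rw [← cycProd_union t ω h hOinv Finset.disjoint_sdiff, Finset.union_sdiff_of_subset hLS]
  have hbl := hL.bypass
  have e2 : cycProd t (S.erase p) (bypass p σ) ω =
      cycProd t l.toFinset (bypass p σ) ω * cycProd t (S \ O) σ ω := by
    rw [hSe, cycProd_union t ω (h.bypass p)]
    · congr 1
      exact cycProd_congr t hT hbT fun _ _ => rfl
    · intro i hi
      rw [List.mem_toFinset] at hi ⊢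
      exact hbl.apply_mem hi
    · rw [Finset.disjoint_left]
      intro x hx hx'
      rw [← hOe] at hx
      exact (Finset.mem_sdiff.1 hx').2 (Finset.mem_of_mem_erase hx)
  rw [e1, e2, ← mul_assoc]
  congr 1
  rw [hL.cycProd_eq t (by simp)]
  -- Either `p` is a cycle by itself, whose trace is the extra factor, or its label is absorbed by
  -- that of its successor.
  rcases l with _ | ⟨x, l⟩
  · have : σ p = p := by simpa using hL.next 0 (by simp)
    simp [this, cycProd_empty]
  · have hx : σ p = x := by
      have := hL.next 0 (by simp)
      simpa using this
    have hne : σ p ≠ p := fun e => hnd.1 (by simp [← hx, e])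
    rw [if_neg hne, one_mul, hbl.cycProd_eq t (by simp)]
    have := hω hne
    rw [hx] at this
    simp only [List.map_cons, List.prod_cons, ← mul_assoc, this]

end Cyc

/-! ### Normally ordered sums over contractions -/

section Contractions

variable {R M : Type*} [CommRing R] [AddCommGroup M] [Module R M] (c : ℕ → ℕ → R) (α β : R)

open Classical in
/-- The contraction of the points `i` and `j`, as an operator on functions of a set of contracted
points and a permutation. -/
def contrOp (i j : ℕ) : Module.End R (Finset ℕ × Equiv.Perm ℕ → M) where
  toFun F s := if i ∉ s.1 ∧ j ∉ s.1 ∧ i ≠ j ∧ FinSupp s.2 then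
    (c i j * contrCoeff α β s.2 i j) • F (insert i (insert j s.1), s.2 * Equiv.swap i j) else 0
  map_add' F G := by
    funext s
    simp only [Pi.add_apply]
    split_ifs <;> simp
  map_smul' r F := by
    funext s
    simp only [Pi.smul_apply, RingHom.id_apply]
    split_ifs
    · rw [smul_comm]
    · simp

lemma contrOp_apply (i j : ℕ) (F : Finset ℕ × Equiv.Perm ℕ → M) {D : Finset ℕ}
    {σ : Equiv.Perm ℕ} (hi : i ∉ D) (hj : j ∉ D) (hij : i ≠ j) (hσ : FinSupp σ) :
    contrOp c α β i j F (D, σ) =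
      (c i j * contrCoeff α β σ i j) • F (insert i (insert j D), σ * Equiv.swap i j) :=
  if_pos ⟨hi, hj, hij, hσ⟩

lemma contrOp_apply_eq_zero (i j : ℕ) (F : Finset ℕ × Equiv.Perm ℕ → M) {D : Finset ℕ}
    {σ : Equiv.Perm ℕ} (h : ¬ (i ∉ D ∧ j ∉ D ∧ i ≠ j ∧ FinSupp σ)) :
    contrOp c α β i j F (D, σ) = 0 :=
  if_neg h

/-- A point can be contracted only once: the outer contraction records `i` and `j` in the set of
contracted points, and the guard of the inner one then fails. -/
lemma contrOp_mul_eq_zero {i j k l : ℕ} (h : k = i ∨ k = j ∨ l = i ∨ l = j) :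
    (contrOp c α β i j : Module.End R (Finset ℕ × Equiv.Perm ℕ → M)) * contrOp c α β k l = 0 := by
  refine LinearMap.ext fun F => funext fun ⟨D, σ⟩ => ?_
  change contrOp c α β i j (contrOp c α β k l F) (D, σ) = 0
  by_cases hc : i ∉ D ∧ j ∉ D ∧ i ≠ j ∧ FinSupp σ
  · rw [contrOp_apply c α β i j _ hc.1 hc.2.1 hc.2.2.1 hc.2.2.2, contrOp_apply_eq_zero, smul_zero]
    rintro ⟨hk, hl, -⟩
    simp only [Finset.mem_insert, not_or] at hk hl
    tauto
  · exact contrOp_apply_eq_zero c α β i j _ hc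

/-- Overlapping pairs give zero in both orders. For disjoint pairs the transpositions commute and
the weights agree by `FinSupp.contrCoeff_comm`. -/
lemma contrOp_commute (i j k l : ℕ) :
    Commute (contrOp c α β i j : Module.End R (Finset ℕ × Equiv.Perm ℕ → M))
      (contrOp c α β k l) := by
  by_cases hd : k = i ∨ k = j ∨ l = i ∨ l = j
  · have hd' : i = k ∨ i = l ∨ j = k ∨ j = l := by tauto
    rw [commute_iff_eq, contrOp_mul_eq_zero c α β hd, contrOp_mul_eq_zero c α β hd']
  · simp only [not_or] at hd
    obtain ⟨hki, hkj, hli, hlj⟩ := hd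
    refine LinearMap.ext fun F => funext fun ⟨D, σ⟩ => ?_
    change contrOp c α β i j (contrOp c α β k l F) (D, σ) =
      contrOp c α β k l (contrOp c α β i j F) (D, σ)
    by_cases h1 : i ∉ D ∧ j ∉ D ∧ i ≠ j ∧ FinSupp σ
    · by_cases h2 : k ∉ D ∧ l ∉ D ∧ k ≠ l ∧ FinSupp σ
      · rw [contrOp_apply c α β i j _ h1.1 h1.2.1 h1.2.2.1 h1.2.2.2,
          contrOp_apply c α β k l _ h2.1 h2.2.1 h2.2.2.1 h2.2.2.2,
          contrOp_apply c α β k l _ (by simp [hki, hkj, h2.1]) (by simp [hli, hlj, h2.2.1])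
            h2.2.2.1 (h1.2.2.2.mul_swap _ _),
          contrOp_apply c α β i j _ (by simp [Ne.symm hki, Ne.symm hli, h1.1])
            (by simp [Ne.symm hkj, Ne.symm hlj, h1.2.1]) h1.2.2.1 (h1.2.2.2.mul_swap _ _),
          smul_smul, smul_smul]
        congr 1
        · have := FinSupp.contrCoeff_comm α β h1.2.2.2 h1.2.2.1 h2.2.2.1 (Ne.symm hki)
            (Ne.symm hli) (Ne.symm hkj) (Ne.symm hlj)
          linear_combination (c i j * c k l) * this
        · congr 1
          refine Prod.ext ?_ ?_
          · ext x
            simp only [Finset.mem_insert]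
            tauto
          · simp only [mul_assoc]
            congr 1
            refine (Equiv.Perm.Disjoint.commute fun x => ?_).eq
            by_cases hx : x = k ∨ x = l
            · left
              rcases hx with rfl | rfl
              · exact Equiv.swap_apply_of_ne_of_ne hki hkj
              · exact Equiv.swap_apply_of_ne_of_ne hli hlj
            · right
              exact Equiv.swap_apply_of_ne_of_ne (fun e => hx (Or.inl e))
                (fun e => hx (Or.inr e))
      · rw [contrOp_apply c α β i j _ h1.1 h1.2.1 h1.2.2.1 h1.2.2.2,
          contrOp_apply_eq_zero c α β k l _ h2, contrOp_apply_eq_zero, smul_zero]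
        simp only [Finset.mem_insert, not_or, FinSupp.mul_swap_iff]
        tauto
    · rw [contrOp_apply_eq_zero c α β i j _ h1]
      by_cases h2 : k ∉ D ∧ l ∉ D ∧ k ≠ l ∧ FinSupp σ
      · rw [contrOp_apply c α β k l _ h2.1 h2.2.1 h2.2.2.1 h2.2.2.2, contrOp_apply_eq_zero,
          smul_zero]
        simp only [Finset.mem_insert, not_or, FinSupp.mul_swap_iff]
        tauto
      · rw [contrOp_apply_eq_zero c α β k l _ h2]

/-- The sum over all contractions of disjoint pairs of points of a list. -/
def wickOp : List ℕ → Module.End R (Finset ℕ × Equiv.Perm ℕ → M)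
  | [] => 1
  | i :: l => (1 + (l.map (contrOp c α β i)).sum) * wickOp l

lemma contrOp_mul_sum_eq_zero (i j k : ℕ) (l : List ℕ) (h : k = i ∨ k = j) :
    (contrOp c α β i j : Module.End R (Finset ℕ × Equiv.Perm ℕ → M)) *
      (l.map (contrOp c α β k)).sum = 0 := by
  induction l with
  | nil => simp
  | cons m l ih =>
    rw [List.map_cons, List.sum_cons, mul_add, ih, contrOp_mul_eq_zero c α β (by tauto), add_zero]

lemma contrOp_sum_commute (i j k : ℕ) (l : List ℕ) :
    Commute (contrOp c α β i j : Module.End R (Finset ℕ × Equiv.Perm ℕ → M))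
      (l.map (contrOp c α β k)).sum := by
  refine Commute.list_sum_right _ _ fun x hx => ?_
  obtain ⟨m, -, rfl⟩ := List.mem_map.1 hx
  exact contrOp_commute c α β i j k m

/-- The interchange of two neighbours in the normally ordered sum over contractions. -/
lemma wickOp_interchange (l m : List ℕ) (i j : ℕ) :
    (wickOp c α β (l ++ i :: j :: m) : Module.End R (Finset ℕ × Equiv.Perm ℕ → M)) -
      wickOp c α β (l ++ j :: i :: m) =
      (contrOp c α β i j - contrOp c α β j i) * wickOp c α β (l ++ m) := by
  induction l with
  | nil =>
    simp only [List.nil_append, wickOp, List.map_cons, List.sum_cons]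
    obtain ⟨P, hP⟩ : ∃ P : Module.End R (Finset ℕ × Equiv.Perm ℕ → M),
      (m.map (contrOp c α β i)).sum = P := ⟨_, rfl⟩
    rw [hP]
    obtain ⟨Q, hQ⟩ : ∃ Q : Module.End R (Finset ℕ × Equiv.Perm ℕ → M),
      (m.map (contrOp c α β j)).sum = Q := ⟨_, rfl⟩
    rw [hQ]
    have h1 : (contrOp c α β i j : Module.End R (Finset ℕ × Equiv.Perm ℕ → M)) * Q = 0 := by
      rw [← hQ]; exact contrOp_mul_sum_eq_zero c α β i j j m (Or.inr rfl)
    have h2 : (contrOp c α β j i : Module.End R (Finset ℕ × Equiv.Perm ℕ → M)) * P = 0 := by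
      rw [← hP]; exact contrOp_mul_sum_eq_zero c α β j i i m (Or.inr rfl)
    have h3 : P * Q = Q * P := by
      rw [← hP]
      refine (Commute.list_sum_left _ _ fun x hx => ?_).eq
      obtain ⟨k, -, rfl⟩ := List.mem_map.1 hx
      rw [← hQ]
      exact contrOp_sum_commute c α β i k j m
    rw [← mul_assoc, ← mul_assoc, ← sub_mul]
    congr 1
    -- In the expansion the mixed terms would contract `i` or `j` twice, and `P` and `Q` commute;
    -- only the contraction of `i` with `j` survives.
    have : (1 + (contrOp c α β i j + P)) * (1 + Q) - (1 + (contrOp c α β j i + Q)) * (1 + P) =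
        (contrOp c α β i j - contrOp c α β j i) + (contrOp c α β i j * Q - contrOp c α β j i * P)
          + (P * Q - Q * P) := by noncomm_ring
    rw [this, h1, h2, h3]
    simp
  | cons p l ih =>
    simp only [List.cons_append, wickOp]
    have hperm : ((l ++ j :: i :: m).map
        (contrOp c α β p : ℕ → Module.End R (Finset ℕ × Equiv.Perm ℕ → M))).sum =
        ((l ++ i :: j :: m).map (contrOp c α β p)).sum :=
      List.Perm.sum_eq (((List.Perm.swap i j m).append_left l).map _)
    rw [hperm, ← mul_sub, ih, ← mul_assoc, ← mul_assoc]
    congr 1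
    have hsplit : ((l ++ i :: j :: m).map
        (contrOp c α β p : ℕ → Module.End R (Finset ℕ × Equiv.Perm ℕ → M))).sum =
        ((l ++ m).map (contrOp c α β p)).sum + (contrOp c α β p i + contrOp c α β p j) := by
      simp only [List.map_append, List.map_cons, List.sum_append, List.sum_cons]
      abel
    -- For a point `p` in front, contractions with `i` or `j` are killed by the difference, and
    -- contractions with all other points commute with it.
    have hz : ((contrOp c α β p i + contrOp c α β p j) *
        (contrOp c α β i j - contrOp c α β j i) :
          Module.End R (Finset ℕ × Equiv.Perm ℕ → M)) = 0 := by
      rw [add_mul, mul_sub, mul_sub]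
      rw [contrOp_mul_eq_zero c α β (by tauto), contrOp_mul_eq_zero c α β (by tauto),
        contrOp_mul_eq_zero c α β (by tauto), contrOp_mul_eq_zero c α β (by tauto)]
      simp
    have hc : Commute ((contrOp c α β i j - contrOp c α β j i) :
        Module.End R (Finset ℕ × Equiv.Perm ℕ → M)) ((l ++ m).map (contrOp c α β p)).sum :=
      (contrOp_sum_commute c α β i j p _).sub_left (contrOp_sum_commute c α β j i p _)
    rw [hsplit, ← add_assoc, add_mul, hz, add_zero, add_mul, mul_add, one_mul, mul_one, hc.eq]

lemma wickOp_interchange_apply (l m : List ℕ) (i j : ℕ) (F : Finset ℕ × Equiv.Perm ℕ → M)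
    (s : Finset ℕ × Equiv.Perm ℕ) :
    wickOp c α β (l ++ i :: j :: m) F s - wickOp c α β (l ++ j :: i :: m) F s =
      contrOp c α β i j (wickOp c α β (l ++ m) F) s -
        contrOp c α β j i (wickOp c α β (l ++ m) F) s :=
  congrArg (fun G => G F s) (wickOp_interchange c α β l m i j)

lemma wickOp_cons_apply (i : ℕ) (l : List ℕ) (F : Finset ℕ × Equiv.Perm ℕ → M)
    (s : Finset ℕ × Equiv.Perm ℕ) :
    wickOp c α β (i :: l) F s =
      wickOp c α β l F s + (l.map fun j => contrOp c α β i j (wickOp c α β l F) s).sum := by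
  have : ∀ (m : List ℕ) (G : Finset ℕ × Equiv.Perm ℕ → M),
      (m.map (contrOp c α β i)).sum G s = (m.map fun j => contrOp c α β i j G s).sum := by
    intro m G
    induction m with
    | nil => rfl
    | cons k m ih =>
      rw [List.map_cons, List.sum_cons, List.map_cons, List.sum_cons, ← ih]
      rfl
  rw [wickOp, ← this]
  rfl

end Contractions

/-! ### Contraction sums evaluated on products of traces along cycles -/

section Wick

variable {R A C : Type*} [CommRing R] [Monoid A] [CommRing C] [Algebra R C]

/-- The labels `ω`, replaced by the labels `ε` on a set of contracted points. -/
def lab (ω ε : ℕ → A) (D : Finset ℕ) (i : ℕ) : A := if i ∈ D then ε i else ω i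

/-- The product of traces along cycles, as a function of the set of contracted points and the
permutation. -/
def cycFun (t : CycTrace A C) (ω ε : ℕ → A) (S : Finset ℕ) :
    Finset ℕ × Equiv.Perm ℕ → C :=
  fun s => cycProd t S s.2 (lab ω ε s.1)

variable (t : CycTrace A C) {α β : R}

lemma mul_swap_mem {S : Finset ℕ} {σ : Equiv.Perm ℕ} (hS : ∀ i ∈ S, σ i ∈ S) {i j : ℕ}
    (hi : i ∈ S) (hj : j ∈ S) : ∀ k ∈ S, (σ * Equiv.swap i j) k ∈ S := by
  intro k hk
  rw [Equiv.Perm.mul_apply]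
  apply hS
  rw [Equiv.swap_apply_def]
  split_ifs <;> assumption

lemma sameCycle_semiconj {S : Finset ℕ} {σ σ' : Equiv.Perm ℕ} {f : ℕ → ℕ}
    (hf : Function.Injective f) (hS : ∀ i ∈ S, σ i ∈ S) (hσ : ∀ i ∈ S, σ' (f i) = f (σ i))
    (h : FinSupp σ) (h' : FinSupp σ') {i j : ℕ} (hi : i ∈ S) :
    σ'.SameCycle (f i) (f j) ↔ σ.SameCycle i j := by
  have hit : ∀ n, σ^[n] i ∈ S ∧ σ'^[n] (f i) = f (σ^[n] i) := by
    intro n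
    induction n with
    | zero => exact ⟨hi, rfl⟩
    | succ n ih =>
      rw [Function.iterate_succ_apply', Function.iterate_succ_apply', ih.2, hσ _ ih.1]
      exact ⟨hS _ ih.1, rfl⟩
  rw [h.sameCycle_iff, h'.sameCycle_iff]
  refine exists_congr fun n => ?_
  rw [(hit n).2, hf.eq_iff]

/-- Used with a transposition for the interchange of two heights, and with `skip` for the deletion
of two heights. The set and the permutation vary in the induction because each contraction changes
both. -/
lemma wick_relabel {S : Finset ℕ} {f : ℕ → ℕ} (hf : Function.Injective f)
    {ω ε ω' ε' : ℕ → A} {c c' : ℕ → ℕ → R} (hω : ∀ i ∈ S, ω' (f i) = ω i)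
    (hε : ∀ i ∈ S, ε' (f i) = ε i) (hc : ∀ i ∈ S, ∀ j ∈ S, c' (f i) (f j) = c i j) :
    ∀ (l : List ℕ), (∀ i ∈ l, i ∈ S) → ∀ (D D' : Finset ℕ) (σ σ' : Equiv.Perm ℕ),
      FinSupp σ → FinSupp σ' → (∀ i ∈ S, σ i ∈ S) → (∀ i ∈ S, σ' (f i) = f (σ i)) →
      (∀ i ∈ S, f i ∈ D' ↔ i ∈ D) →
      wickOp c' α β (l.map f) (cycFun t ω' ε' (S.image f)) (D', σ') =
        wickOp c α β l (cycFun t ω ε S) (D, σ) := by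
  intro l
  induction l with
  | nil =>
    intro _ D D' σ σ' _ _ hS hσ hD
    refine cycProd_relabel t hf hS hσ fun i hi => ?_
    simp only [lab, hD i hi, hω i hi, hε i hi]
  | cons i l ih =>
    intro hl D D' σ σ' h h' hS hσ hD
    have hi : i ∈ S := hl i (by simp)
    have hl' : ∀ j ∈ l, j ∈ S := fun j hj => hl j (by simp [hj])
    rw [List.map_cons, wickOp_cons_apply, wickOp_cons_apply, ih hl' D D' σ σ' h h' hS hσ hD,
      List.map_map]
    congr 2
    refine List.map_congr_left fun j hj => ?_
    have hjS := hl' j hj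
    simp only [Function.comp_apply]
    by_cases hcond : i ∉ D ∧ j ∉ D ∧ i ≠ j ∧ FinSupp σ
    · rw [contrOp_apply _ _ _ _ _ _ hcond.1 hcond.2.1 hcond.2.2.1 h,
        contrOp_apply _ _ _ _ _ _ (by rw [hD i hi]; exact hcond.1)
          (by rw [hD j hjS]; exact hcond.2.1) (hf.ne hcond.2.2.1) h', hc i hi j hjS]
      congr 1
      · congr 1
        have := sameCycle_semiconj hf hS hσ h h' (j := j) hi
        unfold contrCoeff
        by_cases hs : σ.SameCycle i j
        · rw [if_pos hs, if_pos (this.2 hs)]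
        · rw [if_neg hs, if_neg (mt this.1 hs)]
      · refine ih hl' _ _ _ _ (h.mul_swap _ _) (h'.mul_swap _ _) (mul_swap_mem hS hi hjS) ?_ ?_
        · intro k hk
          rw [Equiv.Perm.mul_apply, Equiv.Perm.mul_apply, ← hσ _ ?_, hf.map_swap]
          rw [Equiv.swap_apply_def]
          split_ifs <;> assumption
        · intro k hk
          simp only [Finset.mem_insert, hf.eq_iff, hD k hk]
    · rw [contrOp_apply_eq_zero _ _ _ _ _ _ hcond, contrOp_apply_eq_zero]
      rw [hD i hi, hD j hjS, hf.ne_iff]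
      tauto

/-- A contracted point carries an idempotent that is a left unit for the label after it, so it can
be taken out of its cycle before the remaining contractions are made: these avoid `p`, and removing
`p` changes neither the cycles through the other points nor, therefore, the weights. -/
lemma wick_bypass {S : Finset ℕ} {p : ℕ} (hp : p ∈ S) {ω ε : ℕ → A} {c : ℕ → ℕ → R} :
    ∀ (l : List ℕ), (∀ i ∈ l, i ∈ S ∧ i ≠ p) → ∀ (D : Finset ℕ) (σ : Equiv.Perm ℕ),
      FinSupp σ → (∀ i ∈ S, σ i ∈ S) → p ∈ D →
      (σ p ≠ p → ε p * ω (σ p) = ω (σ p) ∧ ε p * ε (σ p) = ε (σ p)) →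
      wickOp c α β l (cycFun t ω ε S) (D, σ) =
        (if σ p = p then t.toFun (ε p) else 1) *
          wickOp c α β l (cycFun t ω ε (S.erase p)) (D, bypass p σ) := by
  intro l
  induction l with
  | nil =>
    intro _ D σ h hS hpD hu
    have hlp : lab ω ε D p = ε p := if_pos hpD
    refine (cycProd_bypass t h hS hp (fun hne => ?_)).trans ?_
    · rw [hlp]
      simp only [lab]
      split_ifs
      · exact (hu hne).2
      · exact (hu hne).1
    · simp only [hlp]
      rfl
  | cons i l ih =>
    intro hl D σ h hS hpD hu
    obtain ⟨hi, hip⟩ := hl i (by simp)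
    have hl' : ∀ j ∈ l, j ∈ S ∧ j ≠ p := fun j hj => hl j (by simp [hj])
    rw [wickOp_cons_apply, wickOp_cons_apply, ih hl' D σ h hS hpD hu, mul_add]
    congr 1
    rw [← List.sum_map_mul_left]
    congr 1
    refine List.map_congr_left fun j hj => ?_
    obtain ⟨hjS, hjp⟩ := hl' j hj
    by_cases hcond : i ∉ D ∧ j ∉ D ∧ i ≠ j ∧ FinSupp σ
    -- The transposition acts before `σ` and avoids `p`, so the successor of `p` and the unit
    -- property of its label persist.
    · have hσp : (σ * Equiv.swap i j) p = σ p := by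
        rw [Equiv.Perm.mul_apply, Equiv.swap_apply_of_ne_of_ne hip.symm hjp.symm]
      rw [contrOp_apply _ _ _ _ _ _ hcond.1 hcond.2.1 hcond.2.2.1 h,
        contrOp_apply _ _ _ _ _ _ hcond.1 hcond.2.1 hcond.2.2.1 (h.bypass p),
        ih hl' _ _ (h.mul_swap _ _) (mul_swap_mem hS hi hjS) (by simp [hpD]) (by rwa [hσp]),
        hσp, bypass_mul_swap σ hip hjp, mul_smul_comm]
      congr 2
      have := h.sameCycle_bypass (p := p) hip hjp
      unfold contrCoeff
      by_cases hs : σ.SameCycle i j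
      · rw [if_pos hs, if_pos (this.2 hs)]
      · rw [if_neg hs, if_neg (mt this.1 hs)]
    · rw [contrOp_apply_eq_zero _ _ _ _ _ _ hcond, contrOp_apply_eq_zero, mul_zero]
      rwa [finSupp_bypass_iff]

/-- The terms with contractions are of lower degree. -/
lemma wick_sub_mem {S : Finset ℕ} {ω ε : ℕ → A} {c : ℕ → ℕ → R} (J : ℕ → Submodule R C)
    (hJ : Monotone J)
    (h0 : ∀ (D : Finset ℕ) (σ : Equiv.Perm ℕ), D ⊆ S → FinSupp σ → (∀ i ∈ S, σ i ∈ S) →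
      cycFun t ω ε S (D, σ) ∈ J (S.card - D.card)) :
    ∀ (l : List ℕ), (∀ i ∈ l, i ∈ S) → ∀ (D : Finset ℕ) (σ : Equiv.Perm ℕ),
      D ⊆ S → FinSupp σ → (∀ i ∈ S, σ i ∈ S) →
      wickOp c α β l (cycFun t ω ε S) (D, σ) ∈ J (S.card - D.card) ∧
      wickOp c α β l (cycFun t ω ε S) (D, σ) - cycFun t ω ε S (D, σ) ∈
        J (S.card - D.card - 2) := by
  intro l
  induction l with
  | nil =>
    intro _ D σ hD h hS
    refine ⟨h0 D σ hD h hS, ?_⟩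
    simp [wickOp]
  | cons i l ih =>
    intro hl D σ hD h hS
    have hi := hl i (by simp)
    have hl' : ∀ j ∈ l, j ∈ S := fun j hj => hl j (by simp [hj])
    have hsum : (l.map fun j => contrOp c α β i j
        (wickOp c α β l (cycFun t ω ε S)) (D, σ)).sum ∈ J (S.card - D.card - 2) := by
      refine list_sum_mem fun x hx => ?_
      obtain ⟨j, hj, rfl⟩ := List.mem_map.1 hx
      have hjS := hl' j hj
      by_cases hcond : i ∉ D ∧ j ∉ D ∧ i ≠ j ∧ FinSupp σ
      · rw [contrOp_apply _ _ _ _ _ _ hcond.1 hcond.2.1 hcond.2.2.1 h]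
        refine Submodule.smul_mem _ _ ?_
        -- A contraction adds two points to `D` and so lowers the degree by two.
        have := (ih hl' (insert i (insert j D)) (σ * Equiv.swap i j) (by
          intro x hx
          simp only [Finset.mem_insert] at hx
          rcases hx with rfl | rfl | hx
          · exact hi
          · exact hjS
          · exact hD hx) (h.mul_swap _ _) (mul_swap_mem hS hi hjS)).1
        rwa [Finset.card_insert_of_notMem (by simp [hcond.1, hcond.2.2.1]),
          Finset.card_insert_of_notMem hcond.2.1, show S.card - (D.card + 1 + 1) =
            S.card - D.card - 2 by omega] at this
      · rw [contrOp_apply_eq_zero _ _ _ _ _ _ hcond]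
        exact zero_mem _
    rw [wickOp_cons_apply]
    obtain ⟨h1, h2⟩ := ih hl' D σ hD h hS
    refine ⟨add_mem h1 (hJ (by omega) hsum), ?_⟩
    rw [add_sub_right_comm]
    exact add_mem h2 hsum

end Wick

namespace QuiverData

variable {V : Type u} {E : Type v} (Q : QuiverData V E)

/-! ### Cyclic paths and the trace of the path algebra -/

/-- Closed paths in the doubled quiver. -/
abbrev ClosedPath : Type _ := {p : Q.DPath // p.IsClosed}

/-- `q` is a rotation of `p`. -/
def RotRel (p q : Q.ClosedPath) : Prop :=
  ∃ (u v : Q.DPath) (h : u.src = v.tgt) (h' : v.src = u.tgt),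
    p.1 = u.comp v h ∧ q.1 = v.comp u h'

/-- Closed paths up to rotation. -/
def CycPath : Type _ := Quot Q.RotRel

/-- The number of arrows of a closed path up to rotation. -/
def CycPath.length : Q.CycPath → ℕ :=
  Quot.lift (fun p => p.1.word.length) (by
    rintro p q ⟨u, v, h, h', hp, hq⟩
    rw [hp, hq]
    simp [DPath.comp, add_comm])

variable {Q} in
lemma Diagram.finSupp (X : Q.Diagram) : FinSupp X.next := ⟨_, X.next_fix⟩

variable {Q} in
lemma Diagram.next_mem (X : Q.Diagram) :
    ∀ i ∈ Finset.range X.word.length, X.next i ∈ Finset.range X.word.length := fun i hi => by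
  rw [Finset.mem_range] at hi ⊢
  exact X.next_lt hi

variable {Q} in
lemma Diagram.getElem?_next (X : Q.Diagram) {i : ℕ} {x : Letter E} (h : X.word[i]? = some x) :
    ∃ y, X.word[X.next i]? = some y ∧ Q.lsrc x = Q.ltgt y := by
  have hi : i < X.word.length := (List.getElem?_eq_some_iff.1 h).1
  exact ⟨_, List.getElem?_eq_getElem (X.next_lt hi),
    X.compat i x _ h (List.getElem?_eq_getElem (X.next_lt hi))⟩

variable (K : Type w) [Field K]

/-- Polynomials in the closed paths up to rotation, with coefficients in `K[ħ]`. -/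
abbrev CycRing : Type _ := MvPolynomial Q.CycPath K[X]

open Classical in
/-- The class of a path in the ring of polynomials in the closed paths up to rotation. -/
def cycVar (p : Q.DPath) : Q.CycRing K :=
  if h : p.IsClosed then MvPolynomial.X (Quot.mk _ ⟨p, h⟩) else 0

variable {Q} in
lemma cycVar_comp (p q : Q.DPath) (h : p.src = q.tgt) (h' : q.src = p.tgt) :
    Q.cycVar K (p.comp q h) = Q.cycVar K (q.comp p h') := by
  have h1 : (p.comp q h).IsClosed := (DPath.src_comp p q h).trans h'
  have h2 : (q.comp p h').IsClosed := (DPath.src_comp q p h').trans h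
  rw [cycVar, cycVar, dif_pos h1, dif_pos h2]
  congr 1
  exact Quot.sound ⟨p, q, h, h', rfl, rfl⟩

/-- The linear map on the path algebra which sends a closed path to its class. -/
def cycLin : Q.PathAlg K →ₗ[K] Q.CycRing K := PathAlg.extend Q K (Q.cycVar K)

variable [Fintype V]

/-- Two paths that compose to a closed path in one order compose in the other order to a rotation of
it. If they compose in one order only, the composite is not closed and its class is zero. -/
lemma cycLin_mul_comm (x y : Q.PathAlg K) : Q.cycLin K (x * y) = Q.cycLin K (y * x) := by
  have key : (PathAlg.mulLin (Q := Q) (K := K)).compr₂ (Q.cycLin K) =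
      (PathAlg.mulLin (Q := Q) (K := K)).flip.compr₂ (Q.cycLin K) := by
    refine PathAlg.hom_ext fun p => PathAlg.hom_ext fun q => ?_
    simp only [LinearMap.compr₂_apply, LinearMap.flip_apply, PathAlg.mulLin_ofPath]
    by_cases h : p.src = q.tgt <;> by_cases h' : q.src = p.tgt
    · simp only [PathAlg.pathMul, dif_pos h, dif_pos h', cycLin, PathAlg.extend_ofPath]
      exact cycVar_comp K p q h h'
    · have : ¬ (p.comp q h).IsClosed := fun e => h' ((DPath.src_comp p q h).symm.trans e)
      simp [PathAlg.pathMul, dif_pos h, dif_neg h', cycLin, cycVar, this]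
    · have : ¬ (q.comp p h').IsClosed := fun e => h ((DPath.src_comp q p h').symm.trans e)
      simp [PathAlg.pathMul, dif_neg h, dif_pos h', cycLin, cycVar, this]
    · simp [PathAlg.pathMul, dif_neg h, dif_neg h']
  exact congrArg (fun F => F x y) key

/-- The trace of the path algebra with values in the polynomials in closed paths up to
rotation. -/
def cycTrace : CycTrace (Q.PathAlg K) (Q.CycRing K) := ⟨Q.cycLin K, Q.cycLin_mul_comm K⟩

/-- The element of the path algebra given by the letter at a position of a word. -/
def posArr (w : List (Letter E)) (i : ℕ) : Q.PathAlg K :=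
  (w[i]?).elim 1 (PathAlg.arr Q K)

/-- The idempotent at the target of the letter at a position of a word. -/
def posIdem (w : List (Letter E)) (i : ℕ) : Q.PathAlg K :=
  (w[i]?).elim 1 fun x => PathAlg.e Q K (Q.ltgt x)

variable {Q}

lemma posArr_eq {w : List (Letter E)} {i : ℕ} {x : Letter E} (h : w[i]? = some x) :
    Q.posArr K w i = PathAlg.arr Q K x := by rw [posArr, h]; rfl

lemma posIdem_eq {w : List (Letter E)} {i : ℕ} {x : Letter E} (h : w[i]? = some x) :
    Q.posIdem K w i = PathAlg.e Q K (Q.ltgt x) := by rw [posIdem, h]; rfl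

lemma PathAlg.ofPath_mul (p q : Q.DPath) (h : p.src = q.tgt) :
    PathAlg.ofPath Q K p * PathAlg.ofPath Q K q = PathAlg.ofPath Q K (p.comp q h) := by
  rw [PathAlg.mul_def, PathAlg.mulLin_ofPath, PathAlg.pathMul, dif_pos h]

lemma PathAlg.ofPath_mul_eq_zero (p q : Q.DPath) (h : p.src ≠ q.tgt) :
    PathAlg.ofPath Q K p * PathAlg.ofPath Q K q = 0 := by
  rw [PathAlg.mul_def, PathAlg.mulLin_ofPath, PathAlg.pathMul, dif_neg h]

lemma PathAlg.e_mul_ofPath (p : Q.DPath) :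
    PathAlg.e Q K p.tgt * PathAlg.ofPath Q K p = PathAlg.ofPath Q K p :=
  PathAlg.ofPath_mul K (DPath.triv Q p.tgt) p rfl

lemma PathAlg.e_mul_arr (x : Letter E) :
    PathAlg.e Q K (Q.ltgt x) * PathAlg.arr Q K x = PathAlg.arr Q K x :=
  PathAlg.e_mul_ofPath K (DPath.arrow Q x)

lemma PathAlg.e_mul_e (i : V) : PathAlg.e Q K i * PathAlg.e Q K i = PathAlg.e Q K i :=
  PathAlg.e_mul_ofPath K (DPath.triv Q i)

/-! ### The normal form of a diagram and the skein relations -/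

section Phi

variable [DecidableEq E]

/-- The contraction coefficient of two letters: `-1` for `a^*` below `a`, and `0` otherwise. -/
def letterCoeff (R : Type*) [CommRing R] : Letter E → Letter E → R
  | Sum.inr a, Sum.inl b => if a = b then -1 else 0
  | _, _ => 0

lemma letterCoeff_eq_zero {R : Type*} [CommRing R] {x y : Letter E} (h : y ≠ rev x) :
    letterCoeff R x y = 0 := by
  rcases x with a | a <;> rcases y with b | b <;> try rfl
  have : a ≠ b := fun e => h (by rw [e]; rfl)
  simp [letterCoeff, this]

/-- The skein relations see only this antisymmetrization; contracting `a^*` below `a`, and not the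
other way round, is the choice of a normal order. -/
lemma letterCoeff_sub (R : Type*) [CommRing R] (x : Letter E) :
    letterCoeff R x (rev x) - letterCoeff R (rev x) x = (letterBracket x (rev x) : R) := by
  rcases x with a | a <;> simp [letterCoeff, rev, letterBracket]

/-- The contraction coefficient of two positions of a word. -/
def posCoeff (R : Type*) [CommRing R] (w : List (Letter E)) (i j : ℕ) : R :=
  (w[i]?).elim 0 fun x => (w[j]?).elim 0 fun y => letterCoeff R x y

lemma posCoeff_eq (R : Type*) [CommRing R] {w : List (Letter E)} {i j : ℕ} {x y : Letter E}
    (h : w[i]? = some x) (h' : w[j]? = some y) : posCoeff R w i j = letterCoeff R x y := by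
  rw [posCoeff, h, h']; rfl

/-- The product over a multiset of vertices of the classes of the trivial paths. -/
def vertProd (s : Multiset V) : Q.CycRing K :=
  (s.map fun i => Q.cycLin K (PathAlg.e Q K i)).prod

/-- The sum over all contractions of pairs of arrows of a list of positions. -/
def Diagram.wick (α β : K[X]) (X : Q.Diagram) (l : List ℕ) (S : Finset ℕ)
    (s : Finset ℕ × Equiv.Perm ℕ) : Q.CycRing K :=
  wickOp (posCoeff K[X] X.word) α β l
    (cycFun (Q.cycTrace K) (Q.posArr K X.word) (Q.posIdem K X.word) S) s

/-- The normal form of a product of cyclic words with heights. -/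
def Diagram.normalForm (α β : K[X]) (X : Q.Diagram) : Q.CycRing K :=
  vertProd K X.verts *
    X.wick K α β (List.range X.word.length) (Finset.range X.word.length) (∅, X.next)

lemma range_eq_append (k n : ℕ) (h : k + 1 < n) :
    List.range n = List.range k ++ k :: (k + 1) :: List.range' (k + 2) (n - k - 2) := by
  obtain ⟨m, rfl⟩ := Nat.exists_eq_add_of_le h
  rw [show (k + 1).succ + m - k - 2 = m by omega, show (k + 1).succ + m = k + (m + 1 + 1) by omega,
    List.range_add, ← List.range'_eq_map_range, List.range'_succ, List.range'_succ]

/-- Relabelling by the transposition of the two heights carries the interchanged diagram back to the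
cycles of `X`, with its two points listed in the opposite order. Both terms of a skein relation are
then contraction sums over the same permutation. -/
lemma Diagram.normalForm_interchange (α β : K[X]) (X : Q.Diagram) (l m : List (Letter E))
    (x y : Letter E) (h : X.word = l ++ x :: y :: m) :
    (X.interchange l m x y h).normalForm K α β = vertProd K X.verts *
      X.wick K α β (List.range l.length ++ (l.length + 1) :: l.length ::
        List.range' (l.length + 2) (X.word.length - l.length - 2))
        (Finset.range X.word.length) (∅, X.next) := by
  set k := l.length with hk
  have hlen : (X.interchange l m x y h).word.length = X.word.length := by
    rw [h]; simp [Diagram.interchange]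
  have hkn : k + 1 < X.word.length := by rw [h]; simp [hk]
  have hw : ∀ i, (X.interchange l m x y h).word[Equiv.swap k (k + 1) i]? = X.word[i]? := by
    intro i
    have := getElem?_swap l m x y (Equiv.swap k (k + 1) i)
    rw [← hk, Equiv.swap_apply_self, ← h] at this
    exact this
  rw [Diagram.normalForm, hlen]
  congr 1
  have hS : (Finset.range X.word.length).image (Equiv.swap k (k + 1)) =
      Finset.range X.word.length := by
    apply Finset.eq_of_subset_of_card_le
    · intro i hi
      obtain ⟨j, hj, rfl⟩ := Finset.mem_image.1 hi
      rw [Finset.mem_range] at hj ⊢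
      rw [Equiv.swap_apply_def]
      split_ifs <;> omega
    · exact (Finset.card_image_of_injective _ (Equiv.injective _)).ge
  have hl : (List.range k ++ (k + 1) :: k :: List.range' (k + 2) (X.word.length - k - 2)).map
      (Equiv.swap k (k + 1)) = List.range X.word.length := by
    rw [range_eq_append k _ hkn, List.map_append, List.map_cons, List.map_cons,
      Equiv.swap_apply_left, Equiv.swap_apply_right]
    congr 1
    · conv_rhs => rw [← List.map_id (List.range k)]
      refine List.map_congr_left fun i hi => ?_
      rw [List.mem_range] at hi
      exact Equiv.swap_apply_of_ne_of_ne (by omega) (by omega)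
    · congr 2
      conv_rhs => rw [← List.map_id (List.range' _ _)]
      refine List.map_congr_left fun i hi => ?_
      rw [List.mem_range'_1] at hi
      exact Equiv.swap_apply_of_ne_of_ne (by omega) (by omega)
  have := wick_relabel (α := α) (β := β) (Q.cycTrace K) (S := Finset.range X.word.length)
    (f := Equiv.swap k (k + 1)) (Equiv.injective _)
    (ω := Q.posArr K X.word) (ε := Q.posIdem K X.word)
    (ω' := Q.posArr K (X.interchange l m x y h).word)
    (ε' := Q.posIdem K (X.interchange l m x y h).word)
    (c := posCoeff K[X] X.word) (c' := posCoeff K[X] (X.interchange l m x y h).word)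
    (fun i _ => by rw [posArr, posArr, hw]) (fun i _ => by rw [posIdem, posIdem, hw])
    (fun i _ j _ => by rw [posCoeff, posCoeff, hw, hw])
    (List.range k ++ (k + 1) :: k :: List.range' (k + 2) (X.word.length - k - 2))
    (by
      intro i hi
      simp only [List.mem_append, List.mem_range, List.mem_cons, List.mem_range'_1] at hi
      rw [Finset.mem_range]
      omega) ∅ ∅ X.next (X.interchange l m x y h).next X.finSupp
    (X.interchange l m x y h).finSupp X.next_mem
    (by
      intro i _
      simp [Diagram.interchange, ← hk]) (by simp)
  rw [hl, hS] at this
  exact this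

/-- The normal form of a contraction of two neighbouring arrows. -/
lemma Diagram.normalForm_contract (α β : K[X]) (X : Q.Diagram) (l m : List (Letter E))
    (x : Letter E) (h : X.word = l ++ x :: rev x :: m) :
    (X.contract l m x h).normalForm K α β = vertProd K X.verts *
      X.wick K α β (List.range l.length ++
        List.range' (l.length + 2) (X.word.length - l.length - 2))
        (Finset.range X.word.length)
        ({l.length, l.length + 1}, X.next * Equiv.swap l.length (l.length + 1)) := by
  set k := l.length with hk
  set n := X.word.length with hn
  set τ := X.next * Equiv.swap k (k + 1) with hτ
  have hkn : k + 1 < n := by rw [hn, h]; simp [hk]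
  have hx : X.word[k]? = some x := by rw [h]; simp [hk]
  have hy : X.word[k + 1]? = some (rev x) := by
    rw [h, List.getElem?_append_right (by omega)]; simp [hk]
  have hτk : τ k = X.next (k + 1) := by simp [hτ]
  have hτk1 : τ (k + 1) = X.next k := by simp [hτ]
  have hlen : (X.contract l m x h).word.length = n - 2 := by
    rw [hn, h]; simp [Diagram.contract]; omega
  have hτS : ∀ i ∈ Finset.range n, τ i ∈ Finset.range n :=
    mul_swap_mem X.next_mem (by rw [Finset.mem_range]; omega) (by rw [Finset.mem_range]; omega)
  have hτf : FinSupp τ := X.finSupp.mul_swap _ _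
  have hmem : ∀ i ∈ List.range k ++ List.range' (k + 2) (n - k - 2), i < n ∧ i ≠ k ∧ i ≠ k + 1 := by
    intro i hi
    simp only [List.mem_append, List.mem_range, List.mem_range'_1] at hi
    omega
  obtain ⟨z, hz, hzt⟩ := X.getElem?_next hy
  obtain ⟨z', hz', hzt'⟩ := X.getElem?_next hx
  rw [lsrc_rev] at hzt
  -- The idempotent at a contracted point is a left unit for the label of any arrow whose target is
  -- the same vertex.
  have hu : ∀ p q : ℕ, ∀ v : V, Q.posIdem K X.word p = PathAlg.e Q K v →
      (∃ z, X.word[q]? = some z ∧ v = Q.ltgt z) →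
      Q.posIdem K X.word p * Q.posArr K X.word q = Q.posArr K X.word q ∧
        Q.posIdem K X.word p * Q.posIdem K X.word q = Q.posIdem K X.word q := by
    rintro p q v hp ⟨z, hz, rfl⟩
    rw [hp, posArr_eq K hz, posIdem_eq K hz, PathAlg.e_mul_arr, PathAlg.e_mul_e]
    exact ⟨rfl, rfl⟩
  -- Once `k` is removed, `k + 1` leads to the old successor of `k`, or past `k` if that successor
  -- was `k` itself.
  have hb : bypass k τ (k + 1) = if X.next k = k then X.next (k + 1) else X.next k := by
    by_cases h1 : X.next k = k
    · rw [if_pos h1, bypass_apply_of_apply_eq τ (by rw [hτk1, h1]), hτk]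
    · rw [if_neg h1, bypass_apply_of_apply_ne τ (by omega) (by rwa [hτk1]), hτk1]
  -- The permutation `τ` sends `k` and `k + 1` to the successors of each other. Taking them out one
  -- after the other gives `reconnect`, and renumbering by `skip` gives the contracted diagram. A
  -- point that is fixed when it is taken out leaves the trace of an idempotent, that is, a vertex.
  have step1 : X.wick K α β (List.range k ++ List.range' (k + 2) (n - k - 2)) (Finset.range n)
      ({k, k + 1}, τ) = (if τ k = k then Q.cycLin K (PathAlg.e Q K (Q.ltgt x)) else 1) *
      X.wick K α β (List.range k ++ List.range' (k + 2) (n - k - 2)) ((Finset.range n).erase k)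
      ({k, k + 1}, bypass k τ) := by
    have := wick_bypass (α := α) (β := β) (Q.cycTrace K) (S := Finset.range n) (p := k)
      (by rw [Finset.mem_range]; omega) (ω := Q.posArr K X.word) (ε := Q.posIdem K X.word)
      (c := posCoeff K[X] X.word)
      (List.range k ++ List.range' (k + 2) (n - k - 2))
      (fun i hi => ⟨Finset.mem_range.2 (hmem i hi).1, (hmem i hi).2.1⟩) {k, k + 1} τ hτf hτS
      (by simp) (fun _ => hu k (τ k) _ (posIdem_eq K hx) ⟨z, by rw [hτk]; exact hz, hzt⟩)
    rw [posIdem_eq K hx] at this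
    exact this
  have hbS : ∀ i ∈ (Finset.range n).erase k, bypass k τ i ∈ (Finset.range n).erase k := by
    intro i hi
    rw [Finset.mem_erase] at hi ⊢
    refine ⟨fun e => hi.1 ((bypass k τ).injective (e.trans (bypass_self k τ).symm)), ?_⟩
    by_cases h1 : τ i = k
    · rw [bypass_apply_of_apply_eq τ h1]
      exact hτS k (by rw [Finset.mem_range]; omega)
    · rw [bypass_apply_of_apply_ne τ hi.1 h1]
      exact hτS i hi.2
  have step2 : X.wick K α β (List.range k ++ List.range' (k + 2) (n - k - 2))
      ((Finset.range n).erase k) ({k, k + 1}, bypass k τ) =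
      (if bypass k τ (k + 1) = k + 1 then Q.cycLin K (PathAlg.e Q K (Q.lsrc x)) else 1) *
      X.wick K α β (List.range k ++ List.range' (k + 2) (n - k - 2))
        (((Finset.range n).erase k).erase (k + 1)) ({k, k + 1}, reconnect k X.next) := by
    have := wick_bypass (α := α) (β := β) (Q.cycTrace K) (S := (Finset.range n).erase k)
      (p := k + 1)
      (by rw [Finset.mem_erase, Finset.mem_range]; omega) (ω := Q.posArr K X.word)
      (ε := Q.posIdem K X.word) (c := posCoeff K[X] X.word)
      (List.range k ++ List.range' (k + 2) (n - k - 2))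
      (fun i hi => ⟨Finset.mem_erase.2 ⟨(hmem i hi).2.1, Finset.mem_range.2 (hmem i hi).1⟩,
        (hmem i hi).2.2⟩) {k, k + 1} (bypass k τ) (hτf.bypass k) hbS
      (by simp) (fun _ => hu (k + 1) (bypass k τ (k + 1)) _ (posIdem_eq K hy) (by
        rw [ltgt_rev]
        rw [hb]
        by_cases h1 : X.next k = k
        · rw [if_pos h1]
          refine ⟨z, hz, ?_⟩
          rw [h1, hx] at hz'
          rw [hzt', ← hzt, Option.some.inj hz']
        · rw [if_neg h1]
          exact ⟨z', hz', hzt'⟩))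
    rw [posIdem_eq K hy, ltgt_rev] at this
    exact this
  have hskip : Function.Injective (skip k) := fun a b e => by
    rw [← unskip_skip k a, e, unskip_skip]
  have himg : (Finset.range (n - 2)).image (skip k) =
      ((Finset.range n).erase k).erase (k + 1) := by
    ext i
    simp only [Finset.mem_image, Finset.mem_range, Finset.mem_erase]
    constructor
    · rintro ⟨j, hj, rfl⟩
      refine ⟨(skip_ne k j).2, (skip_ne k j).1, ?_⟩
      unfold skip; split_ifs <;> omega
    · rintro ⟨h1, h2, h3⟩
      refine ⟨unskip k i, ?_, skip_unskip k i h2 h1⟩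
      unfold unskip; split_ifs <;> omega
  have hmap : (List.range (n - 2)).map (skip k) =
      List.range k ++ List.range' (k + 2) (n - k - 2) := by
    rw [show n - 2 = k + (n - k - 2) by omega, List.range_add, List.map_append, List.map_map]
    congr 1
    · conv_rhs => rw [← List.map_id (List.range k)]
      refine List.map_congr_left fun i hi => ?_
      rw [List.mem_range] at hi
      simp [skip, hi]
    · rw [List.range'_eq_map_range]
      refine List.map_congr_left fun i hi => ?_
      simp only [Function.comp_apply, skip]
      rw [if_neg (by omega)]
      omega
  have hw : ∀ i, X.word[skip k i]? = (X.contract l m x h).word[i]? := by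
    intro i
    have := getElem?_skip l m x (rev x) i
    rw [← hk, ← h] at this
    exact this.symm
  have step3 : X.wick K α β (List.range k ++ List.range' (k + 2) (n - k - 2))
        (((Finset.range n).erase k).erase (k + 1)) ({k, k + 1}, reconnect k X.next) =
      (X.contract l m x h).wick K α β (List.range (n - 2)) (Finset.range (n - 2))
        (∅, (X.contract l m x h).next) := by
    rw [← hmap, ← himg]
    refine wick_relabel (Q.cycTrace K) hskip (fun i _ => by rw [posArr, posArr, hw])
      (fun i _ => by rw [posIdem, posIdem, hw]) (fun i _ j _ => by rw [posCoeff, posCoeff, hw, hw])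
      _ (fun i hi => Finset.mem_range.2 (List.mem_range.1 hi)) _ _ _ _ (Diagram.finSupp _)
      ((hτf.bypass k).bypass (k + 1)) ?_ ?_ ?_
    · have := (X.contract l m x h).next_mem
      rwa [hlen] at this
    · intro i _
      have hne := reconnect_ne k X.next (skip_ne k i).1 (skip_ne k i).2
      exact (skip_unskip k _ hne.1 hne.2).symm
    · intro i _
      simp [(skip_ne k i).1, (skip_ne k i).2]
  rw [Diagram.normalForm, hlen, step1, step2, step3, ← mul_assoc, ← mul_assoc]
  congr 1
  change vertProd K (X.verts + (if X.next (k + 1) = k then {Q.ltgt x} else 0)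
    + (if X.next k = k + 1 then {Q.lsrc x} else 0)
    + (if X.next k = k ∧ X.next (k + 1) = k + 1 then {Q.ltgt x} else 0)) = _
  have hadd : ∀ s t : Multiset V, (vertProd K (s + t) : Q.CycRing K) =
      vertProd K s * vertProd K t := fun s t => by simp [vertProd]
  have hsing : ∀ (c : Prop) [Decidable c] (v : V), (vertProd K (if c then {v} else 0) : Q.CycRing K)
      = if c then Q.cycLin K (PathAlg.e Q K v) else 1 := by
    intro c _ v
    split_ifs <;> simp [vertProd]
  rw [hadd, hadd, hadd, hsing, hsing, hsing, hτk, hb, mul_assoc, mul_assoc, mul_assoc]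
  congr 2
  -- Matching the vertices: when `k` is a cyclic word by itself, `x` is a loop, so its source and
  -- its target coincide.
  by_cases h1 : X.next k = k
  · have h2 : ¬ X.next k = k + 1 := by omega
    rw [h1, hx] at hz'
    rw [if_neg h2, one_mul, if_pos h1, hzt', ← Option.some.inj hz']
    simp [h1]
  · simp [h1]

-- By `wickOp_interchange` the difference is the contraction of the two neighbours in either order;
-- both orders give the same diagram with the same weight, and their coefficients combine by
-- `letterCoeff_sub`.
open Classical in
lemma Diagram.normalForm_skein (α β : K[X]) (X : Q.Diagram) (l m : List (Letter E))
    (x : Letter E) (h : X.word = l ++ x :: rev x :: m) :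
    X.normalForm K α β - (X.interchange l m x (rev x) h).normalForm K α β =
      (contrCoeff α β X.next l.length (l.length + 1) * (letterBracket x (rev x) : K[X])) •
        (X.contract l m x h).normalForm K α β := by
  have hkn : l.length + 1 < X.word.length := by rw [h]; simp
  have hx : X.word[l.length]? = some x := by rw [h]; simp
  have hy : X.word[l.length + 1]? = some (rev x) := by
    rw [h, List.getElem?_append_right (by omega)]; simp
  rw [X.normalForm_interchange K α β, X.normalForm_contract K α β, Diagram.normalForm,
    range_eq_append l.length _ hkn, ← mul_sub]
  have := wickOp_interchange_apply (posCoeff K[X] X.word) α β (List.range l.length)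
    (List.range' (l.length + 2) (X.word.length - l.length - 2)) l.length (l.length + 1)
    (cycFun (Q.cycTrace K) (Q.posArr K X.word) (Q.posIdem K X.word)
    (Finset.range X.word.length)) (∅, X.next)
  have h2 : X.wick K α β (List.range l.length ++ l.length :: (l.length + 1) ::
        List.range' (l.length + 2) (X.word.length - l.length - 2))
        (Finset.range X.word.length) (∅, X.next) -
      X.wick K α β (List.range l.length ++ (l.length + 1) :: l.length ::
        List.range' (l.length + 2) (X.word.length - l.length - 2))
        (Finset.range X.word.length) (∅, X.next) =
      (contrCoeff α β X.next l.length (l.length + 1) * (letterBracket x (rev x) : K[X])) •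
      X.wick K α β (List.range l.length ++
        List.range' (l.length + 2) (X.word.length - l.length - 2))
        (Finset.range X.word.length)
        ({l.length, l.length + 1}, X.next * Equiv.swap l.length (l.length + 1)) := by
    refine this.trans ?_
    rw [contrOp_apply _ _ _ _ _ _ (by simp) (by simp) (by omega) X.finSupp,
      contrOp_apply _ _ _ _ _ _ (by simp) (by simp) (by omega) X.finSupp,
      posCoeff_eq K[X] hx hy, posCoeff_eq K[X] hy hx, contrCoeff_symm α β X.next (l.length + 1),
      Equiv.swap_comm (l.length + 1), ← letterCoeff_sub, insert_empty_eq, insert_empty_eq,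
      Finset.pair_comm (l.length + 1), ← sub_smul]
    congr 1
    ring
  rw [h2, mul_smul_comm]

lemma Diagram.normalForm_commute (α β : K[X]) (X : Q.Diagram) (l m : List (Letter E))
    (x y : Letter E) (h : X.word = l ++ x :: y :: m) (hxy : y ≠ rev x) :
    X.normalForm K α β - (X.interchange l m x y h).normalForm K α β = 0 := by
  have hkn : l.length + 1 < X.word.length := by rw [h]; simp
  have hx : X.word[l.length]? = some x := by rw [h]; simp
  have hy : X.word[l.length + 1]? = some y := by
    rw [h, List.getElem?_append_right (by omega)]; simp
  rw [X.normalForm_interchange K α β, Diagram.normalForm,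
    range_eq_append l.length _ hkn, ← mul_sub]
  have := wickOp_interchange_apply (posCoeff K[X] X.word) α β (List.range l.length)
    (List.range' (l.length + 2) (X.word.length - l.length - 2)) l.length (l.length + 1)
    (cycFun (Q.cycTrace K) (Q.posArr K X.word) (Q.posIdem K X.word)
    (Finset.range X.word.length)) (∅, X.next)
  refine (congrArg _ (this.trans ?_)).trans (mul_zero _)
  have hyx : x ≠ rev y := fun e => hxy (by rw [e]; simp)
  rw [contrOp_apply _ _ _ _ _ _ (by simp) (by simp) (by omega) X.finSupp,
    contrOp_apply _ _ _ _ _ _ (by simp) (by simp) (by omega) X.finSupp,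
    posCoeff_eq K[X] hx hy, posCoeff_eq K[X] hy hx, letterCoeff_eq_zero hxy,
    letterCoeff_eq_zero hyx]
  simp

end Phi

end QuiverData

/-! ### Quotients of algebras by two-sided ideals -/

section Quotients

variable (k : Type*) {A : Type*} [CommRing k] [Ring A] [Algebra k A] (S : Set A)

lemma QuotBy.mk_surjective : Function.Surjective (QuotBy.mk k S) :=
  RingCon.mkₐ_surjective _

lemma QuotBy.mk_eq_zero_iff (x : A) : QuotBy.mk k S x = 0 ↔ x ∈ TwoSidedIdeal.span S := by
  rw [TwoSidedIdeal.mem_iff]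
  exact RingCon.eq _

lemma QuotBy.mk_eq_zero {x : A} (h : x ∈ S) : QuotBy.mk k S x = 0 :=
  (QuotBy.mk_eq_zero_iff k S x).2 (TwoSidedIdeal.subset_span h)

variable {S}

/-- A homomorphism which vanishes on `S` factors through the quotient by `S`. -/
def QuotBy.lift {B : Type*} [Ring B] (f : A →+* B) (h : ∀ s ∈ S, f s = 0) : QuotBy S →+* B :=
  RingCon.lift _ f (by
    intro x y hxy
    have h1 : x - y ∈ TwoSidedIdeal.span S := (TwoSidedIdeal.rel_iff _ _ _).1 hxy
    have h2 : TwoSidedIdeal.span S ≤ TwoSidedIdeal.ker f := by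
      rw [TwoSidedIdeal.span_le]
      intro s hs
      exact (TwoSidedIdeal.mem_ker f).2 (h s hs)
    have h3 := (TwoSidedIdeal.mem_ker f).1 (h2 h1)
    rw [map_sub, sub_eq_zero] at h3
    exact h3)

/-- A homomorphism of algebras which vanishes on `S` factors through the quotient by `S`. -/
def QuotBy.liftAlg {B : Type*} [Ring B] [Algebra k B] (f : A →ₐ[k] B) (h : ∀ s ∈ S, f s = 0) :
    QuotBy S →ₐ[k] B :=
  { QuotBy.lift (f : A →+* B) h with
    commutes' := fun r => f.commutes r }

/-- A linear map which vanishes on the two-sided ideal generated by `S` factors through the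
quotient by `S`. -/
lemma QuotBy.exists_linear {M : Type*} [AddCommGroup M] [Module k M] (f : A →ₗ[k] M)
    (h : ∀ x ∈ TwoSidedIdeal.span S, f x = 0) :
    ∃ g : QuotBy S →ₗ[k] M, ∀ x, g (QuotBy.mk k S x) = f x := by
  have hs := QuotBy.mk_surjective k S
  refine ⟨(Submodule.liftQ _ f (fun x hx => h x ((QuotBy.mk_eq_zero_iff k S x).1 hx))) ∘ₗ
    ((QuotBy.mk k S).toLinearMap.quotKerEquivOfSurjective hs).symm.toLinearMap, fun x => ?_⟩
  rw [LinearMap.comp_apply]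
  have : ((QuotBy.mk k S).toLinearMap.quotKerEquivOfSurjective hs).symm (QuotBy.mk k S x) =
      Submodule.Quotient.mk x := by
    rw [LinearEquiv.symm_apply_eq]
    rfl
  erw [this]
  rfl

end Quotients

/-! ### Compatibility of the skein relations with products -/

lemma shiftPerm_swap (m a b : ℕ) :
    shiftPerm m (Equiv.swap a b) = Equiv.swap (m + a) (m + b) := by
  ext k
  rw [shiftPerm_apply]
  split_ifs with h
  · rw [Equiv.swap_apply_of_ne_of_ne (by omega) (by omega)]
  · simp only [Equiv.swap_apply_def]
    split_ifs <;> omega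

lemma shiftPerm_apply_add (m : ℕ) (τ : Equiv.Perm ℕ) (k : ℕ) : shiftPerm m τ (m + k) = m + τ k := by
  rw [shiftPerm_apply, if_neg (by omega), Nat.add_sub_cancel_left]

lemma shiftPerm_commute {m : ℕ} {τ : Equiv.Perm ℕ} (h : ∀ k, m ≤ k → τ k = k)
    (ρ : Equiv.Perm ℕ) : Commute τ (shiftPerm m ρ) := by
  refine Equiv.Perm.Disjoint.commute fun x => ?_
  rcases lt_or_ge x m with hx | hx
  · right; rw [shiftPerm_apply, if_pos hx]
  · left; exact h x hx

lemma shiftPerm_bypass (m p : ℕ) (σ : Equiv.Perm ℕ) :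
    shiftPerm m (bypass p σ) = bypass (m + p) (shiftPerm m σ) := by
  rw [bypass, bypass, map_mul, shiftPerm_swap, shiftPerm_apply_add]

lemma shiftPerm_reconnect (m k : ℕ) (σ : Equiv.Perm ℕ) :
    shiftPerm m (reconnect k σ) = reconnect (m + k) (shiftPerm m σ) := by
  rw [reconnect, reconnect, shiftPerm_bypass, shiftPerm_bypass, map_mul, shiftPerm_swap, add_assoc]

lemma bypass_mul_right {p : ℕ} (σ ρ : Equiv.Perm ℕ) (h : ρ p = p) :
    bypass p (σ * ρ) = bypass p σ * ρ := by
  rw [bypass, bypass, Equiv.Perm.mul_apply, h, mul_assoc]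

lemma swap_commute_of_apply_eq {i j : ℕ} {ρ : Equiv.Perm ℕ} (hi : ρ i = i) (hj : ρ j = j) :
    Commute ρ (Equiv.swap i j) := by
  refine Equiv.Perm.Disjoint.commute fun x => ?_
  by_cases hx : x = i ∨ x = j
  · left; rcases hx with rfl | rfl <;> assumption
  · right
    exact Equiv.swap_apply_of_ne_of_ne (fun e => hx (Or.inl e)) (fun e => hx (Or.inr e))

lemma reconnect_mul_right {k : ℕ} (σ ρ : Equiv.Perm ℕ) (h : ρ k = k) (h' : ρ (k + 1) = k + 1) :
    reconnect k (σ * ρ) = reconnect k σ * ρ := by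
  rw [reconnect, reconnect, mul_assoc, (swap_commute_of_apply_eq h h').eq, ← mul_assoc,
    bypass_mul_right _ _ h, bypass_mul_right _ _ h']

lemma bypass_mul_left {p : ℕ} (σ τ : Equiv.Perm ℕ) (h : τ p = p) (h' : τ (σ p) = σ p) :
    bypass p (τ * σ) = τ * bypass p σ := by
  rw [bypass, bypass, Equiv.Perm.mul_apply, h', ← mul_assoc, ← mul_assoc,
    (swap_commute_of_apply_eq h h').eq]

lemma reconnect_mul_left {m k : ℕ} {τ : Equiv.Perm ℕ} (h : ∀ k, m ≤ k → τ k = k)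
    (σ : Equiv.Perm ℕ) :
    reconnect (m + k) (τ * shiftPerm m σ) = τ * reconnect (m + k) (shiftPerm m σ) := by
  have hge : ∀ (ρ : Equiv.Perm ℕ) (i : ℕ), m ≤ shiftPerm m ρ (m + i) := fun ρ i => by
    rw [shiftPerm_apply_add]; omega
  have e : shiftPerm m σ * Equiv.swap (m + k) (m + k + 1) =
      shiftPerm m (σ * Equiv.swap k (k + 1)) := by
    rw [map_mul, shiftPerm_swap, add_assoc]
  rw [reconnect, reconnect, mul_assoc, e, bypass_mul_left _ _ (h _ (by omega)) (h _ (hge _ _)),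
    ← shiftPerm_bypass, add_assoc, bypass_mul_left _ _ (h _ (by omega)) (h _ (hge _ _))]

lemma unskip_add (m k j : ℕ) (h : j ≠ k) (h' : j ≠ k + 1) :
    unskip (m + k) (m + j) = m + unskip k j := by
  unfold unskip
  split_ifs <;> omega

namespace QuiverData
namespace Diagram

variable {V : Type u} {E : Type v} {Q : QuiverData V E}

lemma interchange_mul (X Y : Q.Diagram) (l m : List (Letter E)) (x y : Letter E)
    (h : X.word = l ++ x :: y :: m) (h' : (X * Y).word = l ++ x :: y :: (m ++ Y.word)) :
    X.interchange l m x y h * Y = (X * Y).interchange l (m ++ Y.word) x y h' := by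
  apply Diagram.ext
  · simp [word_mul, interchange]
  · have hlen : (X.interchange l m x y h).word.length = X.word.length := by
      rw [h]; simp [interchange]
    rw [next_mul, hlen]
    change _ * X.next * _ * _ = _ * (X.next * _) * _
    rw [mul_assoc, (shiftPerm_commute (m := X.word.length) ?_ Y.next).eq]
    · simp only [mul_assoc]
    · intro k hk
      rw [h] at hk
      simp only [List.length_append, List.length_cons] at hk
      exact Equiv.swap_apply_of_ne_of_ne (by omega) (by omega)
  · rfl

lemma mul_interchange (W X : Q.Diagram) (l m : List (Letter E)) (x y : Letter E)
    (h : X.word = l ++ x :: y :: m) (h' : (W * X).word = (W.word ++ l) ++ x :: y :: m) :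
    W * X.interchange l m x y h = (W * X).interchange (W.word ++ l) m x y h' := by
  apply Diagram.ext
  · simp [word_mul, interchange]
  · rw [next_mul]
    change _ * shiftPerm _ (_ * X.next * _) = _ * (W.next * _) * _
    rw [map_mul, map_mul, shiftPerm_swap, List.length_append, ← add_assoc, ← mul_assoc,
      ← mul_assoc, ← mul_assoc]
    congr 2
    have := shiftPerm_commute (W.next_fix) (Equiv.swap l.length (l.length + 1))
    rw [shiftPerm_swap, ← add_assoc] at this
    exact this.eq
  · rfl

lemma contract_mul (X Y : Q.Diagram) (l m : List (Letter E)) (x : Letter E)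
    (h : X.word = l ++ x :: rev x :: m) (h' : (X * Y).word = l ++ x :: rev x :: (m ++ Y.word)) :
    X.contract l m x h * Y = (X * Y).contract l (m ++ Y.word) x h' := by
  have hn : X.word.length = (l ++ m).length + 2 := by rw [h]; simp; omega
  have hk : l.length ≤ (l ++ m).length := by simp
  have hfix : ∀ i, i < X.word.length → shiftPerm X.word.length Y.next i = i := fun i hi => by
    rw [shiftPerm_apply, if_pos hi]
  apply Diagram.ext
  · simp [word_mul, contract]
  · rw [next_mul]
    ext j
    change unskip l.length (reconnect l.length X.next (skip l.length
      (shiftPerm (l ++ m).length Y.next j))) =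
      unskip l.length (reconnect l.length (X.next * shiftPerm X.word.length Y.next)
        (skip l.length j))
    rw [reconnect_mul_right _ _ (hfix _ (by omega)) (hfix _ (by omega)), Equiv.Perm.mul_apply]
    congr 2
    rcases lt_or_ge j (l ++ m).length with hj | hj
    · rw [shiftPerm_apply, if_pos hj, hfix]
      unfold skip; split_ifs <;> omega
    · obtain ⟨i, rfl⟩ := Nat.exists_eq_add_of_le hj
      have e1 : ∀ i, skip l.length ((l ++ m).length + i) = X.word.length + i := fun i => by
        rw [skip, if_neg (by omega)]; omega
      rw [shiftPerm_apply_add, e1, e1, shiftPerm_apply_add]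
  · have e : ∀ i, i < X.word.length → (X * Y).next i = X.next i := fun i hi => by
      rw [next_mul, Equiv.Perm.mul_apply, hfix i hi]
    change X.verts + _ + _ + _ + Y.verts = X.verts + Y.verts + _ + _ + _
    rw [e _ (by omega), e _ (by omega)]
    abel

lemma mul_contract (W X : Q.Diagram) (l m : List (Letter E)) (x : Letter E)
    (h : X.word = l ++ x :: rev x :: m) (h' : (W * X).word = (W.word ++ l) ++ x :: rev x :: m) :
    W * X.contract l m x h = (W * X).contract (W.word ++ l) m x h' := by
  have hl : (W.word ++ l).length = W.word.length + l.length := List.length_append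
  have hn : X.word.length = (l ++ m).length + 2 := by rw [h]; simp; omega
  apply Diagram.ext
  · simp [word_mul, contract]
  · rw [next_mul]
    ext j
    change W.next (shiftPerm W.word.length _ j) = unskip _ (reconnect _
      (W.next * shiftPerm W.word.length X.next) (skip _ j))
    rw [hl, reconnect_mul_left W.next_fix, Equiv.Perm.mul_apply, ← shiftPerm_reconnect]
    rcases lt_or_ge j W.word.length with hj | hj
    · rw [shiftPerm_apply, if_pos hj, skip, if_pos (by omega), shiftPerm_apply, if_pos hj, unskip,
        if_pos (by have := W.next_lt hj; omega)]
    · obtain ⟨i, rfl⟩ := Nat.exists_eq_add_of_le hj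
      have e1 : skip (W.word.length + l.length) (W.word.length + i) =
          W.word.length + skip l.length i := by
        unfold skip; split_ifs <;> omega
      rw [shiftPerm_apply_add, e1, shiftPerm_apply_add, W.next_fix _ (by omega),
        W.next_fix _ (by omega), unskip_add]
      · rfl
      · exact (reconnect_ne _ _ (skip_ne l.length i).1 (skip_ne l.length i).2).1
      · exact (reconnect_ne _ _ (skip_ne l.length i).1 (skip_ne l.length i).2).2
  · have e : ∀ i, (W * X).next (W.word.length + i) = W.word.length + X.next i := fun i => by
      rw [next_mul, Equiv.Perm.mul_apply, shiftPerm_apply_add, W.next_fix _ (by omega)]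
    change W.verts + (X.verts + _ + _ + _) = W.verts + X.verts + _ + _ + _
    rw [hl, add_assoc W.word.length, e, e]
    simp only [add_right_inj, add_assoc]

lemma sameCycle_mul_left (X Y : Q.Diagram) {i j : ℕ} (hi : i < X.word.length) :
    (X * Y).next.SameCycle i j ↔ X.next.SameCycle i j := by
  refine sameCycle_semiconj (f := id) Function.injective_id X.next_mem ?_ X.finSupp (finSupp _)
    (Finset.mem_range.2 hi)
  intro i hi
  rw [Finset.mem_range] at hi
  simp [next_mul, Equiv.Perm.mul_apply, shiftPerm_apply, hi]

lemma sameCycle_mul_right (W X : Q.Diagram) {i j : ℕ} (hi : i < X.word.length) :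
    (W * X).next.SameCycle (W.word.length + i) (W.word.length + j) ↔ X.next.SameCycle i j := by
  refine sameCycle_semiconj (f := fun i => W.word.length + i) (add_right_injective _) X.next_mem
    ?_ X.finSupp (finSupp _) (Finset.mem_range.2 hi)
  intro i hi
  rw [next_mul, Equiv.Perm.mul_apply, shiftPerm_apply_add, W.next_fix _ (by omega)]

end Diagram

/-! ### The normal form on the quantized necklace algebra -/

section NormalForm

variable {V : Type u} {E : Type v} {Q : QuiverData V E} (K : Type w) [Field K] [DecidableEq E]
  {α β : K[X]}

lemma Skein.mul_right {z : Q.HeightAlg K} (hz : Q.Skein K α β z) (Y : Q.Diagram) :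
    Q.Skein K α β (z * dg K Y) := by
  cases hz with
  | commute X l m x y h hxy =>
    have h' : (X * Y).word = l ++ x :: y :: (m ++ Y.word) := by simp [Diagram.word_mul, h]
    rw [sub_mul, ← map_mul, ← map_mul, Diagram.interchange_mul X Y l m x y h h']
    exact Skein.commute _ _ _ _ _ _ hxy
  | join X l m x h hc =>
    have h' : (X * Y).word = l ++ x :: rev x :: (m ++ Y.word) := by simp [Diagram.word_mul, h]
    rw [sub_mul, sub_mul, smul_mul_assoc, ← map_mul, ← map_mul, ← map_mul,
      Diagram.interchange_mul X Y l m x _ h h', Diagram.contract_mul X Y l m x h h']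
    refine Skein.join _ _ _ _ _ ?_
    rwa [Diagram.sameCycle_mul_left]
    rw [h]; simp
  | split X l m x h hc =>
    have h' : (X * Y).word = l ++ x :: rev x :: (m ++ Y.word) := by simp [Diagram.word_mul, h]
    rw [sub_mul, sub_mul, smul_mul_assoc, ← map_mul, ← map_mul, ← map_mul,
      Diagram.interchange_mul X Y l m x _ h h', Diagram.contract_mul X Y l m x h h']
    refine Skein.split _ _ _ _ _ ?_
    rwa [Diagram.sameCycle_mul_left]
    rw [h]; simp

lemma Skein.mul_left {z : Q.HeightAlg K} (hz : Q.Skein K α β z) (W : Q.Diagram) :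
    Q.Skein K α β (dg K W * z) := by
  cases hz with
  | commute X l m x y h hxy =>
    have h' : (W * X).word = (W.word ++ l) ++ x :: y :: m := by simp [Diagram.word_mul, h]
    rw [mul_sub, ← map_mul, ← map_mul, Diagram.mul_interchange W X l m x y h h']
    exact Skein.commute _ _ _ _ _ _ hxy
  | join X l m x h hc =>
    have h' : (W * X).word = (W.word ++ l) ++ x :: rev x :: m := by simp [Diagram.word_mul, h]
    rw [mul_sub, mul_sub, mul_smul_comm, ← map_mul, ← map_mul, ← map_mul,
      Diagram.mul_interchange W X l m x _ h h', Diagram.mul_contract W X l m x h h']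
    refine Skein.join _ _ _ _ _ ?_
    rwa [List.length_append, add_assoc, Diagram.sameCycle_mul_right]
    rw [h]; simp
  | split X l m x h hc =>
    have h' : (W * X).word = (W.word ++ l) ++ x :: rev x :: m := by simp [Diagram.word_mul, h]
    rw [mul_sub, mul_sub, mul_smul_comm, ← map_mul, ← map_mul, ← map_mul,
      Diagram.mul_interchange W X l m x _ h h', Diagram.mul_contract W X l m x h h']
    refine Skein.split _ _ _ _ _ ?_
    rwa [List.length_append, add_assoc, Diagram.sameCycle_mul_right]
    rw [h]; simp

/-- Stacking a diagram above or below a skein relation gives a skein relation again, so the linear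
span of the relations is already a two-sided ideal. Hence a linear map that is not multiplicative,
such as the normal form, descends as soon as it kills the relations. -/
lemma span_skein_eq :
    ((TwoSidedIdeal.span {z | Q.Skein K α β z} : TwoSidedIdeal (Q.HeightAlg K)) :
      Set (Q.HeightAlg K)) = Submodule.span K[X] {z | Q.Skein K α β z} := by
  apply Set.Subset.antisymm
  · let I : TwoSidedIdeal (Q.HeightAlg K) := TwoSidedIdeal.mk'
      (Submodule.span K[X] {z | Q.Skein K α β z} : Set (Q.HeightAlg K))
      (zero_mem _) (fun hx hy => add_mem hx hy) (fun hx => neg_mem hx)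
      (by
        intro a b hb
        induction a using MonoidAlgebra.induction_linear with
        | zero => rw [zero_mul]; exact zero_mem _
        | add f g hf hg => rw [add_mul]; exact add_mem hf hg
        | single W r =>
          have e : (MonoidAlgebra.single W r : Q.HeightAlg K) = r • dg K W := by
            simp [dg]
          rw [e, smul_mul_assoc]
          refine Submodule.smul_mem _ _ ?_
          refine Submodule.span_induction (fun z hz => Submodule.subset_span (hz.mul_left K W))
            ?_ ?_ ?_ hb
          · rw [mul_zero]; exact zero_mem _
          · intro x y _ _ hx hy
            rw [mul_add]; exact add_mem hx hy
          · intro r x _ hx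
            rw [mul_smul_comm]; exact Submodule.smul_mem _ _ hx)
      (by
        intro b a hb
        induction a using MonoidAlgebra.induction_linear with
        | zero => rw [mul_zero]; exact zero_mem _
        | add f g hf hg => rw [mul_add]; exact add_mem hf hg
        | single W r =>
          have e : (MonoidAlgebra.single W r : Q.HeightAlg K) = r • dg K W := by
            simp [dg]
          rw [e, mul_smul_comm]
          refine Submodule.smul_mem _ _ ?_
          refine Submodule.span_induction (fun z hz => Submodule.subset_span (hz.mul_right K W))
            ?_ ?_ ?_ hb
          · rw [zero_mul]; exact zero_mem _
          · intro x y _ _ hx hy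
            rw [add_mul]; exact add_mem hx hy
          · intro r x _ hx
            rw [smul_mul_assoc]; exact Submodule.smul_mem _ _ hx)
    have hI : (I : Set (Q.HeightAlg K)) = Submodule.span K[X] {z | Q.Skein K α β z} :=
      TwoSidedIdeal.coe_mk' _ _ _ _ _ _
    have : TwoSidedIdeal.span {z | Q.Skein K α β z} ≤ I := by
      rw [TwoSidedIdeal.span_le, hI]
      exact Submodule.subset_span
    rw [← hI]
    exact this
  · intro z hz
    refine Submodule.span_induction (fun z hz => TwoSidedIdeal.subset_span hz) ?_ ?_ ?_ hz
    · exact TwoSidedIdeal.zero_mem _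
    · intro x y _ _ hx hy
      exact TwoSidedIdeal.add_mem _ hx hy
    · intro r x _ hx
      change r • x ∈ TwoSidedIdeal.span _
      rw [Algebra.smul_def]
      exact TwoSidedIdeal.mul_mem_left _ _ _ hx

variable [Fintype V]

/-- The normal form as a linear map on the quantized necklace algebra. -/
lemma exists_normalForm (α β : K[X]) : ∃ Φ : Q.N K α β →ₗ[K[X]] Q.CycRing K,
    ∀ X : Q.Diagram, Φ (nclass K α β X) = X.normalForm K α β := by
  let Φ₀ : Q.HeightAlg K →ₗ[K[X]] Q.CycRing K :=
    Finsupp.linearCombination K[X] (fun X : Q.Diagram => X.normalForm K α β) ∘ₗ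
      (MonoidAlgebra.coeffLinearEquiv K[X]).toLinearMap
  have h0 : ∀ X : Q.Diagram, Φ₀ (dg K X) = X.normalForm K α β := by
    intro X
    simp [Φ₀, dg]
  obtain ⟨Φ, hΦ⟩ := QuotBy.exists_linear K[X] (S := {z | Q.Skein K α β z}) Φ₀ (by
    intro z hz
    have hz' : z ∈ Submodule.span K[X] {z | Q.Skein K α β z} := by
      have : z ∈ ((TwoSidedIdeal.span {z | Q.Skein K α β z} : TwoSidedIdeal (Q.HeightAlg K)) :
        Set (Q.HeightAlg K)) := hz
      rwa [span_skein_eq] at this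
    have hle : Submodule.span K[X] {z | Q.Skein K α β z} ≤ LinearMap.ker Φ₀ := by
      rw [Submodule.span_le]
      intro z hz
      rw [SetLike.mem_coe, LinearMap.mem_ker]
      cases hz with
      | commute X l m x y h hxy =>
        rw [map_sub, h0, h0]
        exact X.normalForm_commute K α β l m x y h hxy
      | join X l m x h hc =>
        rw [map_sub, map_sub, map_smul, h0, h0, h0, X.normalForm_skein K α β l m x h, contrCoeff,
          if_neg hc, sub_self]
      | split X l m x h hc =>
        rw [map_sub, map_sub, map_smul, h0, h0, h0, X.normalForm_skein K α β l m x h, contrCoeff,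
          if_pos hc, sub_self]
    exact hle hz')
  exact ⟨Φ, fun X => (hΦ _).trans (h0 X)⟩

end NormalForm

end QuiverData

/-! ### Rearrangements of heights -/

lemma exists_perm_of_injOn (n : ℕ) (f : ℕ → ℕ) (hlt : ∀ k, k < n → f k < n)
    (hinj : ∀ i j, i < n → j < n → f i = f j → i = j) :
    ∃ e : Equiv.Perm ℕ, (∀ k, k < n → e k = f k) ∧ ∀ k, n ≤ k → e k = k := by
  let g : ℕ → ℕ := fun k => if k < n then f k else k
  have hg : Function.Injective g := by
    intro i j hij
    simp only [g] at hij
    split_ifs at hij with h1 h2 h2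
    · exact hinj i j h1 h2 hij
    · have := hlt i h1; omega
    · have := hlt j h2; omega
    · exact hij
  have himg : (Finset.range n).image g = Finset.range n := by
    apply Finset.eq_of_subset_of_card_le
    · intro y hy
      obtain ⟨x, hx, rfl⟩ := Finset.mem_image.1 hy
      rw [Finset.mem_range] at hx ⊢
      simp only [g, if_pos hx]
      exact hlt x hx
    · exact (Finset.card_image_of_injective _ hg).ge
  have hs : Function.Surjective g := by
    intro y
    rcases lt_or_ge y n with hy | hy
    · have : y ∈ (Finset.range n).image g := by rw [himg]; exact Finset.mem_range.2 hy
      obtain ⟨x, -, hx⟩ := Finset.mem_image.1 this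
      exact ⟨x, hx⟩
    · exact ⟨y, if_neg (by omega)⟩
  refine ⟨Equiv.ofBijective g ⟨hg, hs⟩, fun k hk => if_pos hk, fun k hk => if_neg (by omega)⟩

/-- Sorting by adjacent exchanges: the position with value `n` is moved up to `n` step by step, and
then the permutation is supported on fewer points. Transpositions act on the right because the
heights exchanged are those of the diagram already rearranged. -/
lemma perm_adjacent_induction (n : ℕ) (P : Equiv.Perm ℕ → Prop) (h1 : P 1)
    (hs : ∀ (e : Equiv.Perm ℕ) (k : ℕ), k + 1 < n → (∀ j, n ≤ j → e j = j) → P e →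
      P (e * Equiv.swap k (k + 1))) :
    ∀ e : Equiv.Perm ℕ, (∀ j, n ≤ j → e j = j) → P e := by
  induction n with
  | zero =>
    intro e he
    have : e = 1 := Equiv.ext fun j => he j (Nat.zero_le _)
    rwa [this]
  | succ n ih =>
    have hfix : ∀ e : Equiv.Perm ℕ, (∀ j, n ≤ j → e j = j) → P e := by
      refine ih fun e k hk he => hs e k (by omega) fun j hj => he j (by omega)
    have key : ∀ d, d ≤ n → ∀ e : Equiv.Perm ℕ, (∀ j, n + 1 ≤ j → e j = j) → e (n - d) = n →
        P e := by
      intro d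
      induction d with
      | zero =>
        intro _ e he hn
        refine hfix e fun j hj => ?_
        rcases Nat.lt_or_ge n j with h | h
        · exact he j h
        · have : j = n := le_antisymm h hj
          rw [this]; exact hn
      | succ d ihd =>
        intro hd e he hn
        set j := n - (d + 1) with hj
        have hj1 : n - d = j + 1 := by omega
        have hsupp : ∀ i, n + 1 ≤ i → (e * Equiv.swap j (j + 1)) i = i := fun i hi => by
          rw [Equiv.Perm.mul_apply, Equiv.swap_apply_of_ne_of_ne (by omega) (by omega)]
          exact he i hi
        have h2 := ihd (by omega) (e * Equiv.swap j (j + 1)) hsupp (by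
          rw [hj1, Equiv.Perm.mul_apply, Equiv.swap_apply_right]; exact hn)
        have h3 := hs (e * Equiv.swap j (j + 1)) j (by omega) hsupp h2
        rwa [mul_assoc, Equiv.swap_mul_self, mul_one] at h3
    intro e he
    have hlt : e⁻¹ n < n + 1 := by
      by_contra h
      have h2 : e (e⁻¹ n) = e⁻¹ n := he _ (by omega)
      have h3 : e (e⁻¹ n) = n := e.apply_symm_apply n
      omega
    refine key (n - e⁻¹ n) (by omega) e he ?_
    rw [show n - (n - e⁻¹ n) = e⁻¹ n by omega]
    exact e.apply_symm_apply n

namespace QuiverData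

variable {V : Type u} {E : Type v} {Q : QuiverData V E}

/-- The class of a closed path up to rotation. -/
def cycClass (p : Q.ClosedPath) : Q.CycPath := Quot.mk _ p

namespace Diagram

/-- `Y` arises from `X` by a permutation of the heights: the arrow of `Y` at height `k` is the
arrow of `X` at height `e k`. -/
structure RearrBy (e : Equiv.Perm ℕ) (X Y : Q.Diagram) : Prop where
  fix : ∀ k, X.word.length ≤ k → e k = k
  length : Y.word.length = X.word.length
  verts : Y.verts = X.verts
  word : ∀ k, Y.word[k]? = X.word[e k]?
  next : X.next * e = e * Y.next

/-- `Y` arises from `X` by a permutation of the heights. -/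
def Rearr (X Y : Q.Diagram) : Prop := ∃ e, RearrBy e X Y

lemma Rearr.refl (X : Q.Diagram) : Rearr X X := ⟨1, fun _ _ => rfl, rfl, rfl, fun _ => rfl, by simp⟩

lemma RearrBy.lt {e : Equiv.Perm ℕ} {X Y : Q.Diagram} (h : RearrBy e X Y) {k : ℕ}
    (hk : k < X.word.length) : e k < X.word.length := FinSupp.lt h.fix hk

lemma Rearr.symm {X Y : Q.Diagram} : Rearr X Y → Rearr Y X := by
  rintro ⟨e, h⟩
  refine ⟨e⁻¹, fun k hk => ?_, h.length.symm, h.verts.symm, fun k => ?_, ?_⟩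
  · rw [Equiv.Perm.inv_eq_iff_eq]
    exact (h.fix k (by rw [← h.length]; exact hk)).symm
  · rw [h.word, show e (e⁻¹ k) = k from e.apply_symm_apply k]
  · rw [eq_inv_mul_iff_mul_eq, ← mul_assoc, ← h.next, mul_assoc, mul_inv_cancel, mul_one]

lemma Rearr.trans {X Y Z : Q.Diagram} : Rearr X Y → Rearr Y Z → Rearr X Z := by
  rintro ⟨e, h⟩ ⟨f, h'⟩
  refine ⟨e * f, fun k hk => ?_, h'.length.trans h.length, h'.verts.trans h.verts, fun k => ?_, ?_⟩
  · rw [Equiv.Perm.mul_apply, h'.fix k (by rw [h.length]; exact hk), h.fix k hk]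
  · rw [h'.word, h.word]; rfl
  · rw [← mul_assoc, h.next, mul_assoc, h'.next, mul_assoc]

lemma RearrBy.unique {e : Equiv.Perm ℕ} {X Y Z : Q.Diagram} (h : RearrBy e X Y)
    (h' : RearrBy e X Z) : Y = Z := by
  apply Diagram.ext
  · exact List.ext_getElem? fun k => by rw [h.word, h'.word]
  · exact mul_left_cancel (h.next.symm.trans h'.next)
  · rw [h.verts, h'.verts]

lemma exists_rearrBy (X : Q.Diagram) (e : Equiv.Perm ℕ) (he : ∀ k, X.word.length ≤ k → e k = k) :
    ∃ Y, RearrBy e X Y := by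
  have hlt : ∀ k, k < X.word.length → e k < X.word.length := fun k hk => FinSupp.lt he hk
  have hw : ∀ k, (List.ofFn fun h : Fin X.word.length => X.word[e h]'(hlt h h.2))[k]? =
      X.word[e k]? := by
    intro k
    rw [List.getElem?_ofFn]
    split_ifs with h
    · rw [List.getElem?_eq_getElem (hlt k h)]
    · rw [he k (by omega), List.getElem?_eq_none (by omega)]
  refine ⟨⟨List.ofFn fun h : Fin X.word.length => X.word[e h]'(hlt h h.2), e⁻¹ * X.next * e,
    X.verts, ?_, ?_⟩, he, by simp, rfl, hw, by simp [← mul_assoc]⟩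
  · intro k hk
    rw [List.length_ofFn] at hk
    rw [Equiv.Perm.mul_apply, Equiv.Perm.mul_apply, he k hk, X.next_fix k hk,
      Equiv.Perm.inv_eq_iff_eq, he k hk]
  · intro k x y hx hy
    rw [hw] at hx hy
    refine X.compat _ x y hx ?_
    rw [← hy]
    congr 1
    exact (e.apply_symm_apply _).symm

lemma rearrBy_interchange (X : Q.Diagram) (l m : List (Letter E)) (x y : Letter E)
    (h : X.word = l ++ x :: y :: m) :
    RearrBy (Equiv.swap l.length (l.length + 1)) X (X.interchange l m x y h) := by
  refine ⟨fun k hk => ?_, ?_, rfl, fun k => ?_, ?_⟩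
  · rw [h] at hk
    simp only [List.length_append, List.length_cons] at hk
    exact Equiv.swap_apply_of_ne_of_ne (by omega) (by omega)
  · rw [h]; simp [interchange]
  · have := getElem?_swap l m x y k
    rw [← h] at this
    exact this
  · change _ = _ * (_ * X.next * _)
    rw [← mul_assoc, ← mul_assoc, Equiv.swap_mul_self, one_mul]

lemma Rearr.mul {X X' Y Y' : Q.Diagram} :
    Rearr X X' → Rearr Y Y' → Rearr (X * Y) (X' * Y') := by
  rintro ⟨e, h⟩ ⟨f, h'⟩
  have hc := shiftPerm_commute h.fix
  refine ⟨e * shiftPerm X.word.length f, fun k hk => ?_, ?_, ?_, fun k => ?_, ?_⟩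
  · rw [word_mul, List.length_append] at hk
    obtain ⟨j, rfl⟩ := Nat.exists_eq_add_of_le (le_trans (Nat.le_add_right _ _) hk)
    rw [Equiv.Perm.mul_apply, shiftPerm_apply_add, h'.fix j (by omega), h.fix _ (by omega)]
  · rw [word_mul, word_mul, List.length_append, List.length_append, h.length, h'.length]
  · rw [verts_mul, verts_mul, h.verts, h'.verts]
  · rw [word_mul, word_mul, Equiv.Perm.mul_apply]
    rcases lt_or_ge k X.word.length with hk | hk
    · rw [shiftPerm_apply, if_pos hk, List.getElem?_append_left (by rw [h.length]; exact hk),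
        List.getElem?_append_left (h.lt hk), h.word]
    · obtain ⟨j, rfl⟩ := Nat.exists_eq_add_of_le hk
      rw [shiftPerm_apply_add, h.fix _ (by omega), List.getElem?_append_right (by rw [h.length]; omega),
        List.getElem?_append_right (by omega), h.length, Nat.add_sub_cancel_left,
        Nat.add_sub_cancel_left, h'.word]
  · rw [next_mul, next_mul, h.length]
    calc X.next * shiftPerm X.word.length Y.next * (e * shiftPerm X.word.length f)
        = X.next * (shiftPerm X.word.length Y.next * e) * shiftPerm X.word.length f := by
          simp only [mul_assoc]
      _ = (X.next * e) * shiftPerm X.word.length (Y.next * f) := by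
          rw [← (hc _).eq, map_mul]; simp only [mul_assoc]
      _ = e * (X'.next * shiftPerm X.word.length f) * shiftPerm X.word.length Y'.next := by
          rw [h.next, h'.next, map_mul]; simp only [mul_assoc]
      _ = _ := by
          have := shiftPerm_commute (X'.next_fix) f
          rw [h.length] at this
          rw [this.eq]; simp only [mul_assoc]

/-- The permutation exchanges the two blocks of heights. Its values are kept because
`arranged_mul_comm` reads off the resulting order of the arrows. -/
lemma exists_rearrBy_mul_comm (X Y : Q.Diagram) : ∃ e, RearrBy e (X * Y) (Y * X) ∧
    (∀ k, k < Y.word.length → e k = X.word.length + k) ∧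
    ∀ k, k < X.word.length → e (Y.word.length + k) = k := by
  set n := X.word.length with hn
  set m := Y.word.length with hm
  obtain ⟨e, he, hfix⟩ := exists_perm_of_injOn (n + m) (fun k => if k < m then n + k else k - m)
    (fun k hk => by
      split_ifs <;> omega) (fun i j hi hj hij => by
      split_ifs at hij <;> omega)
  have he1 : ∀ k, k < m → e k = n + k := fun k hk => by rw [he k (by omega), if_pos hk]
  have he2 : ∀ k, k < n → e (m + k) = k := fun k hk => by
    rw [he _ (by omega), if_neg (by omega)]; omega
  refine ⟨e, ⟨fun k hk => ?_, ?_, add_comm _ _, fun k => ?_, Equiv.ext fun k => ?_⟩, he1, he2⟩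
  · rw [word_mul, List.length_append] at hk
    exact hfix k hk
  · simp [word_mul, add_comm]
  · rw [word_mul, word_mul]
    rcases lt_or_ge k m with hk | hk
    · rw [he1 k hk, List.getElem?_append_left hk, List.getElem?_append_right (by omega), ← hn,
        Nat.add_sub_cancel_left]
    · obtain ⟨j, rfl⟩ := Nat.exists_eq_add_of_le hk
      rw [List.getElem?_append_right (by omega), ← hm, Nat.add_sub_cancel_left]
      rcases lt_or_ge j n with hj | hj
      · rw [he2 j hj, List.getElem?_append_left hj]
      · rw [hfix _ (by omega), List.getElem?_eq_none hj,
          List.getElem?_eq_none (by rw [List.length_append]; omega)]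
  · rw [Equiv.Perm.mul_apply, Equiv.Perm.mul_apply, next_mul, next_mul, Equiv.Perm.mul_apply,
      Equiv.Perm.mul_apply, ← hn, ← hm]
    rcases lt_or_ge k m with hk | hk
    · rw [he1 k hk, shiftPerm_apply_add, shiftPerm_apply, if_pos hk, X.next_fix _ (by omega),
        he1 _ (Y.next_lt hk)]
    · obtain ⟨j, rfl⟩ := Nat.exists_eq_add_of_le hk
      rw [shiftPerm_apply_add, Y.next_fix _ (by omega)]
      rcases lt_or_ge j n with hj | hj
      · rw [he2 j hj, shiftPerm_apply, if_pos hj, he2 _ (X.next_lt hj)]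
      · rw [X.next_fix j hj, hfix _ (by omega)]
        obtain ⟨i, hi⟩ := Nat.exists_eq_add_of_le hj
        rw [show m + j = n + (j + m - n) by omega, shiftPerm_apply_add, Y.next_fix _ (by omega),
          X.next_fix _ (by omega)]

lemma Rearr.mul_comm (X Y : Q.Diagram) : Rearr (X * Y) (Y * X) :=
  let ⟨e, h, _⟩ := exists_rearrBy_mul_comm X Y
  ⟨e, h⟩

/-! ### Decomposition into cyclic words -/

/-- The standard lift of a closed path. -/
def ofC (p : Q.ClosedPath) : Q.Diagram := ofClosed p.1 p.2

lemma ofC_next (p : Q.ClosedPath) {k : ℕ} (hk : k < p.1.word.length) :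
    (ofC p).next k = (k + 1) % p.1.word.length := by
  have := List.formPerm_apply_getElem (List.range p.1.word.length) List.nodup_range k
    (by simpa using hk)
  change (List.range _).formPerm k = _
  simpa using this

lemma ofC_word (p : Q.ClosedPath) : (ofC p).word = p.1.word := rfl

/-- Rotating a closed path exchanges two blocks of heights and respects the cyclic successor. If
both pieces are trivial they sit at the same vertex, since they are composable. -/
lemma Rearr.of_rotRel {p q : Q.ClosedPath} (h : Q.RotRel p q) : Rearr (ofC p) (ofC q) := by
  obtain ⟨u, v, huv, hvu, hp, hq⟩ := h
  have hpw : p.1.word = u.word ++ v.word := by rw [hp]; rfl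
  have hqw : q.1.word = v.word ++ u.word := by rw [hq]; rfl
  have hpn : p.1.word.length = u.word.length + v.word.length := by rw [hpw]; simp
  have hqn : q.1.word.length = u.word.length + v.word.length := by rw [hqw]; simp [add_comm]
  set n := u.word.length with hn
  set m := v.word.length with hm
  obtain ⟨e, he, hfix⟩ := exists_perm_of_injOn (n + m) (fun k => if k < m then n + k else k - m)
    (fun k hk => by
      split_ifs <;> omega) (fun i j hi hj hij => by
      split_ifs at hij <;> omega)
  refine ⟨e, fun k hk => hfix k (by rwa [ofC_word, hpn] at hk), ?_, ?_, fun k => ?_,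
    Equiv.ext fun k => ?_⟩
  · rw [ofC_word, ofC_word, hpn, hqn]
  · change (if q.1.word = [] then {q.1.tgt} else 0) = if p.1.word = [] then {p.1.tgt} else 0
    by_cases h0 : p.1.word = []
    · have hu : u.word = [] := (List.append_eq_nil_iff.1 (hpw ▸ h0)).1
      have hv : v.word = [] := (List.append_eq_nil_iff.1 (hpw ▸ h0)).2
      rw [if_pos h0, if_pos (by rw [hqw, hu, hv]; rfl)]
      have e1 : p.1.tgt = u.tgt := by rw [hp]; rfl
      have e2 : q.1.tgt = v.tgt := by rw [hq]; rfl
      rw [e1, e2, ← huv, DPath.src, hu]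
      rfl
    · rw [if_neg h0, if_neg]
      intro h1
      apply h0
      rw [hqw] at h1
      rw [hpw, (List.append_eq_nil_iff.1 h1).1, (List.append_eq_nil_iff.1 h1).2]
      rfl
  · rw [ofC_word, ofC_word, hpw, hqw]
    rcases lt_or_ge k (n + m) with hk | hk
    · rw [he k hk]
      split_ifs with h
      · rw [List.getElem?_append_left h, List.getElem?_append_right (by omega), ← hn,
          Nat.add_sub_cancel_left]
      · rw [List.getElem?_append_right (by omega), List.getElem?_append_left (by omega)]
    · rw [hfix k hk, List.getElem?_eq_none (by simp; omega), List.getElem?_eq_none (by simp; omega)]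
  · rw [Equiv.Perm.mul_apply, Equiv.Perm.mul_apply]
    rcases lt_or_ge k (n + m) with hk | hk
    · have hek : e k < n + m := FinSupp.lt hfix hk
      have hk1 : (k + 1) % (n + m) < n + m := Nat.mod_lt _ (by omega)
      -- The exchange of blocks is translation by `n` modulo `n + m`, which commutes with the
      -- successor modulo `n + m`.
      have hval : ∀ i, i < n + m → e i = (i + n) % (n + m) := by
        intro i hi
        rw [he i hi]
        split_ifs with h
        · rw [Nat.mod_eq_of_lt (by omega)]; omega
        · rw [show i + n = (i - m) + (n + m) by omega, Nat.add_mod_right, Nat.mod_eq_of_lt (by omega)]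
      rw [ofC_next p (by omega), ofC_next q (by omega), hpn, hqn, hval _ hk1, hval k hk]
      simp only [Nat.mod_add_mod]
      congr 1
      omega
    · rw [hfix k hk, (ofC q).next_fix k (by rw [ofC_word]; omega),
        (ofC p).next_fix k (by rw [ofC_word]; omega), hfix k hk]

lemma Rearr.of_class_eq {p q : Q.ClosedPath}
    (h : cycClass p = cycClass q) : Rearr (ofC p) (ofC q) := by
  have h2 := Quot.eqvGen_exact h
  clear h
  induction h2 with
  | rel p q h => exact Rearr.of_rotRel h
  | refl p => exact Rearr.refl _
  | symm p q _ ih => exact ih.symm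
  | trans p q r _ _ ih1 ih2 => exact ih1.trans ih2

end Diagram

lemma isChain_of_getElem {w : List (Letter E)} {i : V}
    (h0 : ∀ x, w[0]? = some x → Q.ltgt x = i)
    (h : ∀ k x y, w[k]? = some x → w[k + 1]? = some y → Q.lsrc x = Q.ltgt y) :
    Q.IsChain i w := by
  induction w generalizing i with
  | nil => trivial
  | cons z w ih =>
    refine ⟨h0 z rfl, ih (fun x hx => ?_) fun k x y hx hy => ?_⟩
    · exact (h 0 z x rfl (by simpa using hx)).symm
    · exact h (k + 1) x y (by simpa using hx) (by simpa using hy)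

namespace Diagram

/-- The lowest `r` heights form one cycle in increasing order, so they spell a closed path. `next`
then also preserves the remaining heights, which form a diagram placed above it. -/
lemma exists_eq_ofC_mul (Y : Q.Diagram) {r : ℕ} (hr : 0 < r) (hrn : r ≤ Y.word.length)
    (hY : ∀ k, k < r → Y.next k = (k + 1) % r) :
    ∃ (p : Q.ClosedPath) (Z : Q.Diagram), Y = ofC p * Z ∧ p.1.word.length = r := by
  have hlen : (Y.word.take r).length = r := by simp [hrn]
  have hget : ∀ k, k < r → (Y.word.take r)[k]? = Y.word[k]? := fun k hk => by
    rw [List.getElem?_take, if_pos hk]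
  have hlt : ∀ k x, (Y.word.take r)[k]? = some x → k < r := fun k x h => by
    have := (List.getElem?_eq_some_iff.1 h).1
    omega
  obtain ⟨x₀, hx₀⟩ : ∃ x, Y.word[0]? = some x := ⟨_, List.getElem?_eq_getElem (by omega)⟩
  have hchain : Q.IsChain (Q.ltgt x₀) (Y.word.take r) := by
    apply isChain_of_getElem
    · intro x hx
      rw [hget 0 hr, hx₀] at hx
      rw [Option.some.inj hx]
    · intro k x y hx hy
      have hk := hlt _ _ hy
      rw [hget k (by omega)] at hx
      rw [hget _ hk] at hy
      refine Y.compat k x y hx ?_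
      rw [hY k (by omega), Nat.mod_eq_of_lt hk]
      exact hy
  let p : Q.DPath := ⟨Q.ltgt x₀, Y.word.take r, hchain⟩
  have hp : p.IsClosed := by
    obtain ⟨z, hz⟩ : ∃ x, Y.word[r - 1]? = some x := ⟨_, List.getElem?_eq_getElem (by omega)⟩
    have h1 : p.src = Q.lsrc z := Q.endVertex_eq _ _ (r - 1) (by change _ = (List.take r _).length; omega)
      (by change (List.take r _)[_]? = _; rw [hget _ (by omega)]; exact hz)
    change p.src = Q.ltgt x₀
    rw [h1]
    refine Y.compat (r - 1) z x₀ hz ?_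
    rw [hY _ (by omega), Nat.sub_add_cancel hr, Nat.mod_self]
    exact hx₀
  -- All values below `r` are already taken by arguments below `r`.
  have hinj : ∀ k, r ≤ k → r ≤ Y.next k := by
    intro k hk
    by_contra hlt
    rw [not_le] at hlt
    have : ∃ j, j < r ∧ Y.next j = Y.next k := by
      rcases Nat.eq_zero_or_pos (Y.next k) with h0 | h0
      · exact ⟨r - 1, by omega, by rw [hY _ (by omega), Nat.sub_add_cancel hr, Nat.mod_self, h0]⟩
      · refine ⟨Y.next k - 1, by omega, ?_⟩
        rw [hY _ (by omega), Nat.sub_add_cancel h0, Nat.mod_eq_of_lt hlt]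
    obtain ⟨j, hj, hjk⟩ := this
    have := Y.next.injective hjk
    omega
  have hinv : ∀ k, r ≤ k → r ≤ Y.next⁻¹ k := by
    intro k hk
    by_contra hlt
    rw [not_le] at hlt
    have h1 := hY _ hlt
    rw [show Y.next (Y.next⁻¹ k) = k from Y.next.apply_symm_apply k] at h1
    have := Nat.mod_lt (Y.next⁻¹ k + 1) hr
    omega
  let Z : Q.Diagram :=
    { word := Y.word.drop r
      next :=
        { toFun := fun j => Y.next (r + j) - r
          invFun := fun j => Y.next⁻¹ (r + j) - r
          left_inv := fun j => by
            have := hinj (r + j) (by omega)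
            change Y.next⁻¹ (r + (Y.next (r + j) - r)) - r = j
            rw [show r + (Y.next (r + j) - r) = Y.next (r + j) by omega,
              show Y.next⁻¹ (Y.next (r + j)) = r + j from Y.next.symm_apply_apply _]
            omega
          right_inv := fun j => by
            have := hinv (r + j) (by omega)
            change Y.next (r + (Y.next⁻¹ (r + j) - r)) - r = j
            rw [show r + (Y.next⁻¹ (r + j) - r) = Y.next⁻¹ (r + j) by omega,
              show Y.next (Y.next⁻¹ (r + j)) = r + j from Y.next.apply_symm_apply _]
            omega }
      verts := Y.verts
      next_fix := fun k hk => by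
        rw [List.length_drop] at hk
        change Y.next (r + k) - r = k
        rw [Y.next_fix _ (by omega)]
        omega
      compat := fun k x y hx hy => by
        rw [List.getElem?_drop] at hx hy
        refine Y.compat _ x y hx ?_
        have := hinj (r + k) (by omega)
        rw [← hy]
        congr 1
        change _ = r + (Y.next (r + k) - r)
        omega }
  refine ⟨⟨p, hp⟩, Z, ?_, hlen⟩
  apply Diagram.ext
  · exact (List.take_append_drop r Y.word).symm
  · rw [next_mul]
    ext k
    rw [Equiv.Perm.mul_apply, show (ofC ⟨p, hp⟩ : Q.Diagram).word.length = r from hlen]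
    rcases lt_or_ge k r with hk | hk
    · rw [shiftPerm_apply, if_pos hk, ofC_next _ (by change k < (List.take r _).length; omega), hY k hk]
      change _ = _ % (List.take r _).length
      rw [hlen]
    · obtain ⟨j, rfl⟩ := Nat.exists_eq_add_of_le hk
      rw [shiftPerm_apply_add, (ofC ⟨p, hp⟩ : Q.Diagram).next_fix _
        (by change (List.take r _).length ≤ _; omega)]
      have := hinj (r + j) (by omega)
      change _ = r + (Y.next (r + j) - r)
      omega
  · change Y.verts = (if Y.word.take r = [] then {Q.ltgt x₀} else 0) + Y.verts
    rw [if_neg, zero_add]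
    intro h
    rw [h] at hlen
    simp at hlen
    omega

/-- The trivial path at a vertex, as a closed path. -/
def _root_.NecklaceReduction.QuiverData.trivC (Q : QuiverData V E) (i : V) : Q.ClosedPath :=
  ⟨DPath.triv Q i, rfl⟩

lemma prod_trivC (L : List V) :
    (((L.map fun i => ofC (Q.trivC i)).prod : Q.Diagram)).word = [] ∧
    (((L.map fun i => ofC (Q.trivC i)).prod : Q.Diagram)).next = 1 ∧
    (((L.map fun i => ofC (Q.trivC i)).prod : Q.Diagram)).verts = L := by
  induction L with
  | nil => exact ⟨rfl, rfl, rfl⟩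
  | cons i L ih =>
    obtain ⟨h1, h2, h3⟩ := ih
    rw [List.map_cons, List.prod_cons]
    refine ⟨?_, ?_, ?_⟩
    · rw [word_mul, h1]; rfl
    · rw [next_mul, h2, map_one, mul_one]
      change (List.range 0).formPerm = 1
      simp
    · rw [verts_mul, h3]
      rfl

/-- Every product of cyclic words with heights is a rearrangement of a product of standard
lifts. -/
lemma exists_rearr_prod (X : Q.Diagram) :
    ∃ ps : List Q.ClosedPath, Rearr X (ps.map ofC).prod := by
  induction hn : X.word.length using Nat.strong_induction_on generalizing X with
  | _ n ih =>
    rcases Nat.eq_zero_or_pos n with h0 | h0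
    · obtain ⟨L, hL⟩ : ∃ L : List V, (L : Multiset V) = X.verts := ⟨_, Multiset.coe_toList _⟩
      refine ⟨L.map Q.trivC, ?_⟩
      have hX : X = ((L.map Q.trivC).map ofC).prod := by
        rw [List.map_map]
        obtain ⟨h1, h2, h3⟩ := prod_trivC (Q := Q) L
        apply Diagram.ext
        · exact (List.length_eq_zero_iff.1 (hn.trans h0)).trans h1.symm
        · refine Eq.trans ?_ h2.symm
          ext k
          exact X.next_fix k (by omega)
        · exact hL.symm.trans h3.symm
      rw [← hX]
      exact Rearr.refl X
    · set L := orbitList X.next 0 with hL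
      have hLc : IsCycleList X.next L := orbitList_isCycleList X.next 0
      have hLS : ∀ j ∈ L, j < n := fun j hj => by
        have := mem_orbitList_subset X.next_mem (i := 0) (Finset.mem_range.2 (by omega)) hj
        rw [Finset.mem_range] at this
        omega
      have hLne : L ≠ [] := by
        obtain ⟨l, hl⟩ := X.finSupp.orbitList_eq_cons 0
        rw [hL, hl]; simp
      set r := L.length with hr
      have hrpos : 0 < r := List.length_pos_iff.2 hLne
      -- The cycle through height `0` is brought to the bottom in its cyclic order, and the other
      -- heights follow in their old order.
      set M := L ++ (List.range n).filter (fun j => j ∉ L) with hM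
      have hMnd : M.Nodup := by
        rw [hM, List.nodup_append]
        refine ⟨hLc.nodup, List.nodup_range.filter _, ?_⟩
        rintro a ha b hb rfl
        simp at hb
        exact hb.2 ha
      have hMmem : ∀ j, j ∈ M ↔ j < n := by
        intro j
        rw [hM, List.mem_append, List.mem_filter, List.mem_range]
        by_cases hj : j ∈ L
        · simp [hj, hLS j hj]
        · simp [hj]
      have hMlen : M.length = n := by
        have h1 : M.toFinset = Finset.range n := by ext j; simp [hMmem]
        rw [← List.toFinset_card_of_nodup hMnd, h1, Finset.card_range]
      obtain ⟨e, he, hfix⟩ := exists_perm_of_injOn n (fun k => M.getD k 0)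
        (fun k hk => by
          rw [List.getD_eq_getElem _ _ (by omega)]
          exact (hMmem _).1 (List.getElem_mem _))
        (fun i j hi hj hij => by
          rw [List.getD_eq_getElem _ _ (by omega), List.getD_eq_getElem _ _ (by omega)] at hij
          exact (hMnd.getElem_inj_iff).1 hij)
      have hrn : r ≤ n := by rw [← hMlen, hM, List.length_append]; omega
      have heL : ∀ k (hk : k < r), e k = L[k] := fun k hk => by
        rw [he k (by omega), List.getD_eq_getElem _ _ (by omega)]
        simp only [hM]
        rw [List.getElem_append_left]
      obtain ⟨Y, hY⟩ := X.exists_rearrBy e (by rw [hn]; exact hfix)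
      have hYn : ∀ k, k < r → Y.next k = (k + 1) % r := by
        intro k hk
        apply e.injective
        have h1 := congrArg (fun f => f k) hY.next
        simp only [Equiv.Perm.mul_apply] at h1
        rw [← h1, heL k hk, hLc.next k hk, heL _ (Nat.mod_lt _ hrpos)]
      obtain ⟨p, Z, hZ, hp⟩ := Y.exists_eq_ofC_mul hrpos (by rw [hY.length]; omega) hYn
      have hZlen : Z.word.length = n - r := by
        have := congrArg (fun D : Q.Diagram => D.word.length) hZ
        simp only [word_mul, List.length_append, hY.length, ofC_word, hp] at this
        omega
      obtain ⟨ps, hps⟩ := ih (n - r) (by omega) Z hZlen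
      refine ⟨p :: ps, ?_⟩
      rw [List.map_cons, List.prod_cons]
      refine Rearr.trans ⟨e, hY⟩ ?_
      rw [hZ]
      exact (Rearr.refl _).mul hps

lemma Rearr.prod_of_perm {ps qs : List Q.Diagram} (h : ps.Perm qs) : Rearr ps.prod qs.prod := by
  induction h with
  | nil => exact Rearr.refl _
  | cons x _ ih => rw [List.prod_cons, List.prod_cons]; exact (Rearr.refl x).mul ih
  | swap x y l =>
    simp only [List.prod_cons, ← mul_assoc]
    exact (Rearr.mul_comm y x).mul (Rearr.refl _)
  | trans _ _ ih1 ih2 => exact ih1.trans ih2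

end Diagram

/-- A closed path in a given class up to rotation. -/
def CycPath.rep (c : Q.CycPath) : Q.ClosedPath := Quot.out c

lemma CycPath.mk_rep (c : Q.CycPath) : cycClass c.rep = c := Quot.out_eq c

namespace Diagram

/-- A product of standard lifts of closed paths in given classes up to rotation. -/
def ofMultiset (s : Multiset Q.CycPath) : Q.Diagram :=
  (s.toList.map fun c => ofC c.rep).prod

lemma rearr_ofMultiset (ps : List Q.ClosedPath) :
    Rearr (ps.map ofC).prod
      (ofMultiset ((ps.map cycClass : List Q.CycPath) : Multiset Q.CycPath)) := by
  have h1 : Rearr (ps.map ofC).prod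
      ((ps.map cycClass : List Q.CycPath).map fun c => ofC c.rep).prod := by
    induction ps with
    | nil => exact Rearr.refl _
    | cons p ps ih =>
      simp only [List.map_cons, List.prod_cons]
      exact (Rearr.of_class_eq (CycPath.mk_rep _).symm).mul ih
  refine h1.trans (Rearr.prod_of_perm (List.Perm.map _ ?_))
  exact (Multiset.coe_eq_coe.1 (Multiset.coe_toList _)).symm

end Diagram

end QuiverData

/-! ### The leading term of the normal form -/

namespace QuiverData

variable {V : Type u} {E : Type v} {Q : QuiverData V E} (K : Type w) [Field K] [Fintype V]

lemma PathAlg.e_mul_e_of_ne {i j : V} (h : i ≠ j) : PathAlg.e Q K i * PathAlg.e Q K j = 0 :=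
  PathAlg.ofPath_mul_eq_zero K (DPath.triv Q i) (DPath.triv Q j) h

lemma PathAlg.wordElem_cons {i : V} {x : Letter E} (l : List (Letter E)) (h : Q.ltgt x = i) :
    PathAlg.wordElem Q K i (x :: l) =
      PathAlg.arr Q K x * PathAlg.wordElem Q K (Q.lsrc x) l := by
  subst h
  have h2 : PathAlg.arr Q K x * PathAlg.e Q K (Q.lsrc x) = PathAlg.arr Q K x := by
    refine (PathAlg.ofPath_mul K (DPath.arrow Q x) (DPath.triv Q (Q.lsrc x)) rfl).trans ?_
    rfl
  rw [PathAlg.wordElem, PathAlg.wordElem, ← mul_assoc, h2, List.map_cons, List.prod_cons,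
    ← mul_assoc, PathAlg.e_mul_arr]

lemma PathAlg.wordElem_eq_ofPath (i : V) (l : List (Letter E)) (h : Q.IsChain i l) :
    PathAlg.wordElem Q K i l = PathAlg.ofPath Q K ⟨i, l, h⟩ := by
  induction l generalizing i with
  | nil => rw [PathAlg.wordElem, List.map_nil, List.prod_nil, mul_one]; rfl
  | cons x l ih =>
    obtain ⟨h1, h2⟩ := h
    rw [PathAlg.wordElem_cons K l h1, ih _ h2]
    refine (PathAlg.ofPath_mul K (DPath.arrow Q x) ⟨_, l, h2⟩ rfl).trans ?_
    subst h1
    rfl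

lemma PathAlg.prod_map_arr (p : Q.DPath) (hp : p.word ≠ []) :
    (p.word.map (PathAlg.arr Q K)).prod = PathAlg.ofPath Q K p := by
  obtain ⟨i, l, h⟩ := p
  rw [← PathAlg.wordElem_eq_ofPath]
  cases l with
  | nil => exact absurd rfl hp
  | cons x l =>
    obtain ⟨h1, h2⟩ := h
    subst h1
    rw [PathAlg.wordElem, List.map_cons, List.prod_cons, ← mul_assoc, PathAlg.e_mul_arr]

lemma cycLin_ofPath (p : Q.ClosedPath) :
    Q.cycLin K (PathAlg.ofPath Q K p.1) = MvPolynomial.X (cycClass p) := by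
  rw [cycLin, PathAlg.extend_ofPath, cycVar, dif_pos p.2]
  rfl

lemma vertProd_add (s t : Multiset V) :
    vertProd (Q := Q) K (s + t) = vertProd K s * vertProd K t := by
  rw [vertProd, Multiset.map_add, Multiset.prod_add]; rfl

namespace Diagram

/-- The product of the classes of the cyclic words of a product of cyclic words with heights. -/
def mon (X : Q.Diagram) : Q.CycRing K :=
  vertProd K X.verts *
    cycProd (Q.cycTrace K) (Finset.range X.word.length) X.next (Q.posArr K X.word)

variable {K}

lemma Rearr.mon_eq {X Y : Q.Diagram} : Rearr X Y → X.mon K = Y.mon K := by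
  rintro ⟨e, h⟩
  have himg : (Finset.range Y.word.length).image e = Finset.range X.word.length := by
    apply Finset.eq_of_subset_of_card_le
    · intro y hy
      obtain ⟨x, hx, rfl⟩ := Finset.mem_image.1 hy
      rw [Finset.mem_range] at hx ⊢
      exact h.lt (by rwa [← h.length])
    · rw [Finset.card_image_of_injective _ e.injective, Finset.card_range, Finset.card_range,
        h.length]
  rw [mon, mon, h.verts, ← himg]
  congr 1
  refine cycProd_relabel _ e.injective Y.next_mem (fun i _ => ?_) fun i _ => ?_
  · exact congrArg (fun f => f i) h.next
  · rw [posArr, posArr, h.word]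

lemma mon_mul (X Y : Q.Diagram) : (X * Y).mon K = X.mon K * Y.mon K := by
  have hr : Finset.range (X * Y).word.length = Finset.range X.word.length ∪
      (Finset.range Y.word.length).image (X.word.length + ·) := by
    rw [word_mul, List.length_append]
    ext k
    simp only [Finset.mem_range, Finset.mem_union, Finset.mem_image]
    constructor
    · intro h
      by_cases hk : k < X.word.length
      · exact Or.inl hk
      · exact Or.inr ⟨k - X.word.length, by omega, by omega⟩
    · rintro (h | ⟨j, h, rfl⟩) <;> omega
  have h1 : ∀ i ∈ Finset.range X.word.length, (X * Y).next i = X.next i := fun i hi => by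
    rw [next_mul, Equiv.Perm.mul_apply, shiftPerm_apply, if_pos (Finset.mem_range.1 hi)]
  have h2 : ∀ i, (X * Y).next (X.word.length + i) = X.word.length + Y.next i := fun i => by
    rw [next_mul, Equiv.Perm.mul_apply, shiftPerm_apply_add, X.next_fix _ (by omega)]
  rw [mon, mon, mon, verts_mul, vertProd_add, hr, cycProd_union _ _ (finSupp _)]
  · rw [cycProd_congr (σ := X.next) (ω := Q.posArr K X.word), cycProd_relabel (σ := Y.next)
      (ω := Q.posArr K Y.word)]
    · ring
    · exact fun a b h => Nat.add_left_cancel h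
    · exact Y.next_mem
    · exact fun i _ => h2 i
    · intro i _
      rw [posArr, posArr, word_mul, List.getElem?_append_right (by omega),
        Nat.add_sub_cancel_left]
    · exact X.next_mem
    · exact h1
    · intro i hi
      rw [posArr, posArr, word_mul, List.getElem?_append_left (Finset.mem_range.1 hi)]
  · intro i hi
    rw [h1 i hi]
    exact X.next_mem i hi
  · rw [Finset.disjoint_left]
    intro a ha hb
    obtain ⟨j, -, rfl⟩ := Finset.mem_image.1 hb
    rw [Finset.mem_range] at ha
    omega

lemma isCycleList_ofC (p : Q.ClosedPath) :
    IsCycleList (ofC p).next (List.range p.1.word.length) := by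
  refine ⟨List.nodup_range, fun k hk => ?_⟩
  rw [List.length_range] at hk
  simp only [List.getElem_range, List.length_range]
  exact ofC_next p hk

lemma map_posArr_range (w : List (Letter E)) :
    (List.range w.length).map (Q.posArr K w) = w.map (PathAlg.arr Q K) := by
  apply List.ext_getElem
  · simp
  · intro i h1 h2
    simp only [List.getElem_map, List.getElem_range]
    exact posArr_eq K (List.getElem?_eq_getElem (by simpa using h2))

lemma mon_ofC (p : Q.ClosedPath) : (ofC p).mon K = MvPolynomial.X (cycClass p) := by
  rw [mon, ofC_word, ← cycLin_ofPath K p]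
  by_cases h : p.1.word = []
  · have hv : (ofC p).verts = {p.1.tgt} := if_pos h
    rw [hv, h, List.length_nil, Finset.range_zero, cycProd_empty, mul_one, vertProd,
      Multiset.map_singleton, Multiset.prod_singleton]
    congr 1
    rw [PathAlg.e]
    congr 1
    exact DPath.ext rfl h.symm
  · have hv : (ofC p).verts = 0 := if_neg h
    have hne : List.range p.1.word.length ≠ [] := by
      simpa using h
    rw [hv, vertProd, Multiset.map_zero, Multiset.prod_zero, one_mul, ← List.toFinset_range,
      (isCycleList_ofC p).cycProd_eq _ hne, map_posArr_range, PathAlg.prod_map_arr K _ h]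
    rfl

lemma mon_one : (1 : Q.Diagram).mon K = 1 := by
  rw [mon, word_one, verts_one, vertProd]
  simp [cycProd_empty]

lemma mon_prod_ofC (ps : List Q.ClosedPath) :
    ((ps.map ofC).prod : Q.Diagram).mon K =
      (ps.map fun p => (MvPolynomial.X (cycClass p) : Q.CycRing K)).prod := by
  induction ps with
  | nil => exact mon_one
  | cons p ps ih => simp only [List.map_cons, List.prod_cons, mon_mul, mon_ofC, ih]

/-- The monomial given by a multiset of closed paths up to rotation. -/
def _root_.NecklaceReduction.QuiverData.cycMonomial (K : Type w) [Field K] (s : Multiset Q.CycPath) :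
    Q.CycRing K := (s.map MvPolynomial.X).prod

lemma mon_ofMultiset (s : Multiset Q.CycPath) : (ofMultiset s).mon K = cycMonomial K s := by
  have h : (s.toList.map fun c => ofC c.rep) = (s.toList.map CycPath.rep).map ofC := by simp
  rw [ofMultiset, h, mon_prod_ofC, cycMonomial, List.map_map]
  conv_rhs => rw [← Multiset.coe_toList s]
  rw [Multiset.map_coe, Multiset.prod_coe]
  congr 2
  funext c
  exact congrArg _ (CycPath.mk_rep c)

lemma exists_rearr_ofMultiset (X : Q.Diagram) : ∃ s, Rearr X (ofMultiset s) := by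
  obtain ⟨ps, hps⟩ := exists_rearr_prod X
  exact ⟨_, hps.trans (rearr_ofMultiset ps)⟩

open Classical in
lemma _root_.NecklaceReduction.QuiverData.cycMonomial_eq (s : Multiset Q.CycPath) :
    cycMonomial K s = MvPolynomial.monomial (Multiset.toFinsupp s) 1 := by
  induction s using Multiset.induction_on with
  | empty => simp [cycMonomial]
  | cons c s ih =>
    rw [cycMonomial, Multiset.map_cons, Multiset.prod_cons, ← cycMonomial, ih,
      ← Multiset.singleton_add, map_add, Multiset.toFinsupp_singleton, MvPolynomial.X,
      MvPolynomial.monomial_mul, one_mul]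

lemma _root_.NecklaceReduction.QuiverData.cycMonomial_injective :
    Function.Injective (cycMonomial (Q := Q) K) := by
  classical
  intro s t h
  rw [cycMonomial_eq, cycMonomial_eq] at h
  exact Multiset.toFinsupp.injective (MvPolynomial.monomial_left_injective one_ne_zero h)

-- The monomial is a complete invariant of a diagram up to heights: both diagrams are rearrangements
-- of the standard product of the multiset it encodes, because distinct multisets have distinct
-- monomials.
variable (K) in
lemma rearr_of_mon_eq {X Y : Q.Diagram} (h : X.mon K = Y.mon K) : Rearr X Y := by
  obtain ⟨s, hs⟩ := exists_rearr_ofMultiset X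
  obtain ⟨t, ht⟩ := exists_rearr_ofMultiset Y
  rw [hs.mon_eq, ht.mon_eq, mon_ofMultiset, mon_ofMultiset] at h
  rw [cycMonomial_injective h] at hs
  exact hs.trans ht.symm

lemma Rearr.length_eq {X Y : Q.Diagram} : Rearr X Y → Y.word.length = X.word.length
  | ⟨_, h⟩ => h.length

/-- The number of arrows of a multiset of closed paths up to rotation. -/
def _root_.NecklaceReduction.QuiverData.totalLength (s : Multiset Q.CycPath) : ℕ :=
  (s.map (CycPath.length Q)).sum

lemma length_ofMultiset (s : Multiset Q.CycPath) :
    (ofMultiset s).word.length = totalLength s := by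
  have h : ∀ L : List Q.CycPath, ((L.map fun c => ofC c.rep).prod : Q.Diagram).word.length =
      (L.map (CycPath.length Q)).sum := by
    intro L
    induction L with
    | nil => rfl
    | cons c L ih =>
      rw [List.map_cons, List.prod_cons, word_mul, List.length_append, ih, List.map_cons,
        List.sum_cons]
      congr 1
      conv_rhs => rw [← CycPath.mk_rep c]
      rfl
  rw [ofMultiset, h, totalLength]
  conv_rhs => rw [← Multiset.coe_toList s]
  rw [Multiset.map_coe, Multiset.sum_coe]

end Diagram

/-! ### The filtration by the number of arrows -/

variable {K}

variable (K Q) in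
/-- The polynomials in the closed paths up to rotation with at most `n` arrows in each
monomial. -/
def lengthFiltration (n : ℕ) : Submodule K[X] (Q.CycRing K) where
  carrier := {f | ∀ d ∈ f.support, Finsupp.weight (CycPath.length Q) d ≤ n}
  zero_mem' := by simp
  add_mem' := by
    classical
    intro f g hf hg d hd
    rcases Finset.mem_union.1 (MvPolynomial.support_add hd) with h | h
    exacts [hf d h, hg d h]
  smul_mem' := fun c f hf d hd => hf d (MvPolynomial.support_smul hd)

lemma lengthFiltration_mono : Monotone (Q.lengthFiltration K) :=
  fun _ _ h _ hf d hd => (hf d hd).trans h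

lemma mul_mem_lengthFiltration {m n : ℕ} {f g : Q.CycRing K} (hf : f ∈ Q.lengthFiltration K m)
    (hg : g ∈ Q.lengthFiltration K n) : f * g ∈ Q.lengthFiltration K (m + n) := by
  classical
  intro d hd
  obtain ⟨a, ha, b, hb, rfl⟩ := Finset.mem_add.1 (MvPolynomial.support_mul f g hd)
  rw [map_add]
  exact add_le_add (hf a ha) (hg b hb)

lemma X_mem_lengthFiltration (c : Q.CycPath) :
    (MvPolynomial.X c : Q.CycRing K) ∈ Q.lengthFiltration K c.length := by
  intro d hd
  rw [MvPolynomial.support_X, Finset.mem_singleton] at hd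
  rw [hd, Finsupp.weight_single]
  simp

lemma one_mem_lengthFiltration : (1 : Q.CycRing K) ∈ Q.lengthFiltration K 0 := by
  intro d hd
  have hd2 := MvPolynomial.support_monomial_subset (R := K[X]) (s := (0 : Q.CycPath →₀ ℕ)) (a := 1) hd
  rw [Finset.mem_singleton] at hd2
  rw [hd2, map_zero]

lemma prod_mem_lengthFiltration {ι : Type*} (T : Finset ι) (f : ι → Q.CycRing K) (n : ι → ℕ)
    (h : ∀ i ∈ T, f i ∈ Q.lengthFiltration K (n i)) :
    ∏ i ∈ T, f i ∈ Q.lengthFiltration K (∑ i ∈ T, n i) := by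
  classical
  induction T using Finset.induction_on with
  | empty => exact one_mem_lengthFiltration
  | insert a T ha ih =>
    rw [Finset.prod_insert ha, Finset.sum_insert ha]
    exact mul_mem_lengthFiltration (h a (Finset.mem_insert_self a T))
      (ih fun i hi => h i (Finset.mem_insert_of_mem hi))

open Classical in
lemma weight_toFinsupp (s : Multiset Q.CycPath) :
    Finsupp.weight (CycPath.length Q) (Multiset.toFinsupp s) = totalLength s := by
  induction s using Multiset.induction_on with
  | empty => simp [totalLength]
  | cons c s ih =>
    rw [← Multiset.singleton_add, map_add, map_add, ih, Multiset.toFinsupp_singleton,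
      Finsupp.weight_single]
    simp [totalLength]

variable (K) in
/-- Zero, or a path of length `n`. -/
def IsPathOrZero (n : ℕ) (a : Q.PathAlg K) : Prop :=
  a = 0 ∨ ∃ p : Q.DPath, p.word.length = n ∧ a = PathAlg.ofPath Q K p

lemma IsPathOrZero.mul {m n : ℕ} {a b : Q.PathAlg K} :
    IsPathOrZero K m a → IsPathOrZero K n b → IsPathOrZero K (m + n) (a * b) := by
  rintro (rfl | ⟨p, hp, rfl⟩) (rfl | ⟨q, hq, rfl⟩)
  · exact Or.inl (zero_mul _)
  · exact Or.inl (zero_mul _)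
  · exact Or.inl (mul_zero _)
  · by_cases h : p.src = q.tgt
    · exact Or.inr ⟨p.comp q h, (List.length_append).trans (by rw [hp, hq]),
        PathAlg.ofPath_mul K p q h⟩
    · exact Or.inl (PathAlg.ofPath_mul_eq_zero K p q h)

/-- The list is nonempty because the empty product is the unit of the path algebra, a sum of trivial
paths and in general not a path. -/
lemma IsPathOrZero.prod {n : ℕ → ℕ} {f : ℕ → Q.PathAlg K} (i : ℕ) (L : List ℕ)
    (h : ∀ j ∈ i :: L, IsPathOrZero K (n j) (f j)) :
    IsPathOrZero K ((i :: L).map n).sum ((i :: L).map f).prod := by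
  induction L generalizing i with
  | nil => simpa using h i (by simp)
  | cons j L ih =>
    rw [List.map_cons, List.sum_cons, List.map_cons (f := f), List.prod_cons]
    exact (h i (by simp)).mul (ih j fun k hk => h k (List.mem_cons_of_mem i hk))

lemma IsPathOrZero.cycLin_mem {n : ℕ} {a : Q.PathAlg K} :
    IsPathOrZero K n a → Q.cycLin K a ∈ Q.lengthFiltration K n := by
  rintro (rfl | ⟨p, hp, rfl⟩)
  · rw [map_zero]; exact zero_mem _
  · by_cases h : p.IsClosed
    · rw [cycLin_ofPath K ⟨p, h⟩, ← hp]
      exact X_mem_lengthFiltration (cycClass ⟨p, h⟩)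
    · rw [cycLin, PathAlg.extend_ofPath, cycVar, dif_neg h]
      exact zero_mem _

lemma vertProd_mem (s : Multiset V) : vertProd (Q := Q) K s ∈ Q.lengthFiltration K 0 := by
  induction s using Multiset.induction_on with
  | empty => exact one_mem_lengthFiltration
  | cons i s ih =>
    rw [vertProd, Multiset.map_cons, Multiset.prod_cons]
    exact mul_mem_lengthFiltration (m := 0)
      (IsPathOrZero.cycLin_mem (Or.inr ⟨DPath.triv Q i, rfl, rfl⟩)) ih

/-- Along a cycle the labels multiply to zero or to a path with at most one arrow for each point
that is not contracted, the contracted points carrying trivial paths. The points outside `D` are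
then counted cycle by cycle. -/
lemma cycFun_mem (w : List (Letter E)) (D : Finset ℕ) (σ : Equiv.Perm ℕ)
    (hD : D ⊆ Finset.range w.length) (h : FinSupp σ)
    (hσ : ∀ i ∈ Finset.range w.length, σ i ∈ Finset.range w.length) :
    cycFun (Q.cycTrace K) (Q.posArr K w) (Q.posIdem K w) (Finset.range w.length) (D, σ) ∈
      Q.lengthFiltration K ((Finset.range w.length).card - D.card) := by
  classical
  set S := Finset.range w.length with hS
  let g : ℕ → Cycle ℕ := fun i => Function.periodicOrbit σ i
  have key : ∀ c ∈ S.image g,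
      cycVal (Q.cycTrace K) (lab (Q.posArr K w) (Q.posIdem K w) D) c ∈
        Q.lengthFiltration K ((S \ D).filter fun i => g i = c).card := by
    intro c hc
    obtain ⟨i, hi, rfl⟩ := Finset.mem_image.1 hc
    obtain ⟨l, hl⟩ := h.orbitList_eq_cons i
    have hcl := orbitList_isCycleList σ i
    have hmem : i ∈ orbitList σ i := by rw [hl]; simp
    have hg : ∀ j ∈ orbitList σ i, g j = g i := fun j hj =>
      (hcl.periodicOrbit_eq hj).trans (hcl.periodicOrbit_eq hmem).symm
    have h1 : IsPathOrZero K ((orbitList σ i).map fun j => if j ∈ D then 0 else 1).sum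
        ((orbitList σ i).map (lab (Q.posArr K w) (Q.posIdem K w) D)).prod := by
      rw [hl]
      refine IsPathOrZero.prod i l fun j hj => ?_
      rw [← hl] at hj
      have hjS : j ∈ S := mem_orbitList_subset hσ hi hj
      rw [hS, Finset.mem_range] at hjS
      have hx := List.getElem?_eq_getElem hjS
      rw [lab]
      split_ifs
      · rw [posIdem_eq K hx]
        exact Or.inr ⟨DPath.triv Q _, rfl, rfl⟩
      · rw [posArr_eq K hx]
        exact Or.inr ⟨DPath.arrow Q _, rfl, rfl⟩
    have h2 : ((orbitList σ i).map fun j => if j ∈ D then 0 else 1).sum ≤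
        ((S \ D).filter fun j => g j = g i).card := by
      rw [← List.sum_toFinset _ hcl.nodup]
      have : (∑ x ∈ (orbitList σ i).toFinset, if x ∈ D then 0 else 1) =
          ((orbitList σ i).toFinset.filter fun x => x ∉ D).card := by
        rw [Finset.card_filter]
        exact Finset.sum_congr rfl fun x _ => by split_ifs <;> simp_all
      rw [this]
      refine Finset.card_le_card fun j hj => ?_
      rw [Finset.mem_filter, List.mem_toFinset] at hj
      rw [Finset.mem_filter, Finset.mem_sdiff]
      exact ⟨⟨mem_orbitList_subset hσ hi hj.1, hj.2⟩, hg j hj.1⟩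
    have h3 : g i = (orbitList σ i : Cycle ℕ) := hcl.periodicOrbit_eq hmem
    rw [h3, cycVal_coe, ← h3]
    exact lengthFiltration_mono h2 h1.cycLin_mem
  have h4 := prod_mem_lengthFiltration (S.image g) _ _ key
  have h5 : ∑ c ∈ S.image g, ((S \ D).filter fun i => g i = c).card = S.card - D.card := by
    rw [← Finset.card_sdiff_of_subset hD]
    exact (Finset.card_eq_sum_card_fiberwise fun i hi =>
      Finset.mem_coe.2 (Finset.mem_image_of_mem g (Finset.mem_sdiff.1 hi).1)).symm
  rw [h5] at h4
  exact h4

lemma _root_.NecklaceReduction.lab_empty {A : Type*} (ω ε : ℕ → A) : lab ω ε ∅ = ω := by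
  funext i
  simp [lab]

namespace Diagram

variable [DecidableEq E]

/-- Each contraction removes two arrows. The subtraction is truncated, so this says little about
words with fewer than two letters, which are treated in `normalForm_eq_mon`. -/
lemma normalForm_sub_mon (α β : K[X]) (X : Q.Diagram) :
    X.normalForm K α β - X.mon K ∈ Q.lengthFiltration K (X.word.length - 2) := by
  have h := (wick_sub_mem (c := posCoeff K[X] X.word) (α := α) (β := β) (Q.cycTrace K)
    (S := Finset.range X.word.length)
    (ω := Q.posArr K X.word) (ε := Q.posIdem K X.word) (Q.lengthFiltration K)
    lengthFiltration_mono (fun D σ hD hσ hs => cycFun_mem X.word D σ hD hσ hs)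
    (List.range X.word.length) (fun i hi => by simpa using hi) ∅ X.next
    (Finset.empty_subset _) X.finSupp X.next_mem).2
  rw [normalForm, mon, wick, ← mul_sub]
  have h2 := mul_mem_lengthFiltration (vertProd_mem (Q := Q) (K := K) X.verts) h
  rw [zero_add, Finset.card_empty, Nat.sub_zero, Finset.card_range] at h2
  convert h2 using 3
  simp [cycFun, lab_empty]

/-- With fewer than two arrows there is no pair to contract. -/
lemma normalForm_eq_mon (α β : K[X]) (X : Q.Diagram) (h : X.word.length < 2) :
    X.normalForm K α β = X.mon K := by
  rw [normalForm, mon, wick]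
  congr 1
  have h0 : cycFun (Q.cycTrace K) (Q.posArr K X.word) (Q.posIdem K X.word)
      (Finset.range X.word.length) (∅, X.next) =
      cycProd (Q.cycTrace K) (Finset.range X.word.length) X.next (Q.posArr K X.word) := by
    simp [cycFun, lab_empty]
  rw [← h0]
  interval_cases X.word.length
  · rfl
  · rw [show List.range 1 = [0] from rfl, wickOp_cons_apply]
    simp [wickOp]

end Diagram

/-! ### A basis of the quantized necklace algebra -/

variable [DecidableEq E]

lemma nclass_mul (α β : K[X]) (X Y : Q.Diagram) :
    nclass K α β (X * Y) = nclass K α β X * nclass K α β Y := by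
  rw [nclass, nclass, nclass, ← map_mul, dg, map_mul]

lemma nclass_one (α β : K[X]) : nclass K α β (1 : Q.Diagram) = 1 := by
  rw [nclass, dg, map_one, map_one]

lemma nclass_sub_interchange (α β : K[X]) (X : Q.Diagram) (l m : List (Letter E)) (x y : Letter E)
    (h : X.word = l ++ x :: y :: m) (hxy : y ≠ rev x) :
    nclass K α β X - nclass K α β (X.interchange l m x y h) = 0 := by
  rw [nclass, nclass, ← map_sub]
  exact QuotBy.mk_eq_zero _ _ (Skein.commute X l m x y h hxy)

lemma nclass_sub_interchange_rev (α β : K[X]) (X : Q.Diagram) (l m : List (Letter E))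
    (x : Letter E) (h : X.word = l ++ x :: rev x :: m) :
    nclass K α β X - nclass K α β (X.interchange l m x (rev x) h) =
      (contrCoeff α β X.next l.length (l.length + 1) * (letterBracket x (rev x) : K[X])) •
        nclass K α β (X.contract l m x h) := by
  rw [← sub_eq_zero, nclass, nclass, nclass, ← map_sub, ← map_smul, ← map_sub]
  rw [contrCoeff]
  split_ifs with hc
  · exact QuotBy.mk_eq_zero _ _ (Skein.split X l m x h hc)
  · exact QuotBy.mk_eq_zero _ _ (Skein.join X l m x h hc)

namespace Diagram

lemma RearrBy.trans {e f : Equiv.Perm ℕ} {X Y Z : Q.Diagram} (h : RearrBy e X Y)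
    (h' : RearrBy f Y Z) : RearrBy (e * f) X Z := by
  refine ⟨fun k hk => ?_, h'.length.trans h.length, h'.verts.trans h.verts, fun k => ?_, ?_⟩
  · rw [Equiv.Perm.mul_apply, h'.fix k (by rw [h.length]; exact hk), h.fix k hk]
  · rw [h'.word, h.word]; rfl
  · rw [← mul_assoc, h.next, mul_assoc, h'.next, mul_assoc]

lemma exists_split_word {X : Q.Diagram} {k : ℕ} (hk : k + 1 < X.word.length) :
    ∃ l m x y, X.word = l ++ x :: y :: m ∧ l.length = k := by
  refine ⟨X.word.take k, X.word.drop (k + 2), X.word[k], X.word[k + 1], ?_, by simp; omega⟩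
  rw [List.getElem_cons_drop, List.getElem_cons_drop, List.take_append_drop]

/-- If the differences in the skein relations at all rearrangements of `X` lie in `J`, then so do
the differences of all rearrangements of `X`. -/
lemma Rearr.nclass_sub_mem {α β : K[X]} {X Y : Q.Diagram} (J : Submodule K[X] (Q.N K α β))
    (hJ : ∀ X', Rearr X X' → ∀ (l m : List (Letter E)) (x y : Letter E)
      (h : X'.word = l ++ x :: y :: m),
      nclass K α β X' - nclass K α β (X'.interchange l m x y h) ∈ J) :
    Rearr X Y → nclass K α β X - nclass K α β Y ∈ J := by
  rintro ⟨e, he⟩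
  -- Heights are exchanged two at a time, the differences adding up; a rearrangement is determined
  -- by its permutation, so the diagram reached at the end is the given one.
  refine perm_adjacent_induction X.word.length
    (fun e => ∀ Y, RearrBy e X Y → nclass K α β X - nclass K α β Y ∈ J) ?_ ?_ e he.fix Y he
  · intro Y hY
    have : Y = X := hY.unique ⟨fun _ _ => rfl, rfl, rfl, fun _ => rfl, by simp⟩
    rw [this, sub_self]
    exact zero_mem _
  · intro e k hk hfix ih Y' hY'
    obtain ⟨Y, hY⟩ := X.exists_rearrBy e hfix
    obtain ⟨l, m, x, y, hw, rfl⟩ := exists_split_word (X := Y) (k := k) (by rw [hY.length]; exact hk)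
    have h1 := hY.trans (rearrBy_interchange Y l m x y hw)
    rw [hY'.unique h1]
    have h2 := add_mem (ih Y hY) (hJ Y ⟨e, hY⟩ l m x y hw)
    simpa using h2

/-- An exchange of adjacent heights costs at most a contracted diagram, which has two arrows fewer.
-/
lemma Rearr.nclass_sub_mem_span {α β : K[X]} {X Y : Q.Diagram} (h : Rearr X Y) :
    nclass K α β X - nclass K α β Y ∈ Submodule.span K[X]
      (nclass K α β '' {Z : Q.Diagram | Z.word.length < X.word.length}) := by
  refine h.nclass_sub_mem _ fun X' hX' l m x y hw => ?_
  by_cases hxy : y = rev x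
  · subst hxy
    rw [nclass_sub_interchange_rev]
    refine Submodule.smul_mem _ _ (Submodule.subset_span ⟨_, ?_, rfl⟩)
    change (l ++ m).length < _
    rw [← hX'.length_eq, hw]
    simp
  · rw [nclass_sub_interchange α β X' l m x y hw hxy]
    exact zero_mem _

end Diagram

/-- The standard elements of the quantized necklace algebra. -/
def stdClass (α β : K[X]) (s : Multiset Q.CycPath) : Q.N K α β :=
  nclass K α β (Diagram.ofMultiset s)

/-- Induction on the number of arrows: a diagram agrees with the standard product of its cyclic
words modulo shorter diagrams. -/
lemma nclass_mem_span (α β : K[X]) (X : Q.Diagram) :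
    nclass K α β X ∈ Submodule.span K[X] (Set.range (stdClass (Q := Q) α β)) := by
  induction hn : X.word.length using Nat.strong_induction_on generalizing X with
  | _ n ih =>
    obtain ⟨s, hs⟩ := Diagram.exists_rearr_ofMultiset X
    have h1 : nclass K α β X - stdClass α β s ∈
        Submodule.span K[X] (Set.range (stdClass (Q := Q) α β)) := by
      refine Submodule.span_le.2 ?_ hs.nclass_sub_mem_span
      rintro _ ⟨Z, hZ, rfl⟩
      exact ih _ (by rw [← hn]; exact hZ) Z rfl
    have h2 := add_mem h1 (Submodule.subset_span (Set.mem_range_self s))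
    rwa [sub_add_cancel] at h2

lemma span_nclass (α β : K[X]) :
    Submodule.span K[X] (Set.range (nclass (Q := Q) K α β)) = ⊤ := by
  rw [eq_top_iff]
  rintro z -
  obtain ⟨z, rfl⟩ := QuotBy.mk_surjective K[X] _ z
  induction z using MonoidAlgebra.induction_linear with
  | zero => rw [map_zero]; exact zero_mem _
  | add f g hf hg => rw [map_add]; exact add_mem hf hg
  | single X r =>
    rw [show (MonoidAlgebra.single X r : Q.HeightAlg K) = r • dg K X by simp [dg], map_smul]
    exact Submodule.smul_mem _ _ (Submodule.subset_span ⟨X, rfl⟩)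

lemma span_stdClass (α β : K[X]) :
    Submodule.span K[X] (Set.range (stdClass (Q := Q) α β)) = ⊤ := by
  rw [eq_top_iff, ← span_nclass, Submodule.span_le]
  rintro _ ⟨X, rfl⟩
  exact nclass_mem_span α β X

/-- Triangularity of the normal form: the image of the standard element of `t` is the monomial of
`t` plus terms with strictly fewer arrows. -/
lemma linearIndependent_stdClass (α β : K[X]) :
    LinearIndependent K[X] (stdClass (Q := Q) α β) := by
  classical
  obtain ⟨Φ, hΦ⟩ := exists_normalForm (Q := Q) K α β
  have hcoeff : ∀ s t : Multiset Q.CycPath, s ≠ t → totalLength s ≤ totalLength t →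
      MvPolynomial.coeff (Multiset.toFinsupp t) (Φ (stdClass α β s)) = 0 := by
    intro s t hst hle
    have h1 : MvPolynomial.coeff (Multiset.toFinsupp t) ((Diagram.ofMultiset s).mon K) = 0 := by
      rw [Diagram.mon_ofMultiset, cycMonomial_eq, MvPolynomial.coeff_monomial, if_neg]
      exact fun h => hst (Multiset.toFinsupp.injective h)
    rw [stdClass, hΦ]
    rcases lt_or_ge (Diagram.ofMultiset s).word.length 2 with h2 | h2
    · rw [Diagram.normalForm_eq_mon α β _ h2, h1]
    · have h3 := Diagram.normalForm_sub_mon α β (Diagram.ofMultiset s)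
      rw [← sub_add_cancel (Diagram.normalForm K α β _) ((Diagram.ofMultiset s).mon K),
        MvPolynomial.coeff_add, h1, add_zero]
      by_contra h4
      have h5 := h3 _ (MvPolynomial.mem_support_iff.2 h4)
      rw [weight_toFinsupp, Diagram.length_ofMultiset] at h5
      rw [Diagram.length_ofMultiset] at h2
      omega
  have hdiag : ∀ t : Multiset Q.CycPath,
      MvPolynomial.coeff (Multiset.toFinsupp t) (Φ (stdClass α β t)) = 1 := by
    intro t
    have h1 : MvPolynomial.coeff (Multiset.toFinsupp t) ((Diagram.ofMultiset t).mon K) = 1 := by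
      rw [Diagram.mon_ofMultiset, cycMonomial_eq, MvPolynomial.coeff_monomial, if_pos rfl]
    rw [stdClass, hΦ]
    rcases lt_or_ge (Diagram.ofMultiset t).word.length 2 with h2 | h2
    · rw [Diagram.normalForm_eq_mon α β _ h2, h1]
    · have h3 := Diagram.normalForm_sub_mon α β (Diagram.ofMultiset t)
      rw [← sub_add_cancel (Diagram.normalForm K α β _) ((Diagram.ofMultiset t).mon K),
        MvPolynomial.coeff_add, h1, add_eq_right]
      by_contra h4
      have h5 := h3 _ (MvPolynomial.mem_support_iff.2 h4)
      rw [weight_toFinsupp, Diagram.length_ofMultiset] at h5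
      rw [Diagram.length_ofMultiset] at h2
      omega
  rw [linearIndependent_iff]
  intro c hc
  by_contra hne
  -- In a relation, the coefficient at a member of maximal length receives no contribution from the
  -- other members.
  obtain ⟨t, ht, hmax⟩ := Finset.exists_max_image c.support (totalLength (Q := Q))
    (Finsupp.support_nonempty_iff.2 hne)
  have h0 : MvPolynomial.coeff (Multiset.toFinsupp t)
      (Φ (Finsupp.linearCombination K[X] (stdClass (Q := Q) α β) c)) = 0 := by
    rw [hc, map_zero, MvPolynomial.coeff_zero]
  rw [Finsupp.linearCombination_apply, Finsupp.sum, map_sum, MvPolynomial.coeff_sum,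
    Finset.sum_eq_single t] at h0
  · rw [map_smul, MvPolynomial.coeff_smul, hdiag, smul_eq_mul, mul_one] at h0
    exact Finsupp.mem_support_iff.1 ht h0
  · intro s hs hst
    rw [map_smul, MvPolynomial.coeff_smul, hcoeff s t hst (hmax s hs), smul_zero]
  · exact fun h => absurd ht h

variable (Q) in
/-- The standard elements form a basis of the quantized necklace algebra. -/
def stdBasis (α β : K[X]) : Module.Basis (Multiset Q.CycPath) K[X] (Q.N K α β) :=
  Module.Basis.mk (linearIndependent_stdClass α β) (span_stdClass α β).ge

lemma stdBasis_apply (α β : K[X]) (s : Multiset Q.CycPath) :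
    Q.stdBasis α β s = stdClass α β s := by
  rw [stdBasis, Module.Basis.mk_apply]

end QuiverData

/-! ### Commutators of standard lifts -/

/-- When both coefficients are zero only the empty set of contractions remains, and the normal form
is the bare monomial. The formula for the normal form of a contraction thereby also yields the
monomial of a contracted diagram. -/
lemma wickOp_zero {R M : Type*} [CommRing R] [AddCommGroup M] [Module R M] (c : ℕ → ℕ → R)
    (l : List ℕ) : (wickOp c 0 0 l : Module.End R (Finset ℕ × Equiv.Perm ℕ → M)) = 1 := by
  have h0 : ∀ i j, (contrOp c 0 0 i j : Module.End R (Finset ℕ × Equiv.Perm ℕ → M)) = 0 := by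
    intro i j
    ext F ⟨D, σ⟩
    by_cases h : i ∉ D ∧ j ∉ D ∧ i ≠ j ∧ FinSupp σ
    · rw [contrOp_apply c 0 0 i j F h.1 h.2.1 h.2.2.1 h.2.2.2]
      simp [contrCoeff]
    · rw [contrOp_apply_eq_zero c 0 0 i j F h]
      rfl
  induction l with
  | nil => rfl
  | cons i l ih =>
    rw [wickOp, ih, mul_one, show contrOp c 0 0 i = fun _ => (0 : Module.End R (Finset ℕ × Equiv.Perm ℕ → M))
      from funext (h0 i)]
    simp

/-- The difference of the values at two lists which differ by the exchange of two adjacent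
blocks. -/
lemma exchange_blocks_mem {M : Type*} [AddCommGroup M] (J : AddSubgroup M) (F : List ℕ → M)
    (T : ℕ → ℕ → M) (R : List ℕ) (A B : List ℕ)
    (h : ∀ l m a b, a ∈ A → b ∈ B → (l ++ a :: b :: m).Perm R →
      F (l ++ a :: b :: m) - F (l ++ b :: a :: m) - T a b ∈ J) :
    ∀ l m, (l ++ A ++ B ++ m).Perm R →
      F (l ++ A ++ B ++ m) - F (l ++ B ++ A ++ m) -
        (A.map fun a => (B.map (T a)).sum).sum ∈ J := by
  have single : ∀ a ∈ A, ∀ B', (∀ b ∈ B', b ∈ B) → ∀ l m, (l ++ a :: (B' ++ m)).Perm R →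
      F (l ++ a :: (B' ++ m)) - F (l ++ B' ++ a :: m) - (B'.map (T a)).sum ∈ J := by
    intro a ha B'
    induction B' with
    | nil => intro _ l m _; simp
    | cons b B' ih =>
      intro hB l m hR
      have h1 := h l (B' ++ m) a b ha (hB b (by simp)) hR
      have h2 := ih (fun b hb => hB b (by simp [hb])) (l ++ [b]) m (by
        refine List.Perm.trans ?_ hR
        rw [List.append_assoc]
        exact List.Perm.append_left l (List.Perm.swap a b _))
      have h3 := add_mem h1 h2
      simp only [List.append_assoc, List.cons_append, List.nil_append, List.map_cons,
        List.sum_cons] at h3 ⊢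
      convert h3 using 1
      abel
  -- The tail of the first block passes the second block before its head does. The correction `T a
  -- b` does not depend on the surrounding list, so the corrections add up to a double sum.
  have multi : ∀ A', (∀ a ∈ A', a ∈ A) → ∀ l m, (l ++ A' ++ B ++ m).Perm R →
      F (l ++ A' ++ B ++ m) - F (l ++ B ++ A' ++ m) -
        (A'.map fun a => (B.map (T a)).sum).sum ∈ J := by
    intro A'
    induction A' with
    | nil => intro _ l m _; simp
    | cons a A' ih =>
      intro hA l m hR
      have h1 := ih (fun b hb => hA b (by simp [hb])) (l ++ [a]) m (by
        simpa [List.append_assoc] using hR)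
      have h2 := single a (hA a (by simp)) B (fun b hb => hb) l (A' ++ m) (by
        refine List.Perm.trans ?_ hR
        simp only [List.append_assoc, List.cons_append]
        refine List.Perm.append_left l (List.Perm.cons a ?_)
        rw [← List.append_assoc, ← List.append_assoc]
        exact List.Perm.append_right m List.perm_append_comm)
      have h3 := add_mem h1 h2
      simp only [List.append_assoc, List.cons_append, List.nil_append, List.map_cons,
        List.sum_cons] at h3 ⊢
      convert h3 using 1
      abel
  exact multi A fun a ha => ha

lemma getElem?_exchange {α : Type*} (l m : List α) (x y : α) (j : ℕ) :
    (l ++ y :: x :: m)[j]? = (l ++ x :: y :: m)[Equiv.swap l.length (l.length + 1) j]? := by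
  rcases lt_or_ge j l.length with h | h
  · rw [Equiv.swap_apply_of_ne_of_ne (by omega) (by omega), List.getElem?_append_left h,
      List.getElem?_append_left h]
  · obtain ⟨n, rfl⟩ := Nat.exists_eq_add_of_le h
    rcases n with _ | _ | n
    · simp [Equiv.swap_apply_left]
    · simp [Equiv.swap_apply_right]
    · rw [Equiv.swap_apply_of_ne_of_ne (by omega) (by omega), List.getElem?_append_right h,
        List.getElem?_append_right h]
      simp

lemma letterBracket_eq_zero {E : Type*} [DecidableEq E] {x y : Letter E} (h : y ≠ rev x) :
    letterBracket x y = 0 := by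
  cases x <;> cases y <;> simp_all [letterBracket, eq_comm]

namespace QuiverData

variable {V : Type u} {E : Type v} {Q : QuiverData V E} {K : Type w} [Field K] [Fintype V]
  [DecidableEq E]

namespace Diagram

lemma normalForm_zero (X : Q.Diagram) : X.normalForm K 0 0 = X.mon K := by
  rw [normalForm, mon, wick, wickOp_zero, Module.End.one_apply, cycFun, lab_empty]

lemma mon_contract (X : Q.Diagram) (l m : List (Letter E)) (x : Letter E)
    (h : X.word = l ++ x :: rev x :: m) :
    (X.contract l m x h).mon K = vertProd K X.verts *
      cycProd (Q.cycTrace K) (Finset.range X.word.length)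
        (X.next * Equiv.swap l.length (l.length + 1))
        (lab (Q.posArr K X.word) (Q.posIdem K X.word) {l.length, l.length + 1}) := by
  rw [← normalForm_zero, normalForm_contract, wick, wickOp_zero]
  rfl

lemma RearrBy.image_range {e : Equiv.Perm ℕ} {X Y : Q.Diagram} (h : RearrBy e X Y) :
    (Finset.range Y.word.length).image e = Finset.range X.word.length := by
  apply Finset.eq_of_subset_of_card_le
  · intro y hy
    obtain ⟨x, hx, rfl⟩ := Finset.mem_image.1 hy
    rw [Finset.mem_range] at hx ⊢
    exact h.lt (by rwa [← h.length])
  · rw [Finset.card_image_of_injective _ e.injective, Finset.card_range, Finset.card_range,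
      h.length]

lemma RearrBy.mon_contract {e : Equiv.Perm ℕ} {X Y : Q.Diagram} (he : RearrBy e X Y)
    (l m : List (Letter E)) (x : Letter E) (h : Y.word = l ++ x :: rev x :: m) :
    (Y.contract l m x h).mon K = vertProd K X.verts *
      cycProd (Q.cycTrace K) (Finset.range X.word.length)
        (X.next * Equiv.swap (e l.length) (e (l.length + 1)))
        (lab (Q.posArr K X.word) (Q.posIdem K X.word) {e l.length, e (l.length + 1)}) := by
  rw [Diagram.mon_contract, he.verts, ← he.image_range]
  congr 1
  have hk : l.length + 1 < Y.word.length := by rw [h]; simp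
  refine (cycProd_relabel _ e.injective ?_ (fun i _ => ?_) fun i _ => ?_).symm
  · exact mul_swap_mem Y.next_mem (Finset.mem_range.2 (by omega)) (Finset.mem_range.2 hk)
  · have h1 : ∀ j, X.next (e j) = e (Y.next j) := fun j => congrArg (fun f => f j) he.next
    rw [Equiv.Perm.mul_apply, Equiv.Perm.mul_apply, ← h1]
    congr 1
    rw [Equiv.swap_apply_def, Equiv.swap_apply_def]
    simp only [e.injective.eq_iff]
    split_ifs <;> rfl
  · simp only [lab, Finset.mem_insert, Finset.mem_singleton, e.injective.eq_iff, posArr, posIdem,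
      he.word]

lemma RearrBy.sameCycle {e : Equiv.Perm ℕ} {X Y : Q.Diagram} (he : RearrBy e X Y) (i j : ℕ) :
    Y.next.SameCycle i j ↔ X.next.SameCycle (e i) (e j) := by
  have h : X.next = e * Y.next * e⁻¹ := by rw [← he.next, mul_assoc, mul_inv_cancel, mul_one]
  rw [h, Equiv.Perm.sameCycle_conj]
  rw [show e⁻¹ (e i) = i from e.symm_apply_apply i, show e⁻¹ (e j) = j from e.symm_apply_apply j]

lemma sameCycle_ofC (p : Q.ClosedPath) {i j : ℕ} (hi : i < p.1.word.length)
    (hj : j < p.1.word.length) : (ofC p).next.SameCycle i j := by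
  have h0 : ∀ i, i < p.1.word.length → (ofC p).next.SameCycle 0 i := by
    intro i
    induction i with
    | zero => intro _; exact Equiv.Perm.SameCycle.refl _ _
    | succ i ih =>
      intro hi
      refine (ih (by omega)).trans ?_
      have := sameCycle_self_apply (ofC p).next i
      rwa [ofC_next p (by omega), Nat.mod_eq_of_lt hi] at this
  exact (h0 i hi).symm.trans (h0 j hj)

/-- Two products of cyclic words with heights which consist of the same cyclic word are equal
modulo the split coefficient. -/
lemma nclass_sub_ofC_mem (α β : K[X]) {Z : Q.Diagram} (p : Q.ClosedPath)
    (h : Z.mon K = MvPolynomial.X (cycClass p)) :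
    nclass K α β (ofC p) - nclass K α β Z ∈ LinearMap.range (LinearMap.lsmul K[X] (Q.N K α β) β) := by
  have hr : Rearr (ofC p) Z := rearr_of_mon_eq K (by rw [h, mon_ofC])
  refine hr.nclass_sub_mem _ fun X' hX' l m x y hw => ?_
  by_cases hxy : y = rev x
  · subst hxy
    obtain ⟨e, he⟩ := hX'
    have hk : l.length + 1 < p.1.word.length := by
      rw [← ofC_word, ← he.length, hw]; simp
    -- A rearrangement of a single cyclic word has only one cycle, so any contraction in it is a
    -- split and carries the factor `β`.
    have hc : X'.next.SameCycle l.length (l.length + 1) := by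
      rw [he.sameCycle]
      exact sameCycle_ofC p (he.lt (by rw [ofC_word]; omega)) (he.lt (by rw [ofC_word]; omega))
    rw [nclass_sub_interchange_rev, contrCoeff, if_pos hc, mul_smul]
    exact ⟨_, rfl⟩
  · rw [nclass_sub_interchange α β X' l m x y hw hxy]
    exact zero_mem _

/-! ### Arrangements given by lists of heights -/

/-- `Y` is the rearrangement of `X` in which the arrows are listed in the order `M`. -/
def Arranged (X : Q.Diagram) (M : List ℕ) (Y : Q.Diagram) : Prop :=
  ∃ e, RearrBy e X Y ∧ (List.range X.word.length).map e = M

lemma Arranged.unique {X Y Z : Q.Diagram} {M : List ℕ} : Arranged X M Y → Arranged X M Z → Y = Z := by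
  rintro ⟨e, he, rfl⟩ ⟨f, hf, h⟩
  have : f = e := by
    ext k
    rcases lt_or_ge k X.word.length with hk | hk
    · exact List.map_inj_left.1 h k (List.mem_range.2 hk)
    · rw [he.fix k hk, hf.fix k hk]
  subst this
  exact he.unique hf

lemma exists_arranged (X : Q.Diagram) {M : List ℕ} (h : M.Perm (List.range X.word.length)) :
    ∃ Y, Arranged X M Y := by
  have hlen : M.length = X.word.length := by rw [h.length_eq, List.length_range]
  have hnd : M.Nodup := h.nodup_iff.2 List.nodup_range
  obtain ⟨e, he, hfix⟩ := exists_perm_of_injOn X.word.length (fun k => M.getD k 0)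
    (fun k hk => by
      rw [List.getD_eq_getElem _ _ (by omega)]
      exact List.mem_range.1 (h.mem_iff.1 (List.getElem_mem _)))
    (fun i j hi hj hij => by
      rw [List.getD_eq_getElem _ _ (by omega), List.getD_eq_getElem _ _ (by omega)] at hij
      exact (hnd.getElem_inj_iff).1 hij)
  obtain ⟨Y, hY⟩ := X.exists_rearrBy e hfix
  refine ⟨Y, e, hY, List.ext_getElem (by simp [hlen]) fun i h1 h2 => ?_⟩
  rw [List.getElem_map, List.getElem_range, he i (by omega), List.getD_eq_getElem _ _ (by omega)]

open Classical in
/-- The class of the rearrangement in which the arrows are listed in a given order. -/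
def arrClass (α β : K[X]) (X : Q.Diagram) (M : List ℕ) : Q.N K α β :=
  if h : ∃ Y, Arranged X M Y then nclass K α β h.choose else 0

lemma Arranged.arrClass_eq {α β : K[X]} {X Y : Q.Diagram} {M : List ℕ} (h : Arranged X M Y) :
    X.arrClass α β M = nclass K α β Y := by
  have h2 : ∃ Y, Arranged X M Y := ⟨Y, h⟩
  rw [arrClass, dif_pos h2, h2.choose_spec.unique h]

lemma arranged_refl (X : Q.Diagram) : Arranged X (List.range X.word.length) X :=
  ⟨1, ⟨fun _ _ => rfl, rfl, rfl, fun _ => rfl, by simp⟩, by simp⟩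

lemma arranged_mul_comm (X Y : Q.Diagram) : Arranged (X * Y)
    ((List.range Y.word.length).map (X.word.length + ·) ++ List.range X.word.length) (Y * X) := by
  obtain ⟨e, he, h1, h2⟩ := exists_rearrBy_mul_comm X Y
  refine ⟨e, he, ?_⟩
  rw [word_mul, List.length_append, add_comm, List.range_add, List.map_append, List.map_map]
  congr 1
  · exact List.map_congr_left fun i hi => h1 i (List.mem_range.1 hi)
  · conv_rhs => rw [← List.map_id (List.range X.word.length)]
    exact List.map_congr_left fun i hi => h2 i (List.mem_range.1 hi)

end Diagram

/-! ### The commutator of two standard lifts -/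

lemma chain_rotate {i : V} {A B : List (Letter E)} {x : Letter E}
    (h : Q.IsChain i (A ++ x :: B)) (hc : Q.endVertex i (A ++ x :: B) = i) :
    Q.IsChain (Q.lsrc x) (B ++ A) ∧ Q.endVertex (Q.lsrc x) (B ++ A) = Q.ltgt x := by
  rw [isChain_append] at h
  rw [endVertex_append] at hc
  obtain ⟨h1, h2, h3⟩ := h
  have hc' : Q.endVertex (Q.lsrc x) B = i := hc
  rw [isChain_append, endVertex_append, hc']
  exact ⟨⟨h3, h1⟩, h2.symm⟩

/-- The path which arises by joining two closed paths at `x` and `x^*`. -/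
lemma exists_joined_path (p q : Q.ClosedPath) (i : Fin p.1.word.length) (j : Fin q.1.word.length)
    (h : q.1.word.get j = rev (p.1.word.get i)) :
    ∃ c : Q.ClosedPath, PathAlg.wordElem Q K (Q.lsrc (p.1.word.get i))
        (p.1.word.drop (i + 1) ++ p.1.word.take i ++ (q.1.word.drop (j + 1) ++ q.1.word.take j)) =
        PathAlg.ofPath Q K c.1 ∧
      Q.cycLin K (((p.1.word.drop (i + 1) ++ p.1.word.take i).map (PathAlg.arr Q K)).prod *
        PathAlg.e Q K (Q.ltgt (p.1.word.get i)) *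
        (((q.1.word.drop (j + 1) ++ q.1.word.take j).map (PathAlg.arr Q K)).prod *
        PathAlg.e Q K (Q.ltgt (q.1.word.get j)))) = MvPolynomial.X (cycClass c) := by
  have hsplit : ∀ (w : List (Letter E)) (k : Fin w.length),
      w = w.take k ++ w.get k :: w.drop (k + 1) := fun w k => by
    rw [List.get_eq_getElem, List.getElem_cons_drop, List.take_append_drop]
  set x := p.1.word.get i with hx
  have hp1 := p.1.chain
  have hp2 : Q.endVertex p.1.tgt p.1.word = p.1.tgt := p.2
  have hq1 := q.1.chain
  have hq2 : Q.endVertex q.1.tgt q.1.word = q.1.tgt := q.2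
  rw [hsplit _ i] at hp1 hp2
  rw [hsplit _ j] at hq1 hq2
  obtain ⟨hp3, hp4⟩ := chain_rotate hp1 hp2
  obtain ⟨hq3, hq4⟩ := chain_rotate hq1 hq2
  rw [h, lsrc_rev] at hq3 hq4
  rw [ltgt_rev] at hq4
  rw [← hx] at hp3 hp4
  set w1 := p.1.word.drop (i + 1) ++ p.1.word.take i with hw1
  set w2 := q.1.word.drop (j + 1) ++ q.1.word.take j with hw2
  let P1 : Q.DPath := ⟨Q.lsrc x, w1, hp3⟩
  let P2 : Q.DPath := ⟨Q.ltgt x, w2, hq3⟩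
  have hs : P1.src = P2.tgt := hp4
  have hcl : (P1.comp P2 hs).IsClosed := (DPath.src_comp P1 P2 hs).trans hq4
  refine ⟨⟨P1.comp P2 hs, hcl⟩, PathAlg.wordElem_eq_ofPath K _ _ (P1.comp P2 hs).chain, ?_⟩
  -- Moving the last idempotent to the front, which the trace allows, puts before each of the two
  -- words the idempotent at its target.
  rw [← cycLin_ofPath K ⟨P1.comp P2 hs, hcl⟩, ← PathAlg.ofPath_mul K P1 P2 hs,
    ← PathAlg.wordElem_eq_ofPath K _ _ hp3, ← PathAlg.wordElem_eq_ofPath K _ _ hq3, h, ltgt_rev,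
    ← mul_assoc, cycLin_mul_comm]
  simp only [PathAlg.wordElem, mul_assoc]

namespace Diagram

lemma next_mul_left (X Y : Q.Diagram) {k : ℕ} (hk : k < X.word.length) :
    (X * Y).next k = X.next k := by
  rw [next_mul, Equiv.Perm.mul_apply, shiftPerm_apply, if_pos hk]

lemma next_mul_right (X Y : Q.Diagram) (k : ℕ) :
    (X * Y).next (X.word.length + k) = X.word.length + Y.next k := by
  rw [next_mul, Equiv.Perm.mul_apply, shiftPerm_apply_add, X.next_fix _ (by omega)]

lemma rotate_mod {r i k : ℕ} (hi : i < r) (hk : k < r) :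
    (i + 1 + k) % r = if i + 1 + k < r then i + 1 + k else i + 1 + k - r := by
  split_ifs with h
  · exact Nat.mod_eq_of_lt h
  · rw [Nat.mod_eq_sub_mod (by omega), Nat.mod_eq_of_lt (by omega)]

lemma succ_mod {r k : ℕ} (hk : k < r) : (k + 1) % r = if k + 1 = r then 0 else k + 1 := by
  split_ifs with h
  · rw [h, Nat.mod_self]
  · exact Nat.mod_eq_of_lt (by omega)

/-- The transposition links the two cycles: after a full turn of `p` that starts behind `i` and ends
at `i`, the path continues behind `j`, and symmetrically for `q`. -/
lemma isCycleList_join (p q : Q.ClosedPath) {i j : ℕ} (hi : i < p.1.word.length)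
    (hj : j < q.1.word.length) :
    IsCycleList ((ofC p * ofC q).next * Equiv.swap i (p.1.word.length + j))
      ((List.range p.1.word.length).map (fun k => (i + 1 + k) % p.1.word.length) ++
        (List.range q.1.word.length).map
          (fun k => p.1.word.length + (j + 1 + k) % q.1.word.length)) := by
  set r := p.1.word.length with hr
  set s := q.1.word.length with hs
  have hlen : ((List.range r).map (fun k => (i + 1 + k) % r) ++
        (List.range s).map (fun k => r + (j + 1 + k) % s)).length = r + s := by simp
  have hget1 : ∀ k (h : k < r), ((List.range r).map (fun k => (i + 1 + k) % r) ++
        (List.range s).map (fun k => r + (j + 1 + k) % s))[k]'(by omega) =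
        if i + 1 + k < r then i + 1 + k else i + 1 + k - r := fun k h => by
    rw [List.getElem_append_left (by simpa using h), List.getElem_map, List.getElem_range,
      rotate_mod hi h]
  have hget2 : ∀ k (h : k < s), ((List.range r).map (fun k => (i + 1 + k) % r) ++
        (List.range s).map (fun k => r + (j + 1 + k) % s))[r + k]'(by omega) =
        r + if j + 1 + k < s then j + 1 + k else j + 1 + k - s := fun k h => by
    rw [List.getElem_append_right (by simp), List.getElem_map, List.getElem_range]
    simp only [List.length_map, List.length_range, Nat.add_sub_cancel_left]
    rw [rotate_mod hj h]
  have hn1 : ∀ k, k < r → (ofC p * ofC q).next k = if k + 1 = r then 0 else k + 1 := fun k hk => by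
    rw [next_mul_left _ _ hk, ofC_next p hk, succ_mod hk]
  have hn2 : ∀ k, k < s → (ofC p * ofC q).next (r + k) = r + if k + 1 = s then 0 else k + 1 :=
    fun k hk => by
      have := next_mul_right (ofC p) (ofC q) k
      rwa [ofC_next q hk, ← hs, succ_mod hk] at this
  constructor
  · rw [List.nodup_append]
    refine ⟨?_, ?_, ?_⟩
    · rw [List.nodup_map_iff_inj_on List.nodup_range]
      intro a ha b hb hab
      rw [List.mem_range] at ha hb
      rw [rotate_mod hi ha, rotate_mod hi hb] at hab
      split_ifs at hab <;> omega
    · rw [List.nodup_map_iff_inj_on List.nodup_range]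
      intro a ha b hb hab
      rw [List.mem_range] at ha hb
      rw [rotate_mod hj ha, rotate_mod hj hb] at hab
      split_ifs at hab <;> omega
    · intro a ha b hb hab
      rw [List.mem_map] at ha hb
      obtain ⟨a', -, rfl⟩ := ha
      obtain ⟨b', -, rfl⟩ := hb
      have := Nat.mod_lt (i + 1 + a') (show 0 < r by omega)
      omega
  · intro k hk
    rw [hlen] at hk
    have hmod : (k + 1) % (r + s) = if k + 1 = r + s then 0 else k + 1 := succ_mod hk
    have hrhs : ∀ a (ha : a < r + s), (k + 1) % (r + s) = a →
        ((List.range r).map (fun k => (i + 1 + k) % r) ++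
        (List.range s).map (fun k => r + (j + 1 + k) % s))[(k + 1) %
          ((List.range r).map (fun k => (i + 1 + k) % r) ++
        (List.range s).map (fun k => r + (j + 1 + k) % s)).length]'(by
          rw [hlen]; exact Nat.mod_lt _ (by omega)) = ((List.range r).map (fun k => (i + 1 + k) % r) ++
        (List.range s).map (fun k => r + (j + 1 + k) % s))[a]'(by omega) := by
      intro a ha hka
      congr 1
      rw [hlen, hka]
    rw [Equiv.Perm.mul_apply]
    rcases lt_or_ge k r with hkr | hkr
    · rw [hget1 k hkr]
      -- The last entry of the first block is `i`, where the path changes over to the successor of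
      -- `j` in `q`.
      by_cases hlast : k + 1 = r
      · rw [show (if i + 1 + k < r then i + 1 + k else i + 1 + k - r) = i by
          rw [if_neg (by omega)]; omega, Equiv.swap_apply_left, hn2 j hj,
          hrhs (r + 0) (by omega) (by rw [hmod, if_neg (by omega)]; omega), hget2 0 (by omega)]
        split_ifs <;> omega
      · rw [hrhs (k + 1) (by omega) (by rw [hmod, if_neg (by omega)]), hget1 _ (by omega),
          Equiv.swap_apply_of_ne_of_ne (by split_ifs <;> omega) (by split_ifs <;> omega),
          hn1 _ (by split_ifs <;> omega)]
        split_ifs <;> omega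
    · obtain ⟨k, rfl⟩ := Nat.exists_eq_add_of_le hkr
      rw [hget2 k (by omega)]
      by_cases hlast : k + 1 = s
      · rw [show (if j + 1 + k < s then j + 1 + k else j + 1 + k - s) = j by
          rw [if_neg (by omega)]; omega, Equiv.swap_apply_right, hn1 i hi,
          hrhs 0 (by omega) (by rw [hmod, if_pos (by omega)]), hget1 0 (by omega)]
        split_ifs <;> omega
      · rw [hrhs (r + (k + 1)) (by omega) (by rw [hmod, if_neg (by omega)]; omega),
          hget2 _ (by omega),
          Equiv.swap_apply_of_ne_of_ne (by split_ifs <;> omega) (by split_ifs <;> omega),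
          hn2 _ (by split_ifs <;> omega)]
        split_ifs <;> omega

/-- The product of labels along a cyclic word, starting after the position `i`, at which the
arrow is replaced by an idempotent. -/
lemma map_rotate (w : List (Letter E)) {i : ℕ} (hi : i < w.length) (f : ℕ → Q.PathAlg K)
    (u : Q.PathAlg K) (hf : ∀ k (h : k < w.length), k ≠ i → f k = PathAlg.arr Q K w[k])
    (hu : f i = u) :
    (List.range w.length).map (fun k => f ((i + 1 + k) % w.length)) =
      (w.drop (i + 1) ++ w.take i).map (PathAlg.arr Q K) ++ [u] := by
  apply List.ext_getElem
  · simp; omega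
  · intro k h1 h2
    rw [List.length_map, List.length_range] at h1
    rw [List.getElem_map, List.getElem_range, rotate_mod hi h1]
    by_cases hk : k + 1 = w.length
    · rw [List.getElem_append_right (by simp; omega), if_neg (by omega),
        show i + 1 + k - w.length = i by omega, hu]
      simp
    · rw [List.getElem_append_left (by simp; omega), List.getElem_map]
      split_ifs with h
      · rw [hf _ h (by omega), List.getElem_append_left (by simp; omega), List.getElem_drop]
      · rw [hf _ (by omega) (by omega), List.getElem_append_right (by simp; omega),
          List.getElem_take]
        congr 2
        simp
        omega

end Diagram

variable (K) in
/-- A summand of the necklace bracket. -/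
def neckTerm (p q : Q.DPath) (i : Fin p.word.length) (j : Fin q.word.length) : Q.PathAlg K :=
  (letterBracket (p.word.get i) (q.word.get j) : K) •
      PathAlg.wordElem Q K (Q.lsrc (p.word.get i))
        (p.word.drop (i + 1) ++ p.word.take i ++ (q.word.drop (j + 1) ++ q.word.take j))

lemma hat_ofClosedPath (α β : K[X]) (p : Q.ClosedPath) :
    Q.hat K α β (PathAlg.ofPath Q K p.1) = nclass K α β (Diagram.ofC p) := by
  rw [hat, PathAlg.extend_ofPath, dif_pos p.2]
  rfl

namespace Diagram

/-- The exchange of an arrow of `p` and an arrow of `q` in an arrangement of the product of the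
standard lifts of `p` and `q`. -/
lemma arrClass_exchange (α β : K[X]) (p q : Q.ClosedPath) (l m : List ℕ)
    (i : Fin p.1.word.length) (j : Fin q.1.word.length)
    (hR : (l ++ (i : ℕ) :: (p.1.word.length + j) :: m).Perm
      (List.range (ofC p * ofC q).word.length)) :
    (ofC p * ofC q).arrClass α β (l ++ (i : ℕ) :: (p.1.word.length + j) :: m) -
      (ofC p * ofC q).arrClass α β (l ++ (p.1.word.length + j) :: (i : ℕ) :: m) -
      α • Q.hat K α β (neckTerm K p.1 q.1 i j) ∈
    LinearMap.range (LinearMap.lsmul K[X] (Q.N K α β) (α * β)) := by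
  set X := ofC p * ofC q with hX
  obtain ⟨Y, hY⟩ := X.exists_arranged hR
  obtain ⟨e, he, hM⟩ := id hY
  have hXlen : X.word.length = p.1.word.length + q.1.word.length := by
    rw [hX, word_mul, List.length_append]; rfl
  have hMlen : l.length + m.length + 2 = X.word.length := by
    have := hR.length_eq
    simp at this
    omega
  have hek : ∀ k (hk : k < X.word.length), e k = (l ++ (i : ℕ) :: (p.1.word.length + j) :: m)[k]'(by
      simp; omega) := fun k hk => by
    have h1 : k < ((List.range X.word.length).map e).length := by simpa using hk
    have h2 : ((List.range X.word.length).map e)[k] = e k := by simp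
    rw [← h2]
    congr 1
  have hea : e l.length = i := by rw [hek _ (by omega)]; simp
  have heb : e (l.length + 1) = p.1.word.length + j := by
    rw [hek _ (by omega), List.getElem_append_right (by omega)]
    simp
  have hk : l.length + 1 < Y.word.length := by rw [he.length]; omega
  obtain ⟨l', m', x, y, hw, hl'⟩ := exists_split_word hk
  have hx : x = p.1.word.get i := by
    have h1 : Y.word[l.length]? = some x := by rw [hw, ← hl']; simp
    rw [he.word, hea, hX, word_mul, List.getElem?_append_left (by rw [ofC_word]; exact i.2), ofC_word,
      List.getElem?_eq_getElem i.2] at h1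
    exact (Option.some.inj h1).symm
  have hy : y = q.1.word.get j := by
    have h1 : Y.word[l.length + 1]? = some y := by
      rw [hw, ← hl', List.getElem?_append_right (by omega)]; simp
    rw [he.word, heb, hX, word_mul, List.getElem?_append_right (by rw [ofC_word]; omega), ofC_word,
      ofC_word, Nat.add_sub_cancel_left, List.getElem?_eq_getElem j.2] at h1
    exact (Option.some.inj h1).symm
  have hY' : Arranged X (l ++ (p.1.word.length + j) :: (i : ℕ) :: m) (Y.interchange l' m' x y hw) := by
    refine ⟨_, he.trans (rearrBy_interchange Y l' m' x y hw), ?_⟩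
    rw [hl']
    apply List.ext_getElem?
    intro k
    rw [getElem?_exchange l m, ← hM]
    simp only [List.getElem?_map]
    by_cases hkX : k < X.word.length
    · have : Equiv.swap l.length (l.length + 1) k < X.word.length := by
        rw [Equiv.swap_apply_def]; split_ifs <;> omega
      rw [List.getElem?_range hkX, List.getElem?_range this]
      rfl
    · rw [Equiv.swap_apply_of_ne_of_ne (by omega) (by omega),
        List.getElem?_eq_none (by simpa using hkX)]
      rfl
  rw [hY.arrClass_eq, hY'.arrClass_eq]
  by_cases hxy : y = rev x
  -- In every arrangement the cycles of `p` and `q` are separate, so this exchange is a join, with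
  -- coefficient `α`.
  · have hc : ¬ Y.next.SameCycle l'.length (l'.length + 1) := by
      rw [hl', he.sameCycle, hea, heb, hX, sameCycle_mul_left _ _ i.2]
      intro h
      have h2 : (ofC p).next (p.1.word.length + j) = p.1.word.length + j := (ofC p).next_fix _ (by rw [ofC_word]; omega)
      have h3 := (Equiv.Perm.SameCycle.apply_eq_self_iff h).2 h2
      have h4 : (i : ℕ) = p.1.word.length + j := by
        obtain ⟨n, hn⟩ := h
        rw [← hn, Equiv.Perm.zpow_apply_eq_self_of_apply_eq_self h3]
      omega
    subst hxy
    obtain ⟨c, hc1, hc2⟩ := exists_joined_path (K := K) p q i j (by rw [← hx, ← hy])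
    have hmon : (Y.contract l' m' x hw).mon K = MvPolynomial.X (cycClass c) := by
      rw [he.mon_contract, hl', hea, heb]
      have hv : X.verts = 0 := by
        rw [hX, verts_mul]
        have h1 : (ofC p).verts = 0 := if_neg (List.ne_nil_of_length_pos i.pos)
        have h2 : (ofC q).verts = 0 := if_neg (List.ne_nil_of_length_pos j.pos)
        rw [h1, h2]; rfl
      have hL := isCycleList_join p q i.2 j.2
      have hLs : ((List.range p.1.word.length).map (fun k => (i + 1 + k) % p.1.word.length) ++
        (List.range q.1.word.length).map (fun k => p.1.word.length + (j + 1 + k) % q.1.word.length)).toFinset =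
          Finset.range X.word.length := by
        apply Finset.eq_of_subset_of_card_le
        · intro a ha
          rw [List.mem_toFinset, List.mem_append, List.mem_map, List.mem_map] at ha
          rw [Finset.mem_range, hXlen]
          rcases ha with ⟨b, -, rfl⟩ | ⟨b, -, rfl⟩
          · have := Nat.mod_lt (i + 1 + b) i.pos
            omega
          · have := Nat.mod_lt (j + 1 + b) j.pos
            omega
        · rw [List.toFinset_card_of_nodup hL.nodup, Finset.card_range, hXlen]
          simp
      rw [hv, vertProd, Multiset.map_zero, Multiset.prod_zero, one_mul, ← hLs,
        hL.cycProd_eq _ (by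
          intro h0
          have h1 := congrArg List.length h0
          rw [List.length_append, List.length_map, List.length_range, List.length_nil] at h1
          have h2 := i.pos
          omega), ← hc2]
      change Q.cycLin K _ = _
      rw [List.map_append, List.prod_append, List.map_map, List.map_map]
      have e1 := map_rotate (K := K) p.1.word i.2
        (lab (Q.posArr K X.word) (Q.posIdem K X.word) {(i : ℕ), p.1.word.length + j})
        (PathAlg.e Q K (Q.ltgt (p.1.word.get i))) (fun k hk hki => by
          rw [lab, if_neg (by simp; omega)]
          refine posArr_eq K ?_
          rw [hX, word_mul, List.getElem?_append_left (by rw [ofC_word]; exact hk)]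
          exact List.getElem?_eq_getElem hk) (by
          rw [lab, if_pos (by simp)]
          refine posIdem_eq K ?_
          rw [hX, word_mul, List.getElem?_append_left (by rw [ofC_word]; exact i.2)]
          exact List.getElem?_eq_getElem i.2)
      have e2 := map_rotate (K := K) q.1.word j.2
        (fun k => lab (Q.posArr K X.word) (Q.posIdem K X.word) {(i : ℕ), p.1.word.length + j} (p.1.word.length + k))
        (PathAlg.e Q K (Q.ltgt (q.1.word.get j))) (fun k hk hki => by
          rw [lab, if_neg (by simp; omega)]
          refine posArr_eq K ?_
          rw [hX, word_mul, List.getElem?_append_right (by rw [ofC_word]; omega), ofC_word, ofC_word,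
            Nat.add_sub_cancel_left]
          exact List.getElem?_eq_getElem hk) (by
          rw [lab, if_pos (by simp)]
          refine posIdem_eq K ?_
          rw [hX, word_mul, List.getElem?_append_right (by rw [ofC_word]; omega), ofC_word, ofC_word,
            Nat.add_sub_cancel_left]
          exact List.getElem?_eq_getElem j.2)
      have e3 := congrArg List.prod e1
      have e4 := congrArg List.prod e2
      rw [List.prod_append, List.prod_singleton] at e3 e4
      rw [← e3, ← e4]
      rfl
    -- The contracted diagram is a single cyclic word, but its heights need not be in standard
    -- order; correcting them costs a multiple of `β`.
    obtain ⟨z, hz⟩ := nclass_sub_ofC_mem α β c hmon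
    rw [nclass_sub_interchange_rev, contrCoeff, if_neg hc, neckTerm, map_smul, hc1,
      hat_ofClosedPath, ← hx, ← hy]
    refine ⟨-((letterBracket x (rev x) : K[X]) • z), ?_⟩
    have hz' : β • z = nclass K α β (ofC c) - nclass K α β (Y.contract l' m' x hw) := hz
    have hzz : nclass K α β (Y.contract l' m' x hw) = nclass K α β (ofC c) - β • z := by
      rw [hz']; abel
    have hint : ((letterBracket x (rev x) : ℤ) : K) • nclass K α β (ofC c) =
        ((letterBracket x (rev x) : ℤ) : K[X]) • nclass K α β (ofC c) := by
      rw [Int.cast_smul_eq_zsmul, Int.cast_smul_eq_zsmul]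
    rw [hzz, hint]
    change (α * β) • -((letterBracket x (rev x) : K[X]) • z) = _
    module
  · rw [nclass_sub_interchange α β Y l' m' x y hw hxy, neckTerm, ← hx, ← hy,
      letterBracket_eq_zero hxy]
    simp

end Diagram

/-- Lifting the block of `p` over the block of `q` exchanges each arrow of `p` with each arrow of
`q` exactly once. Each exchange contributes `α` times the lift of one summand of the necklace
bracket, up to a multiple of `αβ`. -/
lemma hat_commutator_ofPath (α β : K[X]) (p q : Q.ClosedPath) :
    Q.hat K α β (PathAlg.ofPath Q K p.1) * Q.hat K α β (PathAlg.ofPath Q K q.1) -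
      Q.hat K α β (PathAlg.ofPath Q K q.1) * Q.hat K α β (PathAlg.ofPath Q K p.1) -
      α • Q.hat K α β (PathAlg.necklace K p.1 q.1) ∈
    LinearMap.range (LinearMap.lsmul K[X] (Q.N K α β) (α * β)) := by
  classical
  rw [hat_ofClosedPath, hat_ofClosedPath, ← nclass_mul, ← nclass_mul]
  set X := Diagram.ofC p * Diagram.ofC q with hX
  set r := p.1.word.length with hr
  set s := q.1.word.length with hs
  -- The corrections are indexed by heights in the product, where the arrows of `q` begin at height
  -- `r`.
  let T : ℕ → ℕ → Q.N K α β := fun a b => if h : a < r ∧ b - r < s then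
    α • Q.hat K α β (neckTerm K p.1 q.1 ⟨a, h.1⟩ ⟨b - r, h.2⟩) else 0
  have hXlen : X.word.length = r + s := by
    rw [hX, Diagram.word_mul, List.length_append]; rfl
  have key := exchange_blocks_mem (LinearMap.range (LinearMap.lsmul K[X] (Q.N K α β)
    (α * β))).toAddSubgroup (X.arrClass α β) T (List.range X.word.length) (List.range r)
    ((List.range s).map (r + ·)) (by
      intro l m a b ha hb hR
      rw [List.mem_range] at ha
      obtain ⟨j, hj, rfl⟩ := List.mem_map.1 hb
      rw [List.mem_range] at hj
      have hT : T a (r + j) = α • Q.hat K α β (neckTerm K p.1 q.1 ⟨a, ha⟩ ⟨j, hj⟩) := by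
        have h : a < r ∧ r + j - r < s := ⟨ha, by omega⟩
        simp only [T]
        rw [dif_pos h]
        congr 4
        omega
      rw [hT]
      exact Diagram.arrClass_exchange α β p q l m ⟨a, ha⟩ ⟨j, hj⟩ hR) [] [] (by
      rw [hXlen, List.range_add]; simp)
  have e1 : X.arrClass α β ([] ++ List.range r ++ (List.range s).map (r + ·) ++ []) =
      nclass K α β X := by
    have := X.arranged_refl.arrClass_eq (α := α) (β := β)
    rw [hXlen, List.range_add] at this
    simpa using this
  have e2 : X.arrClass α β ([] ++ (List.range s).map (r + ·) ++ List.range r ++ []) =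
      nclass K α β (Diagram.ofC q * Diagram.ofC p) := by
    have := (Diagram.arranged_mul_comm (Diagram.ofC p) (Diagram.ofC q)).arrClass_eq
      (α := α) (β := β)
    simp only [List.nil_append, List.append_nil]
    exact this
  rw [e1, e2] at key
  have hsum : ∀ (n : ℕ) (f : ℕ → Q.N K α β), ((List.range n).map f).sum = ∑ i : Fin n, f i :=
    fun n f => (Finset.sum_range f : ∑ i ∈ Finset.range n, f i = _)
  suffices h : α • Q.hat K α β (PathAlg.necklace K p.1 q.1) =
      ((List.range r).map fun a => (((List.range s).map (r + ·)).map (T a)).sum).sum by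
    rw [h]; exact key
  rw [hsum, PathAlg.necklace, map_sum, Finset.smul_sum]
  refine Finset.sum_congr rfl fun i _ => ?_
  rw [List.map_map, hsum, map_sum, Finset.smul_sum]
  refine Finset.sum_congr rfl fun j _ => ?_
  have h : (i : ℕ) < r ∧ r + (j : ℕ) - r < s := ⟨i.2, by have := j.2; omega⟩
  simp only [T, Function.comp_apply]
  rw [dif_pos h]
  change α • Q.hat K α β (neckTerm K p.1 q.1 i j) = _
  congr 3
  ext
  simp

end QuiverData

namespace QuiverData

variable {V : Type u} {E : Type v} {Q : QuiverData V E} {K : Type w} [Field K] [Fintype V]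

/-! ### Derivations of the path algebra -/

namespace PathAlg

lemma induction {P : Q.PathAlg K → Prop} (h0 : P 0) (hadd : ∀ x y, P x → P y → P (x + y))
    (hsmul : ∀ (c : K) x, P x → P (c • x)) (hpath : ∀ p, P (ofPath Q K p)) (x : Q.PathAlg K) :
    P x := by
  induction x using Finsupp.induction_linear with
  | zero => exact h0
  | add f g hf hg => exact hadd f g hf hg
  | single p c =>
    have : (Finsupp.single p c : Q.DPath →₀ K) = c • (Finsupp.single p (1 : K)) := by
      rw [Finsupp.smul_single, smul_eq_mul, mul_one]
    exact this ▸ hsmul c _ (hpath p)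

lemma ofPath_mul_e (p : Q.DPath) : ofPath Q K p * e Q K p.src = ofPath Q K p := by
  refine (ofPath_mul K p (DPath.triv Q p.src) rfl).trans ?_
  congr 1
  exact DPath.ext rfl (List.append_nil _)

lemma wordElem_append (i : V) (l m : List (Letter E)) :
    wordElem Q K i (l ++ m) = wordElem Q K i l * (m.map (arr Q K)).prod := by
  simp only [wordElem, List.map_append, List.prod_append, mul_assoc]

lemma wordElem_eq_prod {i : V} {l : List (Letter E)} (h : Q.IsChain i l) (hl : l ≠ []) :
    wordElem Q K i l = (l.map (arr Q K)).prod :=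
  (wordElem_eq_ofPath K i l h).trans (prod_map_arr K ⟨i, l, h⟩ hl).symm

/-- The values on words of the derivation with given values on arrows. -/
def wordDer (h : Letter E → Q.PathAlg K) : List (Letter E) → Q.PathAlg K
  | [] => 0
  | x :: l => h x * (l.map (arr Q K)).prod + arr Q K x * wordDer h l

lemma wordDer_append (h : Letter E → Q.PathAlg K) (l m : List (Letter E)) :
    wordDer h (l ++ m) = wordDer h l * (m.map (arr Q K)).prod +
      (l.map (arr Q K)).prod * wordDer h m := by
  induction l with
  | nil => simp [wordDer]
  | cons x l ih =>
    simp only [List.cons_append, wordDer, ih, List.map_append, List.prod_append, List.map_cons,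
      List.prod_cons]
    noncomm_ring

lemma wordDer_eq_sum (h : Letter E → Q.PathAlg K) (l : List (Letter E)) :
    wordDer h l = ∑ j : Fin l.length, ((l.take j).map (arr Q K)).prod * h (l.get j) *
      ((l.drop (j + 1)).map (arr Q K)).prod := by
  induction l with
  | nil => simp [wordDer]
  | cons x l ih =>
    change _ = ∑ j : Fin (l.length + 1), _
    rw [wordDer, ih, Fin.sum_univ_succ, Finset.mul_sum]
    simp [mul_assoc]

variable (Q K) in
/-- The values on arrows of a derivation are compatible with the idempotents. -/
structure IsBimodular (h : Letter E → Q.PathAlg K) : Prop where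
  left : ∀ x, e Q K (Q.ltgt x) * h x = h x
  right : ∀ x, h x * e Q K (Q.lsrc x) = h x

variable {h : Letter E → Q.PathAlg K}

lemma IsBimodular.e_mul_wordDer (hh : IsBimodular Q K h) (p : Q.DPath) :
    e Q K p.tgt * wordDer h p.word = wordDer h p.word := by
  obtain ⟨i, l, hl⟩ := p
  cases l with
  | nil => simp [wordDer]
  | cons x l =>
    obtain ⟨rfl, -⟩ := hl
    simp only [wordDer, mul_add, ← mul_assoc, hh.left, e_mul_arr]

lemma IsBimodular.wordDer_mul_e (hh : IsBimodular Q K h) (p : Q.DPath) :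
    wordDer h p.word * e Q K p.src = wordDer h p.word := by
  obtain ⟨i, l, hl⟩ := p
  induction l generalizing i with
  | nil => simp [wordDer]
  | cons x l ih =>
    obtain ⟨rfl, h2⟩ := hl
    have ih' := ih (Q.lsrc x) h2
    have hs : (⟨Q.ltgt x, x :: l, rfl, h2⟩ : Q.DPath).src = (⟨Q.lsrc x, l, h2⟩ : Q.DPath).src := rfl
    have h3 : h x * (l.map (arr Q K)).prod = h x * ofPath Q K ⟨Q.lsrc x, l, h2⟩ := by
      rw [← wordElem_eq_ofPath, wordElem, ← mul_assoc, hh.right]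
    simp only [wordDer, add_mul, hs, h3, mul_assoc, ofPath_mul_e]
    rw [ih']

/-- The derivation of the path algebra with given values on arrows. -/
def pathDer (h : Letter E → Q.PathAlg K) : Q.PathAlg K →ₗ[K] Q.PathAlg K :=
  extend Q K fun p => wordDer h p.word

lemma pathDer_ofPath (h : Letter E → Q.PathAlg K) (p : Q.DPath) :
    pathDer h (ofPath Q K p) = wordDer h p.word := extend_ofPath _ _

/-- The idempotent on the right repairs the empty word, whose product of arrows is the unit and not
a trivial path. -/
lemma prod_mul_e (p : Q.DPath) : (p.word.map (arr Q K)).prod * e Q K p.src = ofPath Q K p := by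
  by_cases hp : p.word = []
  · have hs : p.src = p.tgt := by rw [DPath.src, hp]; rfl
    rw [hp, List.map_nil, List.prod_nil, one_mul, hs, e]
    congr 1
    exact DPath.ext rfl hp.symm
  · rw [prod_map_arr K p hp, ofPath_mul_e]

/-- On composable paths this is the Leibniz rule for words. On paths that are not composable both
terms on the right vanish, because compatibility with the idempotents makes idempotents of different
vertices meet. -/
lemma IsBimodular.pathDer_mul (hh : IsBimodular Q K h) (x y : Q.PathAlg K) :
    pathDer h (x * y) = pathDer h x * y + x * pathDer h y := by
  induction x using induction with
  | h0 => simp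
  | hadd a b ha hb => simp only [add_mul, map_add, ha, hb]; abel
  | hsmul c a ha => simp only [smul_mul_assoc, map_smul, ha, smul_add]
  | hpath p =>
    induction y using induction with
    | h0 => simp
    | hadd a b ha hb => simp only [mul_add, map_add, ha, hb]; abel
    | hsmul c a ha => simp only [mul_smul_comm, map_smul, ha, smul_add]
    | hpath q =>
      by_cases hpq : p.src = q.tgt
      · rw [ofPath_mul K p q hpq, pathDer_ofPath, pathDer_ofPath, pathDer_ofPath]
        change wordDer h (p.word ++ q.word) = _
        rw [wordDer_append]
        congr 1
        · rw [← wordElem_eq_ofPath K q.tgt q.word q.chain, wordElem, ← hpq, ← mul_assoc,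
            hh.wordDer_mul_e]
        · rw [← hh.e_mul_wordDer q, ← mul_assoc, ← hpq, prod_mul_e, hpq, hh.e_mul_wordDer]
      · rw [ofPath_mul_eq_zero K p q hpq, pathDer_ofPath, pathDer_ofPath, map_zero,
          ← hh.wordDer_mul_e p, ← hh.e_mul_wordDer q, mul_assoc, ← e_mul_ofPath K q,
          ← mul_assoc (e Q K p.src), e_mul_e_of_ne K hpq, ← mul_assoc (ofPath Q K p),
          ← ofPath_mul_e p, mul_assoc (ofPath Q K p), e_mul_e_of_ne K hpq]
        simp

lemma pathDer_arr (x : Letter E) : pathDer h (arr Q K x) = h x := by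
  rw [arr, pathDer_ofPath]
  simp [DPath.arrow, wordDer]

end PathAlg

/-! ### Classes modulo commutators -/

lemma cl_surjective : Function.Surjective (Q.cl K) := Submodule.mkQ_surjective _

lemma cl_mul_comm (x y : Q.PathAlg K) : Q.cl K (x * y) = Q.cl K (y * x) := by
  rw [← sub_eq_zero, ← map_sub]
  exact (Submodule.Quotient.mk_eq_zero _).2 (Submodule.subset_span ⟨(x, y), rfl⟩)

lemma cl_eq_zero_iff (x : Q.PathAlg K) : Q.cl K x = 0 ↔ x ∈ commutatorSpan K (Q.PathAlg K) :=
  Submodule.Quotient.mk_eq_zero _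

lemma cl_eq_zero_of_bimodular {x : Q.PathAlg K} {i j : V} (hij : i ≠ j)
    (hi : PathAlg.e Q K i * x = x) (hj : x * PathAlg.e Q K j = x) : Q.cl K x = 0 := by
  rw [← hj, cl_mul_comm, ← hi, ← mul_assoc, PathAlg.e_mul_e_of_ne K hij.symm, zero_mul, map_zero]

lemma cl_ofPath_of_not_isClosed {p : Q.DPath} (hp : ¬ p.IsClosed) :
    Q.cl K (PathAlg.ofPath Q K p) = 0 :=
  cl_eq_zero_of_bimodular (i := p.tgt) (j := p.src) (fun h => hp h.symm) (PathAlg.e_mul_ofPath K p)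
    (PathAlg.ofPath_mul_e p)

lemma cl_ofPath_eq_of_class_eq {p q : Q.ClosedPath} (h : cycClass p = cycClass q) :
    Q.cl K (PathAlg.ofPath Q K p.1) = Q.cl K (PathAlg.ofPath Q K q.1) := by
  have h2 := Quot.eqvGen_exact h
  clear h
  induction h2 with
  | rel p q hr =>
    obtain ⟨u, v, h, h', hp, hq⟩ := hr
    rw [hp, hq, ← PathAlg.ofPath_mul, ← PathAlg.ofPath_mul, cl_mul_comm]
  | refl p => rfl
  | symm p q _ ih => exact ih.symm
  | trans p q r _ _ ih1 ih2 => exact ih1.trans ih2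

variable (K) in
/-- The class modulo commutators of a closed path up to rotation. -/
def cycCl (c : Q.CycPath) : Nat0 K (Q.PathAlg K) := Q.cl K (PathAlg.ofPath Q K c.rep.1)

lemma span_cycCl : Submodule.span K (Set.range (cycCl (Q := Q) K)) = ⊤ := by
  rw [eq_top_iff]
  rintro x -
  obtain ⟨x, rfl⟩ := cl_surjective x
  induction x using PathAlg.induction with
  | h0 => rw [map_zero]; exact zero_mem _
  | hadd a b ha hb => rw [map_add]; exact add_mem ha hb
  | hsmul c a ha => rw [map_smul]; exact Submodule.smul_mem _ _ ha
  | hpath p =>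
    by_cases hp : p.IsClosed
    · refine Submodule.subset_span ⟨cycClass ⟨p, hp⟩, ?_⟩
      exact cl_ofPath_eq_of_class_eq (q := ⟨p, hp⟩) (CycPath.mk_rep _)
    · rw [cl_ofPath_of_not_isClosed hp]
      exact zero_mem _

section MomentCl

variable [Fintype E]

variable (Q K) in
/-- The classes of the elements of `K Q̄ w`. -/
def momentCl : Submodule K (Nat0 K (Q.PathAlg K)) :=
  LinearMap.range ((Q.cl K).comp (LinearMap.mulRight K (PathAlg.moment Q K)))

lemma cl_mul_moment_mem (y : Q.PathAlg K) :
    Q.cl K (y * PathAlg.moment Q K) ∈ Q.momentCl K := ⟨y, rfl⟩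

end MomentCl

/-! ### The necklace bracket and Hamiltonian derivations -/

section Necklace

variable [DecidableEq E]

open Classical in
variable (Q K) in
/-- The bilinear extension of the necklace bracket of closed paths. -/
def neckLin : Q.PathAlg K →ₗ[K] Q.PathAlg K →ₗ[K] Q.PathAlg K :=
  PathAlg.extend Q K fun p => PathAlg.extend Q K fun q =>
    if p.IsClosed ∧ q.IsClosed then PathAlg.necklace K p q else 0

open Classical in
lemma neckLin_ofPath (p q : Q.DPath) :
    Q.neckLin K (PathAlg.ofPath Q K p) (PathAlg.ofPath Q K q) =
      if p.IsClosed ∧ q.IsClosed then PathAlg.necklace K p q else 0 := by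
  rw [neckLin, PathAlg.extend_ofPath, PathAlg.extend_ofPath]

variable (K) in
/-- The values on arrows of the Hamiltonian derivation given by a closed path. -/
def hamArr (q : Q.ClosedPath) (x : Letter E) : Q.PathAlg K :=
  ∑ i : Fin q.1.word.length, (letterBracket (q.1.word.get i) x : K) •
    PathAlg.wordElem Q K (Q.lsrc (q.1.word.get i)) (q.1.word.drop (i + 1) ++ q.1.word.take i)

lemma closedPath_rotate (q : Q.ClosedPath) (i : Fin q.1.word.length) :
    Q.IsChain (Q.lsrc (q.1.word.get i)) (q.1.word.drop (i + 1) ++ q.1.word.take i) ∧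
    Q.endVertex (Q.lsrc (q.1.word.get i)) (q.1.word.drop (i + 1) ++ q.1.word.take i) =
      Q.ltgt (q.1.word.get i) := by
  have hsplit : q.1.word = q.1.word.take i ++ q.1.word.get i :: q.1.word.drop (i + 1) := by
    rw [List.get_eq_getElem, List.getElem_cons_drop, List.take_append_drop]
  have h1 := q.1.chain
  have h2 : Q.endVertex q.1.tgt q.1.word = q.1.tgt := q.2
  rw [hsplit] at h1 h2
  exact chain_rotate h1 h2

lemma isBimodular_hamArr (q : Q.ClosedPath) : PathAlg.IsBimodular Q K (hamArr K q) := by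
  constructor
  · intro x
    rw [hamArr, Finset.mul_sum]
    refine Finset.sum_congr rfl fun i _ => ?_
    by_cases hx : x = rev (q.1.word.get i)
    · rw [mul_smul_comm, hx, ltgt_rev, PathAlg.wordElem, ← mul_assoc, PathAlg.e_mul_e]
    · rw [letterBracket_eq_zero hx, Int.cast_zero, zero_smul]; simp only [mul_zero]
  · intro x
    rw [hamArr, Finset.sum_mul]
    refine Finset.sum_congr rfl fun i _ => ?_
    by_cases hx : x = rev (q.1.word.get i)
    · obtain ⟨h1, h2⟩ := closedPath_rotate q i
      rw [smul_mul_assoc, hx, lsrc_rev, PathAlg.wordElem_eq_ofPath K _ _ h1]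
      congr 1
      have := PathAlg.ofPath_mul_e (K := K) ⟨_, _, h1⟩
      rwa [show (⟨_, _, h1⟩ : Q.DPath).src = Q.ltgt (q.1.word.get i) from h2] at this
    · rw [letterBracket_eq_zero hx, Int.cast_zero, zero_smul]; simp only [zero_mul]

/-- Modulo commutators, the letters around the `j`-th letter of a path can be rotated behind it. The
summands with that `j` thus amount to replacing the letter by its value under a derivation, so
bracketing with a closed path is a derivation of the path algebra followed by passage to classes. -/
lemma cl_neckLin_left (q : Q.ClosedPath) (x : Q.PathAlg K) :
    Q.cl K (Q.neckLin K (PathAlg.ofPath Q K q.1) x) = Q.cl K (PathAlg.pathDer (hamArr K q) x) := by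
  induction x using PathAlg.induction with
  | h0 => simp
  | hadd a b ha hb => simp only [map_add, ha, hb]
  | hsmul c a ha => simp only [map_smul, ha]
  | hpath p =>
    rw [neckLin_ofPath, PathAlg.pathDer_ofPath]
    by_cases hp : p.IsClosed
    · rw [if_pos ⟨q.2, hp⟩, PathAlg.wordDer_eq_sum, PathAlg.necklace, Finset.sum_comm, map_sum,
        map_sum]
      refine Finset.sum_congr rfl fun j _ => ?_
      rw [mul_assoc, cl_mul_comm, hamArr, Finset.sum_mul, Finset.sum_mul]
      congr 1
      refine Finset.sum_congr rfl fun i _ => ?_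
      rw [smul_mul_assoc, smul_mul_assoc, PathAlg.wordElem_append, List.map_append,
        List.prod_append, mul_assoc]
    · rw [if_neg fun h => hp h.2, map_zero]
      exact (cl_eq_zero_of_bimodular (fun h => hp h.symm)
        ((isBimodular_hamArr q).e_mul_wordDer p) ((isBimodular_hamArr q).wordDer_mul_e p)).symm

variable [Fintype E]

/-- The `i`-th letter of `q` contributes the rotation of `q` that begins with this letter minus the
rotation that ends with it, that is `ρ i - ρ (i + 1)`. The sum telescopes, and its two ends are both
the product along the whole word of `q`. -/
lemma pathDer_hamArr_moment (q : Q.ClosedPath) :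
    PathAlg.pathDer (hamArr K q) (PathAlg.moment Q K) = 0 := by
  have hb := isBimodular_hamArr (K := K) q
  let ρ : ℕ → Q.PathAlg K := fun k =>
    ((q.1.word.drop k ++ q.1.word.take k).map (PathAlg.arr Q K)).prod
  have hR : ∀ i : Fin q.1.word.length,
      PathAlg.arr Q K (q.1.word.get i) * PathAlg.wordElem Q K (Q.lsrc (q.1.word.get i))
        (q.1.word.drop (i + 1) ++ q.1.word.take i) = ρ i ∧
      PathAlg.wordElem Q K (Q.lsrc (q.1.word.get i))
        (q.1.word.drop (i + 1) ++ q.1.word.take i) * PathAlg.arr Q K (q.1.word.get i) =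
        ρ (i + 1) := by
    intro i
    obtain ⟨h1, h2⟩ := closedPath_rotate q i
    constructor
    · rw [← PathAlg.wordElem_cons K _ rfl, PathAlg.wordElem_eq_prod (show Q.IsChain _ (_ :: _) from ⟨rfl, h1⟩)
        (List.cons_ne_nil _ _),
        ← List.cons_append, List.get_eq_getElem, List.getElem_cons_drop]
    · have h3 : PathAlg.wordElem Q K (Q.lsrc (q.1.word.get i))
          (q.1.word.drop (i + 1) ++ q.1.word.take i) * PathAlg.arr Q K (q.1.word.get i) =
          PathAlg.wordElem Q K (Q.lsrc (q.1.word.get i))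
          ((q.1.word.drop (i + 1) ++ q.1.word.take i) ++ [q.1.word.get i]) := by
        rw [PathAlg.wordElem_append _ (q.1.word.drop (i + 1) ++ q.1.word.take i), List.map_singleton,
          List.prod_singleton]
      rw [h3, PathAlg.wordElem_eq_prod ((Q.isChain_append _ _ _).2
        ⟨h1, show Q.IsChain _ [q.1.word.get i] from ⟨h2.symm, trivial⟩⟩)
        (List.append_ne_nil_of_right_ne_nil _ (List.cons_ne_nil _ _)),
        List.append_assoc, List.get_eq_getElem, List.take_concat_get']
  have key : PathAlg.pathDer (hamArr K q) (PathAlg.moment Q K) =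
      ∑ i : Fin q.1.word.length, (ρ i - ρ (i + 1)) := by
    have h1 : ∀ x, hamArr K q x = ∑ i : Fin q.1.word.length,
      (letterBracket (q.1.word.get i) x : K) • PathAlg.wordElem Q K (Q.lsrc (q.1.word.get i))
        (q.1.word.drop (i + 1) ++ q.1.word.take i) := fun x => rfl
    simp only [PathAlg.moment, map_sum, map_sub, hb.pathDer_mul, PathAlg.pathDer_arr, h1,
      Finset.sum_mul, Finset.mul_sum]
    simp only [← Finset.sum_add_distrib, ← Finset.sum_sub_distrib]
    rw [Finset.sum_comm]
    refine Finset.sum_congr rfl fun i _ => ?_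
    rw [← (hR i).1, ← (hR i).2]
    -- In the sum over the arrows `a` only the arrow underlying the `i`-th letter has a nonzero
    -- bracket with it.
    generalize PathAlg.wordElem Q K _ _ = R
    cases q.1.word.get i with
    | inl b =>
      rw [Finset.sum_eq_single b]
      · simp [letterBracket]
      · intro a _ hab
        simp [letterBracket, hab.symm]
      · simp
    | inr b =>
      rw [Finset.sum_eq_single b]
      · simp [letterBracket]; abel
      · intro a _ hab
        simp [letterBracket, hab.symm]
      · simp
  rw [key, ← Finset.sum_range (fun k => ρ k - ρ (k + 1)), Finset.sum_range_sub']
  simp only [ρ, List.drop_zero, List.take_zero, List.append_nil, List.drop_length,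
    List.take_length, List.nil_append, sub_self]

/-- A derivation that kills `w` sends `y w` to a multiple of `w` on the left, so the classes of `K
Q̄ w` form an ideal for the bracket. -/
lemma cl_neckLin_moment_mem (x y : Q.PathAlg K) :
    Q.cl K (Q.neckLin K x (y * PathAlg.moment Q K)) ∈ Q.momentCl K := by
  induction x using PathAlg.induction with
  | h0 => rw [map_zero, LinearMap.zero_apply, map_zero]; exact zero_mem _
  | hadd a b ha hb => rw [map_add, LinearMap.add_apply, map_add]; exact add_mem ha hb
  | hsmul c a ha =>
    rw [map_smul, LinearMap.smul_apply, map_smul]; exact Submodule.smul_mem _ _ ha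
  | hpath p =>
    by_cases hp : p.IsClosed
    · rw [cl_neckLin_left ⟨p, hp⟩, (isBimodular_hamArr _).pathDer_mul, pathDer_hamArr_moment,
        mul_zero, add_zero]
      exact cl_mul_moment_mem _
    · have : Q.neckLin K (PathAlg.ofPath Q K p) = 0 := by
        refine PathAlg.hom_ext fun q => ?_
        rw [neckLin_ofPath, if_neg fun h => hp h.1]
        rfl
      rw [this, LinearMap.zero_apply, map_zero]
      exact zero_mem _

end Necklace

/-! ### The kernel of the projection `pr` -/

section Kernel

variable [Fintype E]

lemma pr_surjective : Function.Surjective (Q.pr K) := by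
  intro y
  obtain ⟨y, rfl⟩ := Submodule.mkQ_surjective _ y
  obtain ⟨x, rfl⟩ := QuotBy.mk_surjective K _ y
  exact ⟨Q.cl K x, rfl⟩

lemma pr_cl_mul_moment (y : Q.PathAlg K) : Q.pr K (Q.cl K (y * PathAlg.moment Q K)) = 0 := by
  change Submodule.Quotient.mk (QuotBy.mk K _ (y * PathAlg.moment Q K)) = _
  rw [map_mul, QuotBy.mk_eq_zero K _ (Set.mem_singleton _), mul_zero]
  rfl

/-- Cyclically, `a w b` is the same as `b a w`, so the two-sided ideal has no more classes than `K
Q̄ w`. -/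
lemma cl_mem_momentCl_of_mem_span {x : Q.PathAlg K}
    (hx : x ∈ TwoSidedIdeal.span ({PathAlg.moment Q K} : Set (Q.PathAlg K))) :
    Q.cl K x ∈ Q.momentCl K := by
  let J : TwoSidedIdeal (Q.PathAlg K) := TwoSidedIdeal.mk'
    {x | ∀ a b, Q.cl K (a * x * b) ∈ Q.momentCl K}
    (fun a b => by rw [mul_zero, zero_mul, map_zero]; exact zero_mem _)
    (fun hx hy a b => by
      rw [mul_add, add_mul, map_add]; exact add_mem (hx a b) (hy a b))
    (fun hx a b => by rw [mul_neg, neg_mul, map_neg]; exact neg_mem (hx a b))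
    (fun {x y} hy a b => by rw [← mul_assoc a x y]; exact hy (a * x) b)
    (fun {x y} hx a b => by rw [← mul_assoc a x y, mul_assoc (a * x) y b]; exact hx a (y * b))
  have hle : TwoSidedIdeal.span ({PathAlg.moment Q K} : Set (Q.PathAlg K)) ≤ J := by
    rw [TwoSidedIdeal.span_le]
    rintro _ rfl
    rw [SetLike.mem_coe, TwoSidedIdeal.mem_mk']
    intro a b
    rw [cl_mul_comm, ← mul_assoc]
    exact cl_mul_moment_mem _
  have h := hle hx
  rw [TwoSidedIdeal.mem_mk'] at h
  simpa using h 1 1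

/-- Commutators in the quotient lift to commutators, so an element that dies in `(Π Q)_♮` is a
commutator plus an element of the ideal of `w`. -/
lemma pr_eq_zero_iff (x : Nat0 K (Q.PathAlg K)) : Q.pr K x = 0 ↔ x ∈ Q.momentCl K := by
  constructor
  · intro hx
    obtain ⟨x, rfl⟩ := cl_surjective x
    have h1 : QuotBy.mk K ({PathAlg.moment Q K} : Set (Q.PathAlg K)) x ∈
        commutatorSpan K (Q.Preproj K) := (Submodule.Quotient.mk_eq_zero _).1 hx
    have h2 : commutatorSpan K (Q.Preproj K) ≤ (commutatorSpan K (Q.PathAlg K)).map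
        (QuotBy.mk K ({PathAlg.moment Q K} : Set (Q.PathAlg K))).toLinearMap := by
      rw [commutatorSpan, Submodule.span_le]
      rintro _ ⟨⟨a, b⟩, rfl⟩
      obtain ⟨a, rfl⟩ := QuotBy.mk_surjective K _ a
      obtain ⟨b, rfl⟩ := QuotBy.mk_surjective K _ b
      refine ⟨a * b - b * a, Submodule.subset_span ⟨(a, b), rfl⟩, ?_⟩
      simp
    obtain ⟨c, hc, hcx⟩ := h2 h1
    have h3 : QuotBy.mk K ({PathAlg.moment Q K} : Set (Q.PathAlg K)) (x - c) = 0 := by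
      rw [map_sub, sub_eq_zero]; exact hcx.symm
    have h4 := cl_mem_momentCl_of_mem_span ((QuotBy.mk_eq_zero_iff K _ _).1 h3)
    rwa [map_sub, (cl_eq_zero_iff c).2 hc, sub_zero] at h4
  · rintro ⟨y, rfl⟩
    exact pr_cl_mul_moment y

end Kernel

end QuiverData

/-! ### Reduction modulo the formal parameter -/

section ModHbar

variable {K : Type w} [Field K] {A : Type*} [Ring A] [Algebra K[X] A]

/-- `ħ` is central, so its multiples already form a two-sided ideal. -/
lemma toModHbar_eq_zero_iff (x : A) : toModHbar K A x = 0 ↔ ∃ y, x = hbar K • y := by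
  rw [QuotBy.mk_eq_zero_iff]
  constructor
  · intro hx
    let J : TwoSidedIdeal A := TwoSidedIdeal.mk' {x | ∃ y, x = hbar K • y} ⟨0, by simp⟩
      (by rintro _ _ ⟨a, rfl⟩ ⟨b, rfl⟩; exact ⟨a + b, by rw [smul_add]⟩)
      (by rintro _ ⟨a, rfl⟩; exact ⟨-a, by rw [smul_neg]⟩)
      (by rintro x _ ⟨a, rfl⟩; exact ⟨x * a, by rw [mul_smul_comm]⟩)
      (by rintro _ y ⟨a, rfl⟩; exact ⟨a * y, by rw [smul_mul_assoc]⟩)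
    have hle : TwoSidedIdeal.span ({algebraMap K[X] A (hbar K)} : Set A) ≤ J := by
      rw [TwoSidedIdeal.span_le]
      rintro _ rfl
      rw [SetLike.mem_coe, TwoSidedIdeal.mem_mk']
      exact ⟨1, Algebra.algebraMap_eq_smul_one _⟩
    have h := hle hx
    rwa [TwoSidedIdeal.mem_mk'] at h
  · rintro ⟨y, rfl⟩
    rw [Algebra.smul_def]
    exact TwoSidedIdeal.mul_mem_right _ _ _ (TwoSidedIdeal.subset_span (Set.mem_singleton _))

lemma toModHbar_hbar_smul (x : A) : toModHbar K A (hbar K • x) = 0 :=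
  (toModHbar_eq_zero_iff _).2 ⟨x, rfl⟩

lemma toModHbar_smul_of_dvd {p : K[X]} (hp : hbar K ∣ p) (x : A) : toModHbar K A (p • x) = 0 := by
  obtain ⟨q, rfl⟩ := hp
  rw [mul_smul, toModHbar_hbar_smul]

lemma toModHbar_smul (p : K[X]) (x : A) :
    toModHbar K A (p • x) = toModHbar K A (C (p.coeff 0) • x) := by
  conv_lhs => rw [← Polynomial.X_mul_divX_add p, add_smul, map_add,
    toModHbar_smul_of_dvd (dvd_mul_right _ _), zero_add]

variable [Algebra K A] [IsScalarTower K K[X] A]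

lemma toModHbar_C_smul (c : K) (x : A) :
    toModHbar K A (C c • x) = c • toModHbar K A x := by
  have : (C c : K[X]) • x = c • x := by
    rw [← Polynomial.algebraMap_eq, algebraMap_smul]
  rw [this]
  exact map_smul (QuotBy.mk K ({algebraMap K[X] A (hbar K)} : Set A)) c x

variable {I : Type*} (b : Module.Basis I K[X] A)

/-- A relation over `K` lifts to a combination with constant coefficients that is a multiple of `ħ`;
comparing constant terms of its coordinates makes the coefficients vanish. -/
lemma linearIndependent_toModHbar : LinearIndependent K fun i => toModHbar K A (b i) := by
  classical
  rw [linearIndependent_iff]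
  intro c hc
  have h1 : toModHbar K A (c.sum fun i a => C a • b i) = 0 := by
    rw [Finsupp.linearCombination_apply] at hc
    rw [Finsupp.sum, map_sum, ← hc, Finsupp.sum]
    exact Finset.sum_congr rfl fun i _ => toModHbar_C_smul _ _
  obtain ⟨y, hy⟩ := (toModHbar_eq_zero_iff _).1 h1
  ext i
  have h2 := congrArg (fun z => (b.repr z i).coeff 0) hy
  simp only [Finsupp.sum, map_sum, map_smul, Module.Basis.repr_self, Finsupp.smul_single,
    smul_eq_mul, mul_one, Finsupp.smul_apply, Polynomial.coeff_X_mul_zero,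
    Finsupp.finsetSum_apply] at h2
  rw [Finset.sum_eq_single i] at h2
  · simpa using h2
  · intro j _ hj
    simp [hj]
  · intro hi
    simp [Finsupp.notMem_support_iff.1 hi]

lemma span_toModHbar : Submodule.span K (Set.range fun i => toModHbar K A (b i)) = ⊤ := by
  rw [eq_top_iff]
  rintro x -
  obtain ⟨x, rfl⟩ := QuotBy.mk_surjective K[X] _ x
  rw [← b.linearCombination_repr x, Finsupp.linearCombination_apply, Finsupp.sum, map_sum]
  refine Submodule.sum_mem _ fun i _ => ?_
  rw [toModHbar_smul, toModHbar_C_smul]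
  exact Submodule.smul_mem _ _ (Submodule.subset_span ⟨i, rfl⟩)

end ModHbar

/-! ### Ordered monomials in algebras with quadratic-linear relations -/

section Ordered

variable {K : Type*} [Field K] {A : Type*} [Ring A] [Algebra K A] {I : Type*} (u : I → A)

/-- If the commutators of generators are linear combinations of generators, then the ordered
monomials in the generators span the algebra. -/
lemma span_ordered_monomials (hgen : Algebra.adjoin K (Set.range u) = ⊤)
    (hcomm : ∀ i j, u i * u j - u j * u i ∈ Submodule.span K (Set.range u)) :
    Submodule.span K (Set.range fun s : Multiset I => (s.toList.map u).prod) = ⊤ := by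
  let T : ℕ → Submodule K A := fun n =>
    Submodule.span K ((fun L : List I => (L.map u).prod) '' {L | L.length < n})
  have hmul : ∀ i n x, x ∈ T n → u i * x ∈ T (n + 1) := by
    intro i n x hx
    induction hx using Submodule.span_induction with
    | mem x hx =>
      obtain ⟨L, hL, rfl⟩ := hx
      exact Submodule.subset_span ⟨i :: L, by simpa using hL, by simp⟩
    | zero => rw [mul_zero]; exact zero_mem _
    | add x y _ _ hx hy => rw [mul_add]; exact add_mem hx hy
    | smul c x _ hx => rw [mul_smul_comm]; exact Submodule.smul_mem _ _ hx
  -- Exchanging two neighbours costs a commutator, a combination of generators, hence words that are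
  -- shorter by one.
  have hperm : ∀ L₁ L₂ : List I, L₁.Perm L₂ →
      (L₁.map u).prod - (L₂.map u).prod ∈ T L₁.length := by
    intro L₁ L₂ h
    induction h with
    | nil => simp
    | cons i _ ih =>
      simp only [List.map_cons, List.prod_cons, ← mul_sub, List.length_cons]
      exact hmul _ _ _ ih
    | swap i j L =>
      simp only [List.map_cons, List.prod_cons, List.length_cons, ← mul_assoc, ← sub_mul]
      have : ∀ x ∈ Submodule.span K (Set.range u), x * (L.map u).prod ∈ T (L.length + 1 + 1) := by
        intro x hx
        induction hx using Submodule.span_induction with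
        | mem x hx =>
          obtain ⟨k, rfl⟩ := hx
          exact Submodule.subset_span ⟨k :: L, by simp, by simp⟩
        | zero => rw [zero_mul]; exact zero_mem _
        | add x y _ _ hx hy => rw [add_mul]; exact add_mem hx hy
        | smul c x _ hx => rw [smul_mul_assoc]; exact Submodule.smul_mem _ _ hx
      exact this _ (hcomm j i)
    | trans h1 h2 ih1 ih2 =>
      rw [← h1.length_eq] at ih2
      have := add_mem ih1 ih2
      simpa using this
  have hall : ∀ n (L : List I), L.length < n → (L.map u).prod ∈
      Submodule.span K (Set.range fun s : Multiset I => (s.toList.map u).prod) := by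
    intro n
    induction n with
    | zero => intro L hL; omega
    | succ n ih =>
      intro L hL
      have h1 := hperm L (L : Multiset I).toList
        (Multiset.coe_eq_coe.1 (Multiset.coe_toList _)).symm
      have h2 : T L.length ≤
          Submodule.span K (Set.range fun s : Multiset I => (s.toList.map u).prod) := by
        refine Submodule.span_le.2 ?_
        rintro _ ⟨L', hL', rfl⟩
        exact ih L' (lt_of_lt_of_le hL' (by omega))
      have h3 := add_mem (h2 h1) (Submodule.subset_span ⟨(L : Multiset I), rfl⟩)
      simpa using h3
  rw [eq_top_iff]
  rintro x -
  have hx : x ∈ Submodule.span K (Submonoid.closure (Set.range u) : Set A) := by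
    rw [← Algebra.adjoin_eq_span, hgen]
    trivial
  refine Submodule.span_le.2 ?_ hx
  intro y hy
  obtain ⟨L, hL, rfl⟩ := Submonoid.exists_list_of_mem_closure hy
  obtain ⟨L', rfl⟩ : ∃ L' : List I, L'.map u = L := by
    clear hy hx
    induction L with
    | nil => exact ⟨[], rfl⟩
    | cons a L ih =>
      obtain ⟨L', rfl⟩ := ih fun y hy => hL y (by simp [hy])
      obtain ⟨i, rfl⟩ := hL a (by simp)
      exact ⟨i :: L', rfl⟩
  exact hall _ L' (Nat.lt_succ_self _)

/-- A homomorphism which sends ordered monomials to a basis is bijective. -/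
lemma bijective_of_ordered_monomials {B : Type*} [Ring B] [Algebra K B] (F : A →ₐ[K] B)
    (hgen : Algebra.adjoin K (Set.range u) = ⊤)
    (hcomm : ∀ i j, u i * u j - u j * u i ∈ Submodule.span K (Set.range u))
    {e : Multiset I → B} (he : LinearIndependent K e) (he' : Submodule.span K (Set.range e) = ⊤)
    (hF : ∀ s : Multiset I, F (s.toList.map u).prod = e s) : Function.Bijective F := by
  -- Spanning is all that is needed of the source: a vanishing combination of images has zero
  -- coefficients, so nothing has to be known about independence of the ordered monomials
  -- beforehand.
  have hspan := span_ordered_monomials u hgen hcomm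
  constructor
  · rw [injective_iff_map_eq_zero]
    intro x hx
    have hx' : x ∈ Submodule.span K (Set.range fun s : Multiset I => (s.toList.map u).prod) := by
      rw [hspan]; trivial
    obtain ⟨c, rfl⟩ := (Finsupp.mem_span_range_iff_exists_finsupp).1 hx'
    rw [Finsupp.sum, map_sum] at hx
    have : Finsupp.linearCombination K e c = 0 := by
      rw [Finsupp.linearCombination_apply, Finsupp.sum, ← hx]
      exact Finset.sum_congr rfl fun s _ => by rw [map_smul, hF]
    rw [linearIndependent_iff.1 he c this]
    simp
  · intro y
    have hy : y ∈ Submodule.span K (Set.range e) := by rw [he']; trivial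
    induction hy using Submodule.span_induction with
    | mem y hy =>
      obtain ⟨s, rfl⟩ := hy
      exact ⟨_, hF s⟩
    | zero => exact ⟨0, map_zero F⟩
    | add x y _ _ hx hy =>
      obtain ⟨a, rfl⟩ := hx
      obtain ⟨b, rfl⟩ := hy
      exact ⟨a + b, map_add F a b⟩
    | smul c x _ hx =>
      obtain ⟨a, rfl⟩ := hx
      exact ⟨c • a, map_smul F c a⟩

end Ordered

/-! ### Lie brackets -/

section Brackets

variable {K : Type*} [Field K] {L M A : Type*} [AddCommGroup L] [Module K L]
  [AddCommGroup M] [Module K M] [Ring A] [Algebra K A]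

/-- An injective linear map into an algebra, whose image is closed under commutators, induces a Lie
bracket. -/
lemma exists_lieBracket_of_injective (θ : L →ₗ[K] A) (hθ : Function.Injective θ)
    (hc : ∀ x y, ∃ z, θ z = θ x * θ y - θ y * θ x) :
    ∃ B : LieBracket K L, ∀ x y, θ (B.br x y) = θ x * θ y - θ y * θ x := by
  obtain ⟨ρ, hρ⟩ := θ.exists_leftInverse_of_injective (LinearMap.ker_eq_bot.2 hθ)
  have hρ' : ∀ x, ρ (θ x) = x := fun x => congrArg (fun f => f x) hρ
  let br : L →ₗ[K] L →ₗ[K] L := LinearMap.mk₂ K (fun x y => ρ (θ x * θ y - θ y * θ x))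
    (fun x x' y => by rw [← map_add]; congr 1; rw [map_add]; noncomm_ring)
    (fun c x y => by rw [← map_smul]; congr 1; rw [map_smul]; simp [smul_sub])
    (fun x y y' => by rw [← map_add]; congr 1; rw [map_add]; noncomm_ring)
    (fun c x y => by rw [← map_smul]; congr 1; rw [map_smul]; simp [smul_sub])
  have hbr : ∀ x y, θ (br x y) = θ x * θ y - θ y * θ x := by
    intro x y
    obtain ⟨z, hz⟩ := hc x y
    change θ (ρ (θ x * θ y - θ y * θ x)) = _
    rw [← hz, hρ']
  -- The identities of a Lie bracket are those of commutators in an associative algebra, pulled back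
  -- along the injection.
  refine ⟨⟨br, fun x => hθ ?_, fun x y z => hθ ?_⟩, hbr⟩
  · rw [hbr, sub_self, map_zero]
  · simp only [map_add, hbr]
    noncomm_ring

/-- The Lie bracket on a quotient by an ideal. -/
lemma exists_lieBracket_of_surjective (B : LieBracket K L) (f : L →ₗ[K] M)
    (hf : Function.Surjective f) (hker : ∀ x y, f y = 0 → f (B.br x y) = 0) :
    ∃ B' : LieBracket K M, ∀ x y, B'.br (f x) (f y) = f (B.br x y) := by
  obtain ⟨σ, hσ⟩ := f.exists_rightInverse_of_surjective (LinearMap.range_eq_top.2 hf)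
  have hσ' : ∀ x, f (σ x) = x := fun x => congrArg (fun g => g x) hσ
  -- The ideal condition is given in the second variable only; antisymmetry transfers it to the
  -- first.
  have hanti : ∀ x y, B.br x y = - B.br y x := fun x y => by
    have := B.alt (x + y)
    simp only [map_add, LinearMap.add_apply, B.alt, zero_add, add_zero] at this
    exact eq_neg_of_add_eq_zero_right this
  have h1 : ∀ x y y', f y = f y' → f (B.br x y) = f (B.br x y') := fun x y y' h => by
    rw [← sub_eq_zero, ← map_sub, ← map_sub]
    exact hker _ _ (by rw [map_sub, h, sub_self])
  have h2 : ∀ x x' y, f x = f x' → f (B.br x y) = f (B.br x' y) := fun x x' y h => by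
    rw [hanti x, hanti x', map_neg, map_neg, h1 _ _ _ h]
  let br : M →ₗ[K] M →ₗ[K] M := (B.br.compl₁₂ σ σ).compr₂ f
  have hbr : ∀ x y, br (f x) (f y) = f (B.br x y) := fun x y => by
    change f (B.br (σ (f x)) (σ (f y))) = _
    rw [h1 _ _ y (hσ' _), h2 _ x _ (hσ' _)]
  refine ⟨⟨br, fun x => ?_, fun x y z => ?_⟩, hbr⟩
  · obtain ⟨x, rfl⟩ := hf x
    rw [hbr, B.alt, map_zero]
  · obtain ⟨x, rfl⟩ := hf x
    obtain ⟨y, rfl⟩ := hf y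
    obtain ⟨z, rfl⟩ := hf z
    rw [hbr, hbr, hbr, hbr, hbr, hbr, B.leibniz, map_add]

namespace LieBracket

variable (B : LieBracket K L)

/-- The canonical map into the universal enveloping algebra, as a linear map. -/
def ιLin : L →ₗ[K] B.U :=
  letI := B.lieRing
  letI := B.lieAlgebra
  letI : LieRing (UniversalEnvelopingAlgebra K L) := LieRing.ofAssociativeRing
  letI : LieAlgebra K (UniversalEnvelopingAlgebra K L) := LieAlgebra.ofAssociativeAlgebra
  (UniversalEnvelopingAlgebra.ι K (L := L)).toLinearMap

lemma ι_commutator (x y : L) : B.ι x * B.ι y - B.ι y * B.ι x = B.ι (B.br x y) := by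
  let := B.lieRing
  let := B.lieAlgebra
  let : LieRing (UniversalEnvelopingAlgebra K L) := LieRing.ofAssociativeRing
  let : LieAlgebra K (UniversalEnvelopingAlgebra K L) := LieAlgebra.ofAssociativeAlgebra
  exact ((UniversalEnvelopingAlgebra.ι K (L := L)).map_lie x y).symm

lemma exists_lift (θ : L →ₗ[K] A) (hθ : ∀ x y, θ (B.br x y) = θ x * θ y - θ y * θ x) :
    ∃ F : B.U →ₐ[K] A, ∀ x, F (B.ι x) = θ x := by
  let := B.lieRing
  let := B.lieAlgebra
  let : LieRing A := LieRing.ofAssociativeRing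
  let : LieAlgebra K A := LieAlgebra.ofAssociativeAlgebra
  let θ' : L →ₗ⁅K⁆ A := { θ with map_lie' := fun {x y} => hθ x y }
  exact ⟨UniversalEnvelopingAlgebra.lift K θ', fun x =>
    UniversalEnvelopingAlgebra.lift_ι_apply K θ' x⟩

/-- By the universal property the identity factors through the subalgebra generated by the image of
the Lie algebra. -/
lemma adjoin_ι : Algebra.adjoin K (Set.range B.ιLin) = ⊤ := by
  let := B.lieRing
  let := B.lieAlgebra
  let : LieRing (UniversalEnvelopingAlgebra K L) := LieRing.ofAssociativeRing
  let : LieAlgebra K (UniversalEnvelopingAlgebra K L) := LieAlgebra.ofAssociativeAlgebra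
  set S := Algebra.adjoin K (Set.range B.ιLin) with hS
  let θ : L →ₗ[K] S := B.ιLin.codRestrict S.toSubmodule
    fun x => Algebra.subset_adjoin ⟨x, rfl⟩
  obtain ⟨F, hF⟩ := B.exists_lift θ fun x y => by
    apply Subtype.ext
    exact (B.ι_commutator x y).symm
  have h : S.val.comp F = AlgHom.id K B.U := by
    refine UniversalEnvelopingAlgebra.hom_ext (R := K) (L := L) (LieHom.ext fun x => ?_)
    change ((F (B.ι x) : S) : B.U) = B.ι x
    rw [hF]
    rfl
  rw [eq_top_iff]
  rintro x -
  have := congrArg (fun f => f x) h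
  rw [← show ((F x : S) : B.U) = x from this]
  exact (F x).2

end LieBracket

lemma SymmetricAlgebra.exists_lift (hc : ∀ x y : A, x * y = y * x) (θ : L →ₗ[K] A) :
    ∃ F : SymmetricAlgebra K L →ₐ[K] A, ∀ x, F (SymmetricAlgebra.ι K L x) = θ x := by
  let : CommRing A := { (inferInstance : Ring A) with mul_comm := hc }
  exact ⟨SymmetricAlgebra.lift θ, fun x => SymmetricAlgebra.lift_ι_apply θ x⟩

lemma SymmetricAlgebra.adjoin_ι :
    Algebra.adjoin K (Set.range (SymmetricAlgebra.ι K L)) = ⊤ := by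
  rw [eq_top_iff]
  rintro x -
  induction x using SymmetricAlgebra.induction with
  | algebraMap r => exact Subalgebra.algebraMap_mem _ r
  | ι x => exact Algebra.subset_adjoin ⟨x, rfl⟩
  | mul a b ha hb => exact Subalgebra.mul_mem _ ha hb
  | add a b ha hb => exact Subalgebra.add_mem _ ha hb

end Brackets

namespace QuiverData

variable {V : Type u} {E : Type v} {Q : QuiverData V E} {K : Type w} [Field K] [Fintype V]
  [DecidableEq E]

/-! ### Quantization of the necklace Lie algebra -/

lemma smul_mem_of_K {A : Type*} [Ring A] [Algebra K[X] A] [Algebra K A] [IsScalarTower K K[X] A]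
    (S : Submodule K[X] A) (c : K) {x : A} (hx : x ∈ S) : c • x ∈ S := by
  rw [← algebraMap_smul K[X] c x]
  exact S.smul_mem _ hx

lemma hat_ofPath_of_not_isClosed (α β : K[X]) {p : Q.DPath} (hp : ¬ p.IsClosed) :
    Q.hat K α β (PathAlg.ofPath Q K p) = 0 := by
  rw [hat, PathAlg.extend_ofPath, dif_neg hp]

/-- The lift of an element of the path algebra is determined by its class modulo commutators,
modulo the split coefficient. -/
lemma hat_mem_of_cl_eq_zero (α β : K[X]) {t : Q.PathAlg K} (ht : Q.cl K t = 0) :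
    Q.hat K α β t ∈ LinearMap.range (LinearMap.lsmul K[X] (Q.N K α β) β) := by
  have hp : ∀ x y : Q.PathAlg K, Q.hat K α β (x * y - y * x) ∈
      LinearMap.range (LinearMap.lsmul K[X] (Q.N K α β) β) := by
    intro x y
    induction x using PathAlg.induction with
    | h0 => rw [zero_mul, mul_zero, sub_self, map_zero]; exact zero_mem _
    | hadd a b ha hb =>
      rw [add_mul, mul_add, add_sub_add_comm, map_add]; exact add_mem ha hb
    | hsmul c a ha =>
      rw [smul_mul_assoc, mul_smul_comm, ← smul_sub, map_smul]; exact smul_mem_of_K _ c ha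
    | hpath p =>
      induction y using PathAlg.induction with
      | h0 => rw [zero_mul, mul_zero, sub_self, map_zero]; exact zero_mem _
      | hadd a b ha hb =>
        rw [add_mul, mul_add, add_sub_add_comm, map_add]; exact add_mem ha hb
      | hsmul c a ha =>
        rw [smul_mul_assoc, mul_smul_comm, ← smul_sub, map_smul]; exact smul_mem_of_K _ c ha
      | hpath q =>
        have hcomp : ∀ (p q : Q.DPath) (h : p.src = q.tgt), (p.comp q h).IsClosed ↔
            q.src = p.tgt := fun p q h => by
          rw [DPath.IsClosed, DPath.src_comp]; rfl
        have hno : ∀ p q : Q.DPath, ¬ (p.src = q.tgt ∧ q.src = p.tgt) →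
            Q.hat K α β (PathAlg.ofPath Q K p * PathAlg.ofPath Q K q) = 0 := by
          intro p q h
          by_cases h1 : p.src = q.tgt
          · rw [PathAlg.ofPath_mul K p q h1]
            exact hat_ofPath_of_not_isClosed α β fun h2 => h ⟨h1, (hcomp p q h1).1 h2⟩
          · rw [PathAlg.ofPath_mul_eq_zero K p q h1, map_zero]
        by_cases h : p.src = q.tgt ∧ q.src = p.tgt
        -- If the two paths compose in both orders, their commutator is the difference of two
        -- rotations of one closed path. Otherwise each product is zero or a path that is not
        -- closed, whose lift is zero.
        · let c : Q.ClosedPath := ⟨p.comp q h.1, (hcomp p q h.1).2 h.2⟩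
          let c' : Q.ClosedPath := ⟨q.comp p h.2, (hcomp q p h.2).2 h.1⟩
          have hr : Q.RotRel c c' := ⟨p, q, h.1, h.2, rfl, rfl⟩
          rw [PathAlg.ofPath_mul K p q h.1, PathAlg.ofPath_mul K q p h.2, map_sub]
          change Q.hat K α β (PathAlg.ofPath Q K c.1) - Q.hat K α β (PathAlg.ofPath Q K c'.1) ∈ _
          rw [hat_ofClosedPath, hat_ofClosedPath]
          refine Diagram.nclass_sub_ofC_mem α β c ?_
          rw [Diagram.mon_ofC]
          exact congrArg _ (Quot.sound hr).symm
        · rw [map_sub, hno p q h, hno q p fun h' => h ⟨h'.2, h'.1⟩, sub_zero]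
          exact zero_mem _
  rw [cl_eq_zero_iff, commutatorSpan] at ht
  induction ht using Submodule.span_induction with
  | mem x hx =>
    obtain ⟨⟨x, y⟩, rfl⟩ := hx
    exact hp x y
  | zero => rw [map_zero]; exact zero_mem _
  | add x y _ _ hx hy => rw [map_add]; exact add_mem hx hy
  | smul c x _ hx => rw [map_smul]; exact smul_mem_of_K _ c hx

/-- The commutator of two lifts, to first order. -/
lemma hat_commutator (α β : K[X]) (x y : Q.PathAlg K) :
    Q.hat K α β x * Q.hat K α β y - Q.hat K α β y * Q.hat K α β x -
      α • Q.hat K α β (Q.neckLin K x y) ∈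
    LinearMap.range (LinearMap.lsmul K[X] (Q.N K α β) (α * β)) := by
  induction x using PathAlg.induction with
  | h0 =>
    rw [map_zero, map_zero, LinearMap.zero_apply, map_zero, zero_mul, mul_zero, smul_zero]
    simp
  | hadd a b ha hb =>
    convert add_mem ha hb using 1
    simp only [map_add, LinearMap.add_apply, smul_add, add_mul, mul_add]
    abel
  | hsmul c a ha =>
    convert smul_mem_of_K _ c ha using 1
    simp only [map_smul, LinearMap.smul_apply, smul_sub, smul_mul_assoc, mul_smul_comm]
    rw [smul_comm]
  | hpath p =>
    induction y using PathAlg.induction with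
    | h0 =>
      rw [map_zero, map_zero, map_zero, zero_mul, mul_zero, smul_zero]
      simp
    | hadd a b ha hb =>
      convert add_mem ha hb using 1
      simp only [map_add, smul_add, add_mul, mul_add]
      abel
    | hsmul c a ha =>
      convert smul_mem_of_K _ c ha using 1
      simp only [map_smul, smul_sub, smul_mul_assoc, mul_smul_comm]
      rw [smul_comm]
    | hpath q =>
      rw [neckLin_ofPath]
      by_cases h : p.IsClosed ∧ q.IsClosed
      · rw [if_pos h]
        exact hat_commutator_ofPath α β ⟨p, h.1⟩ ⟨q, h.2⟩
      · rw [if_neg h, map_zero, smul_zero, sub_zero]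
        rcases not_and_or.1 h with h | h
        · rw [hat_ofPath_of_not_isClosed α β h, zero_mul, mul_zero, sub_zero]; exact zero_mem _
        · rw [hat_ofPath_of_not_isClosed α β h, zero_mul, mul_zero, sub_zero]; exact zero_mem _

/-! ### The classical limit of the algebra and of its reduction -/

section Classical

variable {α β : K[X]}

variable (α) in
/-- The map `(K Q̄)_♮ → N / ħ N` induced by the lift, when `ħ` divides the split coefficient. -/
def classMap (hβ : hbar K ∣ β) : Nat0 K (Q.PathAlg K) →ₗ[K] ModHbar K (Q.N K α β) :=
  (commutatorSpan K (Q.PathAlg K)).liftQ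
    ((QuotBy.mk K ({algebraMap K[X] (Q.N K α β) (hbar K)} : Set _)).toLinearMap ∘ₗ Q.hat K α β) (by
      intro t ht
      obtain ⟨z, hz⟩ := hat_mem_of_cl_eq_zero α β ((cl_eq_zero_iff t).2 ht)
      rw [LinearMap.mem_ker, LinearMap.comp_apply, ← hz]
      exact toModHbar_smul_of_dvd hβ z)

lemma classMap_cl (hβ : hbar K ∣ β) (x : Q.PathAlg K) :
    classMap α hβ (Q.cl K x) = toModHbar K _ (Q.hat K α β x) := rfl

lemma classMap_cycCl (hβ : hbar K ∣ β) (c : Q.CycPath) :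
    classMap α hβ (cycCl K c) = toModHbar K _ (nclass K α β (Diagram.ofC c.rep)) := by
  rw [cycCl, classMap_cl, hat_ofClosedPath]

/-- The error in the commutator formula is a multiple of `αβ`, and `ħ` divides `β`. -/
lemma classMap_commutator (hβ : hbar K ∣ β) (x y : Q.PathAlg K) :
    classMap α hβ (Q.cl K x) * classMap α hβ (Q.cl K y) -
      classMap α hβ (Q.cl K y) * classMap α hβ (Q.cl K x) =
      toModHbar K _ (α • Q.hat K α β (Q.neckLin K x y)) := by
  obtain ⟨z, hz⟩ := hat_commutator α β x y
  have hz' : (α * β) • z = Q.hat K α β x * Q.hat K α β y - Q.hat K α β y * Q.hat K α β x -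
      α • Q.hat K α β (Q.neckLin K x y) := hz
  rw [classMap_cl, classMap_cl, ← map_mul (toModHbar K _), ← map_mul (toModHbar K _),
    ← map_sub (toModHbar K _), ← sub_eq_zero, ← map_sub (toModHbar K _), ← hz']
  exact toModHbar_smul_of_dvd (Dvd.dvd.mul_left hβ α) z

variable (α β) in
/-- The basis of `N / ħ N`. -/
def stdMod (s : Multiset Q.CycPath) : ModHbar K (Q.N K α β) := toModHbar K _ (stdClass α β s)

lemma stdMod_eq (α β : K[X]) :
    (stdMod (Q := Q) α β) = fun s => toModHbar K _ (Q.stdBasis α β s) := by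
  funext s
  rw [stdBasis_apply]; rfl

lemma linearIndependent_stdMod (α β : K[X]) : LinearIndependent K (stdMod (Q := Q) α β) := by
  rw [stdMod_eq]
  exact linearIndependent_toModHbar _

lemma span_stdMod (α β : K[X]) : Submodule.span K (Set.range (stdMod (Q := Q) α β)) = ⊤ := by
  rw [stdMod_eq]
  exact span_toModHbar _

lemma prod_classMap (hβ : hbar K ∣ β) (s : Multiset Q.CycPath) :
    (s.toList.map fun c => classMap α hβ (cycCl K c)).prod = stdMod α β s := by
  rw [stdMod, stdClass, Diagram.ofMultiset]
  generalize s.toList = L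
  induction L with
  | nil => rw [List.map_nil, List.map_nil, List.prod_nil, List.prod_nil, nclass_one, map_one]
  | cons c L ih =>
    rw [List.map_cons, List.map_cons, List.prod_cons, List.prod_cons, nclass_mul, map_mul, ih,
      classMap_cycCl]

/-- The classes of closed paths up to rotation span the source and are sent to the members of the
basis of `N / ħ N` that are indexed by one-element multisets. -/
lemma classMap_injective (hβ : hbar K ∣ β) : Function.Injective (classMap (Q := Q) α hβ) := by
  rw [injective_iff_map_eq_zero]
  intro x hx
  have hx' : x ∈ Submodule.span K (Set.range (cycCl (Q := Q) K)) := by rw [span_cycCl]; trivial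
  obtain ⟨c, rfl⟩ := (Finsupp.mem_span_range_iff_exists_finsupp).1 hx'
  have h1 : ∀ i : Q.CycPath, classMap α hβ (cycCl K i) = stdMod α β {i} := fun i => by
    rw [← prod_classMap hβ, Multiset.toList_singleton]
    simp
  have hli : LinearIndependent K fun i : Q.CycPath => stdMod (Q := Q) α β {i} :=
    (linearIndependent_stdMod α β).comp _ fun _ _ h => Multiset.singleton_inj.1 h
  have h2 : Finsupp.linearCombination K (fun i : Q.CycPath => stdMod (Q := Q) α β {i}) c = 0 := by
    rw [Finsupp.linearCombination_apply, ← hx, Finsupp.sum, Finsupp.sum, map_sum]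
    exact Finset.sum_congr rfl fun i _ => by rw [map_smul, h1]
  rw [linearIndependent_iff.1 hli c h2]
  simp

variable [Fintype E]

lemma toRq_hat_moment (α β : K[X]) (y : Q.PathAlg K) :
    Q.toRq K α β (Q.hat K α β (y * PathAlg.moment Q K)) = 0 :=
  QuotBy.mk_eq_zero _ _ ⟨y, rfl⟩

variable (Q α β) in
/-- The reduction map modulo `ħ`. -/
def redMod : ModHbar K (Q.N K α β) →ₐ[K] ModHbar K (Q.Rq K α β) :=
  QuotBy.liftAlg K
    ((QuotBy.mk K ({algebraMap K[X] (Q.Rq K α β) (hbar K)} : Set _)).comp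
      (QuotBy.mk K (Q.momentLifts K α β))) (by
    rintro _ rfl
    have h1 : (QuotBy.mk K (Q.momentLifts K α β)) (algebraMap K[X] (Q.N K α β) (hbar K)) =
      algebraMap K[X] (Q.Rq K α β) (hbar K) := (Q.toRq K α β).commutes _
    rw [AlgHom.comp_apply, h1]
    exact QuotBy.mk_eq_zero K _ (Set.mem_singleton _))

lemma redMod_mk (z : Q.N K α β) :
    redMod Q α β (toModHbar K _ z) = toModHbar K _ (Q.toRq K α β z) := rfl

lemma redMod_classMap_eq_zero (hβ : hbar K ∣ β) (x : Nat0 K (Q.PathAlg K)) (hx : Q.pr K x = 0) :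
    redMod Q α β (classMap α hβ x) = 0 := by
  obtain ⟨y, rfl⟩ := (pr_eq_zero_iff x).1 hx
  change redMod Q α β (classMap α hβ (Q.cl K (y * PathAlg.moment Q K))) = 0
  rw [classMap_cl, redMod_mk, toRq_hat_moment, map_zero]

lemma exists_classMap_red (hβ : hbar K ∣ β) :
    ∃ θ' : Nat0 K (Q.Preproj K) →ₗ[K] ModHbar K (Q.Rq K α β),
      ∀ x, θ' (Q.pr K x) = redMod Q α β (classMap α hβ x) := by
  have hker : LinearMap.ker (Q.pr K) ≤
      LinearMap.ker ((redMod Q α β).toLinearMap ∘ₗ classMap α hβ) :=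
    fun x hx => redMod_classMap_eq_zero hβ x hx
  refine ⟨((LinearMap.ker (Q.pr K)).liftQ _ hker) ∘ₗ
    ((Q.pr K).quotKerEquivOfSurjective pr_surjective).symm.toLinearMap, fun x => ?_⟩
  have : ((Q.pr K).quotKerEquivOfSurjective pr_surjective).symm (Q.pr K x) =
      Submodule.Quotient.mk x := by
    rw [LinearEquiv.symm_apply_eq]; rfl
  rw [LinearMap.comp_apply, LinearEquiv.coe_coe, this]
  rfl

/-- Quantization commutes with reduction: the abstract form. -/
theorem quantization_reduction (hβ : hbar K ∣ β)
    {U U' : Type*} [Ring U] [Algebra K U] [Ring U'] [Algebra K U']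
    (ι : Nat0 K (Q.PathAlg K) →ₗ[K] U) (ι' : Nat0 K (Q.Preproj K) →ₗ[K] U')
    (hι : Algebra.adjoin K (Set.range ι) = ⊤) (hι' : Algebra.adjoin K (Set.range ι') = ⊤)
    (hcomm : ∀ x y, ∃ z, ι x * ι y - ι y * ι x = ι z)
    (F : U →ₐ[K] ModHbar K (Q.N K α β)) (hF : ∀ x, F (ι x) = classMap α hβ x)
    (G : U' →ₐ[K] ModHbar K (Q.Rq K α β))
    (hG : ∀ x, G (ι' (Q.pr K x)) = redMod Q α β (classMap α hβ x))
    (redU : U →ₐ[K] U') (hredU : ∀ x, redU (ι x) = ι' (Q.pr K x)) :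
    ∃ (l : U ≃ₐ[K] ModHbar K (Q.N K α β)) (v : U' ≃ₐ[K] ModHbar K (Q.Rq K α β))
      (redU : U →ₐ[K] U') (red : ModHbar K (Q.N K α β) →ₐ[K] ModHbar K (Q.Rq K α β)),
      (∀ x, l (ι (Q.cl K x)) = toModHbar K _ (Q.hat K α β x)) ∧
      (∀ x, v (ι' (Q.pr K (Q.cl K x))) = toModHbar K _ (Q.toRq K α β (Q.hat K α β x))) ∧
      (∀ x, redU (ι x) = ι' (Q.pr K x)) ∧
      (∀ z, red (toModHbar K _ z) = toModHbar K _ (Q.toRq K α β z)) ∧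
      (∀ u, red (l u) = v (redU u)) := by
  have hspan : ∀ x, ι x ∈ Submodule.span K (Set.range fun c => ι (cycCl K c)) := by
    intro x
    have hx : x ∈ Submodule.span K (Set.range (cycCl (Q := Q) K)) := by rw [span_cycCl]; trivial
    have h1 := Submodule.mem_map_of_mem (f := ι) hx
    rwa [Submodule.map_span, ← Set.range_comp] at h1
  have hgen : Algebra.adjoin K (Set.range fun c => ι (cycCl (Q := Q) K c)) = ⊤ := by
    rw [eq_top_iff, ← hι]
    refine Algebra.adjoin_le ?_
    rintro _ ⟨x, rfl⟩
    exact Algebra.span_le_adjoin K _ (hspan x)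
  -- The ordered monomials in the classes of closed paths are sent exactly to the standard basis
  -- modulo `ħ`.
  have hFb : Function.Bijective F := by
    refine bijective_of_ordered_monomials (fun c => ι (cycCl (Q := Q) K c)) F hgen
      (fun i j => ?_) (linearIndependent_stdMod α β) (span_stdMod α β) fun s => ?_
    · obtain ⟨z, hz⟩ := hcomm (cycCl K i) (cycCl K j)
      rw [hz]
      exact hspan z
    · rw [map_list_prod, List.map_map, ← prod_classMap hβ]
      congr 2
      funext c
      exact hF _
  let l : U ≃ₐ[K] ModHbar K (Q.N K α β) := AlgEquiv.ofBijective F hFb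
  have hcompat : ∀ u, redMod Q α β (F u) = G (redU u) := by
    intro u
    have hu : u ∈ Algebra.adjoin K (Set.range ι) := by rw [hι]; trivial
    induction hu using Algebra.adjoin_induction with
    | mem u hu =>
      obtain ⟨x, rfl⟩ := hu
      rw [hF, hredU, hG]
    | algebraMap r => simp only [AlgHom.commutes]
    | add x y _ _ hx hy => simp only [map_add, hx, hy]
    | mul x y _ _ hx hy => simp only [map_mul, hx, hy]
  have hredS : Function.Surjective (redMod Q α β) := by
    intro y
    obtain ⟨y, rfl⟩ := QuotBy.mk_surjective K[X] _ y
    obtain ⟨z, rfl⟩ := QuotBy.mk_surjective K[X] _ y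
    exact ⟨toModHbar K _ z, rfl⟩
  have hGs : Function.Surjective G := by
    intro y
    obtain ⟨z, rfl⟩ := hredS y
    obtain ⟨u, rfl⟩ := hFb.2 z
    exact ⟨redU u, (hcompat u).symm⟩
  -- Candidate for the inverse of `G`: go from `N` through `N / ħ N` back to `U` and reduce there.
  -- It kills the lifts of the `y w`, since `pr` does, and it kills `ħ`, so it descends to `R_q / ħ
  -- R_q`.
  let H₀ : Q.N K α β →ₐ[K] U' := (redU.comp l.symm.toAlgHom).comp
    (QuotBy.mk K ({algebraMap K[X] (Q.N K α β) (hbar K)} : Set _))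
  have hH₀ : ∀ x, H₀ (Q.hat K α β x) = ι' (Q.pr K (Q.cl K x)) := by
    intro x
    change redU (l.symm (toModHbar K _ (Q.hat K α β x))) = _
    rw [← classMap_cl hβ, ← hF, show F (ι (Q.cl K x)) = l (ι (Q.cl K x)) from rfl,
      AlgEquiv.symm_apply_apply, hredU]
  let H₁ : Q.Rq K α β →ₐ[K] U' := QuotBy.liftAlg K H₀ (by
    rintro _ ⟨y, rfl⟩
    rw [hH₀, pr_cl_mul_moment, map_zero])
  let H : ModHbar K (Q.Rq K α β) →ₐ[K] U' := QuotBy.liftAlg K H₁ (by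
    rintro _ rfl
    have h1 : algebraMap K[X] (Q.Rq K α β) (hbar K) =
      QuotBy.mk K (Q.momentLifts K α β) (algebraMap K[X] (Q.N K α β) (hbar K)) :=
      ((Q.toRq K α β).commutes _).symm
    rw [h1]
    change redU (l.symm (toModHbar K _ (algebraMap K[X] (Q.N K α β) (hbar K)))) = 0
    rw [QuotBy.mk_eq_zero K[X] _ (Set.mem_singleton _), map_zero, map_zero])
  -- A left inverse on generators suffices: `G` is surjective because the reduction map is.
  have hHG : ∀ u, H (G u) = u := by
    intro u
    have hu : u ∈ Algebra.adjoin K (Set.range ι') := by rw [hι']; trivial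
    induction hu using Algebra.adjoin_induction with
    | mem u hu =>
      obtain ⟨x, rfl⟩ := hu
      obtain ⟨x, rfl⟩ := pr_surjective x
      obtain ⟨x, rfl⟩ := cl_surjective x
      rw [hG, classMap_cl, redMod_mk]
      exact hH₀ x
    | algebraMap r => simp only [AlgHom.commutes]
    | add x y _ _ hx hy => simp only [map_add, hx, hy]
    | mul x y _ _ hx hy => simp only [map_mul, hx, hy]
  have hGb : Function.Bijective G := ⟨Function.LeftInverse.injective hHG, hGs⟩
  refine ⟨l, AlgEquiv.ofBijective G hGb, redU, redMod Q α β, fun x => ?_, fun x => ?_, hredU,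
    fun z => rfl, hcompat⟩
  · exact (hF _).trans (classMap_cl hβ x)
  · exact (hG _).trans (by rw [classMap_cl]; rfl)

end Classical

/-! ### The Lie brackets -/

section Brackets

variable [Fintype E]

/-- The necklace Lie bracket. -/
lemma exists_necklaceBracket : ∃ BL : LieBracket K (Nat0 K (Q.PathAlg K)),
    ∀ x y, BL.br (Q.cl K x) (Q.cl K y) = Q.cl K (Q.neckLin K x y) := by
  -- For `α = 1` the commutators in `N / ħ N` are the lifts of the necklace bracket, so the Jacobi
  -- identity need not be checked on words.
  have hθ := classMap_injective (Q := Q) (α := 1) (dvd_refl (hbar K))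
  have hc : ∀ x y : Q.PathAlg K, classMap 1 (dvd_refl (hbar K)) (Q.cl K (Q.neckLin K x y)) =
      classMap 1 (dvd_refl (hbar K)) (Q.cl K x) * classMap 1 (dvd_refl (hbar K)) (Q.cl K y) -
      classMap 1 (dvd_refl (hbar K)) (Q.cl K y) * classMap 1 (dvd_refl (hbar K)) (Q.cl K x) := by
    intro x y
    rw [classMap_commutator, one_smul, classMap_cl]
  obtain ⟨B, hB⟩ := exists_lieBracket_of_injective _ hθ (fun x y => by
    obtain ⟨x, rfl⟩ := cl_surjective x
    obtain ⟨y, rfl⟩ := cl_surjective y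
    exact ⟨_, hc x y⟩)
  exact ⟨B, fun x y => hθ (by rw [hB, hc])⟩

lemma exists_reducedBracket (BL : LieBracket K (Nat0 K (Q.PathAlg K)))
    (hBL : ∀ x y, BL.br (Q.cl K x) (Q.cl K y) = Q.cl K (Q.neckLin K x y)) :
    ∃ BP : LieBracket K (Nat0 K (Q.Preproj K)),
      ∀ x y, BP.br (Q.pr K x) (Q.pr K y) = Q.pr K (BL.br x y) := by
  refine exists_lieBracket_of_surjective BL _ pr_surjective fun x y hy => ?_
  obtain ⟨x, rfl⟩ := cl_surjective x
  obtain ⟨y, rfl⟩ := (pr_eq_zero_iff y).1 hy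
  rw [pr_eq_zero_iff]
  change BL.br (Q.cl K x) (Q.cl K (y * PathAlg.moment Q K)) ∈ _
  rw [hBL]
  exact cl_neckLin_moment_mem x y

/-! ### Quantization commutes with reduction -/

/-- For `α = 1` the class maps turn the Lie brackets into commutators, and the universal property of
the enveloping algebras supplies the homomorphisms to which `quantization_reduction` applies. -/
theorem quantization_reduction_envelope (BL : LieBracket K (Nat0 K (Q.PathAlg K)))
    (BP : LieBracket K (Nat0 K (Q.Preproj K)))
    (hBL : ∀ x y, BL.br (Q.cl K x) (Q.cl K y) = Q.cl K (Q.neckLin K x y))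
    (hBP : ∀ x y, BP.br (Q.pr K x) (Q.pr K y) = Q.pr K (BL.br x y)) :
    ∃ (l : BL.U ≃ₐ[K] ModHbar K (Q.N K 1 (hbar K)))
      (v : BP.U ≃ₐ[K] ModHbar K (Q.Rq K 1 (hbar K)))
      (redU : BL.U →ₐ[K] BP.U)
      (red : ModHbar K (Q.N K 1 (hbar K)) →ₐ[K] ModHbar K (Q.Rq K 1 (hbar K))),
      (∀ x, l (BL.ι (Q.cl K x)) = toModHbar K _ (Q.hat K 1 (hbar K) x)) ∧
      (∀ x, v (BP.ι (Q.pr K (Q.cl K x))) =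
        toModHbar K _ (Q.toRq K 1 (hbar K) (Q.hat K 1 (hbar K) x))) ∧
      (∀ x, redU (BL.ι x) = BP.ι (Q.pr K x)) ∧
      (∀ z, red (toModHbar K _ z) = toModHbar K _ (Q.toRq K 1 (hbar K) z)) ∧
      (∀ u, red (l u) = v (redU u)) := by
  have hβ := dvd_refl (hbar K)
  have hθ : ∀ x y, classMap 1 hβ (BL.br x y) =
      classMap 1 hβ x * classMap 1 hβ y - classMap 1 hβ y * classMap 1 hβ x := by
    intro x y
    obtain ⟨x, rfl⟩ := cl_surjective x
    obtain ⟨y, rfl⟩ := cl_surjective y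
    rw [hBL, classMap_commutator, one_smul, classMap_cl]
  obtain ⟨θ', hθ'⟩ := exists_classMap_red (Q := Q) (α := 1) hβ
  obtain ⟨F, hF⟩ := BL.exists_lift (classMap 1 hβ) hθ
  obtain ⟨G, hG⟩ := BP.exists_lift θ' (fun x y => by
    obtain ⟨x, rfl⟩ := pr_surjective x
    obtain ⟨y, rfl⟩ := pr_surjective y
    rw [hBP, hθ', hθ', hθ', hθ, map_sub, map_mul, map_mul])
  obtain ⟨redU, hredU⟩ := BL.exists_lift (BP.ιLin ∘ₗ Q.pr K) (fun x y => by
    rw [LinearMap.comp_apply, ← hBP]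
    exact (BP.ι_commutator _ _).symm)
  exact quantization_reduction hβ BL.ιLin BP.ιLin BL.adjoin_ι BP.adjoin_ι
    (fun x y => ⟨_, BL.ι_commutator x y⟩) F hF G (fun x => (hG _).trans (hθ' x)) redU hredU

/-- `X * Y` and `Y * X` differ only by their heights, and each exchange of heights costs a multiple
of `α` or `β`, hence of `ħ`. -/
lemma modHbar_mul_comm {α β : K[X]} (hα : hbar K ∣ α) (hβ : hbar K ∣ β)
    (x y : ModHbar K (Q.N K α β)) : x * y = y * x := by
  obtain ⟨x, rfl⟩ := QuotBy.mk_surjective K[X] _ x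
  obtain ⟨y, rfl⟩ := QuotBy.mk_surjective K[X] _ y
  have hX : ∀ X Y : Q.Diagram, toModHbar K _ (nclass K α β X) * toModHbar K _ (nclass K α β Y) =
      toModHbar K _ (nclass K α β Y) * toModHbar K _ (nclass K α β X) := by
    intro X Y
    rw [← map_mul, ← map_mul, ← nclass_mul, ← nclass_mul, ← sub_eq_zero, ← map_sub]
    have h := (Diagram.Rearr.mul_comm X Y).nclass_sub_mem (α := α) (β := β)
      (LinearMap.range (LinearMap.lsmul K[X] (Q.N K α β) (hbar K)))
      (fun X' _ l m x y hw => by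
        by_cases hxy : y = rev x
        · subst hxy
          have : hbar K ∣ contrCoeff α β X'.next l.length (l.length + 1) := by
            rw [contrCoeff]; split_ifs <;> assumption
          obtain ⟨q, hq⟩ := this
          rw [nclass_sub_interchange_rev, hq, mul_assoc, mul_smul]
          exact ⟨_, rfl⟩
        · rw [nclass_sub_interchange α β X' l m x y hw hxy]
          exact zero_mem _)
    obtain ⟨z, hz⟩ := h
    rw [← hz]
    exact toModHbar_hbar_smul z
  have hx : x ∈ Submodule.span K[X] (Set.range (nclass (Q := Q) K α β)) := by
    rw [span_nclass]; trivial
  have hy : y ∈ Submodule.span K[X] (Set.range (nclass (Q := Q) K α β)) := by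
    rw [span_nclass]; trivial
  induction hx using Submodule.span_induction with
  | mem x hx =>
    obtain ⟨X, rfl⟩ := hx
    induction hy using Submodule.span_induction with
    | mem y hy =>
      obtain ⟨Y, rfl⟩ := hy
      exact hX X Y
    | zero => simp only [map_zero, zero_mul, mul_zero]
    | add x y _ _ hx hy => simp only [map_add, mul_add, add_mul, hx, hy]
    | smul c x _ hx => simp only [map_smul, smul_mul_assoc, mul_smul_comm, hx]
  | zero => simp only [map_zero, zero_mul, mul_zero]
  | add x y _ _ hx hy => simp only [map_add, mul_add, add_mul, hx, hy]
  | smul c x _ hx => simp only [map_smul, smul_mul_assoc, mul_smul_comm, hx]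

/-- As `ħ` divides both coefficients, `N / ħ N` and its quotient are commutative, and linear maps
into them extend to the symmetric algebras. -/
theorem quantization_reduction_symmetric {α β : K[X]} (hα : hbar K ∣ α) (hβ : hbar K ∣ β) :
    ∃ (l : SymmetricAlgebra K (Nat0 K (Q.PathAlg K)) ≃ₐ[K] ModHbar K (Q.N K α β))
      (v : SymmetricAlgebra K (Nat0 K (Q.Preproj K)) ≃ₐ[K] ModHbar K (Q.Rq K α β))
      (redS : SymmetricAlgebra K (Nat0 K (Q.PathAlg K)) →ₐ[K]
        SymmetricAlgebra K (Nat0 K (Q.Preproj K)))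
      (red : ModHbar K (Q.N K α β) →ₐ[K] ModHbar K (Q.Rq K α β)),
      (∀ x, l (SymmetricAlgebra.ι K _ (Q.cl K x)) = toModHbar K _ (Q.hat K α β x)) ∧
      (∀ x, v (SymmetricAlgebra.ι K _ (Q.pr K (Q.cl K x))) =
        toModHbar K _ (Q.toRq K α β (Q.hat K α β x))) ∧
      (∀ x, redS (SymmetricAlgebra.ι K _ x) = SymmetricAlgebra.ι K _ (Q.pr K x)) ∧
      (∀ z, red (toModHbar K _ z) = toModHbar K _ (Q.toRq K α β z)) ∧
      (∀ u, red (l u) = v (redS u)) := by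
  have hR : ∀ x y : ModHbar K (Q.Rq K α β), x * y = y * x := by
    have hredS : Function.Surjective (redMod Q α β) := by
      intro y
      obtain ⟨y, rfl⟩ := QuotBy.mk_surjective K[X] _ y
      obtain ⟨z, rfl⟩ := QuotBy.mk_surjective K[X] _ y
      exact ⟨toModHbar K _ z, rfl⟩
    intro x y
    obtain ⟨x, rfl⟩ := hredS x
    obtain ⟨y, rfl⟩ := hredS y
    rw [← map_mul, ← map_mul, modHbar_mul_comm hα hβ]
  obtain ⟨θ', hθ'⟩ := exists_classMap_red (Q := Q) (α := α) hβ
  obtain ⟨F, hF⟩ := SymmetricAlgebra.exists_lift (modHbar_mul_comm hα hβ) (classMap (Q := Q) α hβ)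
  obtain ⟨G, hG⟩ := SymmetricAlgebra.exists_lift hR θ'
  exact quantization_reduction hβ (SymmetricAlgebra.ι K _) (SymmetricAlgebra.ι K _)
    SymmetricAlgebra.adjoin_ι SymmetricAlgebra.adjoin_ι
    (fun x y => ⟨0, by rw [map_zero, mul_comm, sub_self]⟩) F hF G
    (fun x => (hG _).trans (hθ' x))
    (SymmetricAlgebra.lift (SymmetricAlgebra.ι K _ ∘ₗ Q.pr K))
    (fun x => SymmetricAlgebra.lift_ι_apply _ x)

/-- The commutator of two lifts for the normalization in which both coefficients are `-ħ`. -/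
lemma hat_commutator_neg_hbar (x y t : Q.PathAlg K) (ht : Q.cl K t = Q.cl K (Q.neckLin K x y)) :
    ∃ z : Q.N K (-hbar K) (-hbar K),
      Q.hat K (-hbar K) (-hbar K) x * Q.hat K (-hbar K) (-hbar K) y -
        Q.hat K (-hbar K) (-hbar K) y * Q.hat K (-hbar K) (-hbar K) x =
      -(hbar K • Q.hat K (-hbar K) (-hbar K) t) + hbar K ^ 2 • z := by
  obtain ⟨z₁, hz₁⟩ := hat_commutator (-hbar K) (-hbar K) x y
  obtain ⟨z₂, hz₂⟩ := hat_mem_of_cl_eq_zero (-hbar K) (-hbar K)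
    (t := t - Q.neckLin K x y) (by rw [map_sub, ht, sub_self])
  have h1 : (-hbar K * -hbar K) • z₁ = _ := hz₁
  have h2 : (-hbar K) • z₂ = _ := hz₂
  rw [map_sub] at h2
  have h3 : Q.hat K (-hbar K) (-hbar K) t =
      Q.hat K (-hbar K) (-hbar K) (Q.neckLin K x y) + (-hbar K) • z₂ := by rw [h2]; abel
  -- `z₁` is the error of the commutator formula, and `z₂` the error of replacing the necklace
  -- expression by another representative `t` of its class.
  refine ⟨z₁ - z₂, ?_⟩
  rw [h3, eq_comm]
  have h4 : Q.hat K (-hbar K) (-hbar K) x * Q.hat K (-hbar K) (-hbar K) y -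
        Q.hat K (-hbar K) (-hbar K) y * Q.hat K (-hbar K) (-hbar K) x =
      (-hbar K * -hbar K) • z₁ + (-hbar K) • Q.hat K (-hbar K) (-hbar K) (Q.neckLin K x y) := by
    rw [h1]; abel
  rw [h4]
  module

end Brackets

end QuiverData

/-! ### Sums over index assignments -/

section Assignments

variable {I : Type*}

/-- Extension of a function on `Fin n` by `none`. -/
def extendNone {n : ℕ} (k : Fin n → I) (i : ℕ) : Option I :=
  if h : i < n then some (k ⟨i, h⟩) else none

lemma extendNone_of_lt {n : ℕ} (k : Fin n → I) {i : ℕ} (h : i < n) :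
    extendNone k i = some (k ⟨i, h⟩) := dif_pos h

lemma extendNone_of_le {n : ℕ} (k : Fin n → I) {i : ℕ} (h : n ≤ i) : extendNone k i = none :=
  dif_neg (Nat.not_lt.2 h)

lemma extendNone_injective (n : ℕ) : Function.Injective (extendNone (I := I) (n := n)) := by
  intro k k' h
  funext i
  have := congrFun h i
  rwa [extendNone_of_lt k i.2, extendNone_of_lt k' i.2, Option.some_inj] at this

/-- Insert two indices at the positions `p` and `p + 1`. -/
def insertTwo (p : ℕ) (a b : I) (f : ℕ → Option I) (i : ℕ) : Option I :=
  if i = p then some a else if i = p + 1 then some b else f (unskip p i)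

lemma insertTwo_left (p : ℕ) (a b : I) (f : ℕ → Option I) : insertTwo p a b f p = some a :=
  if_pos rfl

lemma insertTwo_right (p : ℕ) (a b : I) (f : ℕ → Option I) :
    insertTwo p a b f (p + 1) = some b := by simp [insertTwo]

lemma insertTwo_of_ne {p i : ℕ} (h : i ≠ p) (h' : i ≠ p + 1) (a b : I) (f : ℕ → Option I) :
    insertTwo p a b f i = f (unskip p i) := by simp [insertTwo, h, h']

lemma insertTwo_skip (p : ℕ) (a b : I) (f : ℕ → Option I) (i : ℕ) :
    insertTwo p a b f (skip p i) = f i := by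
  rw [insertTwo_of_ne (skip_ne p i).1 (skip_ne p i).2, unskip_skip]

variable [Fintype I]

open Classical in
variable (I) in
/-- The assignments of an index to each of the positions `0, …, n - 1`. -/
def assignments (n : ℕ) : Finset (ℕ → Option I) := Finset.univ.image (extendNone (n := n))

/-- Assignments are functions on all of `ℕ`, with value `none` beyond the word, so that permutations
of `ℕ` and words of different lengths can be combined without casts. -/
lemma mem_assignments {n : ℕ} {f : ℕ → Option I} :
    f ∈ assignments I n ↔ (∀ i < n, ∃ a, f i = some a) ∧ ∀ i, n ≤ i → f i = none := by
  classical
  simp only [assignments, Finset.mem_image, Finset.mem_univ, true_and]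
  constructor
  · rintro ⟨k, rfl⟩
    exact ⟨fun i h => ⟨_, extendNone_of_lt k h⟩, fun i h => extendNone_of_le k h⟩
  · rintro ⟨h, h'⟩
    choose k hk using h
    refine ⟨fun i => k i i.2, ?_⟩
    funext i
    by_cases hi : i < n
    · rw [extendNone_of_lt _ hi, hk]
    · rw [extendNone_of_le _ (Nat.not_lt.1 hi), h' i (Nat.not_lt.1 hi)]

variable {M : Type*} [AddCommMonoid M]

lemma sum_assignments (n : ℕ) (f : (ℕ → Option I) → M) :
    ∑ k ∈ assignments I n, f k = ∑ k : Fin n → I, f (extendNone k) := by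
  classical
  exact Finset.sum_image fun _ _ _ _ h => extendNone_injective n h

/-- Place the assignment `g` after the first `n` positions of `f`. -/
def appendAt (n : ℕ) (f g : ℕ → Option I) (i : ℕ) : Option I := if i < n then f i else g (i - n)

lemma sum_assignments_add (n m : ℕ) (F : (ℕ → Option I) → M) :
    ∑ k ∈ assignments I (n + m), F k =
      ∑ f ∈ assignments I n, ∑ g ∈ assignments I m, F (appendAt n f g) := by
  rw [← Finset.sum_product']
  refine Finset.sum_nbij' (fun k => (fun i => if i < n then k i else none, fun i => k (n + i)))
    (fun p => appendAt n p.1 p.2) ?_ ?_ ?_ ?_ ?_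
  · intro k hk
    rw [mem_assignments] at hk
    rw [Finset.mem_product, mem_assignments, mem_assignments]
    refine ⟨⟨fun i hi => ?_, fun i hi => ?_⟩, fun i hi => hk.1 _ (by omega),
      fun i hi => hk.2 _ (by omega)⟩
    · simpa [hi] using hk.1 i (by omega)
    · simp [Nat.not_lt.2 hi]
  · rintro ⟨f, g⟩ hp
    rw [Finset.mem_product, mem_assignments, mem_assignments] at hp
    rw [mem_assignments]
    refine ⟨fun i hi => ?_, fun i hi => ?_⟩
    · by_cases h : i < n
      · simpa [appendAt, h] using hp.1.1 i h
      · simpa [appendAt, h] using hp.2.1 (i - n) (by omega)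
    · simpa [appendAt, show ¬ i < n by omega] using hp.2.2 (i - n) (by omega)
  · intro k _
    funext i
    by_cases h : i < n
    · simp [appendAt, h]
    · simp [appendAt, h, show n + (i - n) = i by omega]
  · rintro ⟨f, g⟩ hp
    rw [Finset.mem_product, mem_assignments, mem_assignments] at hp
    refine Prod.ext ?_ ?_
    · funext i
      by_cases h : i < n
      · simp [appendAt, h]
      · simpa [h] using (hp.1.2 i (Nat.not_lt.1 h)).symm
    · funext i
      simp [appendAt]
  · intro k _
    congr 1
    funext i
    by_cases h : i < n
    · simp [appendAt, h]
    · simp [appendAt, h, show n + (i - n) = i by omega]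

/-- Put an index in front of an assignment. -/
def consAt (a : I) (f : ℕ → Option I) : ℕ → Option I
  | 0 => some a
  | i + 1 => f i

lemma sum_assignments_zero (F : (ℕ → Option I) → M) :
    ∑ k ∈ assignments I 0, F k = F fun _ => none := by
  rw [sum_assignments, Fintype.sum_unique]
  rfl

lemma sum_assignments_succ (n : ℕ) (F : (ℕ → Option I) → M) :
    ∑ k ∈ assignments I (n + 1), F k = ∑ a, ∑ f ∈ assignments I n, F (consAt a f) := by
  rw [sum_assignments, ← (Fin.consEquiv fun _ => I).sum_comp, Fintype.sum_prod_type]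
  refine Finset.sum_congr rfl fun a _ => ?_
  rw [sum_assignments]
  refine Finset.sum_congr rfl fun k _ => congrArg F ?_
  funext i
  cases i with
  | zero => rfl
  | succ i =>
    by_cases h : i < n
    · rw [extendNone_of_lt _ (Nat.succ_lt_succ h)]
      exact (extendNone_of_lt k h).symm
    · rw [extendNone_of_le _ (by omega)]
      exact (extendNone_of_le k (Nat.not_lt.1 h)).symm

/-- This isolates the two indices that belong to the arrows at adjacent heights `p` and `p + 1`. -/
lemma sum_assignments_insertTwo {p n : ℕ} (hp : p ≤ n) (F : (ℕ → Option I) → M) :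
    ∑ k ∈ assignments I (n + 2), F k =
      ∑ f ∈ assignments I n, ∑ a, ∑ b, F (insertTwo p a b f) := by
  obtain ⟨m, rfl⟩ := Nat.exists_eq_add_of_le hp
  rw [add_assoc, sum_assignments_add, sum_assignments_add]
  refine Finset.sum_congr rfl fun f _ => ?_
  have h1 : ∀ G : (ℕ → Option I) → M, ∑ h ∈ assignments I (m + 2), G h =
      ∑ g ∈ assignments I m, ∑ a, ∑ b, G (consAt a (consAt b g)) := fun G => by
    rw [sum_assignments_succ, Finset.sum_comm (s := assignments I m)]
    refine Finset.sum_congr rfl fun a _ => ?_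
    rw [sum_assignments_succ, Finset.sum_comm]
  rw [h1]
  refine Finset.sum_congr rfl fun g _ => Finset.sum_congr rfl fun a _ =>
    Finset.sum_congr rfl fun b _ => congrArg F ?_
  funext i
  rcases lt_or_ge i p with h | h
  · simp [appendAt, insertTwo, unskip, h, h.ne, show i ≠ p + 1 by omega]
  · obtain ⟨j, rfl⟩ := Nat.exists_eq_add_of_le h
    match j with
    | 0 => simp [appendAt, insertTwo, consAt]
    | 1 => simp [appendAt, insertTwo, consAt]
    | j + 2 =>
      simp [appendAt, insertTwo, unskip, consAt, show p + (j + 2) - 2 = p + j by omega]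

end Assignments

/-! ### Ordered products of matrix entries -/

section OrdProd

variable {I : Type*} {A : Type*} [Ring A]

/-- The entries of a matrix, extended by zero. -/
def ent (M : Matrix I I A) : Option I → Option I → A
  | some a, some b => M a b
  | _, _ => 0

/-- The ordered product of matrix entries with prescribed rows and columns. -/
def ordProd : List (Matrix I I A) → (ℕ → Option I) → (ℕ → Option I) → A
  | [], _, _ => 1
  | M :: L, f, g => ent M (f 0) (g 0) * ordProd L (fun i => f (i + 1)) fun i => g (i + 1)

lemma ordProd_append (L L' : List (Matrix I I A)) (f g : ℕ → Option I) :
    ordProd (L ++ L') f g =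
      ordProd L f g * ordProd L' (fun i => f (L.length + i)) fun i => g (L.length + i) := by
  induction L generalizing f g with
  | nil => simp [ordProd]
  | cons M L ih =>
    rw [List.cons_append, ordProd, ih, ordProd, mul_assoc, List.length_cons]
    simp only [show ∀ i, L.length + i + 1 = L.length + 1 + i from fun i => by omega]

lemma ordProd_congr (L : List (Matrix I I A)) {f g f' g' : ℕ → Option I}
    (hf : ∀ i < L.length, f i = f' i) (hg : ∀ i < L.length, g i = g' i) :
    ordProd L f g = ordProd L f' g' := by
  induction L generalizing f g f' g' with
  | nil => rfl
  | cons M L ih =>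
    rw [ordProd, ordProd, hf 0 (by simp), hg 0 (by simp)]
    congr 1
    exact ih (fun i hi => hf _ (by simpa using hi)) fun i hi => hg _ (by simpa using hi)

lemma ordProd_extendNone {B : Type*} (L : List B) (M : B → Matrix I I A)
    (k k' : Fin L.length → I) :
    ordProd (L.map M) (extendNone k) (extendNone k') =
      (List.ofFn fun h : Fin L.length => M (L.get h) (k h) (k' h)).prod := by
  induction L with
  | nil => simp [ordProd]
  | cons N L ih =>
    rw [List.map_cons, ordProd, List.ofFn_succ, List.prod_cons]
    congr 1
    refine Eq.trans ?_ (ih (fun i => k i.succ) fun i => k' i.succ)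
    refine ordProd_congr _ (fun i hi => ?_) fun i hi => ?_ <;>
    · rw [List.length_map] at hi
      rw [extendNone_of_lt _ hi, extendNone_of_lt _ (Nat.succ_lt_succ hi)]
      rfl

/-- Each factor of a nonzero product is nonzero. This later forces every index to lie in the block
of its arrow. -/
lemma ent_ne_zero_of_ordProd {L : List (Matrix I I A)} {f g : ℕ → Option I}
    (h : ordProd L f g ≠ 0) {i : ℕ} {M : Matrix I I A} (hi : L[i]? = some M) :
    ent M (f i) (g i) ≠ 0 := by
  induction L generalizing f g i with
  | nil => simp at hi
  | cons N L ih =>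
    rw [ordProd] at h
    cases i with
    | zero =>
      simp only [List.getElem?_cons_zero, Option.some.injEq] at hi
      subst hi
      exact left_ne_zero_of_mul h
    | succ i => exact ih (right_ne_zero_of_mul h) (by simpa using hi)

variable [Fintype I]

/-- The chain sum `∑ M₁(a, k₁) M₂(k₁, k₂) ⋯ M_n(k_{n-1}, b)` computes the entries of a product. -/
lemma sum_ordProd_chain [DecidableEq I] (M : Matrix I I A) (L : List (Matrix I I A)) (a b : I) :
    ∑ f ∈ assignments I L.length,
      ordProd (M :: L) (consAt a f) (fun i => if i < L.length then f i else some b) =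
    (M * L.prod) a b := by
  induction L generalizing M a with
  | nil =>
    rw [List.length_nil, sum_assignments_zero, List.prod_nil, mul_one]
    simp [ordProd, ent, consAt]
  | cons N L ih =>
    rw [List.length_cons, sum_assignments_succ, Matrix.mul_apply]
    refine Finset.sum_congr rfl fun c _ => ?_
    rw [List.prod_cons, ← ih N c, Finset.mul_sum]
    refine Finset.sum_congr rfl fun f _ => ?_
    rw [ordProd]
    congr 1
    refine ordProd_congr _ (fun i _ => rfl) fun i _ => ?_
    simp [consAt]

/-- A cyclic sum computes the trace of a product. -/
lemma sum_ordProd_cycle [DecidableEq I] (M : Matrix I I A) (L : List (Matrix I I A)) (σ : ℕ → ℕ)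
    (hσ : ∀ i < L.length, σ i = i + 1) (hσ' : σ L.length = 0) :
    ∑ f ∈ assignments I (L.length + 1), ordProd (M :: L) f (fun i => f (σ i)) =
      (M * L.prod).trace := by
  rw [sum_assignments_succ, Matrix.trace]
  refine Finset.sum_congr rfl fun a _ => ?_
  rw [Matrix.diag_apply, ← sum_ordProd_chain]
  refine Finset.sum_congr rfl fun f _ => ordProd_congr _ (fun _ _ => rfl) fun i hi => ?_
  rw [List.length_cons] at hi
  by_cases h : i < L.length
  · rw [if_pos h, hσ i h]; rfl
  · rw [if_neg h, show i = L.length by omega, hσ']; rfl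

end OrdProd

/-! ### Differential operators on representation spaces -/

namespace DiffOp

variable {K : Type w} [Field K] {T : Type u} [CommRing T] [Algebra K T]

lemma fn_add (f g : T) : fn K (f + g) = fn K f + fn K g :=
  (mk_rel (DRel.fn_add f g)).trans (map_add _ _ _)

lemma fn_mul_fn (f g : T) : fn K f * fn K g = fn K (f * g) :=
  (map_mul _ _ _).symm.trans (mk_rel (DRel.fn_mul f g))

lemma fn_algebraMap (c : K) : fn K (algebraMap K T c) = algebraMap K[X] (DiffOp K T) (C c) :=
  (mk_rel (DRel.fn_const c)).trans (AlgHom.commutes _ _)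

lemma der_add (D D' : Derivation K T T) : der (D + D') = der D + der D' :=
  (mk_rel (DRel.der_add D D')).trans (map_add _ _ _)

lemma fn_mul_der (f : T) (D : Derivation K T T) : fn K f * der D = der (f • D) :=
  (map_mul _ _ _).symm.trans (mk_rel (DRel.fn_der f D))

lemma der_mul_fn (D : Derivation K T T) (f : T) :
    der D * fn K f = fn K f * der D + hbar K • fn K (D f) := by
  rw [fn_mul_der]
  refine (map_mul _ _ _).symm.trans ((mk_rel (DRel.der_fn D f)).trans ?_)
  rw [map_add, map_smul]; rfl

lemma der_commutator (D D' : Derivation K T T) :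
    der D * der D' - der D' * der D = hbar K • der ⁅D, D'⁆ := by
  refine Eq.trans ?_ ((mk_rel (DRel.der_der D D')).trans (map_smul _ _ _))
  rw [map_sub, map_mul, map_mul]; rfl

lemma fn_zero : fn K (0 : T) = 0 := by
  have := fn_add (K := K) (0 : T) 0
  rwa [add_zero, left_eq_add] at this

lemma fn_one : fn K (1 : T) = 1 := by
  rw [← map_one (algebraMap K T), fn_algebraMap, map_one, map_one]

lemma der_zero : der (0 : Derivation K T T) = 0 := by
  have := der_add (0 : Derivation K T T) 0
  rwa [add_zero, left_eq_add] at this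

variable (K T) in
/-- Functions as differential operators, as a ring homomorphism. -/
def fnHom : T →+* DiffOp K T where
  toFun := fn K
  map_one' := fn_one
  map_mul' f g := (fn_mul_fn f g).symm
  map_zero' := fn_zero
  map_add' := fn_add

variable (K T) in
/-- Derivations as differential operators, as an additive map. -/
def derHom : Derivation K T T →+ DiffOp K T := ⟨⟨der, der_zero⟩, der_add⟩

lemma der_sum {ι : Type*} (s : Finset ι) (D : ι → Derivation K T T) :
    der (∑ i ∈ s, D i) = ∑ i ∈ s, der (D i) := map_sum (derHom K T) D s

lemma fn_sub (f g : T) : fn K (f - g) = fn K f - fn K g := map_sub (fnHom K T) f g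

lemma der_sub (D D' : Derivation K T T) : der (D - D') = der D - der D' :=
  map_sub (derHom K T) D D'

end DiffOp

namespace QuiverData

variable {V : Type u} {E : Type v} {Q : QuiverData V E} {d : V → ℕ} {K : Type w} [Field K]
variable [DecidableEq V] [DecidableEq E]

open DiffOp

lemma derMat_coordMat (a b : E) (p q r s : Idx d) :
    Q.derMat d K b r s (Q.coordMat d K a p q) =
      if b = a ∧ p.1 = Q.tgt a ∧ q.1 = Q.src a ∧ p = s ∧ q = r then 1 else 0 := by
  rw [derMat, coordMat]
  by_cases h : p.1 = Q.tgt a ∧ q.1 = Q.src a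
  · rw [dif_pos h]
    by_cases h' : s.1 = Q.tgt b ∧ r.1 = Q.src b
    · rw [dif_pos h', MvPolynomial.pderiv_X]
      by_cases e : b = a ∧ p = s ∧ q = r
      · obtain ⟨rfl, rfl, rfl⟩ := e
        rw [Pi.single_eq_same, if_pos ⟨rfl, h.1, h.2, rfl, rfl⟩]
      · rw [if_neg fun e' => e ⟨e'.1, e'.2.2.2⟩, Pi.single_eq_of_ne]
        intro e'
        simp only [Subtype.mk.injEq, Prod.mk.injEq] at e'
        exact e ⟨e'.1.symm, e'.2.1, e'.2.2⟩
    · rw [dif_neg h', if_neg]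
      · rfl
      · rintro ⟨rfl, h1, h2, rfl, rfl⟩
        exact h' ⟨h1, h2⟩
  · rw [dif_neg h, map_zero, if_neg fun e => h ⟨e.2.1, e.2.2.1⟩]

lemma lie_derMat (a b : E) (p q r s : Idx d) :
    ⁅Q.derMat d K a p q, Q.derMat d K b r s⁆ = 0 := by
  refine MvPolynomial.derivation_ext fun c => ?_
  obtain ⟨⟨e, i, j⟩, h⟩ := c
  have : (MvPolynomial.X ⟨(e, i, j), h⟩ : Q.RepRing d K) = Q.coordMat d K e i j := by
    rw [coordMat, dif_pos h]
  rw [Derivation.commutator_apply, this, derMat_coordMat, derMat_coordMat]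
  split_ifs <;> simp

/-- Coordinates commute with each other, and so do partial derivatives. The only nonzero commutator
is that of a coordinate with its own derivative, which is the source of the coefficient `-ħ {x,
x^*}`. -/
lemma opMat_commutator (x y : Letter E) (a b r s : Idx d) :
    Q.opMat d K x a b * Q.opMat d K y r s - Q.opMat d K y r s * Q.opMat d K x a b =
      if y = rev x ∧ a.1 = Q.ltgt x ∧ b.1 = Q.lsrc x ∧ a = s ∧ b = r then
        (-hbar K * (letterBracket x (rev x) : K[X])) • (1 : Q.RepDiff d K) else 0 := by
  rcases x with x | x <;> rcases y with y | y
  · rw [if_neg (by simp)]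
    simp only [opMat]
    rw [fn_mul_fn, fn_mul_fn, mul_comm, sub_self]
  · simp only [opMat]
    rw [der_mul_fn, sub_add_cancel_left, derMat_coordMat]
    simp only [Sum.swap_inl, Sum.inr.injEq, ltgt, lsrc, letterBracket, if_true, Int.cast_one,
      mul_one]
    split_ifs
    · rw [fn_one, neg_smul]
    · rw [fn_zero, smul_zero, neg_zero]
  · simp only [opMat]
    rw [der_mul_fn, add_sub_cancel_left, derMat_coordMat]
    simp only [Sum.swap_inr, Sum.inl.injEq, ltgt, lsrc, letterBracket, if_true, Int.cast_one,
      mul_one, Int.cast_neg, mul_neg, neg_neg]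
    by_cases h : y = x
    · subst h
      by_cases h' : a.1 = Q.src y ∧ b.1 = Q.tgt y ∧ a = s ∧ b = r
      · obtain ⟨h1, h2, rfl, rfl⟩ := h'
        rw [if_pos ⟨rfl, h2, h1, rfl, rfl⟩, if_pos ⟨rfl, h1, h2, rfl, rfl⟩, fn_one]
      · rw [if_neg, if_neg, fn_zero, smul_zero]
        · exact fun e => h' e.2
        · rintro ⟨_, h1, h2, rfl, rfl⟩
          exact h' ⟨h2, h1, rfl, rfl⟩
    · rw [if_neg fun e => h e.1.symm, if_neg fun e => h e.1, fn_zero, smul_zero]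
  · rw [if_neg (by simp)]
    simp only [opMat]
    rw [der_commutator, lie_derMat, der_zero, smul_zero]

lemma opMat_eq_zero {x : Letter E} {a b : Idx d} (h : ¬ (a.1 = Q.ltgt x ∧ b.1 = Q.lsrc x)) :
    Q.opMat d K x a b = 0 := by
  rcases x with x | x
  · change ¬ (a.1 = Q.tgt x ∧ b.1 = Q.src x) at h
    simp only [opMat, coordMat]
    rw [dif_neg h, fn_zero]
  · simp only [opMat, derMat]
    rw [dif_neg fun e => h ⟨e.2, e.1⟩, der_zero]

lemma ent_commutator (x y : Letter E) (a r : Idx d) (b s : Option (Idx d)) :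
    ent (Q.opMat d K x) (some a) b * ent (Q.opMat d K y) (some r) s -
      ent (Q.opMat d K y) (some r) s * ent (Q.opMat d K x) (some a) b =
      if y = rev x ∧ a.1 = Q.ltgt x ∧ r.1 = Q.lsrc x ∧ s = some a ∧ b = some r then
        (-hbar K * (letterBracket x (rev x) : K[X])) • (1 : Q.RepDiff d K) else 0 := by
  rcases b with _ | b
  · simp [ent]
  rcases s with _ | s
  · simp [ent]
  simp only [ent, Option.some_inj]
  rw [opMat_commutator]
  refine if_congr ?_ rfl rfl
  constructor
  · rintro ⟨h, h1, h2, rfl, rfl⟩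
    exact ⟨h, h1, h2, rfl, rfl⟩
  · rintro ⟨h, h1, h2, rfl, rfl⟩
    exact ⟨h, h1, h2, rfl, rfl⟩

variable [Fintype V]

variable (Q d K) in
/-- The sum over all indices in the quantum trace. -/
def indexSum (l : List (Letter E)) (σ : ℕ → ℕ) : Q.RepDiff d K :=
  ∑ f ∈ assignments (Idx d) l.length, ordProd (l.map (Q.opMat d K)) f fun i => f (σ i)

variable (d K) in
/-- The contribution of the vertices to the quantum trace. -/
def vertDim (s : Multiset V) : K[X] := (s.map fun i => (d i : K[X])).prod

lemma traceFormula_eq (X : Q.Diagram) :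
    Q.traceFormula d K X = vertDim d K X.verts • Q.indexSum d K X.word X.next := by
  rw [traceFormula, vertDim, indexSum, sum_assignments]
  congr 1
  refine Finset.sum_congr rfl fun k _ => ?_
  rw [← ordProd_extendNone X.word (Q.opMat d K) k fun h => k ⟨X.next h, X.next_lt h.2⟩]
  refine ordProd_congr _ (fun _ _ => rfl) fun i hi => ?_
  rw [List.length_map] at hi
  rw [extendNone_of_lt _ hi, extendNone_of_lt _ (X.next_lt hi)]

lemma vertDim_add (s t : Multiset V) : vertDim d K (s + t) = vertDim d K s * vertDim d K t := by
  rw [vertDim, Multiset.map_add, Multiset.prod_add]; rfl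

lemma indexSum_append (l m : List (Letter E)) (σ τ : Equiv.Perm ℕ)
    (hσ : ∀ k, l.length ≤ k → σ k = k) :
    Q.indexSum d K (l ++ m) (σ * shiftPerm l.length τ : Equiv.Perm ℕ) =
      Q.indexSum d K l σ * Q.indexSum d K m τ := by
  have hlt : ∀ i < l.length, σ i < l.length := fun i hi => by
    by_contra h
    have h1 := hσ _ (Nat.not_lt.1 h)
    exact h ((σ.injective h1).symm ▸ hi)
  rw [indexSum, List.length_append, sum_assignments_add, indexSum, indexSum, Finset.sum_mul_sum]
  refine Finset.sum_congr rfl fun f _ => Finset.sum_congr rfl fun g _ => ?_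
  rw [List.map_append, ordProd_append, List.length_map]
  congr 1
  · refine ordProd_congr _ (fun i hi => ?_) fun i hi => ?_ <;> rw [List.length_map] at hi
    · simp [appendAt, hi]
    · simp [shiftPerm_apply, appendAt, hi, hlt i hi]
  · refine ordProd_congr _ (fun i hi => ?_) fun i hi => ?_
    · simp [appendAt]
    · simp [shiftPerm_apply, appendAt, hσ]

lemma traceFormula_mul (X Y : Q.Diagram) :
    Q.traceFormula d K (X * Y) = Q.traceFormula d K X * Q.traceFormula d K Y := by
  rw [traceFormula_eq, traceFormula_eq, traceFormula_eq, Diagram.verts_mul, Diagram.word_mul,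
    Diagram.next_mul, vertDim_add, indexSum_append _ _ _ _ X.next_fix, smul_mul_smul_comm]

lemma traceFormula_one : Q.traceFormula d K (1 : Q.Diagram) = 1 := by
  rw [traceFormula_eq, Diagram.word_one, Diagram.verts_one, indexSum, List.length_nil,
    sum_assignments_zero]
  simp [vertDim, ordProd]

end QuiverData

/-! ### The quantum trace -/

/-- A function with the same value at `p` and at its successor does not see whether `p` is visited.
-/
lemma apply_bypass {M : Type*} (F : ℕ → M) (p : ℕ) (σ : Equiv.Perm ℕ) (h : F p = F (σ p)) (j : ℕ) :
    F (bypass p σ j) = F (σ j) := by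
  rw [bypass, Equiv.Perm.mul_apply]
  by_cases h1 : σ j = p
  · rw [h1, Equiv.swap_apply_left, h]
  · by_cases h2 : σ j = σ p
    · rw [h2, Equiv.swap_apply_right, h]
    · rw [Equiv.swap_apply_of_ne_of_ne h1 h2]

/-- The Kronecker deltas of the commutator say that the index at `p` equals the one after `p + 1`,
and the index at `p + 1` the one after `p`. Under these equalities the indices along `σ` and along
the reconnected permutation agree. -/
lemma apply_reconnect {M : Type*} (F : ℕ → M) (p : ℕ) (σ : Equiv.Perm ℕ)
    (h : F p = F (σ (p + 1))) (h' : F (p + 1) = F (σ p)) {j : ℕ} (hj : j ≠ p) (hj' : j ≠ p + 1) :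
    F (reconnect p σ j) = F (σ j) := by
  have h1 := apply_bypass F p (σ * Equiv.swap p (p + 1)) (by simpa using h)
  rw [reconnect, apply_bypass F (p + 1), h1, Equiv.Perm.mul_apply,
    Equiv.swap_apply_of_ne_of_ne hj hj']
  rw [h1, Equiv.Perm.mul_apply, Equiv.swap_apply_right, h']

namespace QuiverData

variable {V : Type u} {E : Type v} {Q : QuiverData V E} {d : V → ℕ} {K : Type w} [Field K]
variable [DecidableEq V] [DecidableEq E] [Fintype V]

lemma indexSum_two (l m : List (Letter E)) (x y : Letter E) (σ : ℕ → ℕ) :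
    Q.indexSum d K (l ++ x :: y :: m) σ =
      ∑ f ∈ assignments (Idx d) (l ++ m).length, ∑ a, ∑ b,
        ordProd ((l ++ x :: y :: m).map (Q.opMat d K)) (insertTwo l.length a b f)
          fun i => insertTwo l.length a b f (σ i) := by
  rw [indexSum, show (l ++ x :: y :: m).length = (l ++ m).length + 2 by simp; omega,
    sum_assignments_insertTwo (p := l.length) (by simp)]

lemma ordProd_two (l m : List (Letter E)) (x y : Letter E) (f g : ℕ → Option (Idx d)) :
    ordProd ((l ++ x :: y :: m).map (Q.opMat d K)) f g =
      ordProd (l.map (Q.opMat d K)) f g *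
        ((ent (Q.opMat d K x) (f l.length) (g l.length) *
          ent (Q.opMat d K y) (f (l.length + 1)) (g (l.length + 1))) *
        ordProd (m.map (Q.opMat d K)) (fun i => f (l.length + 2 + i))
          fun i => g (l.length + 2 + i)) := by
  rw [List.map_append, List.map_cons, List.map_cons, ordProd_append, ordProd, ordProd,
    List.length_map, mul_assoc]
  exact congrArg₂ (· * ·) rfl (congrArg₂ (· * ·) rfl (congrArg₂ (· * ·) rfl
    (ordProd_congr _ (fun i _ => congrArg f (by omega)) fun i _ => congrArg g (by omega))))

lemma insertTwo_swap {I : Type*} (p : ℕ) (a b : I) (f : ℕ → Option I) (i : ℕ) :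
    insertTwo p a b f (Equiv.swap p (p + 1) i) = insertTwo p b a f i := by
  by_cases h : i = p
  · subst h; rw [Equiv.swap_apply_left, insertTwo_right, insertTwo_left]
  · by_cases h' : i = p + 1
    · subst h'; rw [Equiv.swap_apply_right, insertTwo_right, insertTwo_left]
    · rw [Equiv.swap_apply_of_ne_of_ne h h', insertTwo_of_ne h h', insertTwo_of_ne h h']

/-- With the two indices renamed, the two products differ only in the order of two adjacent entries.
Their commutator is a scalar times Kronecker deltas: the two entries disappear, and the deltas
identify indices so that the remaining entries are linked by the reconnected permutation. -/
lemma indexSum_sub_interchange (l m : List (Letter E)) (x y : Letter E) (σ : Equiv.Perm ℕ) :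
    Q.indexSum d K (l ++ x :: y :: m) σ - Q.indexSum d K (l ++ y :: x :: m)
        (Equiv.swap l.length (l.length + 1) * σ * Equiv.swap l.length (l.length + 1) :
          Equiv.Perm ℕ) =
      ∑ f ∈ assignments (Idx d) (l ++ m).length, ∑ a, ∑ b,
        if y = rev x ∧ a.1 = Q.ltgt x ∧ b.1 = Q.lsrc x ∧
          insertTwo l.length a b f (σ (l.length + 1)) = some a ∧
          insertTwo l.length a b f (σ l.length) = some b then
        (-hbar K * (letterBracket x (rev x) : K[X])) •
          ordProd ((l ++ m).map (Q.opMat d K)) f fun i =>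
            f (unskip l.length (reconnect l.length σ (skip l.length i)))
        else 0 := by
  rw [indexSum_two, indexSum_two, ← Finset.sum_sub_distrib]
  refine Finset.sum_congr rfl fun f _ => ?_
  -- Exchanging the two sums renames the indices of the interchanged product, whose arrows stand in
  -- the opposite order.
  rw [Finset.sum_comm (f := fun a b => ordProd ((l ++ y :: x :: m).map (Q.opMat d K))
    (insertTwo l.length a b f) _), ← Finset.sum_sub_distrib]
  refine Finset.sum_congr rfl fun a _ => ?_
  rw [← Finset.sum_sub_distrib]
  refine Finset.sum_congr rfl fun b _ => ?_
  set p := l.length with hp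
  set F := insertTwo p a b f with hF
  have e1 : ordProd ((l ++ y :: x :: m).map (Q.opMat d K)) (insertTwo p b a f)
      (fun i => insertTwo p b a f
        ((Equiv.swap p (p + 1) * σ * Equiv.swap p (p + 1) : Equiv.Perm ℕ) i)) =
      ordProd (l.map (Q.opMat d K)) F (fun i => F (σ i)) *
        ((ent (Q.opMat d K y) (F (p + 1)) (F (σ (p + 1))) *
          ent (Q.opMat d K x) (F p) (F (σ p))) *
        ordProd (m.map (Q.opMat d K)) (fun i => F (p + 2 + i)) fun i => F (σ (p + 2 + i))) := by
    have h1 : ∀ i, insertTwo p b a f i = F (Equiv.swap p (p + 1) i) :=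
      fun i => (insertTwo_swap p a b f i).symm
    have h2 : ∀ i, insertTwo p b a f
        ((Equiv.swap p (p + 1) * σ * Equiv.swap p (p + 1) : Equiv.Perm ℕ) i) =
        F (σ (Equiv.swap p (p + 1) i)) := fun i => by
      rw [h1, Equiv.Perm.mul_apply, Equiv.Perm.mul_apply, Equiv.swap_apply_self]
    simp only [h2]
    rw [ordProd_two, ← hp, Equiv.swap_apply_left, Equiv.swap_apply_right, h1, h1,
      Equiv.swap_apply_left, Equiv.swap_apply_right]
    congr 1
    · refine ordProd_congr _ (fun i hi => ?_) fun i hi => ?_ <;> rw [List.length_map] at hi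
      · rw [h1, Equiv.swap_apply_of_ne_of_ne (by omega) (by omega)]
      · rw [Equiv.swap_apply_of_ne_of_ne (by omega) (by omega)]
    · congr 1
      refine ordProd_congr _ (fun i hi => ?_) fun i hi => ?_
      · rw [h1, Equiv.swap_apply_of_ne_of_ne (by omega) (by omega)]
      · rw [Equiv.swap_apply_of_ne_of_ne (by omega) (by omega)]
  rw [e1, ordProd_two, ← hp, ← mul_sub, ← sub_mul, show F p = some a from insertTwo_left _ _ _ _,
    show F (p + 1) = some b from insertTwo_right _ _ _ _, ent_commutator]
  split_ifs with h
  · obtain ⟨-, -, -, ha, hb⟩ := h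
    rw [smul_mul_assoc, one_mul, mul_smul_comm]
    congr 1
    have key : ∀ i, F (σ (skip p i)) = f (unskip p (reconnect p σ (skip p i))) := fun i => by
      have hne := reconnect_ne p σ (skip_ne p i).1 (skip_ne p i).2
      rw [← apply_reconnect F p σ
        ((insertTwo_left _ _ _ _).trans ha.symm) ((insertTwo_right _ _ _ _).trans hb.symm)
        (skip_ne p i).1 (skip_ne p i).2, hF, insertTwo_of_ne hne.1 hne.2]
    have key' : ∀ i, F (skip p i) = f i := insertTwo_skip p a b f
    rw [List.map_append, ordProd_append, List.length_map, ← hp]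
    congr 1
    · refine ordProd_congr _ (fun i hi => ?_) fun i hi => ?_ <;> rw [List.length_map, ← hp] at hi
      · rw [← key', skip, if_pos hi]
      · rw [← key]; simp only [skip, if_pos hi]
    · have hs : ∀ i, skip p (p + i) = p + 2 + i := fun i => by
        rw [skip, if_neg (by omega)]; omega
      refine ordProd_congr _ (fun i hi => ?_) fun i hi => ?_
      · rw [← key', hs]
      · rw [← key, hs]
  · rw [zero_mul, mul_zero]

lemma sum_block (v : V) : ∑ a : Idx d, (if a.1 = v then (1 : K[X]) else 0) = (d v : K[X]) := by
  rw [Fintype.sum_sigma, Finset.sum_eq_single v (fun i _ hi => by simp [hi]) (by simp)]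
  simp

/-- Counts the index pairs allowed by the deltas. Each index is either fixed by its neighbours or
free in the block of a vertex, and the free ones match the vertices created by `contract`, with `s`
and `t` the source and the target of the removed arrow. -/
lemma card_insertions (f : ℕ → Option (Idx d)) (σ : Equiv.Perm ℕ) (p : ℕ) (s t : V)
    (hA : σ (p + 1) ≠ p → σ (p + 1) ≠ p + 1 →
      ∃ a : Idx d, f (unskip p (σ (p + 1))) = some a ∧ a.1 = t)
    (hB : σ p ≠ p → σ p ≠ p + 1 → ∃ b : Idx d, f (unskip p (σ p)) = some b ∧ b.1 = s)
    (hC : σ p = p ∨ σ (p + 1) = p + 1 → s = t) :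
    ∑ a : Idx d, ∑ b : Idx d, (if a.1 = t ∧ b.1 = s ∧
      insertTwo p a b f (σ (p + 1)) = some a ∧ insertTwo p a b f (σ p) = some b
      then (1 : K[X]) else 0) =
    vertDim d K ((if σ (p + 1) = p then {t} else 0) + (if σ p = p + 1 then {s} else 0) +
      (if σ p = p ∧ σ (p + 1) = p + 1 then {t} else 0)) := by
  have hne : σ p ≠ σ (p + 1) := fun h => by have := σ.injective h; omega
  have hv0 : vertDim d K (0 : Multiset V) = 1 := by simp [vertDim]
  have hv1 : ∀ v : V, vertDim d K ({v} : Multiset V) = (d v : K[X]) := fun v => by simp [vertDim]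
  rw [vertDim_add, vertDim_add]
  simp only [apply_ite (vertDim d K), hv0, hv1]
  -- Here the condition on `a` reads `a = a`: the index is free in the block of `t`.
  by_cases h1 : σ (p + 1) = p
  · have hA1 : ∀ a b : Idx d, insertTwo p a b f (σ (p + 1)) = some a := fun a b => by
      rw [h1, insertTwo_left]
    by_cases h2 : σ p = p + 1
    · have hB1 : ∀ a b : Idx d, insertTwo p a b f (σ p) = some b := fun a b => by
        rw [h2, insertTwo_right]
      simp only [hA1, hB1, if_pos h1, if_pos h2, and_true]
      rw [if_neg (by omega), mul_one, ← sum_block t, Finset.sum_mul]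
      refine Finset.sum_congr rfl fun a _ => ?_
      by_cases ha : a.1 = t
      · simp only [ha, true_and, if_true, one_mul, sum_block]
      · simp [ha]
    · obtain ⟨b₀, hb, hbs⟩ := hB (by omega) h2
      have hB1 : ∀ a b : Idx d, insertTwo p a b f (σ p) = some b ↔ b₀ = b := fun a b => by
        rw [insertTwo_of_ne (by omega) h2, hb, Option.some_inj]
      simp only [hA1, hB1, if_pos h1, if_neg h2, true_and]
      rw [if_neg (by omega), mul_one, mul_one, ← sum_block t]
      refine Finset.sum_congr rfl fun a _ => ?_
      rw [Finset.sum_eq_single b₀ (fun b _ hb => if_neg fun e => hb e.2.2.symm) (by simp)]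
      simp [hbs]
  · rw [if_neg h1, one_mul]
    -- Here the condition on `a` reads `b = a`, and `hC` identifies the two blocks.
    by_cases h3 : σ (p + 1) = p + 1
    · have hA1 : ∀ a b : Idx d, insertTwo p a b f (σ (p + 1)) = some a ↔ b = a := fun a b => by
        rw [h3, insertTwo_right, Option.some_inj]
      have hst := hC (Or.inr h3)
      subst hst
      rw [if_neg (by omega), one_mul]
      by_cases h2 : σ p = p
      · have hB1 : ∀ a b : Idx d, insertTwo p a b f (σ p) = some b ↔ a = b := fun a b => by
          rw [h2, insertTwo_left, Option.some_inj]
        simp only [hA1, hB1]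
        rw [if_pos ⟨h2, h3⟩, ← sum_block s]
        refine Finset.sum_congr rfl fun a _ => ?_
        rw [Finset.sum_eq_single a (fun b _ hb => if_neg fun e => hb e.2.2.1) (by simp)]
        simp
      · obtain ⟨b₀, hb, hbs⟩ := hB h2 (by omega)
        have hB1 : ∀ a b : Idx d, insertTwo p a b f (σ p) = some b ↔ b₀ = b := fun a b => by
          rw [insertTwo_of_ne h2 (by omega), hb, Option.some_inj]
        simp only [hA1, hB1]
        rw [if_neg fun e => h2 e.1, Finset.sum_eq_single b₀, Finset.sum_eq_single b₀]
        · simp [hbs]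
        · exact fun b _ hb => if_neg fun e => hb e.2.2.2.symm
        · simp
        · exact fun a _ ha => Finset.sum_eq_zero fun b _ =>
            if_neg fun e => ha (e.2.2.1.symm.trans e.2.2.2.symm)
        · simp
    -- In the remaining case `a` is fixed by the index of an arrow outside the pair.
    · obtain ⟨a₀, ha, hat⟩ := hA h1 h3
      have hA1 : ∀ a b : Idx d, insertTwo p a b f (σ (p + 1)) = some a ↔ a₀ = a := fun a b => by
        rw [insertTwo_of_ne h1 h3, ha, Option.some_inj]
      rw [if_neg (show ¬ (σ p = p ∧ σ (p + 1) = p + 1) from fun e => h3 e.2), mul_one]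
      simp only [hA1]
      rw [Finset.sum_eq_single a₀ (fun a _ ha => Finset.sum_eq_zero fun b _ =>
        if_neg fun e => ha e.2.2.1.symm) (by simp)]
      simp only [hat, true_and]
      by_cases h2 : σ p = p + 1
      · have hB1 : ∀ a b : Idx d, insertTwo p a b f (σ p) = some b := fun a b => by
          rw [h2, insertTwo_right]
        simp only [hB1, and_true]
        rw [if_pos h2, sum_block]
      · rw [if_neg h2]
        by_cases h4 : σ p = p
        · have hst := hC (Or.inl h4)
          subst hst
          have hB1 : ∀ a b : Idx d, insertTwo p a b f (σ p) = some b ↔ a = b := fun a b => by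
            rw [h4, insertTwo_left, Option.some_inj]
          simp only [hB1]
          rw [Finset.sum_eq_single a₀ (fun b _ hb => if_neg fun e => hb e.2.symm) (by simp)]
          simp [hat]
        · obtain ⟨b₀, hb, hbs⟩ := hB h4 h2
          have hB1 : ∀ a b : Idx d, insertTwo p a b f (σ p) = some b ↔ b₀ = b := fun a b => by
            rw [insertTwo_of_ne h4 h2, hb, Option.some_inj]
          simp only [hB1]
          rw [Finset.sum_eq_single b₀ (fun b _ hb => if_neg fun e => hb e.2.symm) (by simp)]
          simp [hbs]

lemma traceFormula_sub_interchange (X : Q.Diagram) (l m : List (Letter E)) (x y : Letter E)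
    (h : X.word = l ++ x :: y :: m) (hxy : y ≠ rev x) :
    Q.traceFormula d K X - Q.traceFormula d K (X.interchange l m x y h) = 0 := by
  rw [traceFormula_eq, traceFormula_eq]
  change _ - vertDim d K X.verts • Q.indexSum d K (l ++ y :: x :: m)
    (Equiv.swap l.length (l.length + 1) * X.next * Equiv.swap l.length (l.length + 1) :
      Equiv.Perm ℕ) = 0
  rw [← smul_sub, h, indexSum_sub_interchange]
  simp [hxy]

/-- Joins and splits need not be told apart: the same commutator produces both, so the two skein
coefficients are equal. The sum over the two indices supplies exactly the dimensions of the new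
vertices. -/
lemma traceFormula_sub_interchange_rev (X : Q.Diagram) (l m : List (Letter E)) (x : Letter E)
    (h : X.word = l ++ x :: rev x :: m) :
    Q.traceFormula d K X - Q.traceFormula d K (X.interchange l m x (rev x) h) =
      (-hbar K * (letterBracket x (rev x) : K[X])) • Q.traceFormula d K (X.contract l m x h) := by
  rw [traceFormula_eq, traceFormula_eq, traceFormula_eq]
  change _ - vertDim d K X.verts • Q.indexSum d K (l ++ rev x :: x :: m)
    (Equiv.swap l.length (l.length + 1) * X.next * Equiv.swap l.length (l.length + 1) :
      Equiv.Perm ℕ) = _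
  have hverts : vertDim d K (X.contract l m x h).verts = vertDim d K X.verts *
      vertDim d K ((if X.next (l.length + 1) = l.length then {Q.ltgt x} else 0) +
        (if X.next l.length = l.length + 1 then {Q.lsrc x} else 0) +
        (if X.next l.length = l.length ∧ X.next (l.length + 1) = l.length + 1
          then {Q.ltgt x} else 0)) := by
    rw [← vertDim_add, ← add_assoc, ← add_assoc]
    congr!
  rw [hverts, ← smul_sub, h, indexSum_sub_interchange, smul_comm, mul_smul, indexSum]
  congr 1
  rw [Finset.smul_sum, Finset.smul_sum]
  refine Finset.sum_congr rfl fun f _ => ?_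
  change _ = _ • _ • ordProd ((l ++ m).map (Q.opMat d K)) f fun i =>
            f (unskip l.length (reconnect l.length X.next (skip l.length i)))
  set P := ordProd ((l ++ m).map (Q.opMat d K)) f fun i =>
            f (unskip l.length (reconnect l.length X.next (skip l.length i))) with hP
  -- Only nonzero products matter, and for these the neighbouring indices lie in the blocks that
  -- `card_insertions` requires.
  by_cases h0 : P = 0
  · simp [h0]
  have hx : X.word[l.length]? = some x := by rw [h]; simp
  have hy : X.word[l.length + 1]? = some (rev x) := by
    rw [h, List.getElem?_append_right (by omega)]; simp
  have hblk : ∀ (j : ℕ) (z : Letter E), j ≠ l.length → j ≠ l.length + 1 → X.word[j]? = some z →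
      ∃ a : Idx d, f (unskip l.length j) = some a ∧ a.1 = Q.ltgt z := by
    intro j z hj hj' hz
    have h1 : ((l ++ m).map (Q.opMat d K))[unskip l.length j]? = some (Q.opMat d K z) := by
      rw [List.getElem?_map, Diagram.getElem?_skip l m x (rev x), ← h, skip_unskip _ _ hj hj', hz]
      rfl
    have h2 := ent_ne_zero_of_ordProd h0 h1
    revert h2
    rcases f (unskip l.length j) with _ | a
    · simp [ent]
    · intro h2
      refine ⟨a, rfl, ?_⟩
      by_contra h3
      apply h2
      rcases f (unskip l.length (reconnect l.length X.next (skip l.length (unskip l.length j))))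
        with _ | b
      · rfl
      · exact opMat_eq_zero fun e => h3 e.1
  have hnext : ∀ i, i < X.word.length → ∃ z, X.word[X.next i]? = some z := fun i hi =>
    ⟨_, List.getElem?_eq_getElem (X.next_lt hi)⟩
  have hl1 : l.length + 1 < X.word.length := by rw [h]; simp
  rw [← card_insertions f X.next l.length (Q.lsrc x) (Q.ltgt x)]
  · simp only [true_and, Finset.sum_smul, ite_smul, one_smul, zero_smul,
      mul_smul]
  · intro h1 h2
    obtain ⟨z, hz⟩ := hnext _ hl1
    obtain ⟨a, ha, ha'⟩ := hblk _ z h1 h2 hz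
    refine ⟨a, ha, ha'.trans ?_⟩
    rw [← X.compat _ _ _ hy hz, lsrc_rev]
  · intro h1 h2
    obtain ⟨z, hz⟩ := hnext l.length (by omega)
    obtain ⟨a, ha, ha'⟩ := hblk _ z h1 h2 hz
    exact ⟨a, ha, ha'.trans (X.compat _ _ _ hx hz).symm⟩
  · rintro (h1 | h1)
    · exact X.compat _ _ _ hx (by rw [h1]; exact hx)
    · have := X.compat _ _ _ hy (by rw [h1]; exact hy)
      rw [lsrc_rev, ltgt_rev] at this
      exact this.symm

variable (Q d K) in
/-- The trace formula as a monoid homomorphism. -/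
def traceMonoidHom : Q.Diagram →* Q.RepDiff d K where
  toFun := Q.traceFormula d K
  map_one' := traceFormula_one
  map_mul' := traceFormula_mul

variable (Q d K) in
/-- The quantum trace. -/
def quantumTrace : Q.N K (-hbar K) (-hbar K) →ₐ[K[X]] Q.RepDiff d K :=
  QuotBy.liftAlg K[X] (MonoidAlgebra.lift K[X] (Q.RepDiff d K) Q.Diagram (traceMonoidHom Q d K)) (by
    have hdg : ∀ X : Q.Diagram, MonoidAlgebra.lift K[X] (Q.RepDiff d K) Q.Diagram
        (traceMonoidHom Q d K) (dg K X) = Q.traceFormula d K X := fun X =>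
      MonoidAlgebra.lift_of _ _
    rintro z (⟨X, l, m, x, y, h, hxy⟩ | ⟨X, l, m, x, h, hc⟩ | ⟨X, l, m, x, h, hc⟩)
    · rw [map_sub, hdg, hdg, traceFormula_sub_interchange X l m x y h hxy]
    · rw [map_sub, map_sub, map_smul, hdg, hdg, hdg, traceFormula_sub_interchange_rev, sub_self]
    · rw [map_sub, map_sub, map_smul, hdg, hdg, hdg, traceFormula_sub_interchange_rev, sub_self])

lemma quantumTrace_nclass (X : Q.Diagram) :
    quantumTrace Q d K (nclass K (-hbar K) (-hbar K) X) = Q.traceFormula d K X :=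
  MonoidAlgebra.lift_of _ _

end QuiverData

/-! ### The quantum trace and the moment map -/

lemma derivation_sum_apply {K T ι : Type*} [CommRing K] [CommRing T] [Algebra K T] (s : Finset ι)
    (D : ι → Derivation K T T) (f : T) : (∑ i ∈ s, D i) f = ∑ i ∈ s, D i f := by
  classical
  induction s using Finset.induction_on with
  | empty => rfl
  | insert i s hi ih => rw [Finset.sum_insert hi, Finset.sum_insert hi, Derivation.add_apply, ih]

namespace QuiverData

variable {V : Type u} {E : Type v} {Q : QuiverData V E} {d : V → ℕ} {K : Type w} [Field K]
variable [DecidableEq V] [DecidableEq E] [Fintype V]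

variable (Q d K) in
/-- The projection onto the block of a vertex. -/
def blockProj (v : V) : Matrix (Idx d) (Idx d) (Q.RepDiff d K) :=
  Matrix.diagonal fun a => if a.1 = v then 1 else 0

lemma blockProj_mul_opMat (x : Letter E) :
    blockProj Q d K (Q.ltgt x) * Q.opMat d K x = Q.opMat d K x := by
  ext a b
  rw [blockProj, Matrix.diagonal_mul]
  split_ifs with h
  · rw [one_mul]
  · rw [zero_mul, opMat_eq_zero fun e => h e.1]

lemma opMat_mul_blockProj (x : Letter E) :
    Q.opMat d K x * blockProj Q d K (Q.lsrc x) = Q.opMat d K x := by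
  ext a b
  rw [blockProj, Matrix.mul_diagonal]
  split_ifs with h
  · rw [mul_one]
  · rw [mul_zero, opMat_eq_zero fun e => h e.2]

lemma blockProj_mul_of_ne {v w : V} (h : v ≠ w) :
    blockProj Q d K v * blockProj Q d K w = 0 := by
  rw [blockProj, blockProj, Matrix.diagonal_mul_diagonal]
  ext a b
  rw [Matrix.diagonal_apply, Matrix.zero_apply]
  split_ifs with h1 h2 h3
  · exact absurd (h2.symm.trans h3) h
  all_goals simp

lemma blockProj_mul_self (v : V) :
    blockProj Q d K v * blockProj Q d K v = blockProj Q d K v := by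
  rw [blockProj, Matrix.diagonal_mul_diagonal]
  congr 1
  funext a
  split_ifs <;> simp

/-- The matrix of differential operators given by a path. -/
def pathMat (d : V → ℕ) (K : Type w) [Field K] (p : Q.DPath) :
    Matrix (Idx d) (Idx d) (Q.RepDiff d K) :=
  blockProj Q d K p.tgt * (p.word.map (Q.opMat d K)).prod

lemma blockProj_chain (i : V) (l : List (Letter E)) (h : Q.IsChain i l) :
    blockProj Q d K i * (l.map (Q.opMat d K)).prod * blockProj Q d K (Q.endVertex i l) =
      blockProj Q d K i * (l.map (Q.opMat d K)).prod := by
  induction l generalizing i with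
  | nil => rw [List.map_nil, List.prod_nil, mul_one]; exact blockProj_mul_self i
  | cons x l ih =>
    have e : blockProj Q d K i * ((x :: l).map (Q.opMat d K)).prod = blockProj Q d K i *
        Q.opMat d K x * (blockProj Q d K (Q.lsrc x) * (l.map (Q.opMat d K)).prod) := by
      rw [List.map_cons, List.prod_cons, ← mul_assoc, ← mul_assoc,
        mul_assoc _ (Q.opMat d K x) (blockProj Q d K _), opMat_mul_blockProj]
    rw [e, mul_assoc, endVertex, ih _ h.2]

lemma pathMat_mul_blockProj (p : Q.DPath) :
    pathMat d K p * blockProj Q d K p.src = pathMat d K p :=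
  blockProj_chain _ _ p.chain

lemma blockProj_mul_pathMat (p : Q.DPath) :
    blockProj Q d K p.tgt * pathMat d K p = pathMat d K p := by
  rw [pathMat, ← mul_assoc, blockProj_mul_self]

lemma pathMat_eq_zero {p : Q.DPath} {a b : Idx d} (h : ¬ (a.1 = p.tgt ∧ b.1 = p.src)) :
    pathMat d K p a b = 0 := by
  rw [← blockProj_mul_pathMat, ← pathMat_mul_blockProj, blockProj, blockProj,
    Matrix.diagonal_mul, Matrix.mul_diagonal]
  split_ifs <;> simp_all

lemma pathMat_comp (p q : Q.DPath) (h : p.src = q.tgt) :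
    pathMat d K (p.comp q h) = pathMat d K p * pathMat d K q := by
  conv_rhs => rw [pathMat.eq_1 d K q, ← h, ← mul_assoc, pathMat_mul_blockProj]
  rw [pathMat, pathMat, mul_assoc]
  change _ * ((p.word ++ q.word).map _).prod = _
  rw [List.map_append, List.prod_append]
  rfl

lemma pathMat_arrow (x : Letter E) : pathMat d K (DPath.arrow Q x) = Q.opMat d K x := by
  change blockProj Q d K (Q.ltgt x) * ([x].map (Q.opMat d K)).prod = _
  rw [List.map_cons, List.map_nil, List.prod_singleton, blockProj_mul_opMat]

lemma trace_blockProj (v : V) : (blockProj Q d K v).trace = (d v : K[X]) • 1 := by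
  rw [blockProj, Matrix.trace_diagonal, ← sum_block, Finset.sum_smul]
  refine Finset.sum_congr rfl fun a _ => ?_
  split_ifs <;> simp

/-- The quantum trace of a closed path is the trace of the matrix of the path. -/
lemma traceFormula_ofC (p : Q.ClosedPath) :
    Q.traceFormula d K (Diagram.ofC p) = (pathMat d K p.1).trace := by
  obtain ⟨⟨v, l, h⟩, hp⟩ := p
  rw [traceFormula_eq]
  cases l with
  | nil =>
    have h1 : (Diagram.ofC (⟨⟨v, [], h⟩, hp⟩ : Q.ClosedPath)).verts = {v} := by
      simp [Diagram.ofC, Diagram.ofClosed]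
    rw [h1, Diagram.ofC_word, pathMat, indexSum]
    change _ • ∑ f ∈ assignments (Idx d) 0, (1 : Q.RepDiff d K) =
      (blockProj Q d K v * (([] : List (Letter E)).map (Q.opMat d K)).prod).trace
    rw [sum_assignments_zero, List.map_nil, List.prod_nil, mul_one, trace_blockProj]
    simp [vertDim]
  | cons x l =>
    have h1 : (Diagram.ofC (⟨⟨v, x :: l, h⟩, hp⟩ : Q.ClosedPath)).verts = 0 := by
      simp [Diagram.ofC, Diagram.ofClosed]
    have hv : Q.ltgt x = v := h.1
    have h2 : pathMat d K (⟨v, x :: l, h⟩ : Q.DPath) =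
        Q.opMat d K x * (l.map (Q.opMat d K)).prod := by
      change blockProj Q d K v * ((x :: l).map (Q.opMat d K)).prod = _
      rw [List.map_cons, List.prod_cons, ← mul_assoc, ← hv, blockProj_mul_opMat]
    rw [h1, h2]
    have h3 := sum_ordProd_cycle (Q.opMat d K x) (l.map (Q.opMat d K))
      (Diagram.ofC (⟨⟨v, x :: l, h⟩, hp⟩ : Q.ClosedPath)).next (by
        intro i hi
        rw [List.length_map] at hi
        rw [Diagram.ofC_next _ (by simp; omega), Nat.mod_eq_of_lt (by simp; omega)]) (by
        rw [List.length_map, Diagram.ofC_next _ (by simp)]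
        simp)
    rw [← h3, List.length_map]
    simp [vertDim, indexSum, Diagram.ofC_word]

lemma quantumTrace_hat_ofPath (p : Q.DPath) :
    quantumTrace Q d K (Q.hat K (-hbar K) (-hbar K) (PathAlg.ofPath Q K p)) =
      (pathMat d K p).trace := by
  by_cases hp : p.IsClosed
  · have h := hat_ofClosedPath (K := K) (α := -hbar K) (β := -hbar K) (⟨p, hp⟩ : Q.ClosedPath)
    rw [h, quantumTrace_nclass, traceFormula_ofC]
  · have h : Q.hat K (-hbar K) (-hbar K) (PathAlg.ofPath Q K p) = 0 := by
      rw [hat, PathAlg.extend_ofPath, dif_neg hp]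
    rw [h, map_zero, Matrix.trace]
    refine (Finset.sum_eq_zero fun a _ => ?_).symm
    exact pathMat_eq_zero fun e => hp (e.2.symm.trans e.1)

/-- The formula persists when the path does not compose with `x x^*`: the block projections of
different vertices annihilate each other. -/
lemma quantumTrace_hat_mul_arr (p : Q.DPath) (x : Letter E) :
    quantumTrace Q d K (Q.hat K (-hbar K) (-hbar K)
        (PathAlg.ofPath Q K p * (PathAlg.arr Q K x * PathAlg.arr Q K (rev x)))) =
      (pathMat d K p * (Q.opMat d K x * Q.opMat d K (rev x))).trace := by
  have h1 : (DPath.arrow Q x).src = (DPath.arrow Q (rev x)).tgt := (Q.ltgt_rev x).symm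
  rw [PathAlg.arr, PathAlg.arr, PathAlg.ofPath_mul K _ _ h1, ← pathMat_arrow x,
    ← pathMat_arrow (rev x), ← pathMat_comp _ _ h1]
  by_cases h : p.src = ((DPath.arrow Q x).comp (DPath.arrow Q (rev x)) h1).tgt
  · rw [PathAlg.ofPath_mul K _ _ h, ← pathMat_comp _ _ h, quantumTrace_hat_ofPath]
  · rw [PathAlg.ofPath_mul_eq_zero K _ _ h, map_zero, map_zero, ← pathMat_mul_blockProj p,
      ← blockProj_mul_pathMat ((DPath.arrow Q x).comp _ h1), mul_assoc, ← mul_assoc (blockProj Q d K _),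
      blockProj_mul_of_ne h, zero_mul, mul_zero, Matrix.trace_zero]

lemma tau_coordMat (x : gld d K) (a : E) (p q : Idx d) :
    Q.tau x (Q.coordMat d K a p q) =
      (Q.coordMat d K a * Q.blk x - Q.blk x * Q.coordMat d K a) p q := by
  by_cases h : p.1 = Q.tgt a ∧ q.1 = Q.src a
  · have hX : Q.coordMat d K a p q = MvPolynomial.X ⟨(a, p, q), h⟩ := by rw [coordMat, dif_pos h]
    rw [hX, tau, MvPolynomial.mkDerivation_X]
  · have h1 := Q.blk_conj_ne (fun _ => 1) x a p q h
    have h2 := Q.blk_conj_ne x (fun _ => 1) a p q h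
    rw [blk_one, Matrix.one_mul] at h1
    rw [blk_one, Matrix.mul_one] at h2
    rw [Matrix.sub_apply, h1, h2, sub_zero, coordMat, dif_neg h, map_zero]

variable [Fintype E]

variable (Q d K) in
/-- The matrix of differential operators given by `∑ (a a^* - a^* a)`. -/
def momentMat : Matrix (Idx d) (Idx d) (Q.RepDiff d K) :=
  ∑ a : E, (Q.opMat d K (Sum.inl a) * Q.opMat d K (Sum.inr a) -
    Q.opMat d K (Sum.inr a) * Q.opMat d K (Sum.inl a))

lemma quantumTrace_hat_mul_moment (p : Q.DPath) :
    quantumTrace Q d K (Q.hat K (-hbar K) (-hbar K) (PathAlg.ofPath Q K p * PathAlg.moment Q K)) =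
      (pathMat d K p * momentMat Q d K).trace := by
  rw [PathAlg.moment, momentMat, Finset.mul_sum, Finset.mul_sum, map_sum, map_sum,
    Matrix.trace_sum]
  refine Finset.sum_congr rfl fun a _ => ?_
  rw [mul_sub, mul_sub, map_sub, map_sub, Matrix.trace_sub]
  exact congrArg₂ (· - ·) (quantumTrace_hat_mul_arr p (Sum.inl a))
    (quantumTrace_hat_mul_arr p (Sum.inr a))

open DiffOp

lemma derivation_eq_sum (D : Derivation K (Q.RepRing d K) (Q.RepRing d K)) :
    D = ∑ a : E, ∑ p : Idx d, ∑ q : Idx d, D (Q.coordMat d K a p q) • Q.derMat d K a q p := by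
  refine MvPolynomial.derivation_ext fun c => ?_
  obtain ⟨⟨b, r, s⟩, h⟩ := c
  have hX : (MvPolynomial.X ⟨(b, r, s), h⟩ : Q.RepRing d K) = Q.coordMat d K b r s := by
    rw [coordMat, dif_pos h]
  rw [hX]
  simp only [derivation_sum_apply, Derivation.smul_apply, derMat_coordMat]
  rw [Finset.sum_eq_single b, Finset.sum_eq_single r, Finset.sum_eq_single s]
  · rw [if_pos ⟨rfl, h.1, h.2, rfl, rfl⟩, smul_eq_mul, mul_one]
  · exact fun q _ hq => by rw [if_neg fun e => hq e.2.2.2.2.symm, smul_zero]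
  · simp
  · exact fun p _ hp => Finset.sum_eq_zero fun q _ => by
      rw [if_neg fun e => hp e.2.2.2.1.symm, smul_zero]
  · simp
  · exact fun a _ ha => Finset.sum_eq_zero fun p _ => Finset.sum_eq_zero fun q _ => by
      rw [if_neg fun e => ha e.1, smul_zero]
  · simp

lemma tau_eq (x : gld d K) :
    Q.tau x = ∑ a : E, ∑ p : Idx d, ∑ q : Idx d,
      (Q.coordMat d K a * Q.blk x - Q.blk x * Q.coordMat d K a) p q • Q.derMat d K a q p := by
  rw [derivation_eq_sum (Q.tau x)]
  simp only [tau_coordMat]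

/-- The elementary matrix in the block of a vertex. -/
def elemGl (i : V) (r q : Fin (d i)) : gld d K := Pi.single i (Matrix.single r q 1)

lemma blockDiagonal_elemGl (i : V) (r q : Fin (d i)) (a b : Idx d) :
    Matrix.blockDiagonal' (elemGl (K := K) i r q) a b =
      if a = ⟨i, r⟩ ∧ b = ⟨i, q⟩ then 1 else 0 := by
  obtain ⟨j, a⟩ := a
  obtain ⟨k, b⟩ := b
  rw [Matrix.blockDiagonal'_apply]
  by_cases h : j = k
  · subst h
    rw [dif_pos rfl, elemGl]
    by_cases h' : j = i
    · subst h'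
      rw [Pi.single_eq_same, Matrix.single_apply]
      simp only [Sigma.mk.injEq, heq_eq_eq, true_and, cast_eq]
      exact if_congr ⟨fun e => ⟨e.1.symm, e.2.symm⟩, fun e => ⟨e.1.symm, e.2.symm⟩⟩ rfl rfl
    · rw [Pi.single_eq_of_ne h', if_neg]
      · rfl
      · rintro ⟨e, _⟩
        exact h' (congrArg Sigma.fst e)
  · rw [dif_neg h, if_neg]
    rintro ⟨e, e'⟩
    exact h ((congrArg Sigma.fst e).trans (congrArg Sigma.fst e').symm)

lemma chi0_elemGl (i : V) (r q : Fin (d i)) :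
    Q.chi0 (elemGl (K := K) i r q) =
      -(if r = q then ((∑ a : E, if Q.src a = i then d (Q.tgt a) else 0 : ℕ) : K) else 0) := by
  rw [chi0, Finset.sum_eq_single i]
  · rw [elemGl, Pi.single_eq_same]
    split_ifs with h
    · subst h; rw [Matrix.trace_single_eq_same, mul_one]
    · rw [Matrix.trace_single_eq_of_ne _ _ _ h, mul_zero]
  · intro k _ hk
    rw [elemGl, Pi.single_eq_of_ne hk, Matrix.trace_zero, mul_zero]
  · simp

/-- The entry at `(q, r)` in the block of a vertex is minus the generator belonging to the
elementary matrix `e_{rq}`; entries between different blocks vanish. In `τ` the functions stand to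
the left of the derivatives, in `a^* a` to the right, and this reordering is what `ħ χ₀`
compensates. -/
lemma momentMat_apply_mem (a b : Idx d) : momentMat Q d K a b ∈ Q.momentIdeal d K := by
  by_cases hab : a.1 = b.1
  swap
  · have : momentMat Q d K a b = 0 := by
      rw [momentMat, Matrix.sum_apply]
      refine Finset.sum_eq_zero fun e _ => ?_
      rw [Matrix.sub_apply, Matrix.mul_apply, Matrix.mul_apply, Finset.sum_eq_zero,
        Finset.sum_eq_zero, sub_zero]
      · intro c _
        by_cases h1 : a.1 = Q.src e
        · rw [opMat_eq_zero (x := Sum.inl e) fun h => hab (h1.trans h.2.symm), mul_zero]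
        · rw [opMat_eq_zero (x := Sum.inr e) fun h => h1 h.1, zero_mul]
      · intro c _
        by_cases h1 : a.1 = Q.tgt e
        · rw [opMat_eq_zero (x := Sum.inr e) fun h => hab (h1.trans h.2.symm), mul_zero]
        · rw [opMat_eq_zero (x := Sum.inl e) fun h => h1 h.1, zero_mul]
    rw [this]
    exact zero_mem _
  obtain ⟨i, q⟩ := a
  obtain ⟨j, r⟩ := b
  obtain rfl : i = j := hab
  have hgen := Ideal.subset_span (α := Q.RepDiff d K) (Set.mem_range_self (f := fun x : gld d K =>
    der (Q.tau x) - algebraMap K[X] (Q.RepDiff d K) (hbar K * C (Q.chi0 x))) (elemGl i r q))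
  suffices h : momentMat Q d K ⟨i, q⟩ ⟨i, r⟩ = -(der (Q.tau (elemGl i r q)) -
      algebraMap K[X] (Q.RepDiff d K) (hbar K * C (Q.chi0 (elemGl i r q)))) by
    rw [h]
    exact neg_mem hgen
  have hblk : ∀ a b : Idx d, Q.blk (elemGl (K := K) i r q) a b =
      if a = ⟨i, r⟩ ∧ b = ⟨i, q⟩ then 1 else 0 := fun a b => by
    rw [blk, Matrix.map_apply, blockDiagonal_elemGl]
    split_ifs <;> simp
  have hterm : ∀ e : E, ∑ p : Idx d, ∑ s : Idx d,
      der ((Q.coordMat d K e * Q.blk (elemGl (K := K) i r q) -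
        Q.blk (elemGl (K := K) i r q) * Q.coordMat d K e) p s • Q.derMat d K e s p) =
      ∑ p : Idx d, Q.opMat d K (Sum.inl e) p ⟨i, r⟩ * Q.opMat d K (Sum.inr e) ⟨i, q⟩ p -
      ∑ p : Idx d, Q.opMat d K (Sum.inl e) ⟨i, q⟩ p * Q.opMat d K (Sum.inr e) p ⟨i, r⟩ := by
    intro e
    simp only [Matrix.sub_apply, ← fn_mul_der, fn_sub, sub_mul, Finset.sum_sub_distrib]
    congr 1
    · refine Finset.sum_congr rfl fun p _ => ?_
      rw [Finset.sum_eq_single ⟨i, q⟩]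
      · rw [Matrix.mul_apply, Finset.sum_eq_single ⟨i, r⟩]
        · rw [hblk, if_pos ⟨rfl, rfl⟩, mul_one]; rfl
        · intro c _ hc
          rw [hblk, if_neg fun h => hc h.1, mul_zero]
        · simp
      · intro s _ hs
        rw [Matrix.mul_apply, Finset.sum_eq_zero, fn_zero, zero_mul]
        intro c _
        rw [hblk, if_neg fun h => hs h.2, mul_zero]
      · simp
    · rw [Finset.sum_eq_single ⟨i, r⟩]
      · refine Finset.sum_congr rfl fun s _ => ?_
        rw [Matrix.mul_apply, Finset.sum_eq_single ⟨i, q⟩]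
        · rw [hblk, if_pos ⟨rfl, rfl⟩, one_mul]; rfl
        · intro c _ hc
          rw [hblk, if_neg fun h => hc h.2, zero_mul]
        · simp
      · intro p _ hp
        refine Finset.sum_eq_zero fun s _ => ?_
        rw [Matrix.mul_apply, Finset.sum_eq_zero, fn_zero, zero_mul]
        intro c _
        rw [hblk, if_neg fun h => hp h.1, zero_mul]
      · simp
  -- Reordering costs `-ħ` for each index `p` in the block of `t(e)` when `r = q` and `s(e) = i`, in
  -- total `-ħ d_{t(e)}`; these are the coefficients of `χ₀`.
  have hcomm : ∀ e : E, ∑ p : Idx d,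
      Q.opMat d K (Sum.inl e) p ⟨i, r⟩ * Q.opMat d K (Sum.inr e) ⟨i, q⟩ p =
      ∑ p : Idx d, Q.opMat d K (Sum.inr e) ⟨i, q⟩ p * Q.opMat d K (Sum.inl e) p ⟨i, r⟩ -
      (hbar K * C (if r = q then if Q.src e = i then (d (Q.tgt e) : K) else 0 else 0)) •
        (1 : Q.RepDiff d K) := by
    intro e
    have h1 : ∀ p : Idx d, Q.opMat d K (Sum.inl e) p ⟨i, r⟩ * Q.opMat d K (Sum.inr e) ⟨i, q⟩ p -
        Q.opMat d K (Sum.inr e) ⟨i, q⟩ p * Q.opMat d K (Sum.inl e) p ⟨i, r⟩ =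
        (if p.1 = Q.tgt e then (1 : K[X]) else 0) •
          (-(hbar K * C (if r = q then if Q.src e = i then 1 else 0 else 0))) •
            (1 : Q.RepDiff d K) := by
      intro p
      rw [opMat_commutator]
      simp only [Sum.swap_inl, ltgt, lsrc, letterBracket, if_true, Int.cast_one, mul_one, true_and,
        Sigma.mk.injEq, heq_eq_eq]
      by_cases h1 : p.1 = Q.tgt e <;> by_cases h2 : r = q <;> by_cases h3 : Q.src e = i
      all_goals simp [h1, h2, h3, eq_comm (a := i)]
    rw [eq_sub_iff_add_eq, ← eq_sub_iff_add_eq', ← neg_inj, neg_sub, ← Finset.sum_sub_distrib,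
      Finset.sum_congr rfl fun p _ => h1 p, ← Finset.sum_smul, sum_block, smul_smul, ← neg_smul]
    congr 1
    split_ifs
    · simp [mul_comm]
    all_goals simp
  rw [tau_eq, der_sum]
  simp only [der_sum, hterm, hcomm]
  rw [chi0_elemGl, momentMat, Matrix.sum_apply]
  simp only [Matrix.sub_apply, Matrix.mul_apply, Finset.sum_sub_distrib]
  have hc : ∑ e : E, (hbar K * C (if r = q then if Q.src e = i then (d (Q.tgt e) : K) else 0
      else 0)) • (1 : Q.RepDiff d K) = -algebraMap K[X] (Q.RepDiff d K) (hbar K *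
      C (-(if r = q then ((∑ a : E, if Q.src a = i then d (Q.tgt a) else 0 : ℕ) : K) else 0))) := by
    rw [← Finset.sum_smul, ← Finset.mul_sum, ← map_sum, Algebra.algebraMap_eq_smul_one, ← neg_smul,
      map_neg, mul_neg, neg_neg]
    congr 3
    split_ifs
    · push_cast
      rfl
    · simp
  rw [hc]
  abel

/-- As `w` is the right factor, the trace is a sum of products whose right factors are entries of
the matrix of `w`, and it lies in the left ideal. -/
lemma quantumTrace_momentLifts_mem (y : Q.PathAlg K) :
    quantumTrace Q d K (Q.hat K (-hbar K) (-hbar K) (y * PathAlg.moment Q K)) ∈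
      Q.momentIdeal d K := by
  induction y using PathAlg.induction with
  | h0 => rw [zero_mul, map_zero, map_zero]; exact zero_mem _
  | hadd x y hx hy => rw [add_mul, map_add, map_add]; exact add_mem hx hy
  | hsmul c x hx =>
    have h : ∀ z : Q.N K (-hbar K) (-hbar K), c • z = (C c : K[X]) • z := fun z => by
      rw [← Polynomial.algebraMap_eq, algebraMap_smul]
    rw [smul_mul_assoc, map_smul, h, map_smul, Algebra.smul_def]
    exact Ideal.mul_mem_left _ _ hx
  | hpath p =>
    rw [quantumTrace_hat_mul_moment, Matrix.trace]
    refine sum_mem fun a _ => ?_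
    rw [Matrix.diag_apply, Matrix.mul_apply]
    exact sum_mem fun b _ => Ideal.mul_mem_left _ _ (momentMat_apply_mem b a)

end QuiverData

/-! ### Invariance of the quantum trace -/

namespace DiffOp

variable {K : Type w} [Field K] {T : Type u} [CommRing T] [Algebra K T]

lemma map_fn (φ : T ≃ₐ[K] T) (f : T) : DiffOp.map φ (fn K f) = fn K (φ f) := by
  refine (RingQuot.liftAlgHom_mkAlgHom_apply _ _ _ _).trans ?_
  rw [FreeAlgebra.lift_ι_apply]; rfl

lemma map_der (φ : T ≃ₐ[K] T) (D : Derivation K T T) :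
    DiffOp.map φ (der D) = der (conjDer φ D) := by
  refine (RingQuot.liftAlgHom_mkAlgHom_apply _ _ _ _).trans ?_
  rw [FreeAlgebra.lift_ι_apply]; rfl

/-- Functions and derivations generate the algebra of differential operators. -/
lemma induction {P : DiffOp K T → Prop} (hfn : ∀ f, P (fn K f)) (hder : ∀ D, P (der D))
    (halg : ∀ c : K[X], P (algebraMap K[X] _ c)) (hadd : ∀ x y, P x → P y → P (x + y))
    (hmul : ∀ x y, P x → P y → P (x * y)) (x : DiffOp K T) : P x := by
  obtain ⟨z, rfl⟩ := RingQuot.mkAlgHom_surjective K[X] (DRel K T) x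
  change P (DiffOp.mk K T z)
  induction z using FreeAlgebra.induction with
  | grade0 c => rw [AlgHom.commutes]; exact halg c
  | grade1 x =>
    rcases x with f | D
    · exact hfn f
    · exact hder D
  | mul a b ha hb => rw [map_mul]; exact hmul _ _ ha hb
  | add a b ha hb => rw [map_add]; exact hadd _ _ ha hb

end DiffOp

namespace QuiverData

variable {V : Type u} {E : Type v} {Q : QuiverData V E} {d : V → ℕ} {K : Type w} [Field K]
variable [DecidableEq V] [DecidableEq E] [Fintype V]

open DiffOp

variable (Q) in
/-- The block diagonal matrix of scalars given by an element of `gl_d`. -/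
def scalarMat (x : gld d K) : Matrix (Idx d) (Idx d) (Q.RepDiff d K) := (Q.blk x).map (fn K)

lemma scalarMat_apply (x : gld d K) (p q : Idx d) :
    Q.scalarMat x p q = algebraMap K[X] _ (C (Matrix.blockDiagonal' x p q)) := by
  rw [scalarMat, Matrix.map_apply, blk, Matrix.map_apply, fn_algebraMap]

lemma scalarMat_comm (x : gld d K) (p q : Idx d) (z : Q.RepDiff d K) :
    Q.scalarMat x p q * z = z * Q.scalarMat x p q := by
  rw [scalarMat_apply]; exact Algebra.commutes _ _

lemma scalarMat_mul (x y : gld d K) :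
    Q.scalarMat x * Q.scalarMat y = Q.scalarMat fun i => x i * y i := by
  have h := Matrix.map_mul (L := Q.blk x) (M := Q.blk y) (f := fnHom K (Q.RepRing d K))
  rw [blk_mul] at h
  exact h.symm

lemma scalarMat_one : Q.scalarMat (fun _ => 1 : gld d K) = 1 := by
  rw [scalarMat, blk_one]
  exact Matrix.map_one _ fn_zero fn_one

/-- The trace is not cyclic over a noncommutative ring; it is here because scalar entries are
central. -/
lemma trace_scalarMat_mul (x : gld d K) (M : Matrix (Idx d) (Idx d) (Q.RepDiff d K)) :
    (Q.scalarMat x * M).trace = (M * Q.scalarMat x).trace := by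
  simp only [Matrix.trace, Matrix.diag_apply, Matrix.mul_apply]
  rw [Finset.sum_comm]
  exact Finset.sum_congr rfl fun p _ => Finset.sum_congr rfl fun q _ => scalarMat_comm _ _ _ _

lemma derivation_blk (D : Derivation K (Q.RepRing d K) (Q.RepRing d K)) (x : gld d K)
    (p q : Idx d) : D (Q.blk x p q) = 0 := by
  rw [blk, Matrix.map_apply, Derivation.map_algebraMap]

/-- One formula for both actions: with `g` and `g⁻¹` it describes conjugation by the group, and with
one factor equal to `1` it describes `τ`. -/
lemma derMat_conj (a b : E) (x y : gld d K) (p q r s : Idx d) :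
    Q.derMat d K a p q ((Q.blk x * Q.coordMat d K b * Q.blk y) r s) =
      if a = b ∧ r.1 = Q.tgt b ∧ s.1 = Q.src b then Q.blk x r q * Q.blk y p s else 0 := by
  rw [Matrix.mul_apply]
  simp only [Matrix.mul_apply, Finset.sum_mul, map_sum, Derivation.leibniz, derivation_blk,
    derMat_coordMat, smul_eq_mul, mul_zero, zero_add, add_zero]
  rw [Finset.sum_eq_single p, Finset.sum_eq_single q]
  · by_cases h1 : r.1 = q.1
    · by_cases h2 : p.1 = s.1
      · rw [h1, ← h2]
        simp only [and_true]
        split_ifs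
        · rw [mul_one, mul_comm]
        · simp
      · rw [Q.blk_apply_ne y h2]; simp
    · rw [Q.blk_apply_ne x h1]; simp
  · intro i _ hi
    rw [if_neg fun e => hi e.2.2.2.1, mul_zero, mul_zero]
  · simp
  · intro j _ hj
    refine Finset.sum_eq_zero fun i _ => ?_
    rw [if_neg fun e => hj e.2.2.2.2, mul_zero, mul_zero]
  · simp

lemma derivation_ext_coordMat {D D' : Derivation K (Q.RepRing d K) (Q.RepRing d K)}
    (h : ∀ a p q, D (Q.coordMat d K a p q) = D' (Q.coordMat d K a p q)) : D = D' := by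
  refine MvPolynomial.derivation_ext fun c => ?_
  obtain ⟨⟨b, r, s⟩, hc⟩ := c
  have hX : (MvPolynomial.X ⟨(b, r, s), hc⟩ : Q.RepRing d K) = Q.coordMat d K b r s := by
    rw [coordMat, dif_pos hc]
  rw [hX, h]

/-- The family of matrices underlying an element of `GL_d`. -/
abbrev glVal (g : GLd d K) : gld d K := fun i => (g i : Matrix (Fin (d i)) (Fin (d i)) K)

lemma conjDer_derMat (g : GLd d K) (a : E) (p q : Idx d) :
    conjDer (Q.glEquiv g) (Q.derMat d K a p q) =
      ∑ v, ∑ u, Q.blk (glVal g⁻¹) p u • Q.blk (glVal g) v q • Q.derMat d K a u v := by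
  refine derivation_ext_coordMat fun b r s => ?_
  have h1 : (Q.glEquiv g).symm (Q.coordMat d K b r s) =
      (Q.blk (glVal g) * Q.coordMat d K b * Q.blk (glVal g⁻¹)) r s := by
    have := congrFun (congrFun (Q.glHom_coordMat g⁻¹ b) r) s
    rwa [inv_inv] at this
  have h2 : ∀ x : gld d K, ∀ i j, (Q.glEquiv g) (Q.blk x i j) = Q.blk x i j := fun x i j =>
    congrFun (congrFun (Q.glHom_blk g x) i) j
  rw [conjDer_apply, h1, derMat_conj, apply_ite (Q.glEquiv g), map_mul, h2, h2, map_zero]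
  simp only [derivation_sum_apply, Derivation.smul_apply, derMat_coordMat, smul_eq_mul]
  rw [Finset.sum_eq_single r, Finset.sum_eq_single s]
  · simp only [and_true]
    split_ifs
    · rw [mul_one, mul_comm]
    · simp
  · intro i _ hi
    rw [if_neg fun e => hi e.2.2.2.2.symm, mul_zero, mul_zero]
  · simp
  · intro j _ hj
    refine Finset.sum_eq_zero fun i _ => ?_
    rw [if_neg fun e => hj e.2.2.2.1.symm, mul_zero, mul_zero]
  · simp

/-- The action of `g` on the matrices of generators is the conjugation by `g⁻¹`. -/
lemma map_opMat (g : GLd d K) (y : Letter E) :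
    (Q.opMat d K y).map (DiffOp.map (Q.glEquiv g)) =
      Q.scalarMat (glVal g⁻¹) * Q.opMat d K y * Q.scalarMat (glVal g) := by
  rcases y with a | a
  · have h1 := congrArg (fun M => Matrix.map M (fnHom K (Q.RepRing d K))) (Q.glHom_coordMat g a)
    simp only [Matrix.map_mul] at h1
    refine Eq.trans ?_ h1
    ext p q
    exact map_fn _ _
  · ext p q
    refine (map_der _ _).trans ?_
    rw [conjDer_derMat, der_sum, Matrix.mul_apply]
    refine Finset.sum_congr rfl fun v _ => ?_
    rw [der_sum, Matrix.mul_apply, Finset.sum_mul]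
    refine Finset.sum_congr rfl fun u _ => ?_
    rw [← fn_mul_der, ← fn_mul_der, mul_assoc, ← scalarMat_comm]
    rfl

lemma glVal_inv_mul (g : GLd d K) : (fun i => glVal g⁻¹ i * glVal g i) = fun _ => 1 := by
  funext i
  change ((g i)⁻¹ : Matrix.GeneralLinearGroup (Fin (d i)) K).1 * (g i).1 = 1
  rw [← Units.val_mul, inv_mul_cancel, Units.val_one]

lemma glVal_mul_inv (g : GLd d K) : (fun i => glVal g i * glVal g⁻¹ i) = fun _ => 1 := by
  funext i
  change (g i).1 * ((g i)⁻¹ : Matrix.GeneralLinearGroup (Fin (d i)) K).1 = 1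
  rw [← Units.val_mul, mul_inv_cancel, Units.val_one]

lemma scalarMat_mul_inv (g : GLd d K) : Q.scalarMat (glVal g) * Q.scalarMat (glVal g⁻¹) = 1 := by
  rw [scalarMat_mul, glVal_mul_inv, scalarMat_one]

lemma scalarMat_inv_mul (g : GLd d K) : Q.scalarMat (glVal g⁻¹) * Q.scalarMat (glVal g) = 1 := by
  rw [scalarMat_mul, glVal_inv_mul, scalarMat_one]

lemma blockProj_mul_scalarMat (v : V) (x : gld d K) :
    blockProj Q d K v * Q.scalarMat x = Q.scalarMat x * blockProj Q d K v := by
  ext p q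
  rw [blockProj, Matrix.diagonal_mul, Matrix.mul_diagonal]
  by_cases h : p.1 = q.1
  · rw [h, scalarMat_comm]
  · rw [scalarMat, Matrix.map_apply, Q.blk_apply_ne x h, fn_zero, mul_zero, zero_mul]

lemma map_prod_opMat (g : GLd d K) (l : List (Letter E)) :
    ((l.map (Q.opMat d K)).prod).map (DiffOp.map (Q.glEquiv g)) =
      Q.scalarMat (glVal g⁻¹) * (l.map (Q.opMat d K)).prod * Q.scalarMat (glVal g) := by
  induction l with
  | nil =>
    rw [List.map_nil, List.prod_nil, mul_one, scalarMat_inv_mul]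
    exact Matrix.map_one _ (map_zero _) (map_one _)
  | cons y l ih =>
    rw [List.map_cons, List.prod_cons, Matrix.map_mul, ih, map_opMat]
    calc _ = Q.scalarMat (glVal g⁻¹) * Q.opMat d K y *
          (Q.scalarMat (glVal g) * Q.scalarMat (glVal g⁻¹)) * (l.map (Q.opMat d K)).prod *
          Q.scalarMat (glVal g) := by simp only [mul_assoc]
      _ = _ := by rw [scalarMat_mul_inv, mul_one]; simp only [mul_assoc]

lemma map_pathMat (g : GLd d K) (p : Q.DPath) :
    (pathMat d K p).map (DiffOp.map (Q.glEquiv g)) =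
      Q.scalarMat (glVal g⁻¹) * pathMat d K p * Q.scalarMat (glVal g) := by
  have h : (blockProj Q d K p.tgt).map (DiffOp.map (Q.glEquiv g)) = blockProj Q d K p.tgt := by
    rw [blockProj, Matrix.diagonal_map (map_zero _)]
    congr 1
    funext a
    rw [apply_ite (DiffOp.map (Q.glEquiv g)), map_one, map_zero]
  rw [pathMat, Matrix.map_mul, map_prod_opMat, h, ← mul_assoc, ← mul_assoc,
    blockProj_mul_scalarMat, ← mul_assoc]

lemma mem_invDiff {D : Q.RepDiff d K} :
    D ∈ Q.invDiff d K ↔ ∀ g : GLd d K, DiffOp.map (Q.glEquiv g) D = D := by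
  rw [invDiff, Algebra.mem_iInf]
  exact forall_congr' fun g => AlgHom.mem_equalizer _ _ _

/-- The group conjugates the matrix of a path by scalar matrices, which leaves the trace unchanged.
-/
lemma trace_pathMat_mem_invDiff (p : Q.DPath) : (pathMat d K p).trace ∈ Q.invDiff d K := by
  rw [mem_invDiff]
  intro g
  have h : DiffOp.map (Q.glEquiv g) (pathMat d K p).trace =
      ((pathMat d K p).map (DiffOp.map (Q.glEquiv g))).trace := by
    rw [Matrix.trace, Matrix.trace, map_sum]; rfl
  rw [h, map_pathMat, mul_assoc, trace_scalarMat_mul, mul_assoc, scalarMat_mul_inv, mul_one]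

/-- On the standard elements, which span, the quantum trace is a product of traces of path matrices.
-/
lemma quantumTrace_mem_invDiff (z : Q.N K (-hbar K) (-hbar K)) :
    quantumTrace Q d K z ∈ Q.invDiff d K := by
  have hz : z ∈ Submodule.span K[X] (Set.range (stdClass (Q := Q) (-hbar K) (-hbar K))) := by
    rw [span_stdClass]; trivial
  have hle : Submodule.span K[X] (Set.range (stdClass (Q := Q) (-hbar K) (-hbar K))) ≤
      (Subalgebra.toSubmodule (Q.invDiff d K)).comap (quantumTrace Q d K).toLinearMap := by
    rw [Submodule.span_le]
    rintro _ ⟨s, rfl⟩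
    change quantumTrace Q d K (stdClass _ _ s) ∈ Q.invDiff d K
    rw [stdClass, quantumTrace_nclass, Diagram.ofMultiset]
    change traceMonoidHom Q d K _ ∈ _
    rw [map_list_prod, List.map_map]
    refine list_prod_mem fun x hx => ?_
    obtain ⟨c, -, rfl⟩ := List.mem_map.1 hx
    change Q.traceFormula d K (Diagram.ofC c.rep) ∈ _
    rw [traceFormula_ofC]
    exact trace_pathMat_mem_invDiff _
  exact hle hz

end QuiverData

/-! ### Invariant operators and the infinitesimal action -/

namespace QuiverData

variable {V : Type u} {E : Type v} {Q : QuiverData V E} {d : V → ℕ} {K : Type w} [Field K]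
variable [DecidableEq V] [DecidableEq E] [Fintype V]

open DiffOp

lemma lie_tau_derMat (x : gld d K) (a : E) (p q : Idx d) :
    ⁅Q.tau x, Q.derMat d K a p q⁆ =
      ∑ v, Q.blk x v q • Q.derMat d K a p v - ∑ u, Q.blk x p u • Q.derMat d K a u q := by
  refine derivation_ext_coordMat fun b r s => ?_
  have h1 := derMat_conj (Q := Q) a b (fun _ => 1) x p q r s
  have h2 := derMat_conj (Q := Q) a b x (fun _ => 1) p q r s
  rw [blk_one, Matrix.one_mul] at h1
  rw [blk_one, Matrix.mul_one] at h2
  have h3 : Q.tau x (Q.derMat d K a p q (Q.coordMat d K b r s)) = 0 := by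
    rw [derMat_coordMat]
    split_ifs <;> simp
  rw [Derivation.commutator_apply, h3, tau_coordMat, Matrix.sub_apply, map_sub, h1, h2,
    Derivation.sub_apply]
  simp only [derivation_sum_apply, Derivation.smul_apply, derMat_coordMat, smul_eq_mul]
  rw [Finset.sum_eq_single r, Finset.sum_eq_single s]
  · by_cases h : a = b ∧ r.1 = Q.tgt b ∧ s.1 = Q.src b
    · obtain ⟨rfl, h4, h5⟩ := h
      simp only [h4, h5, true_and, if_true, and_true, Matrix.one_apply]
      rw [zero_sub, neg_sub]
      congr 1
      · simp [eq_comm]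
      · simp [eq_comm]
    · rw [if_neg h, if_neg h, if_neg fun e => h ⟨e.1, e.2.1, e.2.2.1⟩,
        if_neg fun e => h ⟨e.1, e.2.1, e.2.2.1⟩]
      simp
  · intro i _ hi
    rw [if_neg fun e => hi e.2.2.2.2.symm, mul_zero]
  · simp
  · intro j _ hj
    rw [if_neg fun e => hj e.2.2.2.1.symm, mul_zero]
  · simp

/-- The commutator of the infinitesimal action with the matrices of generators. -/
lemma tau_commutator_opMat (x : gld d K) (y : Letter E) (p q : Idx d) :
    der (Q.tau x) * Q.opMat d K y p q - Q.opMat d K y p q * der (Q.tau x) =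
      hbar K • (Q.opMat d K y * Q.scalarMat x - Q.scalarMat x * Q.opMat d K y) p q := by
  rcases y with a | a
  · simp only [opMat]
    rw [der_mul_fn, add_sub_cancel_left, tau_coordMat]
    have h : (Q.coordMat d K a * Q.blk x - Q.blk x * Q.coordMat d K a).map
        (fnHom K (Q.RepRing d K)) =
        Q.opMat d K (Sum.inl a) * Q.scalarMat x - Q.scalarMat x * Q.opMat d K (Sum.inl a) := by
      rw [Matrix.map_sub _ (map_sub _), Matrix.map_mul, Matrix.map_mul]
      rfl
    exact congrArg (hbar K • ·) (congrFun (congrFun h p) q)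
  · have h : Q.opMat d K (Sum.inr a) p q = der (Q.derMat d K a p q) := rfl
    rw [h, der_commutator, lie_tau_derMat, der_sub, der_sum, der_sum, Matrix.sub_apply,
      Matrix.mul_apply, Matrix.mul_apply]
    congr 2
    · refine Finset.sum_congr rfl fun v _ => ?_
      rw [← fn_mul_der, ← scalarMat_comm]; rfl
    · refine Finset.sum_congr rfl fun v _ => ?_
      rw [← fn_mul_der]; rfl

/-- Evaluation at a scalar of a polynomial with coefficients in the algebra of differential
operators. -/
def evalScalar (Q : QuiverData V E) (d : V → ℕ) (t : K) : (Q.RepDiff d K)[X] →+* Q.RepDiff d K :=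
  eval₂RingHom' (RingHom.id _) (algebraMap K[X] (Q.RepDiff d K) (C t))
    fun z => (Algebra.commutes _ z).symm

lemma evalScalar_C (t : K) (z : Q.RepDiff d K) : evalScalar Q d t (C z) = z :=
  eval₂_C _ _

lemma evalScalar_X (t : K) :
    evalScalar Q d t X = algebraMap K[X] (Q.RepDiff d K) (C t) := eval₂_X _ _

/-- Up to a power of `1 + c t`, the element `D` is transformed by `1 + t x` into a polynomial in
`t`, whose linear coefficient is the commutator with the infinitesimal action of `x`. -/
def HasExpansion (x : gld d K) (c : K) (m : ℕ) (D : Q.RepDiff d K) : Prop :=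
  ∃ P : (Q.RepDiff d K)[X], P.coeff 0 = D ∧
    hbar K • P.coeff 1 = hbar K • (C (m * c) : K[X]) • D + (der (Q.tau x) * D - D * der (Q.tau x)) ∧
    ∀ (g : GLd d K) (t : K), 1 + c * t ≠ 0 → (∀ i, glVal g i = 1 + t • x i) →
      evalScalar Q d t P = (C ((1 + c * t) ^ m) : K[X]) • DiffOp.map (Q.glEquiv g) D

variable {x : gld d K} {c : K}

lemma HasExpansion.mul {m n : ℕ} {D D' : Q.RepDiff d K} (h : HasExpansion x c m D)
    (h' : HasExpansion x c n D') : HasExpansion x c (m + n) (D * D') := by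
  obtain ⟨P, h0, h1, h2⟩ := h
  obtain ⟨P', h0', h1', h2'⟩ := h'
  refine ⟨P * P', by rw [mul_coeff_zero, h0, h0'], ?_, fun g t ht hg => ?_⟩
  · rw [mul_coeff_one, h0, h0', smul_add, ← mul_smul_comm, h1', ← smul_mul_assoc, h1]
    simp only [Nat.cast_add, add_mul, map_add, mul_add, sub_mul, mul_sub, add_smul, smul_add,
      mul_smul_comm, smul_mul_assoc, mul_assoc]
    abel
  · rw [map_mul, h2 g t ht hg, h2' g t ht hg, map_mul, smul_mul_smul_comm, ← C_mul, ← pow_add]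

lemma hasExpansion_algebraMap (f : K[X]) :
    HasExpansion x c 0 (algebraMap K[X] (Q.RepDiff d K) f) := by
  refine ⟨C (algebraMap K[X] _ f), coeff_C_zero, ?_, fun g t _ _ => ?_⟩
  · rw [coeff_C_succ, Algebra.commutes]; simp
  · rw [evalScalar_C, pow_zero, C_1, one_smul, AlgHom.commutes]

lemma hasExpansion_one (n : ℕ) : HasExpansion x c n (1 : Q.RepDiff d K) := by
  induction n with
  | zero => simpa using hasExpansion_algebraMap (Q := Q) (x := x) (c := c) 1
  | succ n ih =>
    have h : HasExpansion x c 1 (1 : Q.RepDiff d K) := by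
      refine ⟨1 + C (algebraMap K[X] _ (C c)) * X, by simp, ?_, fun g t _ _ => ?_⟩
      · simp [coeff_one, Algebra.smul_def]
      · rw [map_add, map_mul, map_one, map_one, evalScalar_C, evalScalar_X, ← map_mul, pow_one,
          Algebra.smul_def, mul_one, ← C_mul, map_add, map_one, map_add, map_one]
    simpa using ih.mul h

/-- Multiplying by an expansion of `1` brings summands to a common power of `1 + c t`. -/
lemma HasExpansion.raise {m : ℕ} {D : Q.RepDiff d K} (h : HasExpansion x c m D) (n : ℕ) :
    HasExpansion x c (m + n) D := by
  simpa using h.mul (hasExpansion_one n)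

lemma HasExpansion.add {m : ℕ} {D D' : Q.RepDiff d K} (h : HasExpansion x c m D)
    (h' : HasExpansion x c m D') : HasExpansion x c m (D + D') := by
  obtain ⟨P, h0, h1, h2⟩ := h
  obtain ⟨P', h0', h1', h2'⟩ := h'
  refine ⟨P + P', by rw [coeff_add, h0, h0'], ?_, fun g t ht hg => ?_⟩
  · rw [coeff_add, smul_add, h1, h1', smul_add, smul_add, mul_add, add_mul]
    abel
  · rw [map_add, h2 g t ht hg, h2' g t ht hg, map_add, smul_add]

lemma scalarMat_linear (a b : K) (y z : gld d K) :
    Q.scalarMat (fun i => a • y i + b • z i) =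
      (C a : K[X]) • Q.scalarMat y + (C b : K[X]) • Q.scalarMat z := by
  have h : Matrix.blockDiagonal' (fun i => a • y i + b • z i) =
      a • Matrix.blockDiagonal' y + b • Matrix.blockDiagonal' z := by
    rw [← Matrix.blockDiagonal'_smul, ← Matrix.blockDiagonal'_smul, ← Matrix.blockDiagonal'_add]
    rfl
  ext p q
  rw [scalarMat_apply, h, Matrix.add_apply, Matrix.smul_apply, Matrix.smul_apply, Matrix.add_apply,
    Matrix.smul_apply, Matrix.smul_apply, scalarMat_apply, scalarMat_apply]
  simp only [smul_eq_mul, map_add, map_mul]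
  rw [Algebra.smul_def, Algebra.smul_def]

lemma coeff_quadratic {R : Type*} [Ring R] (u v w : R) :
    (C u + C v * X + C w * X ^ 2).coeff 0 = u ∧ (C u + C v * X + C w * X ^ 2).coeff 1 = v := by
  constructor <;> simp [coeff_X, coeff_C, coeff_X_pow]

/-- From `x² = c x` one gets `(1 + t x)(1 + t (c - x)) = 1 + c t`. The inverse of `1 + t x` is
polynomial in `t` up to this factor, which is why expansions carry a power of it. -/
lemma smul_glVal_inv (hx : ∀ i, x i * x i = c • x i) (g : GLd d K) (t : K)
    (hg : ∀ i, glVal g i = 1 + t • x i) (i : V) :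
    (1 + c * t) • glVal g⁻¹ i = 1 + t • (c • 1 - x i) := by
  have h1 : glVal g i * (1 + t • (c • 1 - x i)) = (1 + c * t) • 1 := by
    rw [hg, add_mul, one_mul, smul_mul_assoc, mul_add, mul_one, mul_smul_comm, mul_sub,
      mul_smul_comm, mul_one, hx, sub_self, smul_zero, add_zero]
    module
  have h2 : glVal g⁻¹ i * glVal g i = 1 := congrFun (glVal_inv_mul g) i
  have h3 : glVal g⁻¹ i * (glVal g i * (1 + t • (c • 1 - x i))) =
      glVal g⁻¹ i * ((1 + c * t) • 1) := by rw [h1]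
  rw [← mul_assoc, h2, one_mul, mul_smul_comm, mul_one] at h3
  exact h3.symm

lemma hasExpansion_opMat (hx : ∀ i, x i * x i = c • x i) (y : Letter E) (p q : Idx d) :
    HasExpansion x c 1 (Q.opMat d K y p q) := by
  set M := Q.opMat d K y with hM
  set S := Q.scalarMat x with hS
  set Y := Q.scalarMat (fun i => c • 1 - x i) with hY
  have hY' : Y = (C c : K[X]) • (1 : Matrix (Idx d) (Idx d) (Q.RepDiff d K)) - S := by
    have h := scalarMat_linear (Q := Q) c (-1) (fun _ => 1) x
    rw [scalarMat_one, map_neg, C_1, neg_one_smul, ← sub_eq_add_neg] at h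
    rw [hY, hS, ← h]
    congr 1
    funext i
    rw [neg_one_smul, sub_eq_add_neg]
  -- The polynomial is the entry of `(1 + t Y) M (1 + t S)`, which is `1 + c t` times the conjugate
  -- of `M`.
  refine ⟨C (M p q) + C ((M * S + Y * M) p q) * X + C ((Y * M * S) p q) * X ^ 2,
    (coeff_quadratic _ _ _).1, ?_, fun g t ht hg => ?_⟩
  · rw [(coeff_quadratic _ _ _).2, tau_commutator_opMat, ← hM, ← hS, ← smul_add, hY', sub_mul,
      smul_mul_assoc, one_mul]
    congr 1
    simp only [Matrix.add_apply, Matrix.sub_apply, Matrix.smul_apply, Nat.cast_one, one_mul]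
    abel
  · have hg1 : Q.scalarMat (glVal g) = 1 + (C t : K[X]) • S := by
      have h := scalarMat_linear (Q := Q) 1 t (fun _ => 1) x
      rw [scalarMat_one, C_1, one_smul] at h
      rw [hS, ← h]
      congr 1
      funext i
      rw [hg, one_smul]
    have hg2 : (C (1 + c * t) : K[X]) • Q.scalarMat (glVal g⁻¹) = 1 + (C t : K[X]) • Y := by
      have h := scalarMat_linear (Q := Q) 1 t (fun _ => 1) fun i => c • 1 - x i
      have h' := scalarMat_linear (Q := Q) (1 + c * t) 0 (glVal g⁻¹) x
      rw [scalarMat_one, C_1, one_smul] at h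
      rw [C_0, zero_smul, add_zero] at h'
      rw [hY, ← h, ← h']
      congr 1
      funext i
      rw [zero_smul, add_zero, one_smul, smul_glVal_inv hx g t hg]
    have h1 : DiffOp.map (Q.glEquiv g) (M p q) =
        (Q.scalarMat (glVal g⁻¹) * M * Q.scalarMat (glVal g)) p q :=
      congrFun (congrFun (map_opMat g y) p) q
    rw [h1, pow_one, ← Matrix.smul_apply, ← smul_mul_assoc, ← smul_mul_assoc, hg1, hg2, add_mul,
      one_mul, smul_mul_assoc, add_mul, mul_add, mul_one, mul_smul_comm, mul_add, mul_one,
      mul_smul_comm, smul_mul_assoc]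
    simp only [Matrix.add_apply, Matrix.smul_apply]
    simp only [map_add, map_mul, evalScalar_C, evalScalar_X, add_mul, Algebra.smul_def, pow_two]
    simp only [← mul_assoc, Algebra.commutes]
    simp only [mul_assoc, ← Algebra.commutes (C t)]
    abel

variable [Fintype E]

lemma hasExpansion_fn (hx : ∀ i, x i * x i = c • x i) (f : Q.RepRing d K) :
    ∃ m, HasExpansion x c m (fn K f) := by
  induction f using MvPolynomial.induction_on with
  | C a => exact ⟨0, by
      have h := hasExpansion_algebraMap (Q := Q) (x := x) (c := c) (C a)
      rwa [← fn_algebraMap] at h⟩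
  | add f g hf hg =>
    obtain ⟨m, hm⟩ := hf
    obtain ⟨n, hn⟩ := hg
    refine ⟨m + n, ?_⟩
    rw [fn_add]
    exact (hm.raise n).add (add_comm n m ▸ hn.raise m)
  | mul_X f i hf =>
    obtain ⟨m, hm⟩ := hf
    obtain ⟨⟨a, p, q⟩, h⟩ := i
    have hX : (MvPolynomial.X ⟨(a, p, q), h⟩ : Q.RepRing d K) = Q.coordMat d K a p q := by
      rw [coordMat, dif_pos h]
    refine ⟨m + 1, ?_⟩
    rw [← fn_mul_fn, hX]
    exact hm.mul (hasExpansion_opMat hx (Sum.inl a) p q)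

lemma hasExpansion_sum {ι : Type*} (s : Finset ι) (D : ι → Q.RepDiff d K)
    (h : ∀ i ∈ s, ∃ m, HasExpansion x c m (D i)) : ∃ m, HasExpansion x c m (∑ i ∈ s, D i) := by
  refine Finset.sum_induction D (fun D => ∃ m, HasExpansion x c m D) ?_ ?_ h
  · rintro D D' ⟨m, hm⟩ ⟨n, hn⟩
    exact ⟨m + n, (hm.raise n).add (add_comm n m ▸ hn.raise m)⟩
  · exact ⟨0, by simpa using hasExpansion_algebraMap (Q := Q) (x := x) (c := c) 0⟩

lemma exists_hasExpansion (hx : ∀ i, x i * x i = c • x i) (D : Q.RepDiff d K) :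
    ∃ m, HasExpansion x c m D := by
  induction D using DiffOp.induction with
  | hfn f => exact hasExpansion_fn hx f
  | hder D =>
    rw [derivation_eq_sum D, der_sum]
    refine hasExpansion_sum _ _ fun a _ => ?_
    rw [der_sum]
    refine hasExpansion_sum _ _ fun p _ => ?_
    rw [der_sum]
    refine hasExpansion_sum _ _ fun q _ => ?_
    rw [← fn_mul_der]
    obtain ⟨m, hm⟩ := hasExpansion_fn hx (D (Q.coordMat d K a p q))
    exact ⟨_, hm.mul (hasExpansion_opMat hx (Sum.inr a) q p)⟩
  | halg f => exact ⟨0, hasExpansion_algebraMap f⟩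
  | hadd D D' h h' =>
    obtain ⟨m, hm⟩ := h
    obtain ⟨n, hn⟩ := h'
    exact ⟨m + n, (hm.raise n).add (add_comm n m ▸ hn.raise m)⟩
  | hmul D D' h h' =>
    obtain ⟨m, hm⟩ := h
    obtain ⟨n, hn⟩ := h'
    exact ⟨m + n, hm.mul hn⟩

/-- A polynomial with coefficients in the algebra of differential operators which vanishes at
almost all scalars is zero. -/
lemma eq_zero_of_evalScalar [Infinite K] (c : K) (P : (Q.RepDiff d K)[X])
    (h : ∀ t : K, 1 + c * t ≠ 0 → evalScalar Q d t P = 0) : P = 0 := by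
  let _ : Module K (Q.RepDiff d K) := Module.compHom _ (C : K →+* K[X])
  ext n
  rw [coeff_zero]
  -- Linear functionals over `K` separate elements, which reduces the claim to polynomials with
  -- coefficients in the infinite field `K`.
  refine (Module.forall_dual_apply_eq_zero_iff K _).1 fun φ => ?_
  set R : K[X] := ∑ i ∈ Finset.range (P.natDegree + 1), C (φ (P.coeff i)) * X ^ i with hR
  have heval : ∀ t, R.eval t = φ (evalScalar Q d t P) := by
    intro t
    have h1 : evalScalar Q d t P =
        ∑ i ∈ Finset.range (P.natDegree + 1), (t ^ i) • P.coeff i := by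
      change P.eval₂ _ _ = _
      rw [eval₂_eq_sum_range]
      refine Finset.sum_congr rfl fun i _ => ?_
      change _ = (C (t ^ i) : K[X]) • P.coeff i
      rw [Algebra.smul_def, Algebra.commutes, C_pow, map_pow]
      rfl
    rw [h1, map_sum, hR, eval_finsetSum]
    refine Finset.sum_congr rfl fun i _ => ?_
    rw [map_smul, eval_mul, eval_C, eval_pow, eval_X, smul_eq_mul, mul_comm]
  -- The factor `1 + c t` vanishes at the scalars that the hypothesis leaves out, so the product
  -- vanishes everywhere.
  have hprod : (1 + C c * X) * R = 0 := by
    refine Polynomial.funext fun t => ?_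
    rw [eval_mul, eval_zero, heval]
    by_cases ht : 1 + c * t = 0
    · simp [ht]
    · rw [h t ht, map_zero, mul_zero]
  have hR0 : R = 0 := by
    refine (mul_eq_zero.1 hprod).resolve_left fun h0 => ?_
    have := congrArg (eval 0) h0
    simp at this
  have hcoeff : R.coeff n = φ (P.coeff n) := by
    rw [hR, finsetSum_coeff]
    simp only [coeff_C_mul, coeff_X_pow, mul_ite, mul_one, mul_zero]
    rw [Finset.sum_ite_eq]
    split_ifs with hn
    · rfl
    · rw [coeff_eq_zero_of_natDegree_lt (by simpa using hn), map_zero]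
  rw [← hcoeff, hR0, coeff_zero]

/-- For invariant `D` the expansion agrees with `(1 + c t)^m D` wherever `1 + c t ≠ 0`, hence as a
polynomial. Its linear coefficient is then `m c D`, which leaves no room for the commutator with
`τ(x)`. The expansion records `ħ` times the linear coefficient, so no division by `ħ` occurs. -/
lemma tau_commute_of_mul_self [Infinite K] (hx : ∀ i, x i * x i = c • x i) {D : Q.RepDiff d K}
    (hD : D ∈ Q.invDiff d K) : der (Q.tau x) * D = D * der (Q.tau x) := by
  obtain ⟨m, P, h0, h1, h2⟩ := exists_hasExpansion hx D
  rw [mem_invDiff] at hD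
  have hP : P - (1 + C (algebraMap K[X] _ (C c)) * X) ^ m * C D = 0 := by
    refine eq_zero_of_evalScalar c _ fun t ht => ?_
    have hunit : ∀ i, IsUnit (1 + t • x i) := fun i => by
      have hmul : (1 + t • x i) * ((1 + c * t)⁻¹ • (1 + t • (c • 1 - x i))) = 1 := by
        have h3 : (1 + t • x i) * (1 + t • (c • 1 - x i)) = (1 + c * t) • 1 := by
          rw [add_mul, one_mul, smul_mul_assoc, mul_add, mul_one, mul_smul_comm, mul_sub,
            mul_smul_comm, mul_one, hx, sub_self, smul_zero, add_zero]
          module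
        rw [mul_smul_comm, h3, smul_smul, inv_mul_cancel₀ ht, one_smul]
      exact IsUnit.of_mul_eq_one _ hmul
    rw [map_sub, h2 (fun i => (hunit i).unit) t ht (fun i => rfl), hD, map_mul (evalScalar Q d t),
      map_pow (evalScalar Q d t), map_add (evalScalar Q d t), map_mul (evalScalar Q d t),
      map_one (evalScalar Q d t), evalScalar_C, evalScalar_C, evalScalar_X, Algebra.smul_def]
    simp
  have hcoeff : P.coeff 1 = (C (m * c) : K[X]) • D := by
    have h3 : ∀ n : ℕ, ((1 + C (algebraMap K[X] (Q.RepDiff d K) (C c)) * X) ^ n).coeff 0 = 1 ∧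
        ((1 + C (algebraMap K[X] (Q.RepDiff d K) (C c)) * X) ^ n).coeff 1 =
          algebraMap K[X] (Q.RepDiff d K) (C (n * c)) := by
      intro n
      induction n with
      | zero => simp [coeff_one]
      | succ n ih =>
        rw [pow_succ, mul_coeff_zero, mul_coeff_one, ih.1, ih.2]
        simp [coeff_one, add_mul, add_comm]
    rw [sub_eq_zero.1 hP, mul_coeff_one, (h3 m).1, (h3 m).2, coeff_C_succ, mul_zero, zero_add,
      coeff_C_zero, Algebra.smul_def]
  rw [hcoeff, left_eq_add, sub_eq_zero] at h1
  exact h1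

end QuiverData

/-! ### The quantum trace and reduction -/

namespace QuiverData

variable {V : Type u} {E : Type v} {Q : QuiverData V E} {d : V → ℕ} {K : Type w} [Field K]
variable [DecidableEq V] [DecidableEq E] [Fintype V]

open DiffOp

lemma blk_linear (a b : K) (x y : gld d K) :
    Q.blk (fun i => a • x i + b • y i) = a • Q.blk x + b • Q.blk y := by
  have h : Matrix.blockDiagonal' (fun i => a • x i + b • y i) =
      a • Matrix.blockDiagonal' x + b • Matrix.blockDiagonal' y := by
    rw [← Matrix.blockDiagonal'_smul, ← Matrix.blockDiagonal'_smul, ← Matrix.blockDiagonal'_add]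
    rfl
  ext p q : 2
  rw [Matrix.add_apply, Matrix.smul_apply, Matrix.smul_apply, blk, blk, blk, h]
  simp only [Matrix.map_apply, Matrix.add_apply, Matrix.smul_apply, smul_eq_mul, map_add, map_mul]
  rw [Algebra.smul_def, Algebra.smul_def]

variable (Q d K) in
/-- The infinitesimal action as a linear map. -/
def tauLin : gld d K →ₗ[K] Derivation K (Q.RepRing d K) (Q.RepRing d K) where
  toFun := Q.tau
  map_add' x y := derivation_ext_coordMat fun a p q => by
    have h := blk_linear (Q := Q) 1 1 x y
    simp only [one_smul] at h
    rw [Derivation.add_apply, tau_coordMat, tau_coordMat, tau_coordMat,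
      show Q.blk (x + y) = Q.blk x + Q.blk y from h, mul_add, add_mul]
    simp only [Matrix.sub_apply, Matrix.add_apply]
    ring
  map_smul' c x := derivation_ext_coordMat fun a p q => by
    have h := blk_linear (Q := Q) c 0 x x
    simp only [zero_smul, add_zero] at h
    rw [RingHom.id_apply, Derivation.smul_apply, tau_coordMat, tau_coordMat,
      show Q.blk (c • x) = c • Q.blk x from h, mul_smul_comm, smul_mul_assoc, ← smul_sub,
      Matrix.smul_apply]

lemma der_smul (c : K) (D : Derivation K (Q.RepRing d K) (Q.RepRing d K)) :
    der (c • D) = (C c : K[X]) • der D := by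
  rw [← algebraMap_smul (Q.RepRing d K) c D, ← fn_mul_der, fn_algebraMap, Algebra.smul_def]

/-- Elementary matrices span `gl_d` and satisfy `x² = c x` with `c` equal to `1` or `0`, so the
polynomial argument applies to each of them. -/
lemma elemGl_mul_self (i : V) (r q : Fin (d i)) (j : V) :
    elemGl (K := K) i r q j * elemGl i r q j = (if r = q then (1 : K) else 0) • elemGl i r q j := by
  by_cases h : j = i
  · subst h
    rw [elemGl, Pi.single_eq_same]
    split_ifs with h
    · subst h; rw [Matrix.single_mul_single_same, one_mul, one_smul]
    · rw [Matrix.single_mul_single_of_ne _ _ _ _ (Ne.symm h), zero_smul]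
  · rw [elemGl, Pi.single_eq_of_ne h, mul_zero, smul_zero]

lemma eq_sum_elemGl (x : gld d K) :
    x = ∑ i, ∑ r, ∑ q, x i r q • elemGl (K := K) i r q := by
  conv_lhs => rw [← Finset.univ_sum_single x]
  refine Finset.sum_congr rfl fun i _ => ?_
  conv_lhs => rw [Matrix.matrix_eq_sum_single (x i)]
  funext j
  by_cases h : j = i
  · subst h
    simp only [Finset.sum_apply, Pi.smul_apply, elemGl, Pi.single_eq_same, Matrix.smul_single,
      smul_eq_mul, mul_one]
  · simp [elemGl, Pi.single_eq_of_ne h]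

variable [Fintype E]

/-- Invariant differential operators commute with the infinitesimal action. -/
lemma tau_commute [Infinite K] (x : gld d K) {D : Q.RepDiff d K} (hD : D ∈ Q.invDiff d K) :
    der (Q.tau x) * D = D * der (Q.tau x) := by
  change der (tauLin Q d K x) * D = D * der (tauLin Q d K x)
  conv_lhs => rw [eq_sum_elemGl x]
  conv_rhs => rw [eq_sum_elemGl x]
  simp only [map_sum, map_smul, der_sum, der_smul, Finset.sum_mul, Finset.mul_sum, smul_mul_assoc,
    mul_smul_comm]
  refine Finset.sum_congr rfl fun i _ => Finset.sum_congr rfl fun r _ =>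
    Finset.sum_congr rfl fun q _ => ?_
  congr 1
  exact tau_commute_of_mul_self (elemGl_mul_self i r q) hD

/-- Invariant operators commute with the generators of the ideal, `χ₀` contributing central
elements, so they can be moved to their left. -/
lemma momentIdeal_mul_mem [Infinite K] {z D : Q.RepDiff d K} (hz : z ∈ Q.momentIdeal d K)
    (hD : D ∈ Q.invDiff d K) : z * D ∈ Q.momentIdeal d K := by
  induction hz using Submodule.span_induction with
  | mem z hz =>
    obtain ⟨x, rfl⟩ := hz
    change (_ - _) * D ∈ _
    rw [sub_mul, tau_commute x hD, Algebra.commutes, ← mul_sub]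
    exact Ideal.mul_mem_left _ _ (Ideal.subset_span ⟨x, rfl⟩)
  | zero => rw [zero_mul]; exact zero_mem _
  | add x y _ _ hx hy => rw [add_mul]; exact add_mem hx hy
  | smul a x _ hx => rw [smul_eq_mul, mul_assoc]; exact Ideal.mul_mem_left _ _ hx

lemma invMomentIdeal_isTwoSided [Infinite K] : (Q.invMomentIdeal d K).IsTwoSided :=
  ⟨fun {a} b (ha : (a : Q.RepDiff d K) ∈ Q.momentIdeal d K) => momentIdeal_mul_mem ha b.2⟩

/-- The quantum trace descends to the reductions. -/
theorem exists_quantumTrace_reduction [Infinite K] :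
    ∃ (hinv : ∀ z, quantumTrace Q d K z ∈ Q.invDiff d K) (_ : (Q.invMomentIdeal d K).IsTwoSided)
      (TrRed : Q.Rq K (-hbar K) (-hbar K) →ₐ[K[X]] (Q.invDiff d K ⧸ Q.invMomentIdeal d K)),
      ∀ z, TrRed (Q.toRq K (-hbar K) (-hbar K) z) =
        Ideal.Quotient.mk (Q.invMomentIdeal d K) ⟨quantumTrace Q d K z, hinv z⟩ := by
  have h2 : (Q.invMomentIdeal d K).IsTwoSided := invMomentIdeal_isTwoSided
  refine ⟨quantumTrace_mem_invDiff, h2, QuotBy.liftAlg K[X]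
    ((Ideal.Quotient.mkₐ K[X] (Q.invMomentIdeal d K)).comp
      ((quantumTrace Q d K).codRestrict (Q.invDiff d K) quantumTrace_mem_invDiff)) ?_,
    fun z => rfl⟩
  rintro _ ⟨y, rfl⟩
  refine Ideal.Quotient.eq_zero_iff_mem.2 ?_
  exact quantumTrace_momentLifts_mem y

end QuiverData

end NecklaceReduction

end

theorem theorem1p1 {K : Type*} [Field K] [IsAlgClosed K] [CharZero K]
    {V E : Type*} [Fintype V] [DecidableEq V] [Fintype E] [DecidableEq E]
    (Q : QuiverData V E) (d : V → ℕ) :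
    -- the necklace Lie bracket on `(K Q̄)_♮` and the Lie bracket it induces on `(Π Q)_♮`
    ∃ (BL : LieBracket K (Nat0 K (Q.PathAlg K))) (BP : LieBracket K (Nat0 K (Q.Preproj K))),
      Q.IsNecklaceBracket K BL ∧
      (∀ x y, BP.br (Q.pr K x) (Q.pr K y) = Q.pr K (BL.br x y)) ∧
      -- (1) quantization commutes with reduction, for Schedler's algebra `N(1, ħ)`
      (Module.Free K[X] (Q.N K 1 (hbar K)) ∧
        ∃ (l : BL.U ≃ₐ[K] ModHbar K (Q.N K 1 (hbar K)))
          (v : BP.U ≃ₐ[K] ModHbar K (Q.Rq K 1 (hbar K)))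
          (redU : BL.U →ₐ[K] BP.U)
          (red : ModHbar K (Q.N K 1 (hbar K)) →ₐ[K] ModHbar K (Q.Rq K 1 (hbar K))),
          (∀ x, l (BL.ι (Q.cl K x)) = toModHbar K _ (Q.hat K 1 (hbar K) x)) ∧
          (∀ x, v (BP.ι (Q.pr K (Q.cl K x))) =
            toModHbar K _ (Q.toRq K 1 (hbar K) (Q.hat K 1 (hbar K) x))) ∧
          (∀ x, redU (BL.ι x) = BP.ι (Q.pr K x)) ∧
          (∀ z, red (toModHbar K _ z) = toModHbar K _ (Q.toRq K 1 (hbar K) z)) ∧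
          (∀ u, red (l u) = v (redU u))) ∧
      -- (1) quantization commutes with reduction, for the normalization `N(-ħ, -ħ)`
      (Module.Free K[X] (Q.N K (-hbar K) (-hbar K)) ∧
        (∀ x y t, Q.cl K t = BL.br (Q.cl K x) (Q.cl K y) →
          ∃ z : Q.N K (-hbar K) (-hbar K),
            Q.hat K (-hbar K) (-hbar K) x * Q.hat K (-hbar K) (-hbar K) y -
              Q.hat K (-hbar K) (-hbar K) y * Q.hat K (-hbar K) (-hbar K) x =
            -(hbar K • Q.hat K (-hbar K) (-hbar K) t) + hbar K ^ 2 • z) ∧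
        ∃ (l : SymmetricAlgebra K (Nat0 K (Q.PathAlg K)) ≃ₐ[K]
              ModHbar K (Q.N K (-hbar K) (-hbar K)))
          (v : SymmetricAlgebra K (Nat0 K (Q.Preproj K)) ≃ₐ[K]
              ModHbar K (Q.Rq K (-hbar K) (-hbar K)))
          (redS : SymmetricAlgebra K (Nat0 K (Q.PathAlg K)) →ₐ[K]
              SymmetricAlgebra K (Nat0 K (Q.Preproj K)))
          (red : ModHbar K (Q.N K (-hbar K) (-hbar K)) →ₐ[K]
              ModHbar K (Q.Rq K (-hbar K) (-hbar K))),
          (∀ x, l (SymmetricAlgebra.ι K _ (Q.cl K x)) =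
            toModHbar K _ (Q.hat K (-hbar K) (-hbar K) x)) ∧
          (∀ x, v (SymmetricAlgebra.ι K _ (Q.pr K (Q.cl K x))) =
            toModHbar K _ (Q.toRq K (-hbar K) (-hbar K) (Q.hat K (-hbar K) (-hbar K) x))) ∧
          (∀ x, redS (SymmetricAlgebra.ι K _ x) = SymmetricAlgebra.ι K _ (Q.pr K x)) ∧
          (∀ z, red (toModHbar K _ z) = toModHbar K _ (Q.toRq K (-hbar K) (-hbar K) z)) ∧
          (∀ u, red (l u) = v (redS u))) ∧
      -- (2) the quantum trace, and its compatibility with the reductions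
      (∃ Tr : Q.N K (-hbar K) (-hbar K) →ₐ[K[X]] Q.RepDiff d K,
        (∀ X : Q.Diagram,
          Tr (nclass K (-hbar K) (-hbar K) X) = Q.traceFormula d K X) ∧
        ∃ (hinv : ∀ z, Tr z ∈ Q.invDiff d K)
          (_ : (Q.invMomentIdeal d K).IsTwoSided)
          (TrRed : Q.Rq K (-hbar K) (-hbar K) →ₐ[K[X]]
            (Q.invDiff d K ⧸ Q.invMomentIdeal d K)),
          ∀ z, TrRed (Q.toRq K (-hbar K) (-hbar K) z) =
            Ideal.Quotient.mk (Q.invMomentIdeal d K) ⟨Tr z, hinv z⟩) := by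
  obtain ⟨BL, hBL⟩ := exists_necklaceBracket (Q := Q) (K := K)
  obtain ⟨BP, hBP⟩ := exists_reducedBracket BL hBL
  refine ⟨BL, BP, ?_, hBP, ⟨Module.Free.of_basis (Q.stdBasis 1 (hbar K)),
      quantization_reduction_envelope BL BP hBL hBP⟩,
    ⟨Module.Free.of_basis (Q.stdBasis (-hbar K) (-hbar K)), fun x y t ht =>
        hat_commutator_neg_hbar x y t (ht.trans (hBL x y)),
      quantization_reduction_symmetric (dvd_neg.2 dvd_rfl) (dvd_neg.2 dvd_rfl)⟩,
    quantumTrace Q d K, quantumTrace_nclass, exists_quantumTrace_reduction⟩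
  intro p q hp hq
  rw [hBL, neckLin_ofPath, if_pos ⟨hp, hq⟩]
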